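/- \textbf{Notation.} Work on $\mathbb{R}^d$, $d\ge 1$, with Fourier transform $\mathcal F f(\xi)=\int f(x)e^{-2\pi i x\cdot\xi}\,dx$. Fix nonnegative radial $\chi,\varphi\in C_c^\infty(\mathbb{R}^d)$, supported in $\{|\xi|\le\frac43\}$ and $\{\frac34\le|\xi|\le\frac83\}$, with $\chi(\xi)+\sum_{j\ge0}\varphi(2^{-j}\xi)=1$ for all $\xi$; put $\Delta_{-1}=\chi(D)$ and $\Delta_j=\varphi(2^{-j}D)$ for $j\ge0$. For $s\in\mathbb{R}$, $p,r\in[1,\infty]$ and a tempered distribution $f$ let $\|f\|_{B^s_{p,r}}=\|(2^{qs}\|\Delta_qf\|_{L^p})_{q\ge-1}\|_{\ell^r}\in[0,\infty]$, and $C^{s}=B^s_{\infty,\infty}$. Vector fields $V:\mathbb{R}^d\to\mathbb{R}^d$ are smooth with all derivatives of at most polynomial growth, and $\partial_V=V\cdot\nabla$ acts on tempered distributions. For a family $\mathcal W=(W_1,\dots,W_N)$ of vector fields and $\ell\in\mathbb{N}$ let $$\|f\|_{\mathcal B^{s,\ell}_{p,r,\mathcal W}}=\sum_{\lambda=0}^{\ell}\|\partial_{\mathcal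 W}^\lambda f\|_{B^s_{p,r}},\qquad \|\partial_{\mathcal W}^\lambda f\|_{B^s_{p,r}}=\sum_{\lambda_1+\dots+\lambda_N=\lambda}\|\partial_{W_1}^{\lambda_1}\cdots\partial_{W_N}^{\lambda_N}f\|_{B^s_{p,r}},$$ $\mathcal B^{s,\ell}_{\mathcal W}=\mathcal B^{s,\ell}_{\infty,1,\mathcal W}$, and $\|\mathcal W\|_{\mathcal C^{1+\rho,k-1}_{\mathcal W}}=\sum_{\lambda=0}^{k-1}\|\partial^\lambda_{\mathcal W}\mathcal W\|_{C^{1+\rho}}$ (which is $0$ for $k=0$). Norms of vectors, of gradients and of families are sums over the components. All norms take values in $[0,\infty]$, with $0\cdot\infty=0$. Let $m(D)=\Lambda^\sigma m_0(D)$ have the symbol $m(\xi)=|\xi|^\sigma m_0(\xi)$, where $\sigma>-1$, $m_0\in C^\infty(\mathbb{R}^d\setminus\{0\};\mathbb{C})$ and $\sup_{\xi\ne0}|\xi|^{n}|\nabla^n m_0(\xi)|<\infty$ for all $n\in\mathbb{N}$. For a tempered distribution $f$, $m(D)f$ denotes the limit in $\mathcal S'$, as $\varepsilon\to0^+$, of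 $(m*\eta_\varepsilon)(D)f$, $\eta_\varepsilon=\varepsilon^{-d}\eta(\cdot/\varepsilon)$; it is said to be defined if this limit exists and is the same for all $\eta\in C_c^\infty(\mathbb{R}^d;\mathbb{R})$ with $\int\eta=1$. (For Schwartz functions $f$ it is $\mathcal F^{-1}(m\,\mathcal F f)$.) \textbf{Lemma.} Let $k\in\mathbb{N}$, $\rho\in(0,1)$ and $M\ge0$. Let $N\ge1$, let $\mathcal W=(W_i)_{1\le i\le N}$ be a family of divergence-free vector fields with $\|\mathcal W\|_{\mathcal C^{1+\rho,k-1}_{\mathcal W}}\le M$, let $u$ be a divergence-free vector field, and let $\phi$ be a tempered distribution (for instance a smooth function of polynomial growth). Let $(p,r)\in[1,\infty]^2$. (i) For every $\epsilon\in(0,1)$, $$\|u\cdot\nabla\phi\|_{\mathcal B^{-\epsilon,k}_{p,r,\mathcal W}}\le C\min\Big\{\sum_{\mu=0}^k\|u\|_{\mathcal B^{0,\mu}_{\mathcal W}}\|\nabla\phi\|_{\mathcal B^{-\epsilon,k-\mu}_{p,r,\mathcal W}},\ \sum_{\mu=0}^k\|u\|_{\mathcal B^{-\epsilon,\mu}_{p,r,\mathcal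 W}}\|\nabla\phi\|_{\mathcal B^{0,k-\mu}_{\mathcal W}}\Big\}.$$ (ii) If $s\in(-1,1)$, $-1<\sigma+s<1$, and $m(D)\phi$ and $m(D)(u\cdot\nabla\phi)$ are defined, then $$\|[m(D),u\cdot\nabla]\phi\|_{\mathcal B^{s,k}_{p,r,\mathcal W}}\le C\big(\|\nabla u\|_{\mathcal B^{0,k}_{\mathcal W}}+\|u\|_{L^\infty}\big)\|\phi\|_{\mathcal B^{s+\sigma,k}_{p,r,\mathcal W}},$$ where $[m(D),u\cdot\nabla]\phi=m(D)(u\cdot\nabla\phi)-u\cdot\nabla\,m(D)\phi$. (iii) If $s\in(-1,1)$, $-1<\sigma+s<1$, and $m(D)\phi$ is defined, then $$\|m(D)\phi\|_{\mathcal B^{s,k+1}_{p,r,\mathcal W}}\le C\|\phi\|_{\mathcal B^{s+\sigma,k+1}_{p,r,\mathcal W}}+C\|\mathcal W\|_{\mathcal B^{1,k}_{\mathcal W}}\|\phi\|_{\mathcal B^{s+\sigma,k}_{p,r,\mathcal W}}+C\,\mathbf 1_{\{-1<\sigma\le0\}}\|\Delta_{-1}m(D)\phi\|_{L^p}.$$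 Here $C>0$ depends only on $d,\chi,\varphi,k,\rho,M$, and on $\epsilon$ in (i), on $\sigma,s,m_0$ in (ii) and (iii); it does not depend on $N,\mathcal W,u,\phi,p,r$. -/

import Mathlib

open MeasureTheory Filter Topology
open scoped NNReal ENNReal ContDiff SchwartzMap LineDeriv

noncomputable section

namespace Striated

/-- The Euclidean space `ℝ^d`. -/
abbrev Space (d : ℕ) : Type := EuclideanSpace ℝ (Fin d)

/-- The `j`-th vector of the standard basis. -/
def stdVec {d : ℕ} (j : Fin d) : Space d := EuclideanSpace.single j 1

/-! ### Littlewood–Paley decomposition and Besov norms -/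

/-- A pair of nonnegative radial bump functions that generates a Littlewood–Paley decomposition. -/
structure LittlewoodPaley (d : ℕ) where
  χ : Space d → ℝ
  ϕ : Space d → ℝ
  χ_smooth : ContDiff ℝ ∞ χ
  ϕ_smooth : ContDiff ℝ ∞ ϕ
  χ_nonneg : ∀ ξ, 0 ≤ χ ξ
  ϕ_nonneg : ∀ ξ, 0 ≤ ϕ ξ
  χ_radial : ∀ ξ ζ, ‖ξ‖ = ‖ζ‖ → χ ξ = χ ζ
  ϕ_radial : ∀ ξ ζ, ‖ξ‖ = ‖ζ‖ → ϕ ξ = ϕ ζ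
  χ_supp : ∀ ξ, χ ξ ≠ 0 → ‖ξ‖ ≤ 4 / 3
  ϕ_supp : ∀ ξ, ϕ ξ ≠ 0 → 3 / 4 ≤ ‖ξ‖ ∧ ‖ξ‖ ≤ 8 / 3
  partition : ∀ ξ, HasSum (fun j : ℕ => ϕ (((2 : ℝ) ^ j)⁻¹ • ξ)) (1 - χ ξ)

/-- Such pairs exist. -/
theorem LittlewoodPaley.nonempty (d : ℕ) : Nonempty (LittlewoodPaley d) := by
  let g : ℝ → ℝ := fun t => Real.smoothTransition ((16/9 - t) / (16/9 - 9/16))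
  have g1 : ∀ t, t ≤ 9/16 → g t = 1 := fun t ht =>
    Real.smoothTransition.one_of_one_le (by rw [le_div_iff₀ (by norm_num)]; linarith)
  have g0 : ∀ t, 16/9 ≤ t → g t = 0 := fun t ht =>
    Real.smoothTransition.zero_of_nonpos (by apply div_nonpos_of_nonpos_of_nonneg <;> norm_num; linarith)
  have gmono : Antitone g := by
    intro a b h
    apply Real.smoothTransition.monotone
    gcongr
  have gs : ContDiff ℝ ∞ g := Real.smoothTransition.contDiff.comp (by fun_prop)
  have gnn : ∀ t, 0 ≤ g t := fun t => Real.smoothTransition.nonneg _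
  let c : Space d → ℝ := fun ξ => g (‖ξ‖^2)
  have cs : ContDiff ℝ ∞ c := gs.comp (contDiff_norm_sq ℝ)
  refine ⟨⟨c, fun ξ => c ((2:ℝ)⁻¹ • ξ) - c ξ, cs, ?_, fun _ => gnn _, ?_, ?_, ?_, ?_, ?_, ?_⟩⟩
  · exact (cs.comp (by fun_prop)).sub cs
  · intro ξ
    have : c ξ ≤ c ((2:ℝ)⁻¹ • ξ) := by
      apply gmono; simp only [norm_smul]; norm_num; nlinarith [sq_nonneg ‖ξ‖]
    linarith
  · intro a b h; simp [c, h]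
  · intro a b h; simp [c, h, norm_smul]
  · intro ξ h; by_contra! h'; exact h (g0 _ (by nlinarith))
  · intro ξ h
    constructor
    · by_contra! h'
      apply h
      have n0 := norm_nonneg ξ
      have e1 : c ξ = 1 := g1 _ (by nlinarith)
      have e2 : c ((2:ℝ)⁻¹ • ξ) = 1 := g1 _ (by simp only [norm_smul]; norm_num; nlinarith)
      rw [e1, e2]; simp
    · by_contra! h'
      apply h
      have e1 : c ξ = 0 := g0 _ (by nlinarith)
      have e2 : c ((2:ℝ)⁻¹ • ξ) = 0 := g0 _ (by simp only [norm_smul]; norm_num; nlinarith)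
      rw [e1, e2]; simp
  · intro ξ
    have tel : ∀ n : ℕ, ∑ j ∈ Finset.range n, (c ((2:ℝ)⁻¹ • (((2 : ℝ) ^ j)⁻¹ • ξ)) - c (((2 : ℝ) ^ j)⁻¹ • ξ)) = c (((2:ℝ)^n)⁻¹ • ξ) - c ξ := by
      intro n
      induction n with
      | zero => simp
      | succ n ih => rw [Finset.sum_range_succ, ih, smul_smul, ← mul_inv, ← pow_succ']; ring
    have nn : ∀ j : ℕ, 0 ≤ c ((2:ℝ)⁻¹ • (((2 : ℝ) ^ j)⁻¹ • ξ)) - c (((2 : ℝ) ^ j)⁻¹ • ξ) := by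
      intro j
      have : c (((2 : ℝ) ^ j)⁻¹ • ξ) ≤ c ((2:ℝ)⁻¹ • (((2 : ℝ) ^ j)⁻¹ • ξ)) := by
        apply gmono; rw [norm_smul (2:ℝ)⁻¹]; norm_num; nlinarith [sq_nonneg ‖((2 : ℝ) ^ j)⁻¹ • ξ‖]
      linarith
    rw [hasSum_iff_tendsto_nat_of_nonneg nn]
    simp only [tel]
    have h1 : Tendsto (fun n : ℕ => c (((2:ℝ)^n)⁻¹ • ξ)) atTop (𝓝 (c ((0:ℝ) • ξ))) := by
      apply (cs.continuous.tendsto _).comp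
      apply Tendsto.smul_const
      exact tendsto_inv_atTop_zero.comp (tendsto_pow_atTop_atTop_of_one_lt (by norm_num))
    have h0 : c ((0:ℝ) • ξ) = 1 := g1 _ (by simp; norm_num)
    rw [h0] at h1
    exact h1.sub_const _

/-- The symbol of the `n`-th block: `χ` for `n = 0` and `ϕ(2^{-j} ·)` for `n = j + 1`. -/
def LittlewoodPaley.symbol {d : ℕ} (P : LittlewoodPaley d) : ℕ → Space d → ℂ
  | 0 => fun ξ => (P.χ ξ : ℂ)
  | j + 1 => fun ξ => (P.ϕ (((2 : ℝ) ^ j)⁻¹ • ξ) : ℂ)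

/-- The dyadic block `Δ_{n-1}`; the index is shifted by one, so that `block 0 = Δ_{-1}`. -/
def LittlewoodPaley.block {d : ℕ} (P : LittlewoodPaley d) (n : ℕ) :
    𝓢'(Space d, ℂ) →L[ℂ] 𝓢'(Space d, ℂ) :=
  TemperedDistribution.fourierMultiplierCLM ℂ (P.symbol n)

/-- The `L^p` norm of a tempered distribution: the norm of the `L^p` function that represents it,
and `∞` if there is none. -/
def distLpNorm {d : ℕ} (p : ℝ≥0∞) [Fact (1 ≤ p)] (f : 𝓢'(Space d, ℂ)) : ℝ≥0∞ :=
  ⨅ (F : Lp ℂ p (volume : Measure (Space d))) (_ : Lp.toTemperedDistribution F = f), ‖F‖ₑ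

/-- The norm of `B^s_{p,r}`, with values in `[0, ∞]`: the `ℓ^r` norm of
`(2^{qs} ‖Δ_q f‖_{L^p})_{q ≥ -1}`, where `q = n - 1`. -/
def besovNorm {d : ℕ} (P : LittlewoodPaley d) (s : ℝ) (p r : ℝ≥0∞) [Fact (1 ≤ p)]
    (f : 𝓢'(Space d, ℂ)) : ℝ≥0∞ :=
  eLpNorm (fun n : ℕ => ENNReal.ofReal ((2 : ℝ) ^ (((n : ℝ) - 1) * s)) * distLpNorm p (P.block n f))
    r Measure.count

/-! ### Vector fields and striated norms -/

/-- A smooth vector field on `ℝ^d`; temperate growth makes it a multiplier of tempered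
distributions. -/
structure SmoothField (d : ℕ) where
  toFun : Space d → Space d
  temperate : Function.HasTemperateGrowth toFun

namespace SmoothField

variable {d : ℕ}

/-- The `j`-th component of a vector field, as a complex valued function. -/
def comp (V : SmoothField d) (j : Fin d) : Space d → ℂ := fun x => (V.toFun x j : ℂ)

theorem comp_temperate (V : SmoothField d) (j : Fin d) :
    Function.HasTemperateGrowth (V.comp j) := by
  have h1 : Function.HasTemperateGrowth
      (Complex.ofRealCLM.comp (EuclideanSpace.proj j : Space d →L[ℝ] ℝ)) :=
    ContinuousLinearMap.hasTemperateGrowth _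
  exact h1.comp V.temperate

/-- The `j`-th component of a vector field, as a tempered distribution. -/
def dist (V : SmoothField d) (j : Fin d) : 𝓢'(Space d, ℂ) :=
  (V.comp_temperate j).toTemperedDistribution

def IsDivFree (V : SmoothField d) : Prop :=
  ∀ x, ∑ j, fderiv ℝ V.toFun x (stdVec j) j = 0

/-- The operator `∂_V = V · ∇` on tempered distributions. -/
def deriv (V : SmoothField d) : 𝓢'(Space d, ℂ) →L[ℂ] 𝓢'(Space d, ℂ) :=
  ∑ j, (TemperedDistribution.smulLeftCLM ℂ (V.comp j)).comp
    (LineDeriv.lineDerivOpCLM ℂ 𝓢'(Space d, ℂ) (stdVec j))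

/-- `‖V‖_{L^∞}`, the sum over the components. -/
def supNorm (V : SmoothField d) : ℝ≥0∞ := ∑ j, eLpNorm (V.comp j) ∞ volume

end SmoothField

/-- The operator `∂_{W_1}^{λ_1} ⋯ ∂_{W_N}^{λ_N}`; the product is composition, in this order. -/
def fieldMonomial {d N : ℕ} (W : Fin N → SmoothField d) (l : Fin N → ℕ) :
    𝓢'(Space d, ℂ) →L[ℂ] 𝓢'(Space d, ℂ) :=
  (List.ofFn fun i => (W i).deriv ^ l i).prod

/-- `∑_{λ < n} ‖∂_W^λ f‖_{B^s_{p,r}}`, with `‖∂_W^λ f‖` the sum over `λ_1 + ⋯ + λ_N = λ`. -/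
def striatedSum {d N : ℕ} (P : LittlewoodPaley d) (W : Fin N → SmoothField d) (s : ℝ) (n : ℕ)
    (p r : ℝ≥0∞) [Fact (1 ≤ p)] (f : 𝓢'(Space d, ℂ)) : ℝ≥0∞ :=
  ∑ m ∈ Finset.range n, ∑ l ∈ Finset.piAntidiag Finset.univ m,
    besovNorm P s p r (fieldMonomial W l f)

/-- The norm of the striated Besov space `𝓑^{s,ℓ}_{p,r,W}`, with values in `[0, ∞]`. -/
def striatedNorm {d N : ℕ} (P : LittlewoodPaley d) (W : Fin N → SmoothField d) (s : ℝ) (ℓ : ℕ)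
    (p r : ℝ≥0∞) [Fact (1 ≤ p)] (f : 𝓢'(Space d, ℂ)) : ℝ≥0∞ :=
  striatedSum P W s (ℓ + 1) p r f

/-- The striated norm of a vector field, the sum over its components. -/
def fieldNorm {d N : ℕ} (P : LittlewoodPaley d) (W : Fin N → SmoothField d) (s : ℝ) (ℓ : ℕ)
    (p r : ℝ≥0∞) [Fact (1 ≤ p)] (V : SmoothField d) : ℝ≥0∞ :=
  ∑ j, striatedNorm P W s ℓ p r (V.dist j)

/-- The striated norm of the gradient `∇f`, the sum over its components. -/
def gradNorm {d N : ℕ} (P : LittlewoodPaley d) (W : Fin N → SmoothField d) (s : ℝ) (ℓ : ℕ)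
    (p r : ℝ≥0∞) [Fact (1 ≤ p)] (f : 𝓢'(Space d, ℂ)) : ℝ≥0∞ :=
  ∑ j, striatedNorm P W s ℓ p r (∂_{(stdVec j : Space d)} f)

/-- The striated norm of the gradient `∇V` of a vector field. -/
def fieldGradNorm {d N : ℕ} (P : LittlewoodPaley d) (W : Fin N → SmoothField d) (s : ℝ) (ℓ : ℕ)
    (p r : ℝ≥0∞) [Fact (1 ≤ p)] (V : SmoothField d) : ℝ≥0∞ :=
  ∑ j, gradNorm P W s ℓ p r (V.dist j)

/-- `‖W‖_{C^{1+ρ,k-1}_W} = ∑_{λ=0}^{k-1} ‖∂_W^λ W‖_{C^{1+ρ}}`, where `C^{1+ρ} = B^{1+ρ}_{∞,∞}`;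
it vanishes for `k = 0`. -/
def familyHolderNorm {d N : ℕ} (P : LittlewoodPaley d) (W : Fin N → SmoothField d) (ρ : ℝ)
    (k : ℕ) : ℝ≥0∞ :=
  ∑ i, ∑ j, striatedSum P W (1 + ρ) k ∞ ∞ ((W i).dist j)

/-! ### Fourier multipliers that are singular at the origin -/

/-- Symbols of order zero, smooth away from the origin. -/
def IsZeroOrderSymbol {d : ℕ} (m₀ : Space d → ℂ) : Prop :=
  ContDiffOn ℝ ∞ m₀ {0}ᶜ ∧
    ∀ n : ℕ, ∃ A : ℝ, ∀ ξ, ξ ≠ 0 → ‖ξ‖ ^ n * ‖iteratedFDeriv ℝ n m₀ ξ‖ ≤ A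

/-- The symbol `|ξ|^σ m₀(ξ)` of `Λ^σ m₀(D)`. -/
def powerSymbol {d : ℕ} (σ : ℝ) (m₀ : Space d → ℂ) : Space d → ℂ :=
  fun ξ => ((‖ξ‖ ^ σ : ℝ) : ℂ) * m₀ ξ

/-- The mollification `m * η_ε`, where `η_ε = ε^{-d} η(·/ε)`. -/
def mollify {d : ℕ} (m : Space d → ℂ) (η : Space d → ℝ) (ε : ℝ) : Space d → ℂ :=
  fun ξ => ∫ ζ, (η ζ : ℂ) * m (ξ - ε • ζ)

/-- `g = m(D) f` for a locally integrable symbol `m` and a tempered distribution `f`. The symbol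
need not be smooth at the origin, so `m(D) f` is not defined for every `f`. It is the limit in
`𝓢'` of `(m * η_ε)(D) f` as `ε → 0`, provided that this limit exists and is the same for all
mollifiers. For `f` in the Schwartz class it is the inverse Fourier transform of `m` times the
Fourier transform of `f`, and for `m` smooth of temperate growth it is the usual `m(D) f`. -/
def IsMultiplierApply {d : ℕ} (m : Space d → ℂ) (f g : 𝓢'(Space d, ℂ)) : Prop :=
  ∀ η : Space d → ℝ, ContDiff ℝ ∞ η → HasCompactSupport η → ∫ ζ, η ζ = 1 →
    Tendsto (fun ε : ℝ => TemperedDistribution.fourierMultiplierCLM ℂ (mollify m η ε) f)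
      (𝓝[>] 0) (𝓝 g)

end Striated

end

open Striated

noncomputable section

namespace Striated

section

/-! ### Operators on tempered distributions -/

/-! Algebra. A word `w` in the fields differentiates distributions (`dd`) and takes iterated
commutators of operators (`dL`). By the Leibniz rule (`leibniz_bound`), the derivative of a bilinear
expression along `w` is bounded by a convolution `conv` over the splittings of `w`. Commuting a
field with `∂_j` or with a Fourier multiplier produces derivatives of the coefficients of the field
and nothing worse. The resulting quadratic recursion is solved once and for all by the weight `wt
W`, so an `L^p` estimate without derivatives becomes one along `w` after convolution with a power of
`wt W`. The words of the striated norms are sorted, and subwords of sorted words are sorted. Hence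
summation over multi-indices turns convolutions into products (`mass_conv_le`), with constants that
see the length of the words but not `N`. The hypothesis on the family bounds the weights up to
length `k`; at length `k + 1` they are affine in the `B^1_{∞,1}` norm of the family
(`exists_tm_wp`), and this gives the middle term of (iii).

Analysis. The kernel of an iterated commutator of `a(D)` with functions `V` is `∏ (V(x) - V(y)) κ(x
- y)`, so by Young's inequality each commutator at frequency `2^q` gains `2^{-q}` at the price of a
Lipschitz norm. For a divergence-free `W` the commutator of `W · ∇` with `a(D)` is the sum of the
commutators of `W^j` with `(2πi ξ_j a)(D)`: the loss `2^q` and the gain cancel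
(`SymBound.adL_dL_le`). An annular multiplier is `2^{-q}` times a derivative, on either side. This
makes localized operators, and the derivatives along words themselves, almost orthogonal with decay
`2^{-|q-n|}` (`good_mop`, `BaseBound.block_dd_block_le`). The decay beats any weight `2^{qs}` with
`|s| < 1`, so Besov norms of derivatives along words may be computed from derivatives of blocks.

(i) It suffices to gain `2^{-(n-q)_+}` for the output block `q`; the weight `2^{-qε}` sums the rest,
and no paraproducts are needed. With `u` bounded, `n` is the frequency of `φ`, and for `n > q` the
divergence form puts the derivative on the output. With `∇φ` bounded, `n` is the frequency of `u`:
its block is written as a divergence and integrated by parts. If the frequency of `∇φ` also exceeds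
`2^q`, the condition `div u = 0` first moves the gradient off `φ` (`BandBound.exists_factors`).

(iii) On an annulus of size `2^q` the symbol is `2^{qσ}` times a bounded family, so `m(D)` acts
there as a regular multiplier (`AnnRep.mult_dil_eq`). The lowest block is a sum of annuli shrinking
to the origin. It converges geometrically with ratio `2^{-(σ+τ)}` if `f` has `τ` derivatives in
front (`AnnRep.exists_low_freq`): `τ = 1` always controls the gradient of the lowest block, and `τ =
0` controls the block when `σ > 0`. For `σ ≤ 0` the block stays on the right-hand side.

(ii) A block of the commutator is a difference of the commutators of `u · ∇` with the localized
`m(D)`, acting on `φ`, and with the block, acting on `m(D)φ` (`AnnRep.block_comm_eq`). Both are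
almost orthogonal with a Lipschitz norm of `u` as constant (`good_lie`). Low frequencies of `m(D)φ`
enter through their gradient only, and `u · ∇φ` is a divergence, so no extra term is left. The norm
`‖u‖_{L^∞}` is used for the lowest block. -/

/-- Continuous operators on tempered distributions. -/
abbrev Op (d : ℕ) : Type := 𝓢'(Space d, ℂ) →L[ℂ] 𝓢'(Space d, ℂ)

theorem op_mul_apply {d : ℕ} (A B : Op d) (f : 𝓢'(Space d, ℂ)) : (A * B) f = A (B f) := rfl

/-- The algebra of smooth functions of temperate growth. -/
def temperateAlg (d : ℕ) : Subalgebra ℂ (Space d → ℂ) where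
  carrier := {f | f.HasTemperateGrowth}
  mul_mem' hf hg := hf.mul hg
  add_mem' hf hg := hf.add hg
  algebraMap_mem' c := Function.HasTemperateGrowth.const c

/-- Smooth functions of temperate growth. -/
abbrev TFun (d : ℕ) : Type := temperateAlg d

variable {d : ℕ}

theorem TFun.contDiff (V : TFun d) : ContDiff ℝ ∞ (V : Space d → ℂ) := V.2.1

theorem TFun.differentiable (V : TFun d) : Differentiable ℝ (V : Space d → ℂ) :=
  V.contDiff.differentiable (by simp)

theorem _root_.Function.HasTemperateGrowth.fderiv_apply {E F : Type*} [NormedAddCommGroup E]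
    [NormedSpace ℝ E] [NormedAddCommGroup F] [NormedSpace ℝ F] {f : E → F}
    (hf : f.HasTemperateGrowth) (v : E) : (fun x => fderiv ℝ f x v).HasTemperateGrowth := by
  have h1 : (fderiv ℝ f).HasTemperateGrowth := by
    refine ⟨hf.1.fderiv_right (by simp), fun n => ?_⟩
    obtain ⟨k, C, h⟩ := hf.2 (n + 1)
    exact ⟨k, C, fun x => by rw [norm_iteratedFDeriv_fderiv]; exact h x⟩
  exact (ContinuousLinearMap.hasTemperateGrowth (ContinuousLinearMap.apply ℝ F v)).comp h1

/-- The partial derivative of a function of temperate growth. -/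
def TFun.pd (j : Fin d) (V : TFun d) : TFun d :=
  ⟨fun x => fderiv ℝ (V : Space d → ℂ) x (stdVec j), V.2.fderiv_apply _⟩

/-- The components of a vector field. -/
def SmoothField.c (V : SmoothField d) (j : Fin d) : TFun d := ⟨V.comp j, V.comp_temperate j⟩

/-- The derivative of a function along a vector field. -/
def SmoothField.act (W : SmoothField d) (V : TFun d) : TFun d := ∑ j, W.c j * V.pd j

/-- A function of temperate growth as a distribution. -/
def TFun.dist (V : TFun d) : 𝓢'(Space d, ℂ) := V.2.toTemperedDistribution

/-- Multiplication by a function of temperate growth. -/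
def mulOp (V : TFun d) : Op d := TemperedDistribution.smulLeftCLM ℂ (V : Space d → ℂ)

/-- The partial derivative on distributions. -/
def pd (j : Fin d) : Op d := LineDeriv.lineDerivOpCLM ℂ 𝓢'(Space d, ℂ) (stdVec j)

theorem pd_apply (j : Fin d) (f : 𝓢'(Space d, ℂ)) : pd j f = ∂_{(stdVec j : Space d)} f := rfl

theorem mulOp_mul (V U : TFun d) : mulOp (V * U) = mulOp V * mulOp U := by
  ext1 f
  show _ = TemperedDistribution.smulLeftCLM ℂ (V : Space d → ℂ)
    (TemperedDistribution.smulLeftCLM ℂ (U : Space d → ℂ) f)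
  rw [TemperedDistribution.smulLeftCLM_smulLeftCLM_apply U.2 V.2, mul_comm]
  rfl

theorem mulOp_add (V U : TFun d) : mulOp (V + U) = mulOp V + mulOp U :=
  TemperedDistribution.smulLeftCLM_add V.2 U.2

theorem mulOp_zero : mulOp (0 : TFun d) = 0 := by
  have := mulOp_add (0 : TFun d) 0
  simpa using this

theorem mulOp_sum {ι : Type*} (s : Finset ι) (V : ι → TFun d) :
    mulOp (∑ i ∈ s, V i) = ∑ i ∈ s, mulOp (V i) := by
  classical
  induction s using Finset.induction_on with
  | empty => simp [mulOp_zero]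
  | insert a s ha ih => rw [Finset.sum_insert ha, Finset.sum_insert ha, mulOp_add, ih]

theorem mulOp_comm (V U : TFun d) : mulOp V * mulOp U = mulOp U * mulOp V := by
  rw [← mulOp_mul, mul_comm, mulOp_mul]

theorem mulOp_apply_apply (V : TFun d) (f : 𝓢'(Space d, ℂ)) (θ : 𝓢(Space d, ℂ)) :
    mulOp V f θ = f (SchwartzMap.smulLeftCLM ℂ (V : Space d → ℂ) θ) := rfl

/-- Transpose of the Leibniz rule for `V θ`, with `θ` the test function; the sign of the
distributional derivative turns the difference into a sum. -/
theorem pd_mul_mulOp (j : Fin d) (V : TFun d) :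
    pd j * mulOp V = mulOp (V.pd j) + mulOp V * pd j := by
  ext f θ
  show f (SchwartzMap.smulLeftCLM ℂ (V : Space d → ℂ) (-∂_{(stdVec j : Space d)} θ)) =
    f (SchwartzMap.smulLeftCLM ℂ (V.pd j : Space d → ℂ) θ) +
    f (-∂_{(stdVec j : Space d)} (SchwartzMap.smulLeftCLM ℂ (V : Space d → ℂ) θ))
  rw [← map_add]
  congr 1
  ext x
  have hV := V.2
  have hV' := (V.pd j).2
  have e1 : (SchwartzMap.smulLeftCLM ℂ (V : Space d → ℂ) θ : Space d → ℂ) = fun x => V.1 x • θ x := by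
    ext x; exact SchwartzMap.smulLeftCLM_apply_apply hV θ x
  have e2 : (SchwartzMap.smulLeftCLM ℂ (V.pd j : Space d → ℂ) θ : Space d → ℂ) x
    = (V.pd j).1 x • θ x := SchwartzMap.smulLeftCLM_apply_apply hV' θ x
  have e3 : (SchwartzMap.smulLeftCLM ℂ (V : Space d → ℂ) (-∂_{(stdVec j : Space d)} θ) : Space d → ℂ) x
    = V.1 x • (-∂_{(stdVec j : Space d)} θ) x := SchwartzMap.smulLeftCLM_apply_apply hV _ x
  rw [add_apply, neg_apply, SchwartzMap.lineDerivOp_apply_eq_fderiv, e1, e2, e3,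
    fderiv_fun_smul V.differentiable.differentiableAt θ.differentiableAt,
    neg_apply, SchwartzMap.lineDerivOp_apply_eq_fderiv]
  simp [TFun.pd]

theorem deriv_eq (W : SmoothField d) : W.deriv = ∑ j, mulOp (W.c j) * pd j := rfl

/-- The Fourier multiplier with symbol `a`. -/
def mult (a : Space d → ℂ) : Op d := TemperedDistribution.fourierMultiplierCLM ℂ a

theorem mult_mul {a b : Space d → ℂ} (ha : a.HasTemperateGrowth) (hb : b.HasTemperateGrowth) :
    mult a * mult b = mult (a * b) := by
  rw [mul_comm a b]
  exact TemperedDistribution.fourierMultiplierCLM_compL_fourierMultiplierCLM hb ha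

theorem mult_comm {a b : Space d → ℂ} (ha : a.HasTemperateGrowth) (hb : b.HasTemperateGrowth) :
    mult a * mult b = mult b * mult a := by
  rw [mult_mul ha hb, mul_comm, mult_mul hb ha]

/-- The symbol of the `j`-th partial derivative. -/
def xi (j : Fin d) : Space d → ℂ := fun ξ => (2 * Real.pi * Complex.I) * (ξ j : ℂ)

theorem xi_temperate (j : Fin d) : (xi j : Space d → ℂ).HasTemperateGrowth := by
  have h1 : Function.HasTemperateGrowth
      (Complex.ofRealCLM.comp (EuclideanSpace.proj j : Space d →L[ℝ] ℝ)) :=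
    ContinuousLinearMap.hasTemperateGrowth _
  exact (Function.HasTemperateGrowth.const _).mul h1

theorem pd_eq_mult (j : Fin d) : pd j = mult (xi j) := by
  ext1 f
  have h1 : Function.HasTemperateGrowth
      (Complex.ofRealCLM.comp (EuclideanSpace.proj j : Space d →L[ℝ] ℝ)) :=
    ContinuousLinearMap.hasTemperateGrowth _
  rw [pd_apply, TemperedDistribution.lineDeriv_eq_fourierMultiplierCLM]
  have h2 := TemperedDistribution.fourierMultiplierCLM_smul (F := ℂ) h1 (2 * Real.pi * Complex.I)
  have h3 : (fun x : Space d => ((inner ℝ x (stdVec j) : ℝ) : ℂ)) =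
      Complex.ofRealCLM.comp (EuclideanSpace.proj j : Space d →L[ℝ] ℝ) := by
    ext x; simp [stdVec, EuclideanSpace.inner_single_right]
  rw [h3]
  exact (DFunLike.congr_fun h2 f).symm

theorem pd_comm (i j : Fin d) : pd i * pd j = pd j * pd i := by
  rw [pd_eq_mult, pd_eq_mult, mult_comm (xi_temperate i) (xi_temperate j)]

theorem mult_pd_comm {a : Space d → ℂ} (ha : a.HasTemperateGrowth) (j : Fin d) :
    mult a * pd j = pd j * mult a := by
  rw [pd_eq_mult, mult_comm ha (xi_temperate j)]

theorem mult_pd {a : Space d → ℂ} (ha : a.HasTemperateGrowth) (j : Fin d) :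
    mult a * pd j = mult (a * xi j) := by
  rw [pd_eq_mult, mult_mul ha (xi_temperate j)]

theorem dist_def_apply (V : TFun d) (θ : 𝓢(Space d, ℂ)) : V.dist θ = ∫ x, θ x * V.1 x := rfl

theorem mulOp_dist (V U : TFun d) : mulOp V U.dist = (V * U).dist := by
  ext θ
  rw [mulOp_apply_apply, dist_def_apply, dist_def_apply]
  congr 1; ext x
  have e1 : (SchwartzMap.smulLeftCLM ℂ (V : Space d → ℂ) θ : Space d → ℂ) x = V.1 x • θ x :=
    SchwartzMap.smulLeftCLM_apply_apply V.2 θ x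
  rw [e1]
  simp; ring

theorem pd_dist (j : Fin d) (V : TFun d) : pd j V.dist = (V.pd j).dist := by
  ext θ
  have e : pd j V.dist θ = ∫ x, (-∂_{(stdVec j : Space d)} θ) x * V.1 x := rfl
  rw [e, dist_def_apply]
  have hi : ∀ (θ : 𝓢(Space d, ℂ)) (V : TFun d), Integrable (fun x => θ x * V.1 x) := fun θ V => by
    have h := (SchwartzMap.smulLeftCLM ℂ (V : Space d → ℂ) θ).integrable (μ := volume)
    refine h.congr (Eventually.of_forall fun x => ?_)
    have e1 : (SchwartzMap.smulLeftCLM ℂ (V : Space d → ℂ) θ : Space d → ℂ) x = V.1 x • θ x :=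
      SchwartzMap.smulLeftCLM_apply_apply V.2 θ x
    simp only [e1, smul_eq_mul, mul_comm]
  have h := integral_mul_fderiv_eq_neg_fderiv_mul_of_integrable (μ := (volume : Measure (Space d)))
    (f := fun x => θ x) (g := V.1) (v := stdVec j) (𝕜 := ℂ) ?_ ?_ ?_ ?_ ?_
  · show _ = ∫ x, θ x * fderiv ℝ V.1 x (stdVec j)
    rw [h, ← integral_neg]
    congr 1; ext x
    rw [neg_apply, SchwartzMap.lineDerivOp_apply_eq_fderiv]; ring
  · exact (hi (∂_{(stdVec j : Space d)} θ) V).congr (Eventually.of_forall fun x => by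
      simp only [SchwartzMap.lineDerivOp_apply_eq_fderiv])
  · exact hi θ (V.pd j)
  · exact hi θ V
  · exact fun x _ => θ.differentiable x
  · exact fun x _ => V.differentiable x

/-- Reduces the linearity of `TFun.dist` to that of `mulOp`. -/
theorem dist_eq_mulOp_one (V : TFun d) : V.dist = mulOp V (1 : TFun d).dist := by
  rw [mulOp_dist, mul_one]

theorem deriv_dist (W : SmoothField d) (V : TFun d) : W.deriv V.dist = (W.act V).dist := by
  rw [dist_eq_mulOp_one (W.act V), SmoothField.act, mulOp_sum, deriv_eq]
  simp only [_root_.sum_apply, op_mul_apply, pd_dist, mulOp_dist, mul_one]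

/-- The first-order parts cancel because multiplications commute. -/
theorem lie_deriv_mulOp (W : SmoothField d) (V : TFun d) :
    ⁅W.deriv, mulOp V⁆ = mulOp (W.act V) := by
  simp only [Ring.lie_def, deriv_eq, SmoothField.act, mulOp_sum, mulOp_mul, Finset.sum_mul,
    Finset.mul_sum, mul_assoc, pd_mul_mulOp, mul_add, Finset.sum_add_distrib]
  simp only [← mul_assoc, mulOp_comm V]
  abel

theorem isDivFree_iff (W : SmoothField d) : W.IsDivFree ↔ ∑ j, (W.c j).pd j = 0 := by
  have key : ∀ (j : Fin d) (x : Space d), ((W.c j).pd j : Space d → ℂ) x =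
      ((fderiv ℝ W.toFun x (stdVec j) j : ℝ) : ℂ) := fun j x => by
    have hd : DifferentiableAt ℝ W.toFun x := (W.temperate.1.differentiable (by simp)) x
    have h := ((Complex.ofRealCLM.comp
      (EuclideanSpace.proj j : Space d →L[ℝ] ℝ)).hasFDerivAt.comp x hd.hasFDerivAt).fderiv
    show fderiv ℝ (W.comp j) x (stdVec j) = _
    rw [show W.comp j = (Complex.ofRealCLM.comp
      (EuclideanSpace.proj j : Space d →L[ℝ] ℝ)) ∘ W.toFun from rfl, h]
    rfl
  constructor
  · intro h
    ext x
    have := h x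
    simp only [AddSubmonoidClass.coe_finsetSum, Finset.sum_apply, key]
    rw [← Complex.ofReal_sum, this]; rfl
  · intro h x
    have := congrFun (congrArg Subtype.val h) x
    simp only [AddSubmonoidClass.coe_finsetSum, Finset.sum_apply, key] at this
    rw [← Complex.ofReal_sum] at this
    exact Complex.ofReal_eq_zero.1 this

/-- Divergence form of the transport operator, used whenever the derivative is to be handed to an
operator that acts afterwards. -/
theorem deriv_eq_of_divFree {W : SmoothField d} (hW : W.IsDivFree) :
    W.deriv = ∑ j, pd j * mulOp (W.c j) := by
  simp only [pd_mul_mulOp, Finset.sum_add_distrib, ← mulOp_sum, (isDivFree_iff W).1 hW, mulOp_zero,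
    zero_add]
  rfl


/-! ### The `L^p` norm of a distribution -/

section distLpNorm

variable {p : ℝ≥0∞} [Fact (1 ≤ p)]

theorem toTemperedDistribution_injective :
    Function.Injective (fun F : Lp ℂ p (volume : Measure (Space d)) =>
      Lp.toTemperedDistribution F) := by
  have h := Lp.ker_toTemperedDistributionCLM_eq_bot (F := ℂ) (p := p) (μ := (volume : Measure (Space d)))
  exact LinearMap.ker_eq_bot.1 h

theorem distLpNorm_coe (F : Lp ℂ p (volume : Measure (Space d))) :
    distLpNorm p (Lp.toTemperedDistribution F) = ‖F‖ₑ := by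
  apply le_antisymm
  · exact (iInf_le _ F).trans (iInf_le _ rfl)
  · refine le_iInf₂ fun G hG => ?_
    rw [toTemperedDistribution_injective hG]

theorem exists_coe_of_distLpNorm_ne_top {f : 𝓢'(Space d, ℂ)} (h : distLpNorm p f ≠ ⊤) :
    ∃ F : Lp ℂ p (volume : Measure (Space d)), Lp.toTemperedDistribution F = f := by
  by_contra! h'
  apply h
  simp [distLpNorm, h']

theorem toTemperedDistribution_add (F G : Lp ℂ p (volume : Measure (Space d))) :
    Lp.toTemperedDistribution (F + G) = Lp.toTemperedDistribution F + Lp.toTemperedDistribution G :=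
  map_add (Lp.toTemperedDistributionCLM ℂ volume p) F G

theorem toTemperedDistribution_smul (c : ℂ) (F : Lp ℂ p (volume : Measure (Space d))) :
    Lp.toTemperedDistribution (c • F) = c • Lp.toTemperedDistribution F :=
  map_smul (Lp.toTemperedDistributionCLM ℂ volume p) c F

theorem distLpNorm_zero : distLpNorm p (0 : 𝓢'(Space d, ℂ)) = 0 := by
  have h := distLpNorm_coe (d := d) (p := p) 0
  rwa [show Lp.toTemperedDistribution (0 : Lp ℂ p (volume : Measure (Space d))) = 0 from
    map_zero (Lp.toTemperedDistributionCLM ℂ volume p), enorm_zero] at h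

theorem distLpNorm_add_le (f g : 𝓢'(Space d, ℂ)) :
    distLpNorm p (f + g) ≤ distLpNorm p f + distLpNorm p g := by
  by_cases hf : distLpNorm p f = ⊤
  · simp [hf]
  by_cases hg : distLpNorm p g = ⊤
  · simp [hg]
  obtain ⟨F, rfl⟩ := exists_coe_of_distLpNorm_ne_top hf
  obtain ⟨G, rfl⟩ := exists_coe_of_distLpNorm_ne_top hg
  rw [← toTemperedDistribution_add, distLpNorm_coe, distLpNorm_coe, distLpNorm_coe]
  exact enorm_add_le F G

theorem distLpNorm_smul_le (c : ℂ) (f : 𝓢'(Space d, ℂ)) :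
    distLpNorm p (c • f) ≤ ‖c‖ₑ * distLpNorm p f := by
  by_cases hc : c = 0
  · rw [hc, zero_smul ℂ f]; simp [distLpNorm_zero]
  by_cases hf : distLpNorm p f = ⊤
  · simp [hf, hc]
  obtain ⟨F, rfl⟩ := exists_coe_of_distLpNorm_ne_top hf
  rw [← toTemperedDistribution_smul, distLpNorm_coe, distLpNorm_coe, enorm_smul]

theorem distLpNorm_neg (f : 𝓢'(Space d, ℂ)) : distLpNorm p (-f) = distLpNorm p f := by
  have h : ∀ f : 𝓢'(Space d, ℂ), distLpNorm p (-f) ≤ distLpNorm p f := fun f => by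
    have := distLpNorm_smul_le (p := p) (-1) f
    rw [neg_one_smul ℂ f] at this; simpa using this
  exact le_antisymm (h f) (by simpa using h (-f))

theorem distLpNorm_sub_le (f g : 𝓢'(Space d, ℂ)) :
    distLpNorm p (f - g) ≤ distLpNorm p f + distLpNorm p g := by
  rw [sub_eq_add_neg, ← distLpNorm_neg g]
  exact distLpNorm_add_le _ _

theorem distLpNorm_sum_le {ι : Type*} (s : Finset ι) (f : ι → 𝓢'(Space d, ℂ)) :
    distLpNorm p (∑ i ∈ s, f i) ≤ ∑ i ∈ s, distLpNorm p (f i) := by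
  classical
  induction s using Finset.induction_on with
  | empty => simp [distLpNorm_zero]
  | insert a s ha ih =>
    rw [Finset.sum_insert ha, Finset.sum_insert ha]
    exact (distLpNorm_add_le _ _).trans (by gcongr)

theorem eq_zero_of_distLpNorm_eq_zero {f : 𝓢'(Space d, ℂ)} (h : distLpNorm p f = 0) : f = 0 := by
  obtain ⟨F, rfl⟩ := exists_coe_of_distLpNorm_ne_top (p := p) (f := f) (by simp [h])
  rw [distLpNorm_coe, enorm_eq_zero] at h
  rw [h]
  exact map_zero (Lp.toTemperedDistributionCLM ℂ volume p)

/-- Countable subadditivity of the `L^p` norm along series that converge as distributions. -/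
theorem distLpNorm_le_tsum {f : 𝓢'(Space d, ℂ)} {g : ℕ → 𝓢'(Space d, ℂ)}
    (h : Tendsto (fun n => ∑ i ∈ Finset.range n, g i) atTop (𝓝 f)) :
    distLpNorm p f ≤ ∑' i, distLpNorm p (g i) := by
  by_cases hs : ∑' i, distLpNorm p (g i) = ⊤
  · simp [hs]
  have hi : ∀ i, distLpNorm p (g i) ≠ ⊤ := fun i => ENNReal.ne_top_of_tsum_ne_top hs i
  choose G hG using fun i => exists_coe_of_distLpNorm_ne_top (hi i)
  have hn : ∀ i, distLpNorm p (g i) = ‖G i‖ₑ := fun i => by rw [← hG i, distLpNorm_coe]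
  simp only [hn] at hs ⊢
  have hsum : Summable G := by
    apply Summable.of_norm
    have : Summable fun i => (‖G i‖₊ : ℝ≥0) := by
      rw [← ENNReal.tsum_coe_ne_top_iff_summable]; exact hs
    exact NNReal.summable_coe.2 this
  have ht := hsum.hasSum.tendsto_sum_nat
  have ht2 := ((Lp.toTemperedDistributionCLM ℂ volume p).continuous.tendsto _).comp ht
  -- The series converges absolutely in `L^p`, hence as a series of distributions, and the two
  -- limits agree.
  have heq : f = Lp.toTemperedDistribution (∑' i, G i) := by
    refine tendsto_nhds_unique h (ht2.congr fun n => ?_)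
    simp only [Function.comp_apply, map_sum]
    exact Finset.sum_congr rfl fun i _ => hG i
  rw [heq, distLpNorm_coe]
  exact enorm_tsum_le_tsum_enorm

end distLpNorm

/-! ### Functions of temperate growth in `L^p` -/

theorem TFun.ae_eq_of_dist_eq {p : ℝ≥0∞} [Fact (1 ≤ p)] {V : TFun d}
    {F : Lp ℂ p (volume : Measure (Space d))} (h : Lp.toTemperedDistribution F = V.dist) :
    (F : Space d → ℂ) =ᵐ[volume] V.1 := by
  have hV : LocallyIntegrable V.1 := V.contDiff.continuous.locallyIntegrable
  have hF : LocallyIntegrable (F : Space d → ℂ) := (Lp.memLp F).locallyIntegrable (Fact.out)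
  refine ae_eq_of_integral_contDiff_smul_eq hF hV fun g hg hc => ?_
  have hg₁ : HasCompactSupport (Complex.ofRealCLM ∘ g) := hc.comp_left rfl
  have hg₂ : ContDiff ℝ ∞ (Complex.ofRealCLM ∘ g) := by fun_prop
  have := DFunLike.congr_fun h (hg₁.toSchwartzMap hg₂)
  rw [Lp.toTemperedDistribution_apply, dist_def_apply] at this
  simpa using this

theorem TFun.eLpNorm_eq {p : ℝ≥0∞} [Fact (1 ≤ p)] {V : TFun d} (h : distLpNorm p V.dist ≠ ⊤) :
    MemLp V.1 p volume ∧ eLpNorm V.1 p volume = distLpNorm p V.dist := by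
  obtain ⟨F, hF⟩ := exists_coe_of_distLpNorm_ne_top h
  have hae := TFun.ae_eq_of_dist_eq hF
  refine ⟨(memLp_congr_ae hae).1 (Lp.memLp F), ?_⟩
  rw [← hF, distLpNorm_coe, ← eLpNorm_congr_ae hae, Lp.enorm_def]

theorem TFun.distLpNorm_le_eLpNorm {p : ℝ≥0∞} [Fact (1 ≤ p)] (V : TFun d) :
    distLpNorm p V.dist ≤ eLpNorm V.1 p volume := by
  by_cases h : eLpNorm V.1 p volume = ⊤
  · simp [h]
  have hm : MemLp V.1 p volume := ⟨V.contDiff.continuous.aestronglyMeasurable, Ne.lt_top h⟩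
  have : V.dist = Lp.toTemperedDistribution (hm.toLp V.1) := by
    ext θ
    rw [Lp.toTemperedDistribution_apply, dist_def_apply]
    refine integral_congr_ae ?_
    filter_upwards [hm.coeFn_toLp] with x hx
    rw [hx, smul_eq_mul]
  rw [this, distLpNorm_coe, Lp.enorm_def, eLpNorm_congr_ae hm.coeFn_toLp]

theorem TFun.eq_zero_of_dist_eq_zero {V : TFun d} (h : V.dist = 0) : V = 0 := by
  have h0 : Lp.toTemperedDistribution (0 : Lp ℂ 1 (volume : Measure (Space d))) = V.dist := by
    rw [h]; exact map_zero (Lp.toTemperedDistributionCLM ℂ volume 1)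
  have hae := (TFun.ae_eq_of_dist_eq h0).symm.trans (Lp.coeFn_zero _ _ _)
  have := Continuous.ae_eq_iff_eq (μ := volume) V.contDiff.continuous
    (continuous_const (y := (0 : ℂ))) |>.1 hae
  ext x
  exact congrFun this x

theorem distLpNorm_mulOp_le {p₁ p₂ p : ℝ≥0∞} [Fact (1 ≤ p₁)] [Fact (1 ≤ p₂)] [Fact (1 ≤ p)]
    [p₁.HolderTriple p₂ p] (V : TFun d) (f : 𝓢'(Space d, ℂ)) :
    distLpNorm p (mulOp V f) ≤ distLpNorm p₁ V.dist * distLpNorm p₂ f := by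
  -- The vanishing factors come first: a zero factor must beat an infinite one.
  by_cases hV0 : distLpNorm p₁ V.dist = 0
  · rw [TFun.eq_zero_of_dist_eq_zero (eq_zero_of_distLpNorm_eq_zero hV0), mulOp_zero]
    simp [distLpNorm_zero]
  by_cases hf0 : distLpNorm p₂ f = 0
  · rw [eq_zero_of_distLpNorm_eq_zero hf0]
    simp [distLpNorm_zero]
  by_cases hV : distLpNorm p₁ V.dist = ⊤
  · simp [hV, hf0]
  by_cases hf : distLpNorm p₂ f = ⊤
  · simp [hf, hV0]
  obtain ⟨F, rfl⟩ := exists_coe_of_distLpNorm_ne_top hf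
  obtain ⟨hm, he⟩ := TFun.eLpNorm_eq hV
  have := Lp.toTemperedDistribution_smul_eq (r := p) V.2 hm F
  rw [mulOp, ← this, distLpNorm_coe, distLpNorm_coe, ← he]
  have hn := Lp.norm_smul_le (r := p) (hm.toLp V.1) F
  rw [← ofReal_norm, ← ofReal_norm]
  calc ENNReal.ofReal ‖(hm.toLp V.1) • F‖ ≤ ENNReal.ofReal (‖hm.toLp V.1‖ * ‖F‖) :=
        ENNReal.ofReal_le_ofReal hn
    _ = _ := by
        rw [ENNReal.ofReal_mul (norm_nonneg _), Lp.norm_toLp, ENNReal.ofReal_toReal hm.2.ne]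

/-- The sup norm of a function of temperate growth. -/
def supN (V : TFun d) : ℝ≥0∞ := distLpNorm ∞ V.dist

/-- The Lipschitz seminorm of a function of temperate growth. -/
def lipN (V : TFun d) : ℝ≥0∞ := ∑ j, supN (V.pd j)

/-- By continuity the set where the essential bound holds is closed; having full measure, it is
dense. -/
theorem enorm_le_supN (V : TFun d) (x : Space d) : ‖V.1 x‖ₑ ≤ supN V := by
  by_cases h : supN V = ⊤
  · simp [h]
  obtain ⟨hm, he⟩ := TFun.eLpNorm_eq h
  rw [supN, ← he, eLpNorm_exponent_top]
  have hae := ae_le_eLpNormEssSup (f := V.1) (μ := volume)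
  have hcl : IsClosed {y : Space d | ‖V.1 y‖ₑ ≤ eLpNormEssSup V.1 volume} :=
    isClosed_le V.contDiff.continuous.enorm continuous_const
  have hd : Dense {y : Space d | ‖V.1 y‖ₑ ≤ eLpNormEssSup V.1 volume} :=
    Measure.dense_of_ae hae
  have := hd x
  rwa [hcl.closure_eq] at this

/-- Mean value inequality; the operator norm of the derivative is at most the sum of the sup norms
of the partial derivatives. -/
theorem enorm_sub_le_lipN (V : TFun d) (x y : Space d) :
    ‖V.1 x - V.1 y‖ₑ ≤ lipN V * ‖x - y‖ₑ := by
  by_cases hxy : x - y = 0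
  · simp [sub_eq_zero.1 hxy]
  by_cases h : lipN V = ⊤
  · rw [h, ENNReal.top_mul (by simpa using hxy)]; exact le_top
  have hj : ∀ j, supN (V.pd j) ≠ ⊤ := fun j => by
    have := ENNReal.sum_ne_top.1 h j (Finset.mem_univ _); exact this
  have hb : ∀ z, ‖fderiv ℝ V.1 z‖ ≤ (lipN V).toReal := fun z => by
    refine ContinuousLinearMap.opNorm_le_bound _ ENNReal.toReal_nonneg fun v => ?_
    have hv : v = ∑ j, v j • (stdVec j : Space d) := by
      ext i
      simp [stdVec, Pi.single_apply]
    have hs : ‖∑ j, v j • fderiv ℝ V.1 z (stdVec j)‖ ≤ ∑ j, ‖v‖ * (supN (V.pd j)).toReal := by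
      refine norm_sum_le_of_le _ fun j _ => ?_
      rw [norm_smul]
      gcongr
      · exact PiLp.norm_apply_le v j
      · have := enorm_le_supN (V.pd j) z
        have h2 := ENNReal.toReal_mono (hj j) this
        rwa [toReal_enorm] at h2
    calc ‖fderiv ℝ V.1 z v‖ = ‖∑ j, v j • fderiv ℝ V.1 z (stdVec j)‖ := by
          conv_lhs => rw [hv]
          simp
      _ ≤ _ := hs
      _ = (lipN V).toReal * ‖v‖ := by
          rw [← Finset.mul_sum, lipN, ENNReal.toReal_sum (fun j _ => hj j), mul_comm]
  have := Convex.norm_image_sub_le_of_norm_fderiv_le (𝕜 := ℝ) (f := V.1) (s := Set.univ)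
    (x := y) (y := x) (fun z _ => V.differentiable z) (fun z _ => hb z) convex_univ
    (Set.mem_univ _) (Set.mem_univ _)
  rw [← ofReal_norm, ← ofReal_norm, ← ENNReal.ofReal_toReal h, ← ENNReal.ofReal_mul (by simp)]
  exact ENNReal.ofReal_le_ofReal this

/-- Serves the degenerate case `0 · ∞` of the commutator bounds. -/
theorem eq_const_of_lipN_eq_zero {V : TFun d} (h : lipN V = 0) : V.1 = fun _ => V.1 0 := by
  ext x
  have := enorm_sub_le_lipN V x 0
  rw [h, zero_mul, nonpos_iff_eq_zero, enorm_eq_zero] at this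
  exact sub_eq_zero.1 this

end

section

variable {d : ℕ}

/-! ### Young's inequality -/

/-- Hölder's inequality with the kernel split as `h = h^{1/q} h^{1/p}`, `q` being the dual exponent.
-/
theorem lintegral_rpow_conv_le {p : ℝ} (hp : 1 ≤ p) {h g : Space d → ℝ≥0∞} (hh : Measurable h)
    (hg : AEMeasurable g) (x : Space d) :
    (∫⁻ y, h (x - y) * g y) ^ p ≤ (∫⁻ y, h y) ^ (p - 1) * ∫⁻ y, h (x - y) * g y ^ p := by
  have hinv : ∫⁻ y, h (x - y) = ∫⁻ y, h y := lintegral_sub_left_eq_self h x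
  have hm : Measurable fun y => h (x - y) := hh.comp (measurable_const.sub measurable_id)
  rcases eq_or_lt_of_le hp with rfl | hp1
  · simp
  · have hp0 : 0 < p := by linarith
    have hpq := Real.HolderConjugate.conjExponent hp1
    set q := Real.conjExponent p with hq
    have hq0 : 0 < q := hpq.symm.pos
    have key := ENNReal.lintegral_mul_le_Lp_mul_Lq volume hpq.symm
      (f := fun y => h (x - y) ^ (1 / q)) (g := fun y => h (x - y) ^ (1 / p) * g y)
      (hm.pow_const _).aemeasurable ((hm.pow_const _).aemeasurable.mul hg)
    have e1 : ∀ y, ((fun y => h (x - y) ^ (1 / q)) * fun y => h (x - y) ^ (1 / p) * g y) y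
        = h (x - y) * g y := fun y => by
      simp only [Pi.mul_apply]
      rw [← mul_assoc, ← ENNReal.rpow_add_of_nonneg _ _ (by positivity) (by positivity)]
      rw [show 1 / q + 1 / p = 1 by rw [add_comm]; simpa using hpq.inv_add_inv_eq_one]
      simp
    have e2 : ∀ y, (h (x - y) ^ (1 / q)) ^ q = h (x - y) := fun y => by
      rw [← ENNReal.rpow_mul, one_div_mul_cancel hq0.ne', ENNReal.rpow_one]
    have e3 : ∀ y, (h (x - y) ^ (1 / p) * g y) ^ p = h (x - y) * g y ^ p := fun y => by
      rw [ENNReal.mul_rpow_of_nonneg _ _ hp0.le, ← ENNReal.rpow_mul, one_div_mul_cancel hp0.ne',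
        ENNReal.rpow_one]
    simp only [e1, e2, e3, hinv] at key
    calc _ ≤ ((∫⁻ y, h y) ^ (1 / q) * (∫⁻ y, h (x - y) * g y ^ p) ^ (1 / p)) ^ p := by gcongr
      _ = _ := by
        rw [ENNReal.mul_rpow_of_nonneg _ _ hp0.le, ← ENNReal.rpow_mul, ← ENNReal.rpow_mul,
          one_div_mul_cancel hp0.ne', ENNReal.rpow_one]
        congr 2
        have := hpq.div_conj_eq_sub_one
        rw [one_div, inv_mul_eq_div]; exact this

/-- Young's inequality for `L¹ * L^p`, in the form of a domination, since the kernels in use are not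
of convolution type. For finite `p` the pointwise bound `lintegral_rpow_conv_le` is integrated in
`x` by Tonelli. -/
theorem eLpNorm_le_of_le_conv {p : ℝ≥0∞} (hp : 1 ≤ p) {h : Space d → ℝ≥0∞} {F H : Space d → ℂ}
    (hh : Measurable h) (hF : AEStronglyMeasurable F)
    (hle : ∀ x, ‖H x‖ₑ ≤ ∫⁻ y, h (x - y) * ‖F y‖ₑ) :
    eLpNorm H p volume ≤ (∫⁻ y, h y) * eLpNorm F p volume := by
  by_cases hpt : p = ⊤
  · subst hpt
    rw [eLpNorm_exponent_top, eLpNorm_exponent_top]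
    refine essSup_le_of_ae_le _ (Eventually.of_forall fun x => (hle x).trans ?_)
    calc ∫⁻ y, h (x - y) * ‖F y‖ₑ ≤ ∫⁻ y, h (x - y) * eLpNormEssSup F volume := by
          apply lintegral_mono_ae
          filter_upwards [ae_le_eLpNormEssSup (f := F) (μ := volume)] with y hy
          gcongr
      _ = _ := by
          have hm : Measurable fun y => h (x - y) := hh.comp (measurable_const.sub measurable_id)
          rw [lintegral_mul_const _ hm, lintegral_sub_left_eq_self h x]
  · have hp0 : p ≠ 0 := (zero_lt_one.trans_le hp).ne'
    have hpr : 1 ≤ p.toReal := by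
      rw [← ENNReal.toReal_one]; exact ENNReal.toReal_mono hpt hp
    have hpr0 : 0 < p.toReal := by linarith
    rw [eLpNorm_eq_lintegral_rpow_enorm_toReal hp0 hpt, eLpNorm_eq_lintegral_rpow_enorm_toReal hp0 hpt]
    rw [one_div, ENNReal.rpow_inv_le_iff hpr0, ENNReal.mul_rpow_of_nonneg _ _ hpr0.le,
      ← ENNReal.rpow_mul, inv_mul_cancel₀ hpr0.ne', ENNReal.rpow_one]
    set A := ∫⁻ y, h y
    have hgm : AEMeasurable fun y => ‖F y‖ₑ := hF.enorm
    calc ∫⁻ x, ‖H x‖ₑ ^ p.toReal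
        ≤ ∫⁻ x, A ^ (p.toReal - 1) * ∫⁻ y, h (x - y) * ‖F y‖ₑ ^ p.toReal := by
          refine lintegral_mono fun x => ?_
          exact (ENNReal.rpow_le_rpow (hle x) hpr0.le).trans (lintegral_rpow_conv_le hpr hh hgm x)
      _ = A ^ (p.toReal - 1) * ∫⁻ x, ∫⁻ y, h (x - y) * ‖F y‖ₑ ^ p.toReal := by
          rw [lintegral_const_mul'']
          refine AEMeasurable.lintegral_prod_right' (f := fun z : Space d × Space d => h (z.1 - z.2) * ‖F z.2‖ₑ ^ p.toReal) ?_
          refine (hh.comp (measurable_fst.sub measurable_snd)).aemeasurable.mul ?_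
          exact (hgm.comp_snd).pow_const _
      _ = A ^ (p.toReal - 1) * ∫⁻ y, ∫⁻ x, h (x - y) * ‖F y‖ₑ ^ p.toReal := by
          rw [lintegral_lintegral_swap]
          refine (hh.comp (measurable_fst.sub measurable_snd)).aemeasurable.mul ?_
          exact (hgm.comp_snd).pow_const _
      _ = A ^ (p.toReal - 1) * (A * ∫⁻ y, ‖F y‖ₑ ^ p.toReal) := by
          congr 1
          rw [← lintegral_const_mul'' _ (hgm.pow_const _)]
          congr 1; ext y
          have hm : Measurable fun x => h (x - y) := hh.comp (measurable_id.sub measurable_const)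
          rw [lintegral_mul_const _ hm, lintegral_sub_right_eq_self h y]
      _ = _ := by
          rw [← mul_assoc]
          congr 1
          nth_rw 2 [← ENNReal.rpow_one A]
          rw [← ENNReal.rpow_add_of_nonneg _ _ (by linarith) zero_le_one]
          congr 1; ring

/-! ### Distributions given by functions -/

/-- Measurable functions that are integrable against a power weight. -/
def TempInt (F : Space d → ℂ) : Prop :=
  ∃ n : ℕ, Integrable fun x => ((1 + ‖x‖) ^ n)⁻¹ • F x

/-- The distribution `f` is given by the function `F`. -/
def Rep (f : 𝓢'(Space d, ℂ)) (F : Space d → ℂ) : Prop :=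
  TempInt F ∧ ∀ θ : 𝓢(Space d, ℂ), f θ = ∫ x, θ x * F x

theorem one_add_norm_pos (x : Space d) : 0 < 1 + ‖x‖ := by positivity

theorem TempInt.aestronglyMeasurable {F : Space d → ℂ} (h : TempInt F) :
    AEStronglyMeasurable F := by
  obtain ⟨n, hn⟩ := h
  have hc : Continuous fun x : Space d => ((1 + ‖x‖) ^ n : ℝ) := by fun_prop
  refine (hc.aestronglyMeasurable.smul hn.aestronglyMeasurable).congr
    (Eventually.of_forall fun x => ?_)
  simp only [Pi.smul_apply', smul_smul]
  rw [mul_inv_cancel₀ (pow_pos (one_add_norm_pos x) n).ne', one_smul]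

theorem TempInt.mul_of_bound {F G : Space d → ℂ} (h : TempInt F) (hG : AEStronglyMeasurable G)
    {C : ℝ} {k : ℕ} (hb : ∀ x, ‖G x‖ ≤ C * (1 + ‖x‖) ^ k) : TempInt fun x => G x * F x := by
  have hm := h.aestronglyMeasurable
  obtain ⟨n, hn⟩ := h
  refine ⟨n + k, (hn.norm.const_mul C).mono' ?_ (Eventually.of_forall fun x => ?_)⟩
  · have hc : Continuous fun x : Space d => (((1 + ‖x‖) ^ (n + k))⁻¹ : ℝ) := by
      refine Continuous.inv₀ (by fun_prop) fun x => (pow_pos (one_add_norm_pos x) _).ne'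
    exact hc.aestronglyMeasurable.smul (hG.mul hm)
  · have h1 := one_add_norm_pos x
    rw [norm_smul, norm_smul, norm_mul, norm_inv, norm_inv, Real.norm_of_nonneg (by positivity),
      Real.norm_of_nonneg (by positivity), pow_add, mul_inv]
    calc ((1 + ‖x‖) ^ n)⁻¹ * ((1 + ‖x‖) ^ k)⁻¹ * (‖G x‖ * ‖F x‖)
        ≤ ((1 + ‖x‖) ^ n)⁻¹ * ((1 + ‖x‖) ^ k)⁻¹ * (C * (1 + ‖x‖) ^ k * ‖F x‖) := by
          gcongr; exact hb x
      _ = _ := by field_simp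

theorem TempInt.integrable_mul {F G : Space d → ℂ} (h : TempInt F) (hG : AEStronglyMeasurable G)
    (hb : ∀ k : ℕ, ∃ C : ℝ, ∀ x, ‖G x‖ ≤ C * ((1 + ‖x‖) ^ k)⁻¹) :
    Integrable fun x => G x * F x := by
  have hm := h.aestronglyMeasurable
  obtain ⟨n, hn⟩ := h
  obtain ⟨C, hC⟩ := hb n
  refine (hn.norm.const_mul C).mono' (hG.mul hm) (Eventually.of_forall fun x => ?_)
  have h1 := one_add_norm_pos x
  rw [norm_mul, norm_smul, norm_inv, Real.norm_of_nonneg (by positivity), ← mul_assoc]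
  gcongr
  exact hC x

theorem TempInt.mul_tfun {F : Space d → ℂ} (h : TempInt F) (V : TFun d) :
    TempInt fun x => V.1 x * F x := by
  obtain ⟨k, C, hb⟩ := V.2.2 0
  exact h.mul_of_bound V.contDiff.continuous.aestronglyMeasurable (fun x => by
    simpa using hb x)

theorem schwartz_decay (θ : 𝓢(Space d, ℂ)) (k : ℕ) :
    ∃ C : ℝ, 0 ≤ C ∧ ∀ x, ‖θ x‖ ≤ C * ((1 + ‖x‖) ^ k)⁻¹ := by
  refine ⟨2 ^ k * (Finset.Iic (k, 0)).sup (fun m => SchwartzMap.seminorm ℝ m.1 m.2) θ, by positivity, fun x => ?_⟩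
  have h := SchwartzMap.one_add_le_sup_seminorm_apply (𝕜 := ℝ) (m := (k, 0)) (k := k) (n := 0) le_rfl le_rfl θ x
  have h1 := pow_pos (one_add_norm_pos x) k
  rw [← div_eq_mul_inv, le_div_iff₀ h1, mul_comm]
  simpa using h

theorem TempInt.integrable_schwartz_mul {F : Space d → ℂ} (h : TempInt F) (θ : 𝓢(Space d, ℂ)) :
    Integrable fun x => θ x * F x :=
  h.integrable_mul θ.continuous.aestronglyMeasurable fun k =>
    (schwartz_decay θ k).imp fun _ hC => hC.2

theorem Rep.mulOp {f : 𝓢'(Space d, ℂ)} {F : Space d → ℂ} (h : Rep f F) (V : TFun d) :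
    Rep (mulOp V f) (fun x => V.1 x * F x) := by
  refine ⟨h.1.mul_tfun V, fun θ => ?_⟩
  rw [mulOp_apply_apply, h.2]
  congr 1; ext x
  have e1 : (SchwartzMap.smulLeftCLM ℂ (V : Space d → ℂ) θ : Space d → ℂ) x = V.1 x • θ x :=
    SchwartzMap.smulLeftCLM_apply_apply V.2 θ x
  rw [e1, smul_eq_mul]; ring

theorem TempInt.sub {F G : Space d → ℂ} (h : TempInt F) (hG : TempInt G) :
    TempInt fun x => F x - G x := by
  have key : ∀ {F : Space d → ℂ} {n : ℕ} (m : ℕ), (Integrable fun x => ((1 + ‖x‖) ^ n)⁻¹ • F x) →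
      Integrable fun x => ((1 + ‖x‖) ^ (n + m))⁻¹ • F x := fun {F n} m hn => by
    refine hn.norm.mono' ?_ (Eventually.of_forall fun x => ?_)
    · have hc : Continuous fun x : Space d => (((1 + ‖x‖) ^ (n + m))⁻¹ : ℝ) := by
        refine Continuous.inv₀ (by fun_prop) fun x => (pow_pos (one_add_norm_pos x) _).ne'
      exact hc.aestronglyMeasurable.smul (TempInt.aestronglyMeasurable ⟨n, hn⟩)
    · rw [norm_smul, norm_smul]
      gcongr ?_ * _
      rw [norm_inv, norm_inv]
      have h1 := one_add_norm_pos x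
      have : 1 ≤ (1 + ‖x‖) ^ m := one_le_pow₀ (by linarith [norm_nonneg x])
      rw [Real.norm_of_nonneg (by positivity), Real.norm_of_nonneg (by positivity), pow_add]
      gcongr
      nlinarith [pow_pos h1 n]
  obtain ⟨n, hn⟩ := h
  obtain ⟨m, hm⟩ := hG
  refine ⟨n + m, ((key m hn).sub (add_comm m n ▸ key n hm)).congr (Eventually.of_forall fun x => ?_)⟩
  simp [smul_sub]

theorem Rep.sub {f g : 𝓢'(Space d, ℂ)} {F G : Space d → ℂ} (h : Rep f F) (hg : Rep g G) :
    Rep (f - g) (fun x => F x - G x) := by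
  refine ⟨h.1.sub hg.1, fun θ => ?_⟩
  rw [sub_apply, h.2, hg.2, ← integral_sub (h.1.integrable_schwartz_mul θ)
    (hg.1.integrable_schwartz_mul θ)]
  congr 1; ext x; ring

/-- A large negative power of `1 + |x|` lies in the dual Lebesgue space, so Hölder's inequality
gives the weighted integrability. -/
theorem rep_coe {p : ℝ≥0∞} [hp : Fact (1 ≤ p)] (F : Lp ℂ p (volume : Measure (Space d))) :
    Rep (Lp.toTemperedDistribution F) F := by
  refine ⟨?_, fun θ => by simp⟩
  have hpq : ENNReal.HolderConjugate p (1 - p⁻¹)⁻¹ :=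
      ENNReal.HolderConjugate.inv_one_sub_inv' hp.out
  obtain ⟨n, hn⟩ := (inferInstance : (volume : Measure (Space d)).HasTemperateGrowth).exists_eLpNorm_lt_top
    (1 - p⁻¹)⁻¹
  have hc : Continuous fun x : Space d => (1 + ‖x‖) ^ (-n : ℝ) :=
    Continuous.rpow_const (by fun_prop) fun x => Or.inl (one_add_norm_pos x).ne'
  have hm : MemLp (fun x : Space d => (1 + ‖x‖) ^ (-n : ℝ)) (1 - p⁻¹)⁻¹ volume :=
    ⟨hc.aestronglyMeasurable, hn⟩
  have h1 := (Lp.memLp F).smul (r := 1) hm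
  refine ⟨n, (memLp_one_iff_integrable.1 h1).congr (Eventually.of_forall fun x => ?_)⟩
  simp only [Pi.smul_apply']
  rw [Real.rpow_neg (one_add_norm_pos x).le, Real.rpow_natCast]

theorem Rep.distLpNorm_le {p : ℝ≥0∞} [hp : Fact (1 ≤ p)] {f : 𝓢'(Space d, ℂ)} {F : Space d → ℂ}
    (h : Rep f F) : distLpNorm p f ≤ eLpNorm F p volume := by
  by_cases ht : eLpNorm F p volume = ⊤
  · simp [ht]
  have hm : MemLp F p volume := ⟨h.1.aestronglyMeasurable, Ne.lt_top ht⟩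
  have : f = Lp.toTemperedDistribution (hm.toLp F) := by
    ext θ
    rw [Lp.toTemperedDistribution_apply, h.2]
    refine integral_congr_ae ?_
    filter_upwards [hm.coeFn_toLp] with x hx
    rw [hx, smul_eq_mul]
  rw [this, distLpNorm_coe, Lp.enorm_def, eLpNorm_congr_ae hm.coeFn_toLp]

/-! ### Kernels of iterated commutators -/

open FourierTransform in
-- The left side is the test function on which `f` is evaluated in `mult a f θ`. The convolution
-- theorem applies after a reflection `R`, which exchanges the Fourier transform and its inverse.
theorem fourier_mul_fourierInv_apply (a θ : 𝓢(Space d, ℂ)) (y : Space d) :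
    𝓕 (SchwartzMap.smulLeftCLM ℂ (a : Space d → ℂ) (𝓕⁻ θ)) y = ∫ x, θ x * (𝓕⁻ a) (x - y) := by
  set κ := 𝓕⁻ a with hκ
  have ha : 𝓕 κ = a := by rw [hκ, fourier_fourierInv_eq]
  let R := SchwartzMap.compCLMOfContinuousLinearEquiv ℂ (F := ℂ)
    (LinearIsometryEquiv.neg ℝ (E := Space d)).toContinuousLinearEquiv
  have hR : ∀ (g : 𝓢(Space d, ℂ)) z, R g z = g (-z) := fun g z => rfl
  have hinv : ∀ (g : 𝓢(Space d, ℂ)) z, 𝓕⁻ g z = 𝓕 g (-z) := fun g z => rfl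
  have hFR : 𝓕 (R θ) = 𝓕⁻ θ := by
    have : R (𝓕 (𝓕⁻ (R θ))) = θ := by
      rw [fourier_fourierInv_eq]; ext z; simp [hR]
    have h2 : 𝓕 (R θ) = R (𝓕⁻ (R θ)) := by ext z; rw [hR, hinv, neg_neg]
    have h3 : 𝓕⁻ (R θ) = 𝓕 θ := by
      rw [← fourierInv_fourier_eq (F := 𝓢(Space d, ℂ)) (𝓕 θ)]
      congr 1
      ext z
      have : 𝓕⁻ (𝓕 θ) (-z) = θ (-z) := by rw [fourierInv_fourier_eq]
      rw [hR, ← this, hinv, neg_neg]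
    rw [h2, h3]
    ext z; rw [hR, hinv]
  have hmul : SchwartzMap.smulLeftCLM ℂ (a : Space d → ℂ) (𝓕⁻ θ) =
      𝓕 (SchwartzMap.convolution (ContinuousLinearMap.mul ℂ ℂ) κ (R θ)) := by
    rw [SchwartzMap.fourier_convolution, ha, hFR]
    ext z
    rw [SchwartzMap.smulLeftCLM_apply_apply a.hasTemperateGrowth]
    simp
  rw [hmul]
  have h2 : ∀ g : 𝓢(Space d, ℂ), 𝓕 (𝓕 g) y = g (-y) := fun g => by
    have : 𝓕⁻ (𝓕 g) (-y) = g (-y) := by rw [fourierInv_fourier_eq]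
    rw [← this, hinv, neg_neg]
  rw [h2, SchwartzMap.convolution_apply, MeasureTheory.convolution_def]
  rw [← integral_sub_right_eq_self _ y]
  congr 1; ext x
  simp [hR]
  ring

/-- The kernel of an iterated commutator. -/
def kern (κ : Space d → ℂ) (Vs : List (TFun d)) (x y : Space d) : ℂ :=
  (Vs.map fun V => V.1 x - V.1 y).prod * κ (x - y)

/-- Iterated commutators with multiplication operators. -/
def adL (Vs : List (TFun d)) (T : Op d) : Op d := Vs.foldr (fun V S => ⁅mulOp V, S⁆) T

theorem adL_cons (V : TFun d) (Vs : List (TFun d)) (T : Op d) :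
    adL (V :: Vs) T = ⁅mulOp V, adL Vs T⁆ := rfl

/-- One factor `V(x) - V(y)` is expanded at a time. The claim is general in `F`, because the second
term replaces `F` by `V F`. -/
theorem TempInt.integrable_kern {F : Space d → ℂ} (h : TempInt F) (κ : 𝓢(Space d, ℂ))
    (Vs : List (TFun d)) (x : Space d) : Integrable fun y => kern κ Vs x y * F y := by
  induction Vs generalizing F with
  | nil =>
    refine (h.integrable_schwartz_mul (SchwartzMap.compSubConstCLM ℂ x
      (SchwartzMap.compCLMOfContinuousLinearEquiv ℂ (F := ℂ)
      (LinearIsometryEquiv.neg ℝ (E := Space d)).toContinuousLinearEquiv κ))).congr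
      (Eventually.of_forall fun y => ?_)
    simp [kern]
  | cons V Vs ih =>
    refine (((ih h).const_mul (V.1 x)).sub (ih (h.mul_tfun V))).congr
      (Eventually.of_forall fun y => ?_)
    simp only [kern, List.map_cons, List.prod_cons, Pi.sub_apply]
    ring

theorem one_add_norm_le_mul (x y : Space d) : 1 + ‖y‖ ≤ (1 + ‖x - y‖) * (1 + ‖x‖) := by
  have : ‖y‖ ≤ ‖x‖ + ‖x - y‖ := by
    have := norm_sub_le x (x - y); simpa using this
  nlinarith [norm_nonneg x, norm_nonneg (x - y), mul_nonneg (norm_nonneg (x - y)) (norm_nonneg x)]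

/-- Peetre's inequality `(1 + |x|)^{-n} ≤ (1 + |x-y|)^n (1 + |y|)^{-n}` dominates the integrand by a
convolution of two integrable functions. -/
theorem TempInt.integrable_prod {F : Space d → ℂ} (κ : 𝓢(Space d, ℂ)) {n : ℕ}
    (hn : Integrable fun x => ((1 + ‖x‖) ^ n)⁻¹ • F x) :
    Integrable (fun z : Space d × Space d => ((1 + ‖z.1‖) ^ n)⁻¹ • (κ (z.1 - z.2) * F z.2))
      (volume.prod volume) := by
  have hm : AEStronglyMeasurable F := TempInt.aestronglyMeasurable ⟨n, hn⟩
  have hk : Integrable fun z : Space d => (1 + ‖z‖) ^ n * ‖κ z‖ := by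
    obtain ⟨C, hC0, hC⟩ := schwartz_decay κ (n + (volume : Measure (Space d)).integrablePower)
    refine ((Measure.integrable_pow_neg_integrablePower (volume : Measure (Space d))).const_mul
      C).mono' (by have := κ.continuous; fun_prop) (Eventually.of_forall fun z => ?_)
    have h1 := one_add_norm_pos z
    rw [Real.norm_of_nonneg (by positivity), Real.rpow_neg h1.le, Real.rpow_natCast]
    calc _ ≤ (1 + ‖z‖) ^ n * (C * ((1 + ‖z‖) ^ (n + (volume : Measure (Space d)).integrablePower))⁻¹) := by
          gcongr; exact hC z
      _ = _ := by rw [pow_add]; field_simp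
  have hb := Real.integrable_prod_sub (ContinuousLinearMap.mul ℝ ℝ) hk hn.norm
  refine hb.mono' ?_ (Eventually.of_forall fun z => ?_)
  · have hc : Continuous fun z : Space d × Space d => (((1 + ‖z.1‖) ^ n)⁻¹ : ℝ) := by
      refine Continuous.inv₀ (by fun_prop) fun x => (pow_pos (one_add_norm_pos x.1) _).ne'
    refine hc.aestronglyMeasurable.smul (AEStronglyMeasurable.mul ?_ ?_)
    · exact (κ.continuous.comp (continuous_fst.sub continuous_snd)).aestronglyMeasurable
    · exact hm.comp_snd
  · have h1 := one_add_norm_pos z.1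
    have h2 := one_add_norm_pos z.2
    have h3 := one_add_norm_pos (z.1 - z.2)
    have hle : ((1 + ‖z.1‖) ^ n)⁻¹ ≤ (1 + ‖z.1 - z.2‖) ^ n * ((1 + ‖z.2‖) ^ n)⁻¹ := by
      rw [← div_eq_mul_inv, le_div_iff₀ (by positivity), inv_mul_le_iff₀ (by positivity), ← mul_pow]
      gcongr
      rw [mul_comm]; exact one_add_norm_le_mul _ _
    rw [norm_smul, norm_inv, Real.norm_of_nonneg (by positivity : 0 ≤ (1 + ‖z.1‖) ^ n),
      ContinuousLinearMap.opNorm_mul, one_mul, norm_norm, norm_smul, norm_inv, norm_mul, norm_mul,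
      Real.norm_of_nonneg (by positivity : 0 ≤ (1 + ‖z.2‖) ^ n),
      Real.norm_of_nonneg (by positivity : 0 ≤ (1 + ‖z.1 - z.2‖) ^ n), norm_norm]
    calc _ ≤ (1 + ‖z.1 - z.2‖) ^ n * ((1 + ‖z.2‖) ^ n)⁻¹ * (‖κ (z.1 - z.2)‖ * ‖F z.2‖) := by gcongr
      _ = _ := by ring

/-- Fubini, after `a(D)` has been transposed onto the test function. -/
theorem Rep.mult {f : 𝓢'(Space d, ℂ)} {F : Space d → ℂ} (h : Rep f F) (a : 𝓢(Space d, ℂ)) :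
    Rep (mult a f) (fun x => ∫ y, kern (FourierTransform.fourierInv a) [] x y * F y) := by
  set κ : 𝓢(Space d, ℂ) := FourierTransform.fourierInv a
  have hkern : ∀ x y, kern κ [] x y = κ (x - y) := fun x y => by simp [kern]
  simp only [hkern]
  refine ⟨?_, fun θ => ?_⟩
  · obtain ⟨n, hn⟩ := h.1
    refine ⟨n, (TempInt.integrable_prod κ hn).integral_prod_left.congr
      (Eventually.of_forall fun x => ?_)⟩
    simp only [integral_smul]
  · have e : Striated.mult a f θ = f (FourierTransform.fourier (SchwartzMap.smulLeftCLM ℂ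
        (a : Space d → ℂ) (FourierTransform.fourierInv θ))) := rfl
    rw [e, h.2]
    have e2 : ∀ y, (FourierTransform.fourier (SchwartzMap.smulLeftCLM ℂ
        (a : Space d → ℂ) (FourierTransform.fourierInv θ)) : 𝓢(Space d, ℂ)) y * F y =
        ∫ x, θ x * (κ (x - y) * F y) := fun y => by
      rw [fourier_mul_fourierInv_apply, ← integral_mul_const]
      congr 1; ext x; ring
    have e3 : ∀ x, θ x * ∫ y, κ (x - y) * F y = ∫ y, θ x * (κ (x - y) * F y) := fun x => by
      rw [integral_const_mul]
    simp only [e2, e3]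
    rw [integral_integral_swap]
    obtain ⟨n, hn⟩ := h.1
    have hi := TempInt.integrable_prod κ hn
    obtain ⟨C, hC0, hC⟩ := schwartz_decay θ n
    refine (hi.norm.const_mul C).swap.mono' ?_ (Eventually.of_forall fun z => ?_)
    · have hm : AEStronglyMeasurable F := h.1.aestronglyMeasurable
      refine AEStronglyMeasurable.mul ?_ (AEStronglyMeasurable.mul ?_ hm.comp_fst)
      · exact (θ.continuous.comp continuous_snd).aestronglyMeasurable
      · exact (κ.continuous.comp (continuous_snd.sub continuous_fst)).aestronglyMeasurable
    · simp only [Function.uncurry, Function.comp_apply, Prod.fst_swap, Prod.snd_swap]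
      have h1 := one_add_norm_pos z.2
      rw [norm_mul, norm_smul, norm_inv, Real.norm_of_nonneg (by positivity : 0 ≤ (1 + ‖z.2‖) ^ n),
        ← mul_assoc]
      gcongr
      exact hC z.2

/-- Each commutator with a multiplication by `V` multiplies the kernel by `V(x) - V(y)`. -/
theorem Rep.adL {f : 𝓢'(Space d, ℂ)} {F : Space d → ℂ} (h : Rep f F) (a : 𝓢(Space d, ℂ))
    (Vs : List (TFun d)) :
    Rep (adL Vs (Striated.mult a) f)
      (fun x => ∫ y, kern (FourierTransform.fourierInv a) Vs x y * F y) := by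
  induction Vs generalizing f F with
  | nil => exact h.mult a
  | cons V Vs ih =>
    have h1 := ((ih h).mulOp V).sub (ih (h.mulOp V))
    have e : Striated.adL (V :: Vs) (Striated.mult a) f = Striated.mulOp V (Striated.adL Vs
        (Striated.mult a) f) - Striated.adL Vs (Striated.mult a) (Striated.mulOp V f) := rfl
    rw [e]
    convert h1 using 1
    funext x
    rw [← integral_const_mul, ← integral_sub ((h.1.integrable_kern _ Vs x).const_mul _)
      ((h.mulOp V).1.integrable_kern _ Vs x)]
    congr 1; ext y
    simp only [kern, List.map_cons, List.prod_cons]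
    ring

/-- A bound for an operator on all the spaces `L^p`. -/
def OpBound (T : Op d) (A : ℝ≥0∞) : Prop :=
  ∀ (p : ℝ≥0∞) [Fact (1 ≤ p)] (f : 𝓢'(Space d, ℂ)), distLpNorm p (T f) ≤ A * distLpNorm p f

/-- The absolute moments of a function. -/
def moment (n : ℕ) (κ : Space d → ℂ) : ℝ≥0∞ := ∫⁻ z, ‖z‖ₑ ^ n * ‖κ z‖ₑ

/-- One of the functions is constant, and multiplication by a constant commutes with everything.
Without this case a zero Lipschitz norm could meet an infinite `L^p` norm. -/
theorem adL_eq_zero {Vs : List (TFun d)} (h : (Vs.map lipN).prod = 0) (T : Op d) :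
    adL Vs T = 0 := by
  induction Vs with
  | nil => simp at h
  | cons V Vs ih =>
    rw [adL_cons]
    rw [List.map_cons, List.prod_cons, mul_eq_zero] at h
    rcases h with h | h
    · have : mulOp V = V.1 0 • (1 : Op d) := by
        ext1 f
        rw [mulOp, eq_const_of_lipN_eq_zero h, TemperedDistribution.smulLeftCLM_const]
        rfl
      rw [this, Ring.lie_def]
      simp
    · rw [ih h, Ring.lie_def, mul_zero, zero_mul, sub_zero]

theorem enorm_kern_le (κ : Space d → ℂ) (Vs : List (TFun d)) (x y : Space d) :
    ‖kern κ Vs x y‖ₑ ≤ (Vs.map lipN).prod * (‖x - y‖ₑ ^ Vs.length * ‖κ (x - y)‖ₑ) := by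
  rw [kern, enorm_mul, ← mul_assoc]
  gcongr
  induction Vs with
  | nil => simp
  | cons V Vs ih =>
    simp only [List.map_cons, List.prod_cons, enorm_mul, List.length_cons, pow_succ]
    calc _ ≤ lipN V * ‖x - y‖ₑ * ((Vs.map lipN).prod * ‖x - y‖ₑ ^ Vs.length) := by
          gcongr; exact enorm_sub_le_lipN V x y
      _ = _ := by ring

/-- The kernel is dominated by `∏ Lip(V) · |z|^n |κ(z)|` with `z = x - y`, and Young's inequality
applies; this is why moments of `κ` are recorded. `B` must not vanish so that an infinite right-hand
side stays infinite. -/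
theorem opBound_adL (a : 𝓢(Space d, ℂ)) (Vs : List (TFun d)) {B : ℝ≥0∞} (hB : B ≠ 0)
    (h : moment Vs.length (FourierTransform.fourierInv a) ≤ B) :
    OpBound (adL Vs (mult a)) (B * (Vs.map lipN).prod) := by
  intro p hp f
  by_cases h0 : (Vs.map lipN).prod = 0
  · rw [adL_eq_zero h0]
    simp [distLpNorm_zero]
  by_cases hf : distLpNorm p f = ⊤
  · rw [hf, ENNReal.mul_top (mul_ne_zero hB h0)]; exact le_top
  obtain ⟨F, rfl⟩ := exists_coe_of_distLpNorm_ne_top hf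
  set κ : 𝓢(Space d, ℂ) := FourierTransform.fourierInv a
  refine (((rep_coe F).adL a Vs).distLpNorm_le).trans ?_
  rw [distLpNorm_coe, Lp.enorm_def]
  have hm : Measurable fun z : Space d => (Vs.map lipN).prod * (‖z‖ₑ ^ Vs.length * ‖κ z‖ₑ) := by
    have := κ.continuous
    fun_prop
  refine (eLpNorm_le_of_le_conv hp.out hm (Lp.aestronglyMeasurable F) fun x => ?_).trans ?_
  · refine (enorm_integral_le_lintegral_enorm _).trans (lintegral_mono fun y => ?_)
    rw [enorm_mul]
    gcongr
    exact enorm_kern_le _ _ _ _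
  · rw [lintegral_const_mul _ (by have := κ.continuous; fun_prop), mul_comm B]
    gcongr
    exact h

end

section

/-! ### Words and their convolution -/

section Words

variable {ι : Type*}

/-- The iterated operation along a word; the head of the word acts first. -/
def wd {X : Type*} (D : ι → X → X) : List ι → X → X
  | [], x => x
  | i :: w, x => wd D w (D i x)

theorem wd_cons {X : Type*} (D : ι → X → X) (i : ι) (w : List ι) (x : X) :
    wd D (i :: w) x = wd D w (D i x) := rfl

theorem wd_add {X : Type*} [Add X] {D : ι → X → X} (hD : ∀ i x y, D i (x + y) = D i x + D i y)
    (w : List ι) (x y : X) : wd D w (x + y) = wd D w x + wd D w y := by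
  induction w generalizing x y with
  | nil => rfl
  | cons i w ih => rw [wd_cons, hD, ih]; rfl

theorem wd_map {X Y : Type*} {D : ι → X → X} {D' : ι → Y → Y} (φ : X → Y)
    (h : ∀ i x, φ (D i x) = D' i (φ x)) (w : List ι) (x : X) : φ (wd D w x) = wd D' w (φ x) := by
  induction w generalizing x with
  | nil => rfl
  | cons i w ih => rw [wd_cons, wd_cons, ih, h]

/-- The convolution of two functions of words: the sum over all splittings of a word. -/
def conv : (List ι → ℝ≥0∞) → (List ι → ℝ≥0∞) → List ι → ℝ≥0∞
  | F, G, [] => F [] * G []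
  | F, G, i :: w => conv (fun a => F (i :: a)) G w + conv F (fun a => G (i :: a)) w

theorem conv_nil (F G : List ι → ℝ≥0∞) : conv F G [] = F [] * G [] := by rw [conv]

theorem conv_cons (F G : List ι → ℝ≥0∞) (i : ι) (w : List ι) : conv F G (i :: w) =
    conv (fun a => F (i :: a)) G w + conv F (fun a => G (i :: a)) w := by rw [conv]

theorem conv_mono {F F' G G' : List ι → ℝ≥0∞} {w : List ι}
    (hF : ∀ a, a.length ≤ w.length → F a ≤ F' a) (hG : ∀ a, a.length ≤ w.length → G a ≤ G' a) :
    conv F G w ≤ conv F' G' w := by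
  induction w generalizing F F' G G' with
  | nil => rw [conv_nil, conv_nil]; exact mul_le_mul' (hF _ le_rfl) (hG _ le_rfl)
  | cons i w ih =>
    rw [conv_cons, conv_cons]
    have h1 : ∀ {F F' : List ι → ℝ≥0∞}, (∀ a, a.length ≤ (i :: w).length → F a ≤ F' a) →
      ∀ a, a.length ≤ w.length → F a ≤ F' a := fun h a ha => h a (by simp; omega)
    have h2 : ∀ {F F' : List ι → ℝ≥0∞}, (∀ a, a.length ≤ (i :: w).length → F a ≤ F' a) →
      ∀ a, a.length ≤ w.length → F (i :: a) ≤ F' (i :: a) := fun h a ha => h _ (by simp; omega)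
    exact add_le_add (ih (h2 hF) (h1 hG)) (ih (h1 hF) (h2 hG))

theorem conv_comm (F G : List ι → ℝ≥0∞) (w : List ι) : conv F G w = conv G F w := by
  induction w generalizing F G with
  | nil => rw [conv_nil, conv_nil, mul_comm]
  | cons i w ih => rw [conv_cons, conv_cons, ih, ih F, add_comm]

theorem conv_add_left (F F' G : List ι → ℝ≥0∞) (w : List ι) :
    conv (fun a => F a + F' a) G w = conv F G w + conv F' G w := by
  induction w generalizing F F' G with
  | nil => simp only [conv_nil, add_mul]
  | cons i w ih => simp only [conv_cons, ih]; ring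

theorem conv_add_right (F G G' : List ι → ℝ≥0∞) (w : List ι) :
    conv F (fun a => G a + G' a) w = conv F G w + conv F G' w := by
  rw [conv_comm, conv_add_left, conv_comm G, conv_comm G']

theorem conv_mul_left (c : ℝ≥0∞) (F G : List ι → ℝ≥0∞) (w : List ι) :
    conv (fun a => c * F a) G w = c * conv F G w := by
  induction w generalizing F G with
  | nil => simp only [conv_nil, mul_assoc]
  | cons i w ih => simp only [conv_cons, ih]; ring

theorem conv_mul_right (c : ℝ≥0∞) (F G : List ι → ℝ≥0∞) (w : List ι) :
    conv F (fun a => c * G a) w = c * conv F G w := by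
  rw [conv_comm, conv_mul_left, conv_comm]

theorem conv_zero_left (G : List ι → ℝ≥0∞) (w : List ι) : conv (fun _ => 0) G w = 0 := by
  have := conv_mul_left 0 (fun _ => 0) G w
  simpa using this

theorem conv_sum_left {κ : Type*} (s : Finset κ) (F : κ → List ι → ℝ≥0∞) (G : List ι → ℝ≥0∞)
    (w : List ι) : conv (fun a => ∑ j ∈ s, F j a) G w = ∑ j ∈ s, conv (F j) G w := by
  classical
  induction s using Finset.induction_on with
  | empty => simp [conv_zero_left]
  | insert a s ha ih => simp only [Finset.sum_insert ha, conv_add_left, ih]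

theorem conv_sum_right {κ : Type*} (s : Finset κ) (F : List ι → ℝ≥0∞) (G : κ → List ι → ℝ≥0∞)
    (w : List ι) : conv F (fun a => ∑ j ∈ s, G j a) w = ∑ j ∈ s, conv F (G j) w := by
  rw [conv_comm, conv_sum_left]
  exact Finset.sum_congr rfl fun j _ => conv_comm _ _ _

theorem conv_assoc (F G H : List ι → ℝ≥0∞) (w : List ι) :
    conv (conv F G) H w = conv F (conv G H) w := by
  induction w generalizing F G H with
  | nil => simp only [conv_nil, mul_assoc]
  | cons i w ih => simp only [conv_cons, conv_add_left, conv_add_right, ih]; ring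

theorem conv_left_comm (F G H : List ι → ℝ≥0∞) (w : List ι) :
    conv F (conv G H) w = conv G (conv F H) w := by
  rw [← conv_assoc, ← conv_assoc]
  exact conv_mono (fun a _ => (conv_comm F G a).le) (fun _ _ => le_rfl) |>.antisymm
    (conv_mono (fun a _ => (conv_comm G F a).le) (fun _ _ => le_rfl))

/-- Keeps only the splitting that gives every letter to `G`. -/
theorem le_conv (F G : List ι → ℝ≥0∞) (w : List ι) : F [] * G w ≤ conv F G w := by
  induction w generalizing F G with
  | nil => rw [conv_nil]
  | cons i w ih => rw [conv_cons]; exact (ih F _).trans le_add_self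

theorem le_conv_of_one_le {F : List ι → ℝ≥0∞} (hF : 1 ≤ F []) (G : List ι → ℝ≥0∞) (w : List ι) :
    G w ≤ conv F G w :=
  le_trans (by simpa using mul_le_mul_left hF (G w)) (le_conv F G w)

/-- A subadditive functional of sequences passes through a convolution. -/
theorem conv_subadditive {A : Type*} (Φ : (A → ℝ≥0∞) → ℝ≥0∞)
    (hadd : ∀ x y, Φ (fun n => x n + y n) ≤ Φ x + Φ y) (hmul : ∀ c x, Φ (fun n => c * x n) ≤ c * Φ x)
    (F : List ι → ℝ≥0∞) (G : A → List ι → ℝ≥0∞) (w : List ι) :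
    Φ (fun n => conv F (G n) w) ≤ conv F (fun a => Φ (fun n => G n a)) w := by
  induction w generalizing F G with
  | nil => simp only [conv_nil]; exact hmul _ _
  | cons i w ih =>
    simp only [conv_cons]
    exact (hadd _ _).trans (add_le_add (ih _ _) (ih _ _))

/-- The Leibniz rule, as an estimate. -/
theorem leibniz_bound {X Y Z : Type*} [Add Z] {D₁ : ι → X → X} {D₂ : ι → Y → Y} {D₃ : ι → Z → Z}
    {β : X → Y → Z} {nrm : Z → ℝ≥0∞} (hnrm : ∀ x y, nrm (x + y) ≤ nrm x + nrm y)
    (hD : ∀ i x y, D₃ i (x + y) = D₃ i x + D₃ i y)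
    (hβ : ∀ i x y, D₃ i (β x y) = β (D₁ i x) y + β x (D₂ i y))
    {F G : List ι → ℝ≥0∞} {w : List ι} {x : X} {y : Y}
    (h : ∀ a b, a.length ≤ w.length → b.length ≤ w.length →
      nrm (β (wd D₁ a x) (wd D₂ b y)) ≤ F a * G b) :
    nrm (wd D₃ w (β x y)) ≤ conv F G w := by
  induction w generalizing x y F G with
  | nil => rw [conv_nil]; exact h [] [] le_rfl le_rfl
  | cons i w ih =>
    rw [wd_cons, hβ, wd_add hD, conv_cons]
    refine (hnrm _ _).trans (add_le_add ?_ ?_)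
    · exact ih fun a b ha hb => h (i :: a) b (by simp; omega) (by simp; omega)
    · exact ih fun a b ha hb => h a (i :: b) (by simp; omega) (by simp; omega)

end Words

/-! ### Multi-indices -/

section MultiIndex

variable {N : ℕ}

/-- The word of a multi-index, in decreasing order. -/
def word (l : Fin N → ℕ) : List (Fin N) :=
  (((List.finRange N).map fun i => List.replicate (l i) i).flatten).reverse

theorem wd_eq_prod {d : ℕ} (D : Fin N → Op d) (w : List (Fin N)) (f : 𝓢'(Space d, ℂ)) :
    wd (fun i f => D i f) w f = (w.reverse.map D).prod f := by
  induction w generalizing f with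
  | nil => rfl
  | cons i w ih =>
    rw [wd_cons, ih, List.reverse_cons, List.map_append, List.prod_append]
    simp

/-- In the operator product the last field acts first, while in a word the head acts first; this is
the reason for the decreasing order of `word`. -/
theorem fieldMonomial_eq {d : ℕ} (W : Fin N → SmoothField d) (l : Fin N → ℕ)
    (f : 𝓢'(Space d, ℂ)) :
    fieldMonomial W l f = wd (fun i f => (W i).deriv f) (word l) f := by
  rw [wd_eq_prod (fun i => (W i).deriv), word, List.reverse_reverse, List.map_flatten,
    List.prod_flatten, fieldMonomial, List.ofFn_eq_map]
  simp [Function.comp_def]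

theorem count_word (l : Fin N → ℕ) (i : Fin N) : (word l).count i = l i := by
  rw [word, List.count_reverse, List.count_flatten, List.map_map]
  have : (List.count i ∘ fun j => List.replicate (l j) j) = fun j => if j = i then l j else 0 := by
    funext j
    simp [List.count_replicate]
  rw [this, ← List.ofFn_eq_map, List.sum_ofFn]
  simp

theorem word_sorted (l : Fin N → ℕ) : (word l).Pairwise (· ≥ ·) := by
  rw [word, List.pairwise_reverse, List.pairwise_flatten]
  refine ⟨fun L hL => ?_, ?_⟩
  · obtain ⟨i, -, rfl⟩ := List.mem_map.1 hL
    exact List.pairwise_replicate.2 (Or.inr le_rfl)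
  · rw [List.pairwise_map]
    refine (List.pairwise_lt_finRange N).imp fun {a b} hab x hx y hy => ?_
    rw [List.eq_of_mem_replicate hx, List.eq_of_mem_replicate hy]
    exact hab.le

theorem eq_word {w : List (Fin N)} (hs : w.Pairwise (· ≥ ·)) {l : Fin N → ℕ}
    (hc : ∀ i, w.count i = l i) : w = word l := by
  refine List.Perm.eq_of_pairwise (le := (· ≥ ·)) (fun a b _ _ h1 h2 => le_antisymm h2 h1) hs (word_sorted l) ?_
  rw [List.perm_iff_count]
  intro i
  rw [hc, count_word]

/-- All letters present are at most `i`, so putting `i` in front keeps the word decreasing. -/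
theorem word_add_single {l : Fin N → ℕ} {i : Fin N} (h : ∀ j, i < j → l j = 0) :
    word (l + Pi.single i 1) = i :: word l := by
  symm
  refine eq_word (List.pairwise_cons.2 ⟨fun j hj => ?_, word_sorted l⟩) fun j => ?_
  · by_contra! hlt
    have := List.count_pos_iff.2 hj
    rw [count_word, h j hlt] at this
    exact lt_irrefl _ this
  · rw [List.count_cons, count_word, Pi.add_apply, Pi.single_apply]
    by_cases hij : i = j
    · simp [hij]
    · simp [hij, Ne.symm hij]

theorem length_word (l : Fin N → ℕ) : (word l).length = ∑ i, l i := by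
  rw [word, List.length_reverse, List.length_flatten, List.map_map, ← List.ofFn_eq_map,
    List.sum_ofFn]
  simp

/-- Removing the largest index that occurs is removing the head of the word; it matches the
recursion of `conv`. -/
theorem multiIndex_induction {P : (Fin N → ℕ) → Prop} (h0 : P 0)
    (hs : ∀ l i, (∀ j, i < j → l j = 0) → P l → P (l + Pi.single i 1)) (l : Fin N → ℕ) : P l := by
  induction hn : ∑ i, l i generalizing l with
  | zero =>
    have : l = 0 := by
      funext i
      exact (Finset.sum_eq_zero_iff.1 hn) i (Finset.mem_univ _)
    rwa [this]
  | succ n ih =>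
    have hne : (Finset.univ.filter fun i => l i ≠ 0).Nonempty := by
      by_contra! he
      have : ∑ i, l i = 0 := Finset.sum_eq_zero fun i _ => by
        by_contra hi
        have : i ∈ (Finset.univ.filter fun i => l i ≠ 0) := by simp [hi]
        rw [he] at this; simp at this
      omega
    set i := (Finset.univ.filter fun i => l i ≠ 0).max' hne
    have hi : l i ≠ 0 := by
      have := Finset.max'_mem _ hne
      simpa using this
    have hmax : ∀ j, i < j → l j = 0 := fun j hj => by
      by_contra hj0
      have := Finset.le_max' (Finset.univ.filter fun i => l i ≠ 0) j (by simp [hj0])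
      exact absurd hj (not_lt.2 this)
    have hl : l = (l - Pi.single i 1) + Pi.single i 1 := by
      funext j
      by_cases hj : j = i
      · subst hj; simp; omega
      · simp [hj]
    rw [hl]
    refine hs _ i (fun j hj => by simp [hmax j hj]) (ih _ ?_)
    have h2 : ∑ j, l j = ∑ j, (l - Pi.single i 1 : Fin N → ℕ) j + 1 := by
      conv_lhs => rw [hl]
      simp [Finset.sum_add_distrib]
    omega

/-- A subword of a decreasing word is decreasing, so every splitting is a pair of words of
multi-indices `a` and `l - a`. Each pair occurs at most as often as there are splittings. Since no
letters are ever reordered, commutators of the fields with each other do not arise. -/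
theorem conv_word_le (F G : List (Fin N) → ℝ≥0∞) (l : Fin N → ℕ) :
    conv F G (word l) ≤ 2 ^ (∑ i, l i) * ∑ a ∈ Finset.Iic l, F (word a) * G (word (l - a)) := by
  revert F G
  induction l using multiIndex_induction with
  | h0 =>
    intro F G
    have h1 : word (0 : Fin N → ℕ) = [] := by
      rw [← List.length_eq_zero_iff, length_word]; simp
    have h2 : (Finset.Iic (0 : Fin N → ℕ)) = {0} := by
      ext a; simp [Finset.mem_Iic]
    simp [h1, h2, conv_nil]
  | hs l i hi ih =>
    intro F G
    have hw : ∀ a, a ≤ l → word (a + Pi.single i 1) = i :: word a := fun a ha =>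
      word_add_single fun j hj => by
        have := ha j
        rw [hi j hj] at this
        exact Nat.le_zero.1 this
    rw [hw l le_rfl, conv_cons]
    refine (add_le_add (ih _ _) (ih _ _)).trans ?_
    have hsum : ∑ j, (l + Pi.single i 1 : Fin N → ℕ) j = ∑ j, l j + 1 := by simp [Finset.sum_add_distrib]
    rw [hsum, pow_succ, ← mul_add, mul_assoc]
    gcongr
    -- The letter `i` goes to `F` or to `G`. Each of the two sums is part of the sum over all `a ≤ l
    -- + e_i`: in the first one `a` is shifted by `e_i`, in the second it is not.
    rw [two_mul]
    gcongr ?_ + ?_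
    · generalize (Pi.single i 1 : Fin N → ℕ) = e at hw
      have h1 : ∀ a ∈ Finset.Iic l, F (i :: word a) * G (word (l - a)) =
          F (word (a + e)) * G (word (l + e - (a + e))) :=
        fun a ha => by rw [hw a (Finset.mem_Iic.1 ha), add_tsub_add_eq_tsub_right]
      rw [Finset.sum_congr rfl h1]
      have h2 := Finset.sum_image (s := Finset.Iic l) (g := fun a : Fin N → ℕ => a + e)
        (f := fun a : Fin N → ℕ => F (word a) * G (word (l + e - a)))
        (fun a _ b _ h => add_right_cancel h)
      refine h2.symm.le.trans (Finset.sum_le_sum_of_subset fun b hb => ?_)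
      obtain ⟨a, ha, rfl⟩ := Finset.mem_image.1 hb
      exact Finset.mem_Iic.2 (add_le_add_left (Finset.mem_Iic.1 ha) _)
    · have h1 : ∀ a ∈ Finset.Iic l, F (word a) * G (i :: word (l - a)) =
          F (word a) * G (word (l + Pi.single i 1 - a)) := fun a ha => by
        rw [← hw _ tsub_le_self, tsub_add_eq_add_tsub (Finset.mem_Iic.1 ha)]
      rw [Finset.sum_congr rfl h1]
      refine Finset.sum_le_sum_of_subset fun a ha => Finset.mem_Iic.2 ?_
      exact (Finset.mem_Iic.1 ha).trans le_self_add

/-- The sum of a function over all words of a given length that come from multi-indices. -/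
def mass (F : List (Fin N) → ℝ≥0∞) (n : ℕ) : ℝ≥0∞ :=
  ∑ l ∈ Finset.piAntidiag Finset.univ n, F (word l)

/-- The pairs `a ≤ l` correspond to arbitrary pairs `(a, b)` through `b = l - a`. The constant does
not involve `N`, and this is the source of the uniformity in the number of fields. -/
theorem mass_conv_le (F G : List (Fin N) → ℝ≥0∞) (n : ℕ) : mass (conv F G) n ≤
    2 ^ n * ∑ x ∈ Finset.HasAntidiagonal.antidiagonal n, mass F x.1 * mass G x.2 := by
  have h1 : mass (conv F G) n ≤ ∑ l ∈ Finset.piAntidiag Finset.univ n,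
      2 ^ n * ∑ a ∈ Finset.Iic l, F (word a) * G (word (l - a)) :=
    Finset.sum_le_sum fun l hl => by
      have := conv_word_le F G l
      rwa [(Finset.mem_piAntidiag.1 hl).1] at this
  refine h1.trans ?_
  rw [← Finset.mul_sum]
  gcongr
  simp only [mass, Finset.sum_mul_sum, ← Finset.sum_product']
  rw [Finset.sum_sigma', Finset.sum_sigma']
  refine (Finset.sum_bij' (fun x _ => ⟨(∑ i, x.2 i, ∑ i, (x.1 - x.2) i), (x.2, x.1 - x.2)⟩)
    (fun y _ => ⟨y.2.1 + y.2.2, y.2.1⟩) ?_ ?_ ?_ ?_ ?_).le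
  · rintro ⟨l, a⟩ h
    simp only [Finset.mem_sigma, Finset.mem_piAntidiag, Finset.mem_Iic,
      Finset.HasAntidiagonal.mem_antidiagonal, Finset.mem_product] at h ⊢
    refine ⟨?_, by simp, by simp⟩
    rw [← h.1.1, ← Finset.sum_add_distrib]
    exact Finset.sum_congr rfl fun i _ => Nat.add_sub_of_le (h.2 i)
  · rintro ⟨⟨n₁, n₂⟩, ⟨a, b⟩⟩ h
    simp only [Finset.mem_sigma, Finset.mem_piAntidiag, Finset.mem_Iic,
      Finset.HasAntidiagonal.mem_antidiagonal, Finset.mem_product] at h ⊢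
    refine ⟨⟨?_, by simp⟩, le_self_add⟩
    rw [← h.1, ← h.2.1.1, ← h.2.2.1, ← Finset.sum_add_distrib]
    rfl
  · rintro ⟨l, a⟩ h
    simp only [Finset.mem_sigma, Finset.mem_Iic] at h
    simp [add_tsub_cancel_of_le h.2]
  · rintro ⟨⟨n₁, n₂⟩, ⟨a, b⟩⟩ h
    simp only [Finset.mem_sigma, Finset.mem_piAntidiag,
      Finset.HasAntidiagonal.mem_antidiagonal, Finset.mem_product] at h
    simp [h.2.1.1, h.2.2.1]
  · rintro ⟨l, a⟩ h
    rfl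

end MultiIndex

end

section

/-! ### Derivatives along words and the commutator weight -/

section Weights

variable {ι : Type*}

theorem wd_zero {X : Type*} [AddCommGroup X] {D : ι → X → X}
    (hD : ∀ i x y, D i (x + y) = D i x + D i y) (w : List ι) : wd D w 0 = 0 := by
  have := wd_add hD w 0 0
  simpa using this

theorem wd_neg {X : Type*} [AddCommGroup X] {D : ι → X → X}
    (hD : ∀ i x y, D i (x + y) = D i x + D i y) (w : List ι) (x : X) : wd D w (-x) = -wd D w x := by
  have := wd_add hD w x (-x)
  rw [add_neg_cancel, wd_zero hD] at this
  exact (neg_eq_of_add_eq_zero_right this.symm).symm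

theorem wd_sum {X : Type*} [AddCommGroup X] {D : ι → X → X}
    (hD : ∀ i x y, D i (x + y) = D i x + D i y) (w : List ι) {κ : Type*} (s : Finset κ)
    (x : κ → X) : wd D w (∑ k ∈ s, x k) = ∑ k ∈ s, wd D w (x k) := by
  classical
  induction s using Finset.induction_on with
  | empty => simp [wd_zero hD]
  | insert a s ha ih => rw [Finset.sum_insert ha, Finset.sum_insert ha, wd_add hD, ih]

theorem conv_congr {F F' G G' : List ι → ℝ≥0∞} {w : List ι}
    (hF : ∀ a, a.length ≤ w.length → F a = F' a) (hG : ∀ a, a.length ≤ w.length → G a = G' a) :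
    conv F G w = conv F' G' w :=
  (conv_mono (fun a h => (hF a h).le) fun a h => (hG a h).le).antisymm
    (conv_mono (fun a h => (hF a h).ge) fun a h => (hG a h).ge)

theorem conv_mono' {F F' G G' : List ι → ℝ≥0∞} (hF : ∀ a, F a ≤ F' a) (hG : ∀ a, G a ≤ G' a)
    (w : List ι) : conv F G w ≤ conv F' G' w :=
  conv_mono (fun a _ => hF a) fun a _ => hG a

/-- The weight generated by `τ`, truncated. -/
def weightAux (τ : List ι → ℝ≥0∞) : ℕ → List ι → ℝ≥0∞
  | _, [] => 1
  | 0, _ :: _ => 0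
  | n + 1, i :: w => conv (fun a => τ (i :: a)) (conv (weightAux τ n) (weightAux τ n)) w

/-- The weight `Y` that solves `Y [] = 1` and `Y (i :: w) = (τ (i :: ·) * Y * Y) w`. -/
def weight (τ : List ι → ℝ≥0∞) (w : List ι) : ℝ≥0∞ := weightAux τ w.length w

theorem weightAux_eq (τ : List ι → ℝ≥0∞) (n m : ℕ) (w : List ι) (hn : w.length ≤ n)
    (hm : w.length ≤ m) : weightAux τ n w = weightAux τ m w := by
  induction n generalizing m w with
  | zero =>
    have : w = [] := List.length_eq_zero_iff.1 (Nat.le_zero.1 hn)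
    subst this
    cases m <;> simp [weightAux]
  | succ n ih =>
    cases w with
    | nil => cases m <;> simp [weightAux]
    | cons i w =>
      simp only [List.length_cons] at hn hm
      obtain ⟨m, rfl⟩ : ∃ m', m = m' + 1 := ⟨m - 1, by omega⟩
      rw [weightAux, weightAux]
      have h1 : ∀ a : List ι, a.length ≤ w.length → weightAux τ n a = weightAux τ m a :=
        fun a ha => ih m a (by omega) (by omega)
      exact conv_congr (fun _ _ => rfl) fun a ha =>
        conv_congr (fun b hb => h1 b (hb.trans ha)) fun b hb => h1 b (hb.trans ha)

theorem weight_nil (τ : List ι → ℝ≥0∞) : weight τ [] = 1 := by simp [weight, weightAux]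

theorem weight_cons (τ : List ι → ℝ≥0∞) (i : ι) (w : List ι) : weight τ (i :: w) =
    conv (fun a => τ (i :: a)) (conv (weight τ) (weight τ)) w := by
  rw [weight, List.length_cons, weightAux]
  have h1 : ∀ a : List ι, a.length ≤ w.length → weightAux τ w.length a = weight τ a :=
    fun a ha => weightAux_eq τ _ _ a ha le_rfl
  exact conv_congr (fun _ _ => rfl) fun a ha =>
    conv_congr (fun b hb => h1 b (hb.trans ha)) fun b hb => h1 b (hb.trans ha)

theorem one_le_weight_nil (τ : List ι → ℝ≥0∞) : 1 ≤ weight τ [] := (weight_nil τ).ge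

theorem conv_le_weight_cons (τ : List ι → ℝ≥0∞) (i : ι) (w : List ι) :
    conv (fun a => τ (i :: a)) (weight τ) w ≤ weight τ (i :: w) := by
  rw [weight_cons]
  exact conv_mono' (fun _ => le_rfl) (le_conv_of_one_le (one_le_weight_nil τ) _) w

/-- Forgets that `τ` receives the first letter, so that the mass bound for full convolutions
applies. -/
theorem weight_cons_le (τ : List ι → ℝ≥0∞) (i : ι) (w : List ι) :
    weight τ (i :: w) ≤ conv τ (conv (weight τ) (weight τ)) (i :: w) := by
  rw [weight_cons, conv_cons]
  exact le_self_add

end Weights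

section Bracket

variable {R : Type*} [Ring R]

theorem bracket_add (a x y : R) : ⁅a, x + y⁆ = ⁅a, x⁆ + ⁅a, y⁆ := by
  simp only [Ring.lie_def]; noncomm_ring

theorem bracket_mul (a x y : R) : ⁅a, x * y⁆ = ⁅a, x⁆ * y + x * ⁅a, y⁆ := by
  simp only [Ring.lie_def]; noncomm_ring

theorem bracket_bracket (a x y : R) : ⁅a, ⁅x, y⁆⁆ = ⁅⁅a, x⁆, y⁆ + ⁅x, ⁅a, y⁆⁆ := by
  simp only [Ring.lie_def]; noncomm_ring

end Bracket

section FieldWords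

variable {d N : ℕ} (W : Fin N → SmoothField d)

/-- The derivative of a distribution along a word. -/
def dd (w : List (Fin N)) (f : 𝓢'(Space d, ℂ)) : 𝓢'(Space d, ℂ) :=
  wd (fun i f => (W i).deriv f) w f

/-- The derivative of a function along a word. -/
def df (w : List (Fin N)) (V : TFun d) : TFun d := wd (fun i V => (W i).act V) w V

/-- The iterated commutator of an operator along a word. -/
def dL (w : List (Fin N)) (T : Op d) : Op d := wd (fun i T => ⁅(W i).deriv, T⁆) w T

theorem dd_cons (i : Fin N) (w : List (Fin N)) (f : 𝓢'(Space d, ℂ)) :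
    dd W (i :: w) f = dd W w ((W i).deriv f) := rfl

theorem dL_cons (i : Fin N) (w : List (Fin N)) (T : Op d) :
    dL W (i :: w) T = dL W w ⁅(W i).deriv, T⁆ := rfl

theorem dd_dist (w : List (Fin N)) (V : TFun d) : dd W w V.dist = (df W w V).dist :=
  (wd_map (D := fun i V => (W i).act V) (D' := fun i f => (W i).deriv f) (fun V : TFun d => V.dist)
    (fun i V => (deriv_dist (W i) V).symm) w V).symm

theorem dL_mulOp (w : List (Fin N)) (V : TFun d) : dL W w (mulOp V) = mulOp (df W w V) :=
  (wd_map (D := fun i V => (W i).act V) (D' := fun i T => ⁅(W i).deriv, T⁆)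
    (fun V : TFun d => mulOp V) (fun i V => (lie_deriv_mulOp (W i) V).symm) w V).symm

theorem dL_sum (w : List (Fin N)) {κ : Type*} (s : Finset κ) (T : κ → Op d) :
    dL W w (∑ k ∈ s, T k) = ∑ k ∈ s, dL W w (T k) :=
  wd_sum (fun _ _ _ => bracket_add _ _ _) w s T

theorem dL_neg (w : List (Fin N)) (T : Op d) : dL W w (-T) = -dL W w T :=
  wd_neg (fun _ _ _ => bracket_add _ _ _) w T

theorem dL_smul (w : List (Fin N)) (c : ℂ) (T : Op d) : dL W w (c • T) = c • dL W w T :=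
  (wd_map (D := fun i T => ⁅(W i).deriv, T⁆) (D' := fun i T => ⁅(W i).deriv, T⁆)
    (fun T : Op d => c • T) (fun i T => by
      simp only [Ring.lie_def, smul_sub, mul_smul_comm, smul_mul_assoc]) w T).symm

theorem dd_sum (w : List (Fin N)) {κ : Type*} (s : Finset κ) (f : κ → 𝓢'(Space d, ℂ)) :
    dd W w (∑ k ∈ s, f k) = ∑ k ∈ s, dd W w (f k) :=
  wd_sum (fun _ _ _ => map_add _ _ _) w s f

theorem dd_add (w : List (Fin N)) (f g : 𝓢'(Space d, ℂ)) :
    dd W w (f + g) = dd W w f + dd W w g :=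
  wd_add (fun _ _ _ => map_add _ _ _) w f g

theorem dd_neg (w : List (Fin N)) (f : 𝓢'(Space d, ℂ)) : dd W w (-f) = -dd W w f :=
  wd_neg (fun _ _ _ => map_add _ _ _) w f

theorem dd_sub (w : List (Fin N)) (f g : 𝓢'(Space d, ℂ)) :
    dd W w (f - g) = dd W w f - dd W w g := by
  rw [sub_eq_add_neg, dd_add, dd_neg, ← sub_eq_add_neg]

theorem dd_smul (w : List (Fin N)) (c : ℂ) (f : 𝓢'(Space d, ℂ)) :
    dd W w (c • f) = c • dd W w f :=
  (wd_map (D := fun i f => (W i).deriv f) (D' := fun i f => (W i).deriv f)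
    (fun f : 𝓢'(Space d, ℂ) => c • f) (fun i f => (map_smul _ c f).symm) w f).symm

theorem dd_zero (w : List (Fin N)) : dd W w 0 = 0 := wd_zero (fun _ _ _ => map_add _ _ _) w

/-- The derivative along a word as an operator. -/
theorem dd_eq_op (w : List (Fin N)) :
    ∃ T : Op d, ∀ f, dd W w f = T f :=
  ⟨_, fun f => wd_eq_prod (fun i => (W i).deriv) w f⟩

variable {W}

/-- A field acts on the pairing of `T` and `f` as a derivation, through its commutator on `T` and by
differentiation on `f`. -/
theorem dd_apply_le {p : ℝ≥0∞} [Fact (1 ≤ p)] {T : Op d} {f : 𝓢'(Space d, ℂ)}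
    {F G : List (Fin N) → ℝ≥0∞} {w : List (Fin N)}
    (h : ∀ a b, a.length ≤ w.length → b.length ≤ w.length →
      distLpNorm p (dL W a T (dd W b f)) ≤ F a * G b) :
    distLpNorm p (dd W w (T f)) ≤ conv F G w :=
  leibniz_bound (D₁ := fun i T => ⁅(W i).deriv, T⁆) (D₂ := fun i f => (W i).deriv f)
    (β := fun (T : Op d) f => T f) (nrm := distLpNorm p) distLpNorm_add_le
    (fun _ _ _ => map_add _ _ _)
    (fun i T f => by
      show _ = ((W i).deriv * T - T * (W i).deriv) f + T ((W i).deriv f)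
      simp) h

theorem dL_mul_le {nrm : Op d → ℝ≥0∞} (hn : ∀ S T, nrm (S + T) ≤ nrm S + nrm T) {S T : Op d}
    {F G : List (Fin N) → ℝ≥0∞} {w : List (Fin N)}
    (h : ∀ a b, a.length ≤ w.length → b.length ≤ w.length →
      nrm (dL W a S * dL W b T) ≤ F a * G b) :
    nrm (dL W w (S * T)) ≤ conv F G w :=
  leibniz_bound (D₁ := fun i T => ⁅(W i).deriv, T⁆) (D₂ := fun i T => ⁅(W i).deriv, T⁆)
    (D₃ := fun i T => ⁅(W i).deriv, T⁆)
    (β := fun (S T : Op d) => S * T) hn (fun _ _ _ => bracket_add _ _ _)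
    (fun _ _ _ => bracket_mul _ _ _) h

/-- By the Jacobi identity the commutator with a field distributes over `⁅mulOp V, S⁆`, and on
`mulOp V` it is differentiation of `V`. -/
theorem dL_ad_le {nrm : Op d → ℝ≥0∞} (hn : ∀ S T, nrm (S + T) ≤ nrm S + nrm T) {V : TFun d}
    {S : Op d} {F G : List (Fin N) → ℝ≥0∞} {w : List (Fin N)}
    (h : ∀ a b, a.length ≤ w.length → b.length ≤ w.length →
      nrm ⁅mulOp (df W a V), dL W b S⁆ ≤ F a * G b) :
    nrm (dL W w ⁅mulOp V, S⁆) ≤ conv F G w :=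
  leibniz_bound (D₁ := fun i V => (W i).act V) (D₂ := fun i T => ⁅(W i).deriv, T⁆)
    (D₃ := fun i T => ⁅(W i).deriv, T⁆)
    (β := fun (V : TFun d) (S : Op d) => ⁅mulOp V, S⁆) hn (fun _ _ _ => bracket_add _ _ _)
    (fun i V S => by rw [← lie_deriv_mulOp, bracket_bracket]) h

theorem dd_mulOp_le {p₁ p₂ p : ℝ≥0∞} [Fact (1 ≤ p₁)] [Fact (1 ≤ p₂)] [Fact (1 ≤ p)]
    [p₁.HolderTriple p₂ p] (V : TFun d) (f : 𝓢'(Space d, ℂ)) (w : List (Fin N)) :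
    distLpNorm p (dd W w (mulOp V f)) ≤
      conv (fun a => distLpNorm p₁ (dd W a V.dist)) (fun b => distLpNorm p₂ (dd W b f)) w := by
  refine dd_apply_le fun a b _ _ => ?_
  rw [dL_mulOp, dd_dist]
  exact distLpNorm_mulOp_le _ _

variable (W)

/-- The size of the fields of the family along words: `om (i :: c)` bounds `∂_c W_i` and its
gradient. -/
def om : List (Fin N) → ℝ≥0∞
  | [] => 0
  | i :: c => (d + 1) * ∑ h, (supN (df W c ((W i).c h)) + lipN (df W c ((W i).c h)))

/-- The weight of the family. -/
def wt : List (Fin N) → ℝ≥0∞ := weight (om W)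

variable {W}

theorem om_sup_le (i : Fin N) (c : List (Fin N)) :
    ∑ h, supN (df W c ((W i).c h)) ≤ om W (i :: c) := by
  rw [om]
  refine le_trans (Finset.sum_le_sum fun h _ => ?_)
    (le_mul_of_one_le_left (zero_le) (by simp))
  exact le_self_add

/-- The factor `d` arises when a bound is summed over the `d` derivatives of `f`; the factor `d + 1`
in `om` is there to absorb it. -/
theorem om_lip_le (i : Fin N) (c : List (Fin N)) :
    d * ∑ h, lipN (df W c ((W i).c h)) ≤ om W (i :: c) := by
  rw [om]
  gcongr
  · exact le_self_add
  · exact le_add_self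

theorem om_lip_le' (i : Fin N) (c : List (Fin N)) :
    ∑ h, lipN (df W c ((W i).c h)) ≤ om W (i :: c) := by
  rw [om]
  refine le_trans (Finset.sum_le_sum fun h _ => ?_)
    (le_mul_of_one_le_left (zero_le) (by simp))
  exact le_add_self

theorem lie_deriv_pd (V : SmoothField d) (j : Fin d) :
    ⁅V.deriv, pd j⁆ = -∑ h, mulOp ((V.c h).pd j) * pd h := by
  rw [Ring.lie_def, deriv_eq, Finset.sum_mul, Finset.mul_sum, ← Finset.sum_sub_distrib,
    ← Finset.sum_neg_distrib]
  refine Finset.sum_congr rfl fun h _ => ?_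
  rw [← mul_assoc, pd_mul_mulOp, add_mul, mul_assoc, mul_assoc, pd_comm j h]
  abel

/-- The gradient of a distribution, in `L^p`. -/
def gradN (p : ℝ≥0∞) [Fact (1 ≤ p)] (f : 𝓢'(Space d, ℂ)) : ℝ≥0∞ := ∑ h, distLpNorm p (pd h f)

theorem lipN_eq (V : TFun d) : lipN V = gradN ∞ V.dist := by
  simp only [lipN, gradN, supN, pd_dist]

theorem norm_pd_le {p : ℝ≥0∞} [Fact (1 ≤ p)] (f : 𝓢'(Space d, ℂ)) (h : Fin d) :
    distLpNorm p (pd h f) ≤ gradN p f :=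
  Finset.single_le_sum (f := fun h => distLpNorm p (pd h f)) (fun _ _ => zero_le)
    (Finset.mem_univ h)

/-- The commutator of `W · ∇` with `∂_j` is `-∑ (∂_j W^h) ∂_h`. Along the rest of the word both the
coefficient and `∂_h` are differentiated. The coefficient is bounded by the claim itself for `p =
∞`, which costs one weight, and `∂_h` costs another; this dictates the recursion of `weight`. All
exponents are treated at once for that reason. -/
theorem dL_pd_le_of_length_le (n : ℕ) : (∀ w : List (Fin N), w.length ≤ n → ∀ (p : ℝ≥0∞) [Fact (1 ≤ p)]
    (j : Fin d) (f : 𝓢'(Space d, ℂ)), distLpNorm p (dL W w (pd j) f) ≤ wt W w * gradN p f) := by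
  induction n with
  | zero =>
    intro w hw p _ j f
    have : w = [] := List.length_eq_zero_iff.1 (Nat.le_zero.1 hw)
    subst this
    rw [wt, weight_nil, one_mul]
    exact norm_pd_le f j
  | succ n ih =>
    intro w hw p _ j f
    cases w with
    | nil => rw [wt, weight_nil, one_mul]; exact norm_pd_le f j
    | cons i w =>
      simp only [List.length_cons, Nat.add_le_add_iff_right] at hw
      have hsup : ∀ (V : TFun d) (a : List (Fin N)), a.length ≤ n →
          supN (df W a (V.pd j)) ≤ conv (fun b => lipN (df W b V)) (wt W) a := fun V a ha => by
        rw [supN, ← dd_dist, ← pd_dist, conv_comm]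
        refine dd_apply_le fun b c hb hc => ?_
        rw [lipN_eq, ← dd_dist]
        exact ih b (hb.trans ha) _ j _
      rw [dL_cons, lie_deriv_pd, dL_neg, dL_sum, neg_apply, distLpNorm_neg, _root_.sum_apply]
      refine (distLpNorm_sum_le _ _).trans ?_
      have h1 : ∀ h : Fin d, distLpNorm p (dL W w (mulOp (((W i).c h).pd j) * pd h) f) ≤
          conv (conv (fun b => lipN (df W b ((W i).c h))) (wt W)) (wt W) w * gradN p f :=
          fun h => by
        rw [mul_comm, ← conv_mul_right]
        refine dL_mul_le (nrm := fun T => distLpNorm p (T f))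
          (fun S T => distLpNorm_add_le _ _) fun a b ha hb => ?_
        rw [dL_mulOp, op_mul_apply]
        refine (distLpNorm_mulOp_le (p₁ := ∞) (p₂ := p) _ _).trans ?_
        rw [mul_comm (gradN p f)]
        exact mul_le_mul' (hsup _ a (ha.trans hw)) (ih b (hb.trans hw) p h f)
      refine (Finset.sum_le_sum fun h _ => h1 h).trans ?_
      rw [← Finset.sum_mul, wt, weight_cons]
      gcongr
      simp only [conv_assoc]
      rw [← conv_sum_left]
      exact conv_mono' (om_lip_le' i) (fun _ => le_rfl) w

theorem dL_pd_le {p : ℝ≥0∞} [Fact (1 ≤ p)] (w : List (Fin N)) (j : Fin d)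
    (f : 𝓢'(Space d, ℂ)) : distLpNorm p (dL W w (pd j) f) ≤ wt W w * gradN p f :=
  dL_pd_le_of_length_le w.length w le_rfl p j f

theorem dd_pd_le {p : ℝ≥0∞} [Fact (1 ≤ p)] (w : List (Fin N)) (j : Fin d)
    (f : 𝓢'(Space d, ℂ)) :
    distLpNorm p (dd W w (pd j f)) ≤ conv (wt W) (fun a => gradN p (dd W a f)) w :=
  dd_apply_le fun a b _ _ => dL_pd_le a j _

theorem supN_df_pd_le (w : List (Fin N)) (j : Fin d) (V : TFun d) :
    supN (df W w (V.pd j)) ≤ conv (wt W) (fun a => lipN (df W a V)) w := by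
  rw [supN, ← dd_dist, ← pd_dist]
  simp only [lipN_eq, ← dd_dist]
  exact dd_pd_le w j _

/-- The gradient of a derivative along a word, in terms of derivatives of the gradient. -/
theorem gradN_dd_le {p : ℝ≥0∞} [Fact (1 ≤ p)] (w : List (Fin N)) (f : 𝓢'(Space d, ℂ)) :
    gradN p (dd W w f) ≤ conv (wt W) (fun a => ∑ j, distLpNorm p (dd W a (pd j f))) w := by
  induction w generalizing f with
  | nil => rw [conv_nil, wt, weight_nil, one_mul]; rfl
  | cons i w ih =>
    rw [dd_cons]
    refine (ih _).trans ?_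
    have h1 : ∀ a, ∑ j, distLpNorm p (dd W a (pd j ((W i).deriv f))) ≤
        ∑ j, distLpNorm p (dd W (i :: a) (pd j f)) + conv (conv (fun b => om W (i :: b)) (wt W))
          (fun b => ∑ j, distLpNorm p (dd W b (pd j f))) a := fun a => by
      have h2 : ∀ j, pd j ((W i).deriv f) = (W i).deriv (pd j f) +
          ∑ h, mulOp (((W i).c h).pd j) (pd h f) := fun j => by
        have := congrArg (fun T : Op d => T f) (lie_deriv_pd (W i) j)
        simp only [Ring.lie_def, sub_apply, op_mul_apply, neg_apply, _root_.sum_apply] at this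
        rw [sub_eq_iff_eq_add.1 this]; abel
      simp only [h2, dd_add, dd_sum]
      refine (Finset.sum_le_sum fun j _ => (distLpNorm_add_le _ _).trans
        (add_le_add_right (distLpNorm_sum_le _ _) _)).trans ?_
      rw [Finset.sum_add_distrib]
      refine add_le_add le_rfl ?_
      have h3 : ∀ j h, distLpNorm p (dd W a (mulOp (((W i).c h).pd j) (pd h f))) ≤
          conv (conv (fun b => lipN (df W b ((W i).c h))) (wt W))
            (fun b => ∑ j, distLpNorm p (dd W b (pd j f))) a := fun j h => by
        refine (dd_mulOp_le (p₁ := ∞) (p₂ := p) _ _ a).trans (conv_mono' (fun b => ?_) (fun b =>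
          Finset.single_le_sum (f := fun j => distLpNorm p (dd W b (pd j f)))
            (fun _ _ => zero_le) (Finset.mem_univ h)) a)
        rw [dd_dist, conv_comm]
        exact supN_df_pd_le b j _
      refine (Finset.sum_le_sum fun j _ => Finset.sum_le_sum fun h _ => h3 j h).trans ?_
      rw [Finset.sum_const, Finset.card_univ, Fintype.card_fin, nsmul_eq_mul]
      simp only [conv_assoc]
      rw [← conv_sum_left, ← conv_mul_left]
      exact conv_mono' (om_lip_le i) (fun _ => le_rfl) a
    refine (conv_mono' (fun _ => le_rfl) h1 w).trans ?_
    rw [conv_add_right, conv_cons, add_comm]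
    refine add_le_add ?_ le_rfl
    -- The weight absorbs the letter `i`: `wt W (i :: ·)` is the convolution of `om W (i :: ·)` with
    -- two copies of `wt W`.
    rw [← conv_assoc]
    refine conv_mono (fun a _ => ?_) fun _ _ => le_rfl
    rw [wt, weight_cons, conv_left_comm]

/-- Derivatives of a gradient, in divergence form. -/
theorem opBound_dd_pd_le (hdiv : ∀ i, (W i).IsDivFree) {p : ℝ≥0∞} [Fact (1 ≤ p)] {T : Op d}
    {A : ℝ≥0∞} (hT : ∀ j, OpBound (T * pd j) A) (w : List (Fin N)) (j : Fin d)
    (f : 𝓢'(Space d, ℂ)) : distLpNorm p (T (dd W w (pd j f))) ≤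
      A * conv (wt W) (fun a => distLpNorm p (dd W a f)) w := by
  induction w generalizing f j with
  | nil => rw [conv_nil, wt, weight_nil, one_mul]; exact hT j p f
  | cons i w ih =>
    -- Every term must keep a derivative in front for `T` to meet. In `(∂_j W^h) ∂_h f` the
    -- derivative `∂_h` can be pulled out because the remainder is `∂_j (div W) f = 0`.
    have h2 : (W i).deriv (pd j f) = pd j ((W i).deriv f) -
          ∑ h, pd h (mulOp (((W i).c h).pd j) f) := by
      have := congrArg (fun T : Op d => T f) (lie_deriv_pd (W i) j)
      simp only [Ring.lie_def, sub_apply, op_mul_apply, neg_apply, _root_.sum_apply] at this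
      rw [sub_eq_iff_eq_add.1 this]
      have h3 : ∀ h, pd h (mulOp (((W i).c h).pd j) f) =
          mulOp ((((W i).c h).pd j).pd h) f + mulOp (((W i).c h).pd j) (pd h f) := fun h =>
        congrArg (fun T : Op d => T f) (pd_mul_mulOp h _)
      have h4 : ∑ h, mulOp ((((W i).c h).pd j).pd h) f = 0 := by
        have h5 : ∑ h, (((W i).c h).pd j).pd h = 0 := by
          apply TFun.eq_zero_of_dist_eq_zero
          have e1 : (∑ h, (((W i).c h).pd j).pd h).dist = pd j (∑ h, ((W i).c h).pd h).dist := by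
            have hs : ∀ V : Fin d → TFun d, (∑ h, V h).dist = ∑ h, (V h).dist := fun V => by
              rw [dist_eq_mulOp_one, mulOp_sum, _root_.sum_apply]
              exact Finset.sum_congr rfl fun h _ => (dist_eq_mulOp_one _).symm
            rw [hs, hs, map_sum]
            refine Finset.sum_congr rfl fun h _ => ?_
            rw [← pd_dist, ← pd_dist, ← pd_dist]
            exact congrArg (fun T : Op d => T _) (pd_comm h j)
          rw [e1, (isDivFree_iff _).1 (hdiv i), dist_eq_mulOp_one, mulOp_zero, zero_apply, map_zero]
        have := congrArg (fun V : TFun d => mulOp V f) h5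
        simpa [mulOp_sum, mulOp_zero] using this
      simp only [h3, Finset.sum_add_distrib, h4, zero_add]
      abel
    rw [dd_cons, h2, dd_sub, dd_sum, map_sub, map_sum]
    refine (distLpNorm_sub_le _ _).trans ((add_le_add (ih j _)
      ((distLpNorm_sum_le _ _).trans (Finset.sum_le_sum fun h _ => ih h _))).trans ?_)
    rw [← Finset.mul_sum, ← mul_add, conv_cons, add_comm]
    refine mul_le_mul' le_rfl (add_le_add ?_ le_rfl)
    have h3 : ∀ h, conv (wt W) (fun a => distLpNorm p (dd W a (mulOp (((W i).c h).pd j) f))) w ≤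
        conv (wt W) (conv (conv (fun b => lipN (df W b ((W i).c h))) (wt W))
          (fun a => distLpNorm p (dd W a f))) w := fun h =>
      conv_mono' (fun _ => le_rfl) (fun a => (dd_mulOp_le (p₁ := ∞) (p₂ := p) _ _ a).trans
        (conv_mono' (fun b => by
          rw [dd_dist, conv_comm]; exact supN_df_pd_le b j _) (fun b => le_rfl) a)) w
    refine (Finset.sum_le_sum fun h _ => h3 h).trans ?_
    rw [← conv_sum_right]
    have h6 : ∀ a, wt W (i :: a) = conv (wt W) (conv (fun b => om W (i :: b)) (wt W)) a :=
      fun a => by rw [wt, weight_cons, conv_left_comm]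
    simp only [h6]
    rw [conv_assoc]
    refine conv_mono' (fun _ => le_rfl) (fun a => ?_) w
    simp only [conv_assoc]
    rw [← conv_sum_left]
    exact conv_mono' (om_lip_le' i) (fun _ => le_rfl) a

end FieldWords

end

section

/-! ### Commutators of fields and Fourier multipliers -/

section Symbols

variable {d : ℕ}

/-- Multiplication of a symbol by the symbol of `∂_j`. -/
def mulXi (j : Fin d) : 𝓢(Space d, ℂ) →L[ℂ] 𝓢(Space d, ℂ) := SchwartzMap.smulLeftCLM ℂ (xi j)

theorem mulXi_apply (j : Fin d) (a : 𝓢(Space d, ℂ)) (ξ : Space d) :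
    mulXi j a ξ = a ξ * xi j ξ := by
  rw [mulXi, SchwartzMap.smulLeftCLM_apply_apply (xi_temperate j), smul_eq_mul, mul_comm]

theorem coe_mulXi (j : Fin d) (a : 𝓢(Space d, ℂ)) :
    (mulXi j a : Space d → ℂ) = (a : Space d → ℂ) * xi j := funext fun ξ => mulXi_apply j a ξ

theorem mult_mul_pd (a : 𝓢(Space d, ℂ)) (j : Fin d) : mult a * pd j = mult (mulXi j a) := by
  rw [mult_pd a.hasTemperateGrowth, coe_mulXi]

theorem pd_mul_mult (a : 𝓢(Space d, ℂ)) (j : Fin d) : pd j * mult a = mult (mulXi j a) := by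
  rw [← mult_pd_comm a.hasTemperateGrowth, mult_mul_pd]

/-- Multiplication of a symbol by a product of symbols of partial derivatives. -/
def mulXis (js : List (Fin d)) (a : 𝓢(Space d, ℂ)) : 𝓢(Space d, ℂ) := js.foldl (fun b j => mulXi j b) a

/-- The kernels of `a` and of its products with polynomials have the moments of a symbol of
size `C` at frequency `L`. -/
structure SymBound (K : ℕ) (C L : ℝ≥0∞) (a : 𝓢(Space d, ℂ)) : Prop where
  C_ne : C ≠ 0
  L_ne : L ≠ 0
  L_ne_top : L ≠ ⊤
  le : ∀ (js : List (Fin d)) (n : ℕ), js.length ≤ K → n ≤ K →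
    moment n (FourierTransform.fourierInv (mulXis js a)) ≤ C * L ^ js.length * L⁻¹ ^ n

theorem SymBound.mono {K K' : ℕ} {C C' L : ℝ≥0∞} {a : 𝓢(Space d, ℂ)} (h : SymBound K C L a)
    (hK : K' ≤ K) (hC : C ≤ C') : SymBound K' C' L a :=
  ⟨fun h0 => h.C_ne (by rw [h0] at hC; exact nonpos_iff_eq_zero.1 hC), h.L_ne, h.L_ne_top,
    fun js n hj hn => (h.le js n (hj.trans hK) (hn.trans hK)).trans (by gcongr)⟩

theorem SymBound.mul_xi {K : ℕ} {C L : ℝ≥0∞} {a : 𝓢(Space d, ℂ)} (h : SymBound (K + 1) C L a)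
    (j : Fin d) : SymBound K (C * L) L (mulXi j a) :=
  ⟨mul_ne_zero h.C_ne h.L_ne, h.L_ne, h.L_ne_top, fun js n hj hn => by
    have := h.le (j :: js) n (by simp; omega) (by omega)
    rw [List.length_cons, pow_succ', ← mul_assoc C] at this
    exact this⟩

theorem SymBound.opBound_adL {K : ℕ} {C L : ℝ≥0∞} {a : 𝓢(Space d, ℂ)} (h : SymBound K C L a)
    {Vs : List (TFun d)} (hV : Vs.length ≤ K) :
    OpBound (adL Vs (mult a)) (C * L⁻¹ ^ Vs.length * (Vs.map lipN).prod) := by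
  refine Striated.opBound_adL a Vs (mul_ne_zero h.C_ne (pow_ne_zero _ (ENNReal.inv_ne_zero.2 h.L_ne_top))) ?_
  simpa [mulXis] using h.le [] Vs.length (by simp) hV

theorem SymBound.opBound {K : ℕ} {C L : ℝ≥0∞} {a : 𝓢(Space d, ℂ)} (h : SymBound K C L a) :
    OpBound (mult a) C := by
  simpa [adL] using h.opBound_adL (Vs := []) (by simp)

theorem adL_append (Vs : List (TFun d)) (V : TFun d) (S : Op d) :
    adL (Vs ++ [V]) S = adL Vs ⁅mulOp V, S⁆ := by
  simp [adL]

theorem adL_add (Vs : List (TFun d)) (S T : Op d) : adL Vs (S + T) = adL Vs S + adL Vs T := by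
  induction Vs with
  | nil => rfl
  | cons V Vs ih => rw [adL_cons, adL_cons, adL_cons, ih, bracket_add]

theorem adL_sum (Vs : List (TFun d)) {κ : Type*} (s : Finset κ) (T : κ → Op d) :
    adL Vs (∑ k ∈ s, T k) = ∑ k ∈ s, adL Vs (T k) := by
  classical
  induction s using Finset.induction_on with
  | empty =>
    have := adL_add Vs 0 0
    simpa using this
  | insert a s ha ih => rw [Finset.sum_insert ha, Finset.sum_insert ha, adL_add, ih]

theorem adL_mul_mulOp (Vs : List (TFun d)) (S : Op d) (U : TFun d) :
    adL Vs (S * mulOp U) = adL Vs S * mulOp U := by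
  induction Vs with
  | nil => rfl
  | cons V Vs ih =>
    rw [adL_cons, adL_cons, ih, Ring.lie_def, Ring.lie_def, sub_mul, mul_assoc, mul_assoc,
      mul_assoc, mulOp_comm U V]

/-- A derivative to the right of a commutator is merged with `S`; the error puts it on `V`, where it
costs a Lipschitz norm and no frequency. -/
theorem ad_mul_pd (V : TFun d) (S : Op d) (j : Fin d) :
    ⁅mulOp V, S⁆ * pd j = ⁅mulOp V, S * pd j⁆ + S * mulOp (V.pd j) := by
  have h : mulOp (V.pd j) = pd j * mulOp V - mulOp V * pd j := by rw [pd_mul_mulOp]; abel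
  rw [h, Ring.lie_def, Ring.lie_def]
  simp only [sub_mul, mul_sub, mul_assoc]
  abel

/-- To the left of `a(D)` the field is used as `W^j ∂_j`, to the right as `∂_j W^j`, so that `∂_j`
is adjacent to `a(D)` in both products. -/
theorem lie_deriv_mult {W : SmoothField d} (hW : W.IsDivFree) (a : 𝓢(Space d, ℂ)) :
    ⁅W.deriv, mult a⁆ = ∑ j, ⁅mulOp (W.c j), mult (mulXi j a)⁆ := by
  simp only [Ring.lie_def, Finset.sum_sub_distrib]
  congr 1
  · rw [deriv_eq, Finset.sum_mul]
    simp only [mul_assoc, pd_mul_mult]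
  · rw [deriv_eq_of_divFree hW, Finset.mul_sum]
    simp only [← mul_assoc, mult_mul_pd]

theorem supN_pd_le_lipN (V : TFun d) (j : Fin d) : supN (V.pd j) ≤ lipN V :=
  Finset.single_le_sum (f := fun j => supN (V.pd j)) (fun _ _ => zero_le) (Finset.mem_univ j)

variable {N : ℕ} {W : Fin N → SmoothField d}

/-- `d + 1 ≥ 2` unless `d = 0`, when the sum is empty. -/
theorem two_mul_om_lip_le (i : Fin N) (c : List (Fin N)) :
    2 * ∑ h, lipN (df W c ((W i).c h)) ≤ om W (i :: c) := by
  rcases Nat.eq_zero_or_pos d with rfl | hd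
  · simp
  rw [om]
  refine mul_le_mul' ?_ (Finset.sum_le_sum fun h _ => le_add_self)
  have : ((2 : ℕ) : ℝ≥0∞) ≤ ((d + 1 : ℕ) : ℝ≥0∞) := Nat.cast_le.2 (by omega)
  simpa using this

/-- Induction on `b`. By `lie_deriv_mult` a letter multiplies the symbol by `ξ_j`, which costs `L`,
and adds one function to the list of commutators, which gains `L⁻¹`; the bound does not depend on
the frequency. A letter therefore consumes two units of `K`, one derivative symbol and one moment.
-/
theorem SymBound.adL_dL_le (hdiv : ∀ i, (W i).IsDivFree) {p : ℝ≥0∞} [Fact (1 ≤ p)]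
    (f : 𝓢'(Space d, ℂ)) {b : List (Fin N)} {K : ℕ} {C L : ℝ≥0∞} {a : 𝓢(Space d, ℂ)}
    (h : SymBound K C L a) {Vs : List (TFun d)} (hK : Vs.length + 2 * b.length ≤ K) :
    distLpNorm p (adL Vs (dL W b (mult a)) f) ≤
      C * L⁻¹ ^ Vs.length * (Vs.map lipN).prod * distLpNorm p f * wt W b := by
  induction hn : b.length using Nat.strong_induction_on generalizing b K C a Vs with
  | _ n ih =>
  cases b with
  | nil =>
    rw [wt, weight_nil, mul_one]
    exact h.opBound_adL (by simpa using hK) p f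
  | cons i b =>
    simp only [List.length_cons] at hK hn
    obtain ⟨K, rfl⟩ : ∃ K', K = K' + 1 := ⟨K - 1, by omega⟩
    rw [dL_cons, lie_deriv_mult (hdiv i), dL_sum, adL_sum, _root_.sum_apply]
    refine (distLpNorm_sum_le _ _).trans ?_
    have h1 : ∀ j, distLpNorm p (adL Vs (dL W b ⁅mulOp ((W i).c j), mult (mulXi j a)⁆) f) ≤
        conv (fun c => lipN (df W c ((W i).c j)))
          (fun c => C * L⁻¹ ^ Vs.length * (Vs.map lipN).prod * distLpNorm p f * wt W c) b :=
      fun j => by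
      refine dL_ad_le (nrm := fun T => distLpNorm p (adL Vs T f))
        (fun S T => by rw [adL_add]; exact distLpNorm_add_le _ _) fun c e hc he => ?_
      have := ih e.length (by omega) (h.mul_xi j) (Vs := Vs ++ [df W c ((W i).c j)]) (b := e)
        (by simp; omega) rfl
      rw [← adL_append]
      refine this.trans_eq ?_
      have hL : L * L⁻¹ = 1 := ENNReal.mul_inv_cancel h.L_ne h.L_ne_top
      simp only [List.length_append, List.length_singleton, pow_succ, List.map_append,
        List.prod_append, List.map_singleton, List.prod_singleton]
      calc _ = C * (L * L⁻¹) * L⁻¹ ^ Vs.length * ((Vs.map lipN).prod *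
            lipN (df W c ((W i).c j))) * distLpNorm p f * wt W e := by ring
        _ = _ := by rw [hL]; ring
    refine (Finset.sum_le_sum fun j _ => h1 j).trans ?_
    simp only [conv_mul_right]
    rw [← Finset.mul_sum, ← conv_sum_left]
    gcongr
    exact (conv_mono' (om_lip_le' i) (fun _ => le_rfl) b).trans (conv_le_weight_cons _ i b)

/-- The same induction with a derivative on the right, carried along by `ad_mul_pd`. Its two terms
have equal size, and the resulting factor `2` is absorbed by `om`. -/
theorem SymBound.adL_dL_pd_le (hdiv : ∀ i, (W i).IsDivFree) {p : ℝ≥0∞} [Fact (1 ≤ p)] (l : Fin d)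
    (f : 𝓢'(Space d, ℂ)) {b : List (Fin N)} {K : ℕ} {C L : ℝ≥0∞} {a : 𝓢(Space d, ℂ)}
    (h : SymBound K C L a) {Vs : List (TFun d)} (hK : Vs.length + 2 * b.length + 1 ≤ K) :
    distLpNorm p (adL Vs (dL W b (mult a) * pd l) f) ≤
      C * L * L⁻¹ ^ Vs.length * (Vs.map lipN).prod * distLpNorm p f * wt W b := by
  induction hn : b.length using Nat.strong_induction_on generalizing b K C a Vs with
  | _ n ih =>
  cases b with
  | nil =>
    obtain ⟨K, rfl⟩ : ∃ K', K = K' + 1 := ⟨K - 1, by omega⟩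
    rw [wt, weight_nil, mul_one]
    show distLpNorm p (adL Vs (mult a * pd l) f) ≤ _
    rw [mult_mul_pd]
    exact (h.mul_xi l).opBound_adL (by simp at hK; omega) p f
  | cons i b =>
    simp only [List.length_cons] at hK hn
    obtain ⟨K, rfl⟩ : ∃ K', K = K' + 1 := ⟨K - 1, by omega⟩
    rw [dL_cons, lie_deriv_mult (hdiv i), dL_sum, Finset.sum_mul, adL_sum, _root_.sum_apply]
    refine (distLpNorm_sum_le _ _).trans ?_
    have h1 : ∀ j, distLpNorm p (adL Vs (dL W b ⁅mulOp ((W i).c j), mult (mulXi j a)⁆ * pd l) f) ≤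
        conv (fun c => 2 * lipN (df W c ((W i).c j)))
          (fun c => C * L * L⁻¹ ^ Vs.length * (Vs.map lipN).prod * distLpNorm p f * wt W c) b :=
      fun j => by
      refine dL_ad_le (nrm := fun T => distLpNorm p (adL Vs (T * pd l) f))
        (fun S T => by rw [add_mul, adL_add]; exact distLpNorm_add_le _ _) fun c e hc he => ?_
      rw [ad_mul_pd, adL_add, ← adL_append, adL_mul_mulOp]
      refine (distLpNorm_add_le _ _).trans ?_
      have h2 := ih e.length (by omega) (h.mul_xi j) (Vs := Vs ++ [df W c ((W i).c j)]) (b := e)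
        (by simp; omega) rfl
      have h3 := (h.mul_xi j).adL_dL_le hdiv (p := p)
        (mulOp ((df W c ((W i).c j)).pd l) f) (Vs := Vs) (b := e) (by omega)
      have h4 : distLpNorm p (mulOp ((df W c ((W i).c j)).pd l) f) ≤
          lipN (df W c ((W i).c j)) * distLpNorm p f :=
        (distLpNorm_mulOp_le (p₁ := ∞) (p₂ := p) _ _).trans
          (mul_le_mul' (supN_pd_le_lipN _ _) le_rfl)
      have hL : L * L⁻¹ = 1 := ENNReal.mul_inv_cancel h.L_ne h.L_ne_top
      simp only [List.length_append, List.length_singleton, pow_succ, List.map_append,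
        List.prod_append, List.map_singleton, List.prod_singleton] at h2
      have h5 : C * L * L * (L⁻¹ ^ Vs.length * L⁻¹) * ((Vs.map lipN).prod *
          lipN (df W c ((W i).c j))) * distLpNorm p f * wt W e =
          lipN (df W c ((W i).c j)) * (C * L * L⁻¹ ^ Vs.length * (Vs.map lipN).prod *
            distLpNorm p f * wt W e) := by
        calc _ = C * L * (L * L⁻¹) * L⁻¹ ^ Vs.length * ((Vs.map lipN).prod *
            lipN (df W c ((W i).c j))) * distLpNorm p f * wt W e := by ring
          _ = _ := by rw [hL]; ring
      rw [h5] at h2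
      have h6 := h3.trans (mul_le_mul' (mul_le_mul' le_rfl h4) le_rfl)
      refine (add_le_add h2 h6).trans_eq ?_
      ring
    refine (Finset.sum_le_sum fun j _ => h1 j).trans ?_
    simp only [conv_mul_right]
    rw [← Finset.mul_sum, ← conv_sum_left]
    gcongr
    refine (conv_mono' (fun c => ?_) (fun _ => le_rfl) b).trans (conv_le_weight_cons _ i b)
    rw [← Finset.mul_sum]
    exact two_mul_om_lip_le i c

theorem SymBound.dL_le (hdiv : ∀ i, (W i).IsDivFree) {p : ℝ≥0∞} [Fact (1 ≤ p)]
    (f : 𝓢'(Space d, ℂ)) {b : List (Fin N)} {K : ℕ} {C L : ℝ≥0∞} {a : 𝓢(Space d, ℂ)}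
    (h : SymBound K C L a) (hK : 2 * b.length ≤ K) :
    distLpNorm p (dL W b (mult a) f) ≤ C * wt W b * distLpNorm p f := by
  have := h.adL_dL_le hdiv (p := p) f (Vs := []) (b := b) (by simpa using hK)
  simp only [adL, List.foldr_nil, List.length_nil, pow_zero, List.map_nil, List.prod_nil,
    mul_one] at this
  exact this.trans_eq (by ring)

theorem SymBound.dL_pd_le (hdiv : ∀ i, (W i).IsDivFree) {p : ℝ≥0∞} [Fact (1 ≤ p)] (l : Fin d)
    (f : 𝓢'(Space d, ℂ)) {b : List (Fin N)} {K : ℕ} {C L : ℝ≥0∞} {a : 𝓢(Space d, ℂ)}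
    (h : SymBound K C L a) (hK : 2 * b.length + 1 ≤ K) :
    distLpNorm p (dL W b (mult a) (pd l f)) ≤ C * L * wt W b * distLpNorm p f := by
  have := h.adL_dL_pd_le hdiv (p := p) l f (Vs := []) (b := b) (by simpa using hK)
  simp only [adL, List.foldr_nil, List.length_nil, pow_zero, List.map_nil, List.prod_nil,
    mul_one] at this
  exact this.trans_eq (by ring)

theorem SymBound.ad_dL_le (hdiv : ∀ i, (W i).IsDivFree) {p : ℝ≥0∞} [Fact (1 ≤ p)]
    (f : 𝓢'(Space d, ℂ)) {b : List (Fin N)} {K : ℕ} {C L : ℝ≥0∞} {a : 𝓢(Space d, ℂ)}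
    (h : SymBound K C L a) (V : TFun d) (hK : 2 * b.length + 1 ≤ K) :
    distLpNorm p (⁅mulOp V, dL W b (mult a)⁆ f) ≤
      C * L⁻¹ * lipN V * wt W b * distLpNorm p f := by
  have := h.adL_dL_le hdiv (p := p) f (Vs := [V]) (b := b) (by simp; omega)
  simp only [adL, List.foldr_cons, List.foldr_nil, List.length_singleton, pow_one, List.map_cons,
    List.map_nil, List.prod_singleton] at this
  exact this.trans_eq (by ring)

theorem SymBound.ad_dL_pd_le (hdiv : ∀ i, (W i).IsDivFree) {p : ℝ≥0∞} [Fact (1 ≤ p)] (l : Fin d)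
    (f : 𝓢'(Space d, ℂ)) {b : List (Fin N)} {K : ℕ} {C L : ℝ≥0∞} {a : 𝓢(Space d, ℂ)}
    (h : SymBound K C L a) (V : TFun d) (hK : 2 * b.length + 2 ≤ K) :
    distLpNorm p (⁅mulOp V, dL W b (mult a)⁆ (pd l f)) ≤
      2 * C * lipN V * wt W b * distLpNorm p f := by
  have h1 := h.adL_dL_pd_le hdiv (p := p) l f (Vs := [V]) (b := b) (by simp; omega)
  simp only [adL, List.foldr_cons, List.foldr_nil, List.length_singleton, pow_one, List.map_cons,
    List.map_nil, List.prod_singleton] at h1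
  rw [mul_assoc C, ENNReal.mul_inv_cancel h.L_ne h.L_ne_top, mul_one] at h1
  rw [← op_mul_apply, ad_mul_pd, add_apply, op_mul_apply]
  refine (distLpNorm_add_le _ _).trans ((add_le_add h1 (h.dL_le hdiv _ (by omega))).trans ?_)
  have h4 : distLpNorm p (mulOp (V.pd l) f) ≤ lipN V * distLpNorm p f :=
    (distLpNorm_mulOp_le (p₁ := ∞) (p₂ := p) _ _).trans
      (mul_le_mul' (supN_pd_le_lipN _ _) le_rfl)
  calc _ ≤ C * lipN V * distLpNorm p f * wt W b + C * wt W b * (lipN V * distLpNorm p f) := by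
        gcongr
    _ = _ := by ring

end Symbols

end

section

/-! ### Dilations and bounded families of symbols -/

section Dilation

variable {d : ℕ}

theorem lintegral_comp_smul' (L : ℝˣ) {G : Space d → ℝ≥0∞} (hG : Measurable G) :
    ∫⁻ z, G ((L : ℝ) • z) = (‖(L : ℝ)‖ₑ ^ d)⁻¹ * ∫⁻ z, G z := by
  have h1 := Measure.map_addHaar_smul (volume : Measure (Space d)) (r := (L : ℝ)) L.ne_zero
  have h2 := lintegral_map (μ := (volume : Measure (Space d))) hG
    (measurable_const_smul (L : ℝ) : Measurable fun z : Space d => (L : ℝ) • z)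
  rw [← h2, h1, lintegral_smul_measure, smul_eq_mul]
  congr 1
  rw [finrank_euclideanSpace, Fintype.card_fin, abs_inv, abs_pow, ENNReal.ofReal_inv_of_pos
    (pow_pos (abs_pos.2 L.ne_zero) d), ENNReal.ofReal_pow (abs_nonneg _), ← Real.enorm_eq_ofReal_abs]

/-- The dilation `b(L⁻¹ ·)` of a symbol. -/
def dil (L : ℝˣ) : 𝓢(Space d, ℂ) →L[ℂ] 𝓢(Space d, ℂ) :=
  SchwartzMap.compCLMOfContinuousLinearEquiv ℂ (ContinuousLinearEquiv.smulLeft L⁻¹)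

theorem dil_apply (L : ℝˣ) (b : 𝓢(Space d, ℂ)) (ξ : Space d) :
    dil L b ξ = b ((L : ℝ)⁻¹ • ξ) := by
  show b (L⁻¹ • ξ) = _
  rw [Units.smul_def, Units.val_inv_eq_inv_val]

theorem fourierInv_dil (L : ℝˣ) (b : 𝓢(Space d, ℂ)) (x : Space d) :
    (FourierTransform.fourierInv (dil L b) : 𝓢(Space d, ℂ)) x =
      (|(L : ℝ)| ^ d : ℝ) • (FourierTransform.fourierInv b : 𝓢(Space d, ℂ)) ((L : ℝ) • x) := by
  rw [SchwartzMap.fourierInv_coe, SchwartzMap.fourierInv_coe, Real.fourierInv_eq, Real.fourierInv_eq]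
  have h := Measure.integral_comp_inv_smul (volume : Measure (Space d))
    (fun v => Real.fourierChar (inner ℝ v ((L : ℝ) • x)) • b v) (L : ℝ)
  rw [finrank_euclideanSpace, Fintype.card_fin, abs_pow] at h
  rw [← h]
  congr 1; ext v
  rw [dil_apply]
  have h1 : inner ℝ ((L : ℝ)⁻¹ • v) ((L : ℝ) • x) = inner ℝ v x := by
    rw [inner_smul_left, inner_smul_right, ← mul_assoc]
    simp
  rw [h1]

theorem moment_dil (n : ℕ) (L : ℝˣ) (b : 𝓢(Space d, ℂ)) :
    moment n (FourierTransform.fourierInv (dil L b)) =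
      ‖(L : ℝ)‖ₑ⁻¹ ^ n * moment n (FourierTransform.fourierInv b) := by
  set κ : 𝓢(Space d, ℂ) := FourierTransform.fourierInv b
  have hL0 : ‖(L : ℝ)‖ₑ ≠ 0 := by simp
  have hLt : ‖(L : ℝ)‖ₑ ≠ ⊤ := by simp
  have hG : Measurable fun z : Space d => ‖z‖ₑ ^ n * ‖κ z‖ₑ :=
    (continuous_enorm.measurable.pow_const n).mul
      (continuous_enorm.measurable.comp κ.continuous.measurable)
  have h := lintegral_comp_smul' L hG
  have h1 : ∀ z : Space d, ‖z‖ₑ ^ n * ‖(FourierTransform.fourierInv (dil L b) : 𝓢(Space d, ℂ)) z‖ₑ =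
      (‖(L : ℝ)‖ₑ⁻¹ ^ n * ‖(L : ℝ)‖ₑ ^ d) * (‖(L : ℝ) • z‖ₑ ^ n * ‖κ ((L : ℝ) • z)‖ₑ) := fun z => by
    rw [fourierInv_dil, enorm_smul, enorm_smul, mul_pow, enorm_pow, Real.enorm_abs]
    calc _ = ‖z‖ₑ ^ n * (‖(L : ℝ)‖ₑ ^ d * ‖κ ((L : ℝ) • z)‖ₑ) := rfl
      _ = (‖(L : ℝ)‖ₑ⁻¹ * ‖(L : ℝ)‖ₑ) ^ n * (‖z‖ₑ ^ n * (‖(L : ℝ)‖ₑ ^ d * ‖κ ((L : ℝ) • z)‖ₑ)) := by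
        rw [ENNReal.inv_mul_cancel hL0 hLt, one_pow, one_mul]
      _ = _ := by rw [mul_pow]; ring
  rw [moment, lintegral_congr h1, lintegral_const_mul' _ _ (by finiteness), h, moment]
  rw [mul_assoc, ← mul_assoc (_ ^ d), ENNReal.mul_inv_cancel (pow_ne_zero _ hL0) (by finiteness),
    one_mul]

theorem mulXi_dil (j : Fin d) (L : ℝˣ) (b : 𝓢(Space d, ℂ)) :
    mulXi j (dil L b) = ((L : ℝ) : ℂ) • dil L (mulXi j b) := by
  ext ξ
  rw [mulXi_apply, dil_apply, smul_apply, dil_apply, mulXi_apply, smul_eq_mul, xi, xi]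
  have h1 : (((L : ℝ)⁻¹ • ξ : Space d) j : ℂ) = ((L : ℝ) : ℂ)⁻¹ * (ξ j : ℂ) := by simp
  have h2 : ((L : ℝ) : ℂ) ≠ 0 := by simp
  simp only [h1]
  field_simp

theorem mulXis_smul (js : List (Fin d)) (c : ℂ) (b : 𝓢(Space d, ℂ)) :
    mulXis js (c • b) = c • mulXis js b := by
  induction js generalizing b with
  | nil => rfl
  | cons j js ih =>
    show mulXis js (mulXi j (c • b)) = c • mulXis js (mulXi j b)
    rw [map_smul, ih]

theorem mulXis_dil (js : List (Fin d)) (L : ℝˣ) (b : 𝓢(Space d, ℂ)) :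
    mulXis js (dil L b) = ((L : ℝ) : ℂ) ^ js.length • dil L (mulXis js b) := by
  induction js generalizing b with
  | nil => simp [mulXis]
  | cons j js ih =>
    show mulXis js (mulXi j (dil L b)) = _ • dil L (mulXis js (mulXi j b))
    rw [mulXi_dil, mulXis_smul, ih, smul_smul, List.length_cons, pow_succ']

theorem moment_smul (n : ℕ) (c : ℂ) (κ : 𝓢(Space d, ℂ)) :
    moment n (c • κ : 𝓢(Space d, ℂ)) = ‖c‖ₑ * moment n κ := by
  rw [moment, moment, ← lintegral_const_mul' _ _ (by simp)]
  congr 1; ext z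
  rw [smul_apply, enorm_smul]; ring

theorem fourierInv_smul' (c : ℂ) (b : 𝓢(Space d, ℂ)) :
    (FourierTransform.fourierInv (c • b) : 𝓢(Space d, ℂ)) = c • FourierTransform.fourierInv b :=
  map_smul (FourierTransform.fourierInvCLM ℂ 𝓢(Space d, ℂ)) c b

theorem SymBound.dil {K : ℕ} {C : ℝ≥0∞} {b : 𝓢(Space d, ℂ)} (h : SymBound K C 1 b) (L : ℝˣ) :
    SymBound K C ‖(L : ℝ)‖ₑ (dil L b) :=
  ⟨h.C_ne, by simp, by simp, fun js n hj hn => by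
    rw [mulXis_dil, fourierInv_smul', moment_smul, moment_dil, enorm_pow]
    have h1 : ‖((L : ℝ) : ℂ)‖ₑ = ‖(L : ℝ)‖ₑ := by
      rw [← ofReal_norm_eq_enorm, ← ofReal_norm_eq_enorm, Complex.norm_real]
    have h2 := h.le js n hj hn
    simp only [one_pow, inv_one, mul_one] at h2
    rw [h1]
    calc _ ≤ ‖(L : ℝ)‖ₑ ^ js.length * (‖(L : ℝ)‖ₑ⁻¹ ^ n * C) := by gcongr
      _ = _ := by ring⟩

/-- A family of Schwartz functions that is bounded in every seminorm. -/
def BddFam {ι : Type*} (b : ι → 𝓢(Space d, ℂ)) : Prop :=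
  ∀ k n : ℕ, ∃ A : ℝ, ∀ i, SchwartzMap.seminorm ℂ k n (b i) ≤ A

theorem bddFam_const {ι : Type*} (b : 𝓢(Space d, ℂ)) : BddFam fun _ : ι => b :=
  fun k n => ⟨SchwartzMap.seminorm ℂ k n b, fun _ => le_rfl⟩

theorem exists_sup_seminorm_le {ι : Type*} {b : ι → 𝓢(Space d, ℂ)} (h : BddFam b)
    (s : Finset (ℕ × ℕ)) : ∃ A : ℝ, 0 ≤ A ∧ ∀ i, s.sup (schwartzSeminormFamily ℂ (Space d) ℂ) (b i) ≤ A := by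
  choose A hA using h
  refine ⟨∑ x ∈ s, max (A x.1 x.2) 0, Finset.sum_nonneg fun _ _ => le_max_right _ _, fun i => ?_⟩
  refine Seminorm.finset_sup_apply_le (Finset.sum_nonneg fun _ _ => le_max_right _ _) fun x hx => ?_
  refine ((hA x.1 x.2 i).trans (le_max_left _ 0)).trans ?_
  exact Finset.single_le_sum (f := fun x : ℕ × ℕ => max (A x.1 x.2) 0)
    (fun _ _ => le_max_right _ _) hx

theorem BddFam.map {ι : Type*} {b : ι → 𝓢(Space d, ℂ)} (h : BddFam b)
    (T : 𝓢(Space d, ℂ) →L[ℂ] 𝓢(Space d, ℂ)) : BddFam fun i => T (b i) := by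
  intro k n
  have hc : Continuous ((SchwartzMap.seminorm ℂ k n : Seminorm ℂ 𝓢(Space d, ℂ)).comp T.toLinearMap) :=
    ((schwartz_withSeminorms ℂ (Space d) ℂ).continuous_seminorm (k, n)).comp T.continuous
  obtain ⟨s, C, -, hC⟩ := Seminorm.bound_of_continuous (schwartz_withSeminorms ℂ (Space d) ℂ) _ hc
  obtain ⟨A, hA0, hA⟩ := exists_sup_seminorm_le h s
  refine ⟨C * A, fun i => (hC (b i)).trans ?_⟩
  rw [Seminorm.smul_apply, NNReal.smul_def, smul_eq_mul]
  exact mul_le_mul_of_nonneg_left (hA i) C.2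

theorem BddFam.moment {ι : Type*} {b : ι → 𝓢(Space d, ℂ)} (h : BddFam b) (n : ℕ) :
    ∃ C : ℝ≥0, ∀ i, moment n (b i) ≤ C := by
  -- The `d + 1` powers beyond the moment make the remaining weight integrable.
  obtain ⟨A, hA0, hA⟩ := exists_sup_seminorm_le h (Finset.Iic (n + (d + 1), 0))
  have hint : Integrable fun z : Space d => (1 + ‖z‖) ^ (-((d + 1 : ℕ) : ℝ)) :=
    integrable_one_add_norm (by simp [finrank_euclideanSpace])
  set B : ℝ := 2 ^ (n + (d + 1)) * A
  have hb : ∀ i z, ‖z‖ ^ n * ‖b i z‖ ≤ B * (1 + ‖z‖) ^ (-((d + 1 : ℕ) : ℝ)) := fun i z => by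
    have h1 := SchwartzMap.one_add_le_sup_seminorm_apply (𝕜 := ℂ) (m := (n + (d + 1), 0))
      (k := n + (d + 1)) (n := 0) le_rfl le_rfl (b i) z
    rw [norm_iteratedFDeriv_zero] at h1
    have h2 : (1 + ‖z‖) ^ (n + (d + 1)) * ‖b i z‖ ≤ B :=
      h1.trans (mul_le_mul_of_nonneg_left (hA i) (by positivity))
    have h3 : 0 < (1 + ‖z‖) ^ (d + 1) := by positivity
    rw [Real.rpow_neg (by positivity), Real.rpow_natCast, ← div_eq_mul_inv, le_div_iff₀ h3]
    refine le_trans ?_ h2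
    rw [pow_add]
    have h4 : ‖z‖ ^ n ≤ (1 + ‖z‖) ^ n := pow_le_pow_left₀ (norm_nonneg _) (by linarith) n
    calc _ = ‖z‖ ^ n * ((1 + ‖z‖) ^ (d + 1) * ‖b i z‖) := by ring
      _ ≤ (1 + ‖z‖) ^ n * ((1 + ‖z‖) ^ (d + 1) * ‖b i z‖) := by gcongr
      _ = _ := by ring
  have hfin := (hint.const_mul B).lintegral_lt_top
  refine ⟨(∫⁻ z : Space d, ENNReal.ofReal (B * (1 + ‖z‖) ^ (-((d + 1 : ℕ) : ℝ)))).toNNReal, fun i => ?_⟩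
  rw [ENNReal.coe_toNNReal hfin.ne]
  refine lintegral_mono fun z => ?_
  rw [← ofReal_norm_eq_enorm, ← ofReal_norm_eq_enorm, ← ENNReal.ofReal_pow (norm_nonneg _),
    ← ENNReal.ofReal_mul (by positivity)]
  exact ENNReal.ofReal_le_ofReal (hb i z)

theorem mulXis_eq_clm (js : List (Fin d)) :
    ∃ T : 𝓢(Space d, ℂ) →L[ℂ] 𝓢(Space d, ℂ), ∀ b, T b = mulXis js b := by
  induction js with
  | nil => exact ⟨ContinuousLinearMap.id ℂ _, fun b => rfl⟩
  | cons j js ih =>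
    obtain ⟨T, hT⟩ := ih
    exact ⟨T.comp (mulXi j), fun b => hT _⟩

/-- Only finitely many monomials and moments are involved, and each is controlled by the image of
the family under a continuous linear map. -/
theorem BddFam.symBound {ι : Type*} {b : ι → 𝓢(Space d, ℂ)} (h : BddFam b) (K : ℕ) :
    ∃ C : ℝ≥0, ∀ i, SymBound K C 1 (b i) := by
  have h1 : ∀ (js : List (Fin d)) (n : ℕ), ∃ C : ℝ≥0, ∀ i,
      Striated.moment n (FourierTransform.fourierInv (mulXis js (b i))) ≤ C := fun js n => by
    obtain ⟨T, hT⟩ := mulXis_eq_clm js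
    have := ((h.map T).map (FourierTransform.fourierInvCLM ℂ 𝓢(Space d, ℂ))).moment n
    simpa only [hT, FourierTransform.fourierInvCLM_apply] using this
  choose C hC using h1
  have hfin : {js : List (Fin d) | js.length ≤ K}.Finite := List.finite_length_le _ K
  set S := hfin.toFinset ×ˢ Finset.range (K + 1)
  refine ⟨1 + ∑ x ∈ S, C x.1 x.2, fun i => ⟨by simp, one_ne_zero, by simp, fun js n hj hn => ?_⟩⟩
  simp only [one_pow, inv_one, mul_one]
  refine (hC js n i).trans (ENNReal.coe_le_coe.2 (le_trans ?_ le_add_self))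
  exact Finset.single_le_sum (f := fun x : List (Fin d) × ℕ => C x.1 x.2) (fun _ _ => zero_le)
    (show (js, n) ∈ S by simp [S, hj, Nat.lt_succ_iff.2 hn])

/-- Multiplication by `g(t ·)` tends to multiplication by `g(0)` as `t → 0`. -/
theorem exists_seminorm_scale_le (g θ : 𝓢(Space d, ℂ)) (k n : ℕ) : ∃ A : ℝ, ∀ t : ℝ, 0 ≤ t → t ≤ 1 →
    ∀ ψ : 𝓢(Space d, ℂ), (∀ x, ψ x = (g (t • x) - g 0) * θ x) →
      SchwartzMap.seminorm ℂ k n ψ ≤ A * t := by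
  set G : ℕ → ℝ := fun i => SchwartzMap.seminorm ℂ 0 i g
  set Θ : ℕ → ℝ := fun i => SchwartzMap.seminorm ℂ k i θ + SchwartzMap.seminorm ℂ (k + 1) i θ
  have hG0 : ∀ i, 0 ≤ G i := fun i => apply_nonneg _ _
  have hΘ0 : ∀ i, 0 ≤ Θ i := fun i => add_nonneg (apply_nonneg _ _) (apply_nonneg _ _)
  have hGi : ∀ i x, ‖iteratedFDeriv ℝ i g x‖ ≤ G i := fun i x =>
    SchwartzMap.norm_iteratedFDeriv_le_seminorm ℂ g i x
  refine ⟨∑ i ∈ Finset.range (n + 1), n.choose i * (G (max i 1)) * Θ (n - i), fun t ht0 ht1 ψ hψ => ?_⟩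
  have hA : 0 ≤ ∑ i ∈ Finset.range (n + 1), n.choose i * (G (max i 1)) * Θ (n - i) :=
    Finset.sum_nonneg fun i _ => by have := hG0 (max i 1); have := hΘ0 (n - i); positivity
  refine SchwartzMap.seminorm_le_bound ℂ k n ψ (mul_nonneg hA ht0) fun x => ?_
  set h : Space d → ℂ := fun x => g (t • x) - g 0
  have hh : ContDiff ℝ ∞ h := ((g.smooth ⊤).comp (contDiff_const_smul t)).sub contDiff_const
  have hψ' : (ψ : Space d → ℂ) = fun x => h x * θ x := funext hψ
  have h1 := norm_iteratedFDeriv_mul_le (N := ∞) hh (θ.smooth ⊤) x (n := n) (by exact_mod_cast le_top)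
  rw [hψ']
  -- Order zero comes from the mean value inequality, which uses the first derivative of `g`, hence
  -- `max i 1`. Higher orders come from the chain rule and `t^i ≤ t`.
  have hi : ∀ i, ‖iteratedFDeriv ℝ i h x‖ ≤ G (max i 1) * t * (1 + ‖x‖) := fun i => by
    rcases Nat.eq_zero_or_pos i with rfl | hi
    · rw [norm_iteratedFDeriv_zero]
      have hl := Convex.norm_image_sub_le_of_norm_fderiv_le (𝕜 := ℝ) (f := g) (C := G 1) (s := Set.univ)
        (x := 0) (y := t • x) (fun y _ => g.differentiableAt) (fun y _ => by
          have := hGi 1 y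
          rwa [norm_iteratedFDeriv_one] at this) convex_univ trivial trivial
      rw [sub_zero, norm_smul, Real.norm_of_nonneg ht0] at hl
      refine hl.trans ?_
      simp only [zero_le, sup_of_le_right]
      have := hG0 1
      nlinarith [norm_nonneg x, mul_nonneg this ht0]
    · have e : iteratedFDeriv ℝ i h x = iteratedFDeriv ℝ i (fun y => g (t • y)) x := by
        have h2 : h = (fun y => g (t • y)) - fun _ => g 0 := rfl
        have h3 : ContDiff ℝ i fun y => g (t • y) := (g.smooth i).comp (contDiff_const_smul t)
        rw [h2, iteratedFDeriv_sub_apply h3.contDiffAt contDiff_const.contDiffAt, iteratedFDeriv_const_of_ne hi.ne']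
        simp
      rw [e, iteratedFDeriv_comp_const_smul t (g.smooth i), norm_smul, norm_pow, Real.norm_of_nonneg ht0,
        max_eq_left hi]
      have h3 : t ^ i ≤ t := by
        calc t ^ i ≤ t ^ 1 := pow_le_pow_of_le_one ht0 ht1 hi
          _ = t := pow_one t
      calc t ^ i * ‖iteratedFDeriv ℝ i g (t • x)‖ ≤ t * G i := by gcongr; exact hGi _ _
        _ ≤ G i * t * (1 + ‖x‖) := by
          have := mul_nonneg (hG0 i) ht0
          nlinarith [norm_nonneg x]
  have hθ : ∀ i, ‖x‖ ^ k * (1 + ‖x‖) * ‖iteratedFDeriv ℝ i θ x‖ ≤ Θ i := fun i => by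
    have h2 := SchwartzMap.le_seminorm ℂ k i θ x
    have h3 := SchwartzMap.le_seminorm ℂ (k + 1) i θ x
    calc _ = ‖x‖ ^ k * ‖iteratedFDeriv ℝ i θ x‖ + ‖x‖ ^ (k + 1) * ‖iteratedFDeriv ℝ i θ x‖ := by ring
      _ ≤ _ := add_le_add h2 h3
  calc ‖x‖ ^ k * ‖iteratedFDeriv ℝ n (fun x => h x * θ x) x‖
      ≤ ‖x‖ ^ k * ∑ i ∈ Finset.range (n + 1), n.choose i * (G (max i 1) * t * (1 + ‖x‖)) *
          ‖iteratedFDeriv ℝ (n - i) θ x‖ := by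
        gcongr
        refine h1.trans (Finset.sum_le_sum fun i _ => ?_)
        gcongr
        exact hi i
    _ = ∑ i ∈ Finset.range (n + 1), n.choose i * (G (max i 1)) * t *
          (‖x‖ ^ k * (1 + ‖x‖) * ‖iteratedFDeriv ℝ (n - i) θ x‖) := by
        rw [Finset.mul_sum]
        exact Finset.sum_congr rfl fun i _ => by ring
    _ ≤ ∑ i ∈ Finset.range (n + 1), n.choose i * (G (max i 1)) * t * Θ (n - i) := by
        refine Finset.sum_le_sum fun i _ => mul_le_mul_of_nonneg_left (hθ _) ?_
        have := hG0 (max i 1)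
        positivity
    _ = _ := by
        rw [Finset.sum_mul]
        exact Finset.sum_congr rfl fun i _ => by ring

theorem tendsto_scale {α : Type*} {l : Filter α} {t : α → ℝ} (ht : Tendsto t l (𝓝[≥] 0))
    (g θ : 𝓢(Space d, ℂ)) {ψ : α → 𝓢(Space d, ℂ)} (hψ : ∀ a x, ψ a x = g (t a • x) * θ x)
    {ψ₀ : 𝓢(Space d, ℂ)} (h₀ : ∀ x, ψ₀ x = g 0 * θ x) : Tendsto ψ l (𝓝 ψ₀) := by
  rw [(schwartz_withSeminorms ℂ (Space d) ℂ).tendsto_nhds]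
  rintro ⟨k, n⟩ ε hε
  obtain ⟨A, hA⟩ := exists_seminorm_scale_le g θ k n
  have h1 : ∀ᶠ a in l, 0 ≤ t a := ht.eventually (eventually_mem_nhdsWithin)
  have ht0 : Tendsto t l (𝓝 0) := ht.mono_right nhdsWithin_le_nhds
  have h2 : ∀ᶠ a in l, t a ≤ 1 := ht0.eventually (eventually_le_nhds one_pos)
  have h3 : Tendsto (fun a => A * t a) l (𝓝 0) := by simpa using ht0.const_mul A
  have h4 := h3.eventually (gt_mem_nhds hε)
  filter_upwards [h1, h2, h4] with a ha1 ha2 ha3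
  refine (hA (t a) ha1 ha2 (ψ a - ψ₀) fun x => ?_).trans_lt ha3
  rw [sub_apply, hψ, h₀]; ring

end Dilation

end

section

/-! ### Littlewood–Paley blocks -/

section Blocks

variable {d : ℕ}

/-- The unit `2`. -/
def two : ℝˣ := Units.mk0 2 two_ne_zero

theorem coe_two_pow (n : ℕ) : ((two ^ n : ℝˣ) : ℝ) = 2 ^ n := by simp [two]

theorem enorm_two_pow (n : ℕ) : ‖((two ^ n : ℝˣ) : ℝ)‖ₑ = 2 ^ n := by
  rw [coe_two_pow, enorm_pow]
  congr 1
  simp [Real.enorm_eq_ofReal_abs]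

/-- The multiplier with symbol `b(2^{-n} ·)`. -/
def mop (n : ℕ) (b : 𝓢(Space d, ℂ)) : Op d := mult (dil (two ^ n) b)

theorem mop_zero (b : 𝓢(Space d, ℂ)) : mop 0 b = mult b := by
  rw [mop]
  congr 1; ext ξ
  rw [dil_apply]; simp

theorem SymBound.mop {K : ℕ} {C : ℝ≥0∞} {b : 𝓢(Space d, ℂ)} (h : SymBound K C 1 b) (n : ℕ) :
    SymBound K C (2 ^ n) (Striated.dil (two ^ n) b) := by
  have := h.dil (two ^ n)
  rwa [enorm_two_pow] at this

namespace LittlewoodPaley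

variable (P : LittlewoodPaley d)

/-- No dilate `ϕ(2^{-j} ·)` with `j ≥ 0` is active inside the ball of radius `3/4`. -/
theorem χ_eq_one {ξ : Space d} (h : ‖ξ‖ < 3 / 4) : P.χ ξ = 1 := by
  have h0 : ∀ j : ℕ, P.ϕ (((2 : ℝ) ^ j)⁻¹ • ξ) = 0 := fun j => by
    by_contra hne
    have h1 := (P.ϕ_supp _ hne).1
    rw [norm_smul, norm_inv, norm_pow, Real.norm_ofNat] at h1
    have h2 : ((2 : ℝ) ^ j)⁻¹ ≤ 1 := inv_le_one_of_one_le₀ (one_le_pow₀ (by norm_num))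
    nlinarith [norm_nonneg ξ]
  have h1 := P.partition ξ
  simp only [h0] at h1
  linarith [h1.unique hasSum_zero]

theorem χ_eq_zero {ξ : Space d} (h : 4 / 3 < ‖ξ‖) : P.χ ξ = 0 := by
  by_contra hne
  exact absurd (P.χ_supp ξ hne) (not_le.2 h)

theorem hasCompactSupport_of_norm {f : Space d → ℂ} {R : ℝ} (h : ∀ ξ, f ξ ≠ 0 → ‖ξ‖ ≤ R) :
    HasCompactSupport f :=
  HasCompactSupport.of_support_subset_isCompact (isCompact_closedBall 0 R) fun ξ hξ => by
    simpa using h ξ hξ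

/-- The low frequency symbol. -/
def lowS : 𝓢(Space d, ℂ) :=
  (hasCompactSupport_of_norm (f := fun ξ => (P.χ ξ : ℂ)) (R := 4 / 3)
    fun ξ h => P.χ_supp ξ (by simpa using h)).toSchwartzMap
    (Complex.ofRealCLM.contDiff.comp P.χ_smooth)

theorem lowS_apply (ξ : Space d) : P.lowS ξ = (P.χ ξ : ℂ) := rfl

/-- The symbol `ϕ(2 ·)`. -/
def bandS : 𝓢(Space d, ℂ) :=
  dil two⁻¹ ((hasCompactSupport_of_norm (f := fun ξ => (P.ϕ ξ : ℂ)) (R := 8 / 3)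
    fun ξ h => (P.ϕ_supp ξ (by simpa using h)).2).toSchwartzMap
    (Complex.ofRealCLM.contDiff.comp P.ϕ_smooth))

theorem bandS_apply (ξ : Space d) : P.bandS ξ = (P.ϕ ((2 : ℝ) • ξ) : ℂ) := by
  rw [bandS, dil_apply]
  show (P.ϕ _ : ℂ) = _
  simp [two]

/-- The normalized symbol of the `n`-th block. -/
def blockS : ℕ → 𝓢(Space d, ℂ)
  | 0 => P.lowS
  | _ + 1 => P.bandS

/-- The block `n + 1` carries `ϕ(2^{-n} ·)`, while `mop` dilates by `2^{n+1}`; the `2` in `bandS`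
compensates this shift of the index. -/
theorem block_eq (n : ℕ) : P.block n = mop n (P.blockS n) := by
  show mult (P.symbol n) = mult _
  congr 1; ext ξ
  rw [dil_apply, coe_two_pow]
  cases n with
  | zero => simp [blockS, symbol, lowS_apply]
  | succ n =>
    rw [blockS, bandS_apply, symbol, smul_smul]
    rw [pow_succ]; field_simp

theorem symbol_temperate (n : ℕ) : (P.symbol n).HasTemperateGrowth := by
  have h : P.symbol n = (dil (two ^ n) (P.blockS n) : Space d → ℂ) := by
    ext ξ
    rw [dil_apply, coe_two_pow]
    cases n with
    | zero => simp [blockS, symbol, lowS_apply]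
    | succ n =>
      rw [blockS, bandS_apply, symbol, smul_smul]
      rw [pow_succ]; field_simp
  rw [h]
  exact SchwartzMap.hasTemperateGrowth _

/-- The partition of unity at `2^{-n} ξ` is a tail of the one at `ξ`; comparing the two identifies
the partial sum. -/
theorem sum_symbol (n : ℕ) (ξ : Space d) :
    ∑ i ∈ Finset.range (n + 1), P.symbol i ξ = P.lowS (((2 : ℝ) ^ n)⁻¹ • ξ) := by
  rw [Finset.sum_range_succ', lowS_apply]
  have h1 := P.partition ξ
  have h2 := P.partition (((2 : ℝ) ^ n)⁻¹ • ξ)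
  have h3 : ∀ j : ℕ, ((2 : ℝ) ^ j)⁻¹ • ((2 : ℝ) ^ n)⁻¹ • ξ = ((2 : ℝ) ^ (j + n))⁻¹ • ξ := fun j => by
    rw [smul_smul, ← mul_inv, ← pow_add]
  simp only [h3] at h2
  have h4 := (hasSum_nat_add_iff (f := fun j : ℕ => P.ϕ (((2 : ℝ) ^ j)⁻¹ • ξ)) n).1 h2
  have h5 := h1.unique h4
  have h6 : P.χ (((2 : ℝ) ^ n)⁻¹ • ξ) = ∑ i ∈ Finset.range n, P.ϕ (((2 : ℝ) ^ i)⁻¹ • ξ) + P.χ ξ := by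
    linarith
  rw [h6]
  simp [symbol]

theorem sum_block_apply (n : ℕ) (f : 𝓢'(Space d, ℂ)) :
    ∑ i ∈ Finset.range (n + 1), P.block i f = mop n P.lowS f := by
  rw [← _root_.sum_apply]
  congr 1
  have h := TemperedDistribution.fourierMultiplierCLM_sum (F := ℂ) (g := P.symbol) (s := Finset.range (n + 1))
    fun i _ => P.symbol_temperate i
  refine h.symm.trans ?_
  show mult _ = mult _
  congr 1; ext ξ
  rw [sum_symbol, dil_apply, coe_two_pow]

/-- Transposed to the test function, this is the convergence of `χ(2^{-n} ·) ψ` to `ψ` in the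
Schwartz space. -/
theorem tendsto_mop_low (f : 𝓢'(Space d, ℂ)) :
    Tendsto (fun n => mop n P.lowS f) atTop (𝓝 f) := by
  refine PointwiseConvergenceCLM.tendsto_iff_forall_tendsto.2 fun θ => ?_
  have h1 : ∀ n, mop n P.lowS f θ = f (FourierTransform.fourier (SchwartzMap.smulLeftCLM ℂ
      (dil (two ^ n) P.lowS : Space d → ℂ) (FourierTransform.fourierInv θ))) := fun n => rfl
  simp only [h1]
  have h2 : Tendsto (fun n : ℕ => SchwartzMap.smulLeftCLM ℂ
      (dil (two ^ n) P.lowS : Space d → ℂ) (FourierTransform.fourierInv θ)) atTop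
      (𝓝 (FourierTransform.fourierInv θ)) := by
    refine tendsto_scale (t := fun n : ℕ => ((2 : ℝ) ^ n)⁻¹) ?_ P.lowS (FourierTransform.fourierInv θ) (fun n x => ?_) fun x => ?_
    · refine tendsto_nhdsWithin_iff.2 ⟨tendsto_inv_atTop_zero.comp
        (tendsto_pow_atTop_atTop_of_one_lt one_lt_two), Eventually.of_forall fun n => ?_⟩
      simp only [Set.mem_Ici]; positivity
    · rw [SchwartzMap.smulLeftCLM_apply_apply (SchwartzMap.hasTemperateGrowth _), dil_apply,
        coe_two_pow, smul_eq_mul]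
    · rw [lowS_apply, P.χ_eq_one (by simp)]; simp
  have h3 := ((FourierTransform.fourierCLM ℂ 𝓢(Space d, ℂ)).continuous.tendsto _).comp h2
  have h4 := (f.continuous.tendsto _).comp h3
  have h5 : FourierTransform.fourierCLM ℂ 𝓢(Space d, ℂ) (FourierTransform.fourierInv θ) = θ := by
    change (FourierTransform.fourier (FourierTransform.fourierInv θ : 𝓢(Space d, ℂ)) : 𝓢(Space d, ℂ)) = θ
    exact FourierTransform.fourier_fourierInv_eq θ
  rw [h5] at h4
  exact h4

theorem tendsto_sum_block (f : 𝓢'(Space d, ℂ)) :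
    Tendsto (fun n => ∑ i ∈ Finset.range n, P.block i f) atTop (𝓝 f) := by
  rw [← tendsto_add_atTop_iff_nat 1]
  simp only [sum_block_apply]
  exact P.tendsto_mop_low f

theorem distLpNorm_le_tsum_block {p : ℝ≥0∞} [Fact (1 ≤ p)] (T : Op d) (f : 𝓢'(Space d, ℂ)) :
    distLpNorm p (T f) ≤ ∑' n, distLpNorm p (T (P.block n f)) := by
  refine distLpNorm_le_tsum ?_
  have := (T.continuous.tendsto _).comp (P.tendsto_sum_block f)
  simpa [Function.comp_def] using this

/-- The cutoff `χ(t ·)`. -/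
def cut (t : ℝˣ) : 𝓢(Space d, ℂ) := dil t⁻¹ P.lowS

theorem cut_apply (t : ℝˣ) (ξ : Space d) : P.cut t ξ = (P.χ ((t : ℝ) • ξ) : ℂ) := by
  rw [cut, dil_apply, lowS_apply]
  simp

theorem cut_eq_one {t : ℝˣ} {ξ : Space d} (h : |(t : ℝ)| * ‖ξ‖ < 3 / 4) : P.cut t ξ = 1 := by
  rw [cut_apply, P.χ_eq_one (by rwa [norm_smul])]; simp

theorem cut_eq_zero {t : ℝˣ} {ξ : Space d} (h : 4 / 3 < |(t : ℝ)| * ‖ξ‖) : P.cut t ξ = 0 := by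
  rw [cut_apply, P.χ_eq_zero (by rwa [norm_smul])]; simp

theorem abs_two_pow (n : ℕ) : |((two ^ n : ℝˣ) : ℝ)| = 2 ^ n := by
  rw [coe_two_pow, abs_of_pos (by positivity)]

theorem abs_two_pow_inv (n : ℕ) : |(((two ^ n)⁻¹ : ℝˣ) : ℝ)| = (2 ^ n)⁻¹ := by
  rw [Units.val_inv_eq_inv_val, coe_two_pow, abs_of_pos (by positivity)]

/-- The symbol of the slightly enlarged block. -/
def fatS : ℕ → 𝓢(Space d, ℂ)
  | 0 => P.cut (two ^ 1)⁻¹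
  | _ + 1 => P.cut (two ^ 1)⁻¹ - P.cut (two ^ 2)

theorem fatS_mul_blockS (n : ℕ) (ξ : Space d) : P.fatS n ξ * P.blockS n ξ = P.blockS n ξ := by
  cases n with
  | zero =>
    by_cases h : P.χ ξ = 0
    · simp [blockS, lowS_apply, h]
    · rw [fatS, P.cut_eq_one, one_mul]
      rw [abs_two_pow_inv]
      have := P.χ_supp ξ h
      linarith
  | succ n =>
    by_cases h : P.ϕ ((2 : ℝ) • ξ) = 0
    · simp [blockS, bandS_apply, h]
    · have h1 := P.ϕ_supp _ h
      rw [norm_smul, Real.norm_ofNat] at h1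
      rw [fatS, sub_apply, P.cut_eq_one, P.cut_eq_zero, sub_zero, one_mul]
      · rw [abs_two_pow]; linarith
      · rw [abs_two_pow_inv]; linarith

theorem mop_fat_block (n : ℕ) (f : 𝓢'(Space d, ℂ)) :
    mop n (P.fatS n) (P.block n f) = P.block n f := by
  rw [block_eq, ← op_mul_apply, mop, mop, mult_mul (SchwartzMap.hasTemperateGrowth _)
    (SchwartzMap.hasTemperateGrowth _)]
  congr 2; ext ξ
  rw [Pi.mul_apply, dil_apply, dil_apply, fatS_mul_blockS]

/-- The annulus that contains the supports of the normalized symbols. -/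
def Annular (b : 𝓢(Space d, ℂ)) : Prop := ∀ ξ, b ξ ≠ 0 → 3 / 16 ≤ ‖ξ‖ ∧ ‖ξ‖ ≤ 8 / 3

theorem annular_bandS : Annular P.bandS := fun ξ h => by
  rw [bandS_apply] at h
  have h1 := P.ϕ_supp _ (by simpa using h)
  rw [norm_smul, Real.norm_ofNat] at h1
  constructor <;> linarith

/-- The radii `3/16` and `8/3` in `Annular` are those of this symbol, `χ(·/2) - χ(4 ·)`. -/
theorem annular_fatS (n : ℕ) : Annular (P.fatS (n + 1)) := fun ξ h => by
  rw [fatS, sub_apply] at h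
  constructor
  · by_contra! hlt
    apply h
    rw [P.cut_eq_one, P.cut_eq_one, sub_self]
    · rw [abs_two_pow]; linarith
    · rw [abs_two_pow_inv]; linarith
  · by_contra! hlt
    apply h
    rw [P.cut_eq_zero, P.cut_eq_zero, sub_self]
    · rw [abs_two_pow]; linarith
    · rw [abs_two_pow_inv]; linarith

/-- A cutoff to the annulus. -/
def ann : 𝓢(Space d, ℂ) := P.cut (two ^ 2)⁻¹ - P.cut (two ^ 3)

theorem ann_eq_one {ξ : Space d} (h1 : 3 / 16 ≤ ‖ξ‖) (h2 : ‖ξ‖ ≤ 8 / 3) : P.ann ξ = 1 := by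
  rw [ann, sub_apply, P.cut_eq_one, P.cut_eq_zero, sub_zero]
  · rw [abs_two_pow]; linarith
  · rw [abs_two_pow_inv]; linarith

theorem ann_eq_zero {ξ : Space d} (h : ‖ξ‖ < 3 / 32) : P.ann ξ = 0 := by
  rw [ann, sub_apply, P.cut_eq_one, P.cut_eq_one, sub_self]
  · rw [abs_two_pow]; linarith
  · rw [abs_two_pow_inv]; linarith

theorem ann_eq_zero' {ξ : Space d} (h : 16 / 3 < ‖ξ‖) : P.ann ξ = 0 := by
  rw [ann, sub_apply, P.cut_eq_zero, P.cut_eq_zero, sub_self]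
  · rw [abs_two_pow]; linarith
  · rw [abs_two_pow_inv]; linarith

/-- The function `ξ_j / (2πi|ξ|²)`, cut off to the annulus. -/
def divFun (j : Fin d) : Space d → ℂ :=
  fun ξ => P.ann ξ * ((ξ j : ℂ) * (2 * Real.pi * Complex.I * ((‖ξ‖ ^ 2 : ℝ) : ℂ))⁻¹)

theorem divFun_contDiff (j : Fin d) : ContDiff ℝ ∞ (P.divFun j) := by
  rw [contDiff_iff_contDiffAt]
  intro ξ
  by_cases h : ξ = 0
  · have h1 : P.divFun j =ᶠ[𝓝 ξ] fun _ => 0 := by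
      have : Metric.ball (0 : Space d) (3 / 32) ∈ 𝓝 ξ := by
        rw [h]; exact Metric.ball_mem_nhds _ (by norm_num)
      filter_upwards [this] with ζ hζ
      rw [divFun, P.ann_eq_zero (by simpa using hζ), zero_mul]
    exact contDiffAt_const.congr_of_eventuallyEq h1
  · have hc : ContDiff ℝ ∞ fun ξ : Space d => (ξ j : ℂ) :=
      (Complex.ofRealCLM.comp (EuclideanSpace.proj j : Space d →L[ℝ] ℝ)).contDiff
    have hn : ContDiff ℝ ∞ fun ξ : Space d => (2 * Real.pi * Complex.I * ((‖ξ‖ ^ 2 : ℝ) : ℂ)) :=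
      contDiff_const.mul (Complex.ofRealCLM.contDiff.comp (contDiff_norm_sq ℝ))
    refine (P.ann.smooth ⊤).contDiffAt.mul (hc.contDiffAt.mul (hn.contDiffAt.inv ?_))
    simp [h]

/-- `divFun` as a Schwartz function. -/
def divS (j : Fin d) : 𝓢(Space d, ℂ) :=
  (hasCompactSupport_of_norm (f := P.divFun j) (R := 16 / 3) fun ξ h => by
    by_contra! hlt
    exact h (by rw [divFun, P.ann_eq_zero' hlt, zero_mul])).toSchwartzMap (P.divFun_contDiff j)

theorem divS_apply (j : Fin d) (ξ : Space d) : P.divS j ξ = P.divFun j ξ := rfl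

/-- Division of a symbol by the gradient. -/
def rho (j : Fin d) : 𝓢(Space d, ℂ) →L[ℂ] 𝓢(Space d, ℂ) :=
  SchwartzMap.smulLeftCLM ℂ (P.divS j : Space d → ℂ)

theorem rho_apply (j : Fin d) (b : 𝓢(Space d, ℂ)) (ξ : Space d) :
    P.rho j b ξ = P.divFun j ξ * b ξ := by
  rw [rho, SchwartzMap.smulLeftCLM_apply_apply (P.divS j).hasTemperateGrowth, divS_apply,
    smul_eq_mul]

/-- `∑ ξ_j · ξ_j / |ξ|² = 1`, and the cutoff `ann` equals `1` on the support of `b`. -/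
theorem sum_mulXi_rho {b : 𝓢(Space d, ℂ)} (hb : Annular b) :
    ∑ j, mulXi j (P.rho j b) = b := by
  ext ξ
  rw [_root_.sum_apply]
  by_cases h : b ξ = 0
  · simp [mulXi_apply, rho_apply, h]
  obtain ⟨h1, h2⟩ := hb ξ h
  have hξ : ((‖ξ‖ ^ 2 : ℝ) : ℂ) ≠ 0 := by
    have : ‖ξ‖ ≠ 0 := by intro h0; rw [h0] at h1; norm_num at h1
    simp [this]
  have hpi : (2 * Real.pi * Complex.I : ℂ) ≠ 0 := by simp [Real.pi_ne_zero]
  have e : ∀ j, mulXi j (P.rho j b) ξ = ((ξ j ^ 2 : ℝ) : ℂ) * (b ξ * ((‖ξ‖ ^ 2 : ℝ) : ℂ)⁻¹) :=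
      fun j => by
    rw [mulXi_apply, rho_apply, divFun, P.ann_eq_one h1 h2, xi, mul_inv]
    push_cast
    field_simp
  simp only [e]
  rw [← Finset.sum_mul, ← Complex.ofReal_sum]
  have hs : ∑ j, ξ j ^ 2 = ‖ξ‖ ^ 2 := by
    rw [EuclideanSpace.norm_sq_eq]
    simp
  rw [hs]
  field_simp

/-- The reverse Bernstein inequality as an identity of operators, which survives commutators with
the fields. -/
theorem mop_eq_sum (n : ℕ) {b : 𝓢(Space d, ℂ)} (hb : Annular b) :
    mop n b = ((2 : ℂ) ^ n)⁻¹ • ∑ j, mop n (P.rho j b) * pd j := by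
  have h1 : ∀ j, mop n (P.rho j b) * pd j = (2 : ℂ) ^ n • mop n (mulXi j (P.rho j b)) := fun j => by
    rw [mop, mult_mul_pd, mulXi_dil, coe_two_pow]
    push_cast
    exact TemperedDistribution.fourierMultiplierCLM_smul (SchwartzMap.hasTemperateGrowth _) _
  simp only [h1]
  rw [← Finset.smul_sum, smul_smul, inv_mul_cancel₀ (pow_ne_zero _ two_ne_zero), one_smul]
  have h2 := TemperedDistribution.fourierMultiplierCLM_sum (F := ℂ) (s := Finset.univ)
    (g := fun j : Fin d => (dil (two ^ n) (mulXi j (P.rho j b)) : Space d → ℂ))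
    fun i _ => SchwartzMap.hasTemperateGrowth _
  refine Eq.trans ?_ h2
  show mult _ = mult _
  congr 1; ext ξ
  simp only [dil_apply]
  conv_lhs => rw [← P.sum_mulXi_rho hb, _root_.sum_apply]

theorem mop_eq_sum' (n : ℕ) {b : 𝓢(Space d, ℂ)} (hb : Annular b) :
    mop n b = ((2 : ℂ) ^ n)⁻¹ • ∑ j, pd j * mop n (P.rho j b) := by
  rw [P.mop_eq_sum n hb]
  simp only [mop, mult_pd_comm (SchwartzMap.hasTemperateGrowth _)]

end LittlewoodPaley

end Blocks

end

section

/-! ### Almost orthogonality of blocks and derivatives along words -/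

section Orthogonality

variable {d N : ℕ} {P : LittlewoodPaley d} {W : Fin N → SmoothField d}

/-- The weight `2^{-|q-n|}`. -/
def dy (q n : ℕ) : ℝ≥0∞ := 2⁻¹ ^ ((q - n) + (n - q))

theorem dy_comm (q n : ℕ) : dy q n = dy n q := by rw [dy, dy, add_comm]

theorem dy_of_le {q n : ℕ} (h : n ≤ q) : dy q n = (2 ^ q)⁻¹ * 2 ^ n := by
  obtain ⟨m, rfl⟩ := Nat.exists_eq_add_of_le h
  have h1 : n + m - n + (n - (n + m)) = m := by omega
  rw [dy, h1, pow_add, ENNReal.mul_inv (Or.inl (by simp)) (Or.inl (by simp)), mul_right_comm,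
    ENNReal.inv_mul_cancel (by simp) (by simp), one_mul, ENNReal.inv_pow]

theorem dy_self (q : ℕ) : dy q q = 1 := by simp [dy]

variable (P) in
/-- The constants of the Littlewood–Paley decomposition. -/
structure BaseBound (K : ℕ) (C : ℝ≥0∞) : Prop where
  one_le : 1 ≤ C
  block : ∀ n, SymBound K C 1 (P.blockS n)
  fat : ∀ n, SymBound K C 1 (P.fatS n)
  rho_block : ∀ n j, SymBound K C 1 (P.rho j (P.blockS (n + 1)))
  rho_fat : ∀ n j, SymBound K C 1 (P.rho j (P.fatS (n + 1)))

variable (P) in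
/-- The constants of an annular symbol. -/
structure AnnBound (K : ℕ) (C : ℝ≥0∞) (b : 𝓢(Space d, ℂ)) : Prop where
  sym : SymBound K C 1 b
  ann : LittlewoodPaley.Annular b
  rho : ∀ j, SymBound K C 1 (P.rho j b)

theorem BddFam.comp {ι κ : Type*} {b : ι → 𝓢(Space d, ℂ)} (h : BddFam b) (u : κ → ι) :
    BddFam fun k => b (u k) := fun k n => (h k n).imp fun _ hA i => hA (u i)

theorem bddFam_nat {b : ℕ → 𝓢(Space d, ℂ)} (h : ∀ n, b (n + 1) = b 1) : BddFam b := by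
  intro k n
  refine ⟨SchwartzMap.seminorm ℂ k n (b 0) + SchwartzMap.seminorm ℂ k n (b 1), fun i => ?_⟩
  have h0 : 0 ≤ SchwartzMap.seminorm ℂ k n (b 0) := apply_nonneg _ _
  have h1 : 0 ≤ SchwartzMap.seminorm ℂ k n (b 1) := apply_nonneg _ _
  cases i with
  | zero => linarith
  | succ i => rw [h]; linarith

variable (P) in
theorem exists_baseBound (K : ℕ) : ∃ C : ℝ≥0, BaseBound P K C := by
  have hb : BddFam P.blockS := bddFam_nat fun n => rfl
  have hf : BddFam P.fatS := bddFam_nat fun n => rfl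
  obtain ⟨C₁, h₁⟩ := hb.symBound K
  obtain ⟨C₂, h₂⟩ := hf.symBound K
  choose C₃ h₃ using fun j => ((hb.comp Nat.succ).map (P.rho j)).symBound K
  choose C₄ h₄ using fun j => ((hf.comp Nat.succ).map (P.rho j)).symBound K
  have hs : ∀ (C : Fin d → ℝ≥0) j, C j ≤ ∑ j, C j := fun C j =>
    Finset.single_le_sum (f := C) (fun _ _ => zero_le) (Finset.mem_univ j)
  refine ⟨1 + C₁ + C₂ + ∑ j, C₃ j + ∑ j, C₄ j, ?_, fun n => (h₁ n).mono le_rfl ?_,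
    fun n => (h₂ n).mono le_rfl ?_, fun n j => (h₃ j n).mono le_rfl ?_,
    fun n j => (h₄ j n).mono le_rfl ?_⟩ <;> norm_cast
  · calc 1 ≤ 1 + (C₁ + C₂ + ∑ j, C₃ j + ∑ j, C₄ j) := le_self_add
      _ = _ := by ring
  · calc C₁ ≤ C₁ + (1 + C₂ + ∑ j, C₃ j + ∑ j, C₄ j) := le_self_add
      _ = _ := by ring
  · calc C₂ ≤ C₂ + (1 + C₁ + ∑ j, C₃ j + ∑ j, C₄ j) := le_self_add
      _ = _ := by ring
  · calc C₃ j ≤ ∑ j, C₃ j := hs C₃ j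
      _ ≤ ∑ j, C₃ j + (1 + C₁ + C₂ + ∑ j, C₄ j) := le_self_add
      _ = _ := by ring
  · exact (hs C₄ j).trans le_add_self

theorem BddFam.annBound {ι : Type*} {b : ι → 𝓢(Space d, ℂ)} (h : BddFam b)
    (ha : ∀ i, LittlewoodPaley.Annular (b i)) (K : ℕ) : ∃ C : ℝ≥0, ∀ i, AnnBound P K C (b i) := by
  obtain ⟨C₁, h₁⟩ := h.symBound K
  choose C₃ h₃ using fun j => (h.map (P.rho j)).symBound K
  refine ⟨C₁ + ∑ j, C₃ j, fun i => ⟨(h₁ i).mono le_rfl ?_, ha i, fun j => (h₃ j i).mono le_rfl ?_⟩⟩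
    <;> norm_cast
  · exact le_self_add
  · exact (Finset.single_le_sum (f := C₃) (fun _ _ => zero_le) (Finset.mem_univ j)).trans le_add_self

theorem BaseBound.ann_block {K : ℕ} {C : ℝ≥0∞} (h : BaseBound P K C) (n : ℕ) :
    AnnBound P K C (P.blockS (n + 1)) := ⟨h.block _, P.annular_bandS, h.rho_block n⟩

theorem BaseBound.ann_fat {K : ℕ} {C : ℝ≥0∞} (h : BaseBound P K C) (n : ℕ) :
    AnnBound P K C (P.fatS (n + 1)) := ⟨h.fat _, P.annular_fatS n, h.rho_fat n⟩

theorem enorm_two_pow_inv (n : ℕ) : ‖((2 : ℂ) ^ n)⁻¹‖ₑ = (2 ^ n)⁻¹ := by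
  rw [enorm_inv (by simp), enorm_pow]
  congr 2
  rw [← ofReal_norm_eq_enorm]; simp

variable {p : ℝ≥0∞} [Fact (1 ≤ p)] {K : ℕ} {C : ℝ≥0∞}

theorem SymBound.mop_mul_pd {b : 𝓢(Space d, ℂ)} (h : SymBound (K + 1) C 1 b) (n : ℕ) (j : Fin d) :
    OpBound (Striated.mop n b * pd j) (C * 2 ^ n) := by
  rw [Striated.mop, mult_mul_pd]
  exact ((h.mop n).mul_xi j).opBound

theorem SymBound.pd_mop_le {b : 𝓢(Space d, ℂ)} (h : SymBound (K + 1) C 1 b) (n : ℕ) (j : Fin d)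
    (f : 𝓢'(Space d, ℂ)) :
    distLpNorm p (pd j (Striated.mop n b f)) ≤ C * 2 ^ n * distLpNorm p f := by
  rw [← op_mul_apply, Striated.mop, pd_mul_mult]
  exact ((h.mop n).mul_xi j).opBound p f

theorem gradN_le_of_forall {f : 𝓢'(Space d, ℂ)} {A : ℝ≥0∞} (h : ∀ j, distLpNorm p (pd j f) ≤ A) :
    gradN p f ≤ d * A := by
  refine (Finset.sum_le_sum fun j _ => h j).trans ?_
  rw [Finset.sum_const, Finset.card_univ, Fintype.card_fin, nsmul_eq_mul]

theorem BaseBound.gradN_block_le (h : BaseBound P (K + 1) C) (n : ℕ) (f : 𝓢'(Space d, ℂ)) :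
    gradN p (P.block n f) ≤ d * (C * 2 ^ n * distLpNorm p (P.block n f)) :=
  gradN_le_of_forall fun j => by
    conv_lhs => rw [← P.mop_fat_block n f]
    exact (h.fat n).pd_mop_le n j _

/-- A block away from the origin is `2^{-(n+1)}` times a divergence, so a bound for `T ∂_j` turns
into a gain for `T`. -/
theorem BaseBound.apply_block_le (h : BaseBound P K C) (n : ℕ) (f : 𝓢'(Space d, ℂ)) {T : Op d}
    {A : ℝ≥0∞} (hT : ∀ j g, distLpNorm p (T (pd j g)) ≤ A * distLpNorm p g) :
    distLpNorm p (T (P.block (n + 1) f)) ≤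
      d * (A * C * (2 ^ (n + 1))⁻¹ * distLpNorm p (P.block (n + 1) f)) := by
  conv_lhs => rw [← P.mop_fat_block (n + 1) f, P.mop_eq_sum' (n + 1) (P.annular_fatS n)]
  rw [_root_.smul_apply, _root_.sum_apply, map_smul, map_sum]
  refine (distLpNorm_smul_le _ _).trans ?_
  rw [enorm_two_pow_inv]
  refine (mul_le_mul' le_rfl ((distLpNorm_sum_le _ _).trans (Finset.sum_le_sum
    (g := fun _ => A * (C * distLpNorm p (P.block (n + 1) f))) fun j _ => ?_))).trans_eq ?_
  · exact (hT j _).trans (mul_le_mul' le_rfl (((h.rho_fat n j).mop _).opBound p _))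
  · rw [Finset.sum_const, Finset.card_univ, Fintype.card_fin, nsmul_eq_mul]; ring

variable (W) in
/-- The convolution square of the weight. -/
def wt2 : List (Fin N) → ℝ≥0∞ := conv (wt W) (wt W)

theorem wt_le_wt2 (w : List (Fin N)) : wt W w ≤ wt2 W w :=
  le_conv_of_one_le (one_le_weight_nil _) _ w

/-- In the factorization `2^{-q} ∑ (ρ_j b)(2^{-q} D) ∂_j` both factors are commuted with the fields,
and each costs one weight. -/
theorem AnnBound.dL_le_gradN (hdiv : ∀ i, (W i).IsDivFree) {b : 𝓢(Space d, ℂ)}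
    (h : AnnBound P K C b) (q : ℕ) (f : 𝓢'(Space d, ℂ)) {w : List (Fin N)} (hw : 2 * w.length ≤ K) :
    distLpNorm p (dL W w (mop q b) f) ≤ d * (C * (2 ^ q)⁻¹ * wt2 W w * gradN p f) := by
  rw [P.mop_eq_sum q h.ann, dL_smul, dL_sum, _root_.smul_apply, _root_.sum_apply]
  refine (distLpNorm_smul_le _ _).trans ?_
  rw [enorm_two_pow_inv]
  have h1 : ∀ j, distLpNorm p (dL W w (mop q (P.rho j b) * pd j) f) ≤
      C * wt2 W w * gradN p f := fun j => by
    have : distLpNorm p (dL W w (mop q (P.rho j b) * pd j) f) ≤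
        conv (fun a => C * wt W a) (fun a => gradN p f * wt W a) w := by
      refine dL_mul_le (nrm := fun T => distLpNorm p (T f)) (fun S T => distLpNorm_add_le _ _)
        fun a c ha hc => ?_
      rw [op_mul_apply]
      refine (((h.rho j).mop q).dL_le hdiv _ (by omega)).trans ?_
      gcongr
      exact (Striated.dL_pd_le c j f).trans_eq (mul_comm _ _)
    rw [conv_mul_left, conv_mul_right] at this
    exact this.trans_eq (by rw [wt2]; ring)
  refine (mul_le_mul' le_rfl ((distLpNorm_sum_le _ _).trans (Finset.sum_le_sum fun j _ => h1 j))).trans_eq ?_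
  rw [Finset.sum_const, Finset.card_univ, Fintype.card_fin, nsmul_eq_mul]; ring

variable (P W) in
/-- The operator `T` is localized at the frequency `2^q`, with its commutators along words. -/
def Good (k : ℕ) (Θ : List (Fin N) → ℝ≥0∞) (q : ℕ) (T : Op d) : Prop :=
  ∀ (p : ℝ≥0∞) [Fact (1 ≤ p)] (f : 𝓢'(Space d, ℂ)) (n : ℕ) (w : List (Fin N)), w.length ≤ k →
    distLpNorm p (dL W w T (P.block n f)) ≤ Θ w * dy q n * distLpNorm p (P.block n f)

/-- Commutators with the fields destroy the frequency localization but leave the decay. For `q < n`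
the input block is written as a divergence and the derivative costs only `2^q`; for `n ≤ q` the
operator itself is `2^{-q}` times a derivative, which costs only `2^n` on the block. -/
theorem good_mop (hdiv : ∀ i, (W i).IsDivFree) {k : ℕ} {C' : ℝ≥0∞} {b : 𝓢(Space d, ℂ)}
    (hK : 2 * k + 1 ≤ K) (hB : BaseBound P K C) (q : ℕ) (hb : SymBound K C' 1 b)
    (ha : q ≠ 0 → AnnBound P K C' b) :
    Good P W k (fun w => (d + 1) ^ 2 * C * C' * wt2 W w) q (mop q b) := by
  intro p _ f n w hw
  beta_reduce
  have hd1 : (1 : ℝ≥0∞) ≤ (d + 1) ^ 2 := one_le_pow₀ (by simp)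
  have hd : (d : ℝ≥0∞) ≤ (d + 1) ^ 2 := by
    calc (d : ℝ≥0∞) ≤ d + 1 := le_self_add
      _ ≤ (d + 1) ^ 2 := le_self_pow₀ (by simp) (by simp)
  have hd2 : (d * d : ℝ≥0∞) ≤ (d + 1) ^ 2 := by
    rw [← sq]; gcongr; exact le_self_add
  rcases lt_or_ge q n with hqn | hnq
  · obtain ⟨n, rfl⟩ : ∃ m, n = m + 1 := ⟨n - 1, by omega⟩
    have := hB.apply_block_le n f (p := p) (T := dL W w (mop q b)) (A := C' * 2 ^ q * wt W w)
      fun j g => (hb.mop q).dL_pd_le hdiv j g (by omega)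
    refine this.trans ?_
    rw [dy_comm, dy_of_le hqn.le]
    calc _ = d * C * C' * wt W w * ((2 ^ (n + 1))⁻¹ * 2 ^ q) * distLpNorm p (P.block (n + 1) f) := by
          ring
      _ ≤ _ := by gcongr; exact wt_le_wt2 w
  · rcases Nat.eq_zero_or_pos q with rfl | hq
    -- The lowest symbol need not be annular, but here `n = q = 0` and no gain is required.
    · obtain rfl : n = 0 := by omega
      refine ((hb.mop 0).dL_le hdiv _ (by omega)).trans ?_
      rw [dy_self]
      calc _ = 1 * 1 * C' * wt W w * 1 * distLpNorm p (P.block 0 f) := by ring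
        _ ≤ _ := by gcongr; exacts [hB.one_le, wt_le_wt2 w]
    · obtain ⟨K, rfl⟩ : ∃ K', K = K' + 1 := ⟨K - 1, by omega⟩
      refine ((ha hq.ne').dL_le_gradN hdiv q _ (by omega)).trans ?_
      rw [dy_of_le hnq]
      calc _ ≤ d * (C' * (2 ^ q)⁻¹ * wt2 W w * (d * (C * 2 ^ n * distLpNorm p (P.block n f)))) := by
            gcongr; exact hB.gradN_block_le n f
        _ = d * d * C * C' * wt2 W w * ((2 ^ q)⁻¹ * 2 ^ n) * distLpNorm p (P.block n f) := by ring
        _ ≤ _ := by gcongr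

variable (P W) in
/-- The sizes of the blocks of the derivatives of `f`, averaged near the frequency `2^q`. -/
def nearN (p : ℝ≥0∞) [Fact (1 ≤ p)] (q : ℕ) (f : 𝓢'(Space d, ℂ)) (w : List (Fin N)) : ℝ≥0∞ :=
  ∑' n, dy q n * distLpNorm p (P.block n (dd W w f))

theorem Good.dd_le {k : ℕ} {Θ : List (Fin N) → ℝ≥0∞} {q : ℕ} {T : Op d} (h : Good P W k Θ q T)
    (f : 𝓢'(Space d, ℂ)) {w : List (Fin N)} (hw : w.length ≤ k) :
    distLpNorm p (dd W w (T f)) ≤ conv Θ (nearN P W p q f) w := by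
  refine dd_apply_le fun a b ha hb => ?_
  refine (P.distLpNorm_le_tsum_block _ _).trans ?_
  rw [nearN, ← ENNReal.tsum_mul_left]
  refine ENNReal.tsum_le_tsum fun n => ?_
  exact (h p _ n a (ha.trans hw)).trans_eq (by ring)

theorem SymBound.dd_mop_le (hdiv : ∀ i, (W i).IsDivFree) {b : 𝓢(Space d, ℂ)}
    (h : SymBound K C 1 b) (q : ℕ) (f : 𝓢'(Space d, ℂ)) {w : List (Fin N)} (hw : 2 * w.length ≤ K) :
    distLpNorm p (dd W w (Striated.mop q b f)) ≤
      C * conv (wt W) (fun a => distLpNorm p (dd W a f)) w := by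
  rw [← conv_mul_left]
  exact dd_apply_le fun a c ha hc => (h.mop q).dL_le hdiv _ (by omega)

theorem SymBound.dd_pd_mop_le (hdiv : ∀ i, (W i).IsDivFree) {b : 𝓢(Space d, ℂ)}
    (h : SymBound (K + 1) C 1 b) (q : ℕ) (j : Fin d) (f : 𝓢'(Space d, ℂ)) {w : List (Fin N)}
    (hw : 2 * w.length ≤ K) :
    distLpNorm p (dd W w (pd j (Striated.mop q b f))) ≤
      C * 2 ^ q * conv (wt W) (fun a => distLpNorm p (dd W a f)) w := by
  rw [← conv_mul_left, ← op_mul_apply, Striated.mop, pd_mul_mult]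
  exact dd_apply_le fun a c ha hc => ((h.mop q).mul_xi j).dL_le hdiv _ (by omega)

theorem BaseBound.block_le (h : BaseBound P K C) (n : ℕ) (f : 𝓢'(Space d, ℂ)) :
    distLpNorm p (P.block n f) ≤ C * distLpNorm p f := by
  rw [P.block_eq]
  exact ((h.block n).mop n).opBound p f

theorem BaseBound.block_succ_le (h : BaseBound P K C) (n : ℕ) (f : 𝓢'(Space d, ℂ)) :
    distLpNorm p (P.block (n + 1) f) ≤ C * (2 ^ (n + 1))⁻¹ * gradN p f := by
  rw [P.block_eq, P.mop_eq_sum (n + 1) (b := P.blockS (n + 1)) P.annular_bandS, _root_.smul_apply, _root_.sum_apply]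
  refine (distLpNorm_smul_le _ _).trans ?_
  rw [enorm_two_pow_inv]
  refine (mul_le_mul' le_rfl ((distLpNorm_sum_le _ _).trans (Finset.sum_le_sum fun j _ =>
    ((h.rho_block n j).mop (n + 1)).opBound p (pd j f)))).trans_eq ?_
  rw [← Finset.mul_sum, gradN]; ring

variable (W) in
/-- The sizes of the derivatives of `f` along words. -/
def vN (p : ℝ≥0∞) [Fact (1 ≤ p)] (f : 𝓢'(Space d, ℂ)) (w : List (Fin N)) : ℝ≥0∞ :=
  distLpNorm p (dd W w f)

/-- Derivatives along words spread the spectrum of a block with decay `2^{-|n-q|}`. Above, the outer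
block gains `2^{-n}` against the gradient of the derivative, which costs `2^q`. Below, the inner
block is a divergence, and the derivative is carried outwards through the fields to the outer block.
-/
theorem BaseBound.block_dd_block_le (hdiv : ∀ i, (W i).IsDivFree) (h : BaseBound P K C) (n q : ℕ)
    (f : 𝓢'(Space d, ℂ)) {w : List (Fin N)} (hw : 2 * w.length + 1 ≤ K) :
    distLpNorm p (P.block n (dd W w (P.block q f))) ≤
      (d + 1) * C ^ 2 * dy n q * conv (wt2 W) (vN W p (P.block q f)) w := by
  obtain ⟨K, rfl⟩ : ∃ K', K = K' + 1 := ⟨K - 1, by omega⟩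
  have hv : ∀ a, vN W p (P.block q f) a ≤ conv (wt2 W) (vN W p (P.block q f)) a := fun a =>
    le_conv_of_one_le (by rw [wt2, conv_nil, wt, weight_nil, one_mul]) _ a
  rcases lt_or_ge q n with hqn | hnq
  · obtain ⟨n, rfl⟩ : ∃ m, n = m + 1 := ⟨n - 1, by omega⟩
    refine (h.block_succ_le n _).trans ?_
    refine (mul_le_mul' le_rfl (gradN_dd_le w _)).trans ?_
    have h1 : ∀ a : List (Fin N), a.length ≤ w.length →
        ∑ j, distLpNorm p (dd W a (pd j (P.block q f))) ≤
        d * (C * 2 ^ q * conv (wt W) (vN W p (P.block q f)) a) := fun a ha => by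
      refine (Finset.sum_le_sum (g := fun _ => C * 2 ^ q * conv (wt W) (vN W p (P.block q f)) a)
        fun j _ => ?_).trans_eq ?_
      · conv_lhs => rw [← P.mop_fat_block q f]
        exact (h.fat q).dd_pd_mop_le hdiv q j _ (by omega)
      · rw [Finset.sum_const, Finset.card_univ, Fintype.card_fin, nsmul_eq_mul]
    refine (mul_le_mul' le_rfl (conv_mono (fun _ _ => le_rfl) h1)).trans ?_
    rw [dy_of_le hqn.le, conv_mul_right, conv_mul_right, wt2, conv_assoc]
    calc _ = d * C ^ 2 * ((2 ^ (n + 1))⁻¹ * 2 ^ q) *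
          conv (wt W) (conv (wt W) (vN W p (P.block q f))) w := by ring
      _ ≤ _ := by gcongr; exact le_self_add
  · rcases Nat.eq_zero_or_pos q with rfl | hq
    · obtain rfl : n = 0 := by omega
      refine (h.block_le 0 _).trans ?_
      rw [dy_self, mul_one]
      calc _ ≤ C * conv (wt2 W) (vN W p (P.block 0 f)) w := by gcongr; exact hv w
        _ ≤ _ := by
          gcongr
          calc C ≤ C ^ 2 := le_self_pow₀ h.one_le two_ne_zero
            _ ≤ _ := le_mul_of_one_le_left zero_le (by simp)
    · obtain ⟨q, rfl⟩ : ∃ m, q = m + 1 := ⟨q - 1, by omega⟩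
      set g := P.block (q + 1) f with hg
      -- The enlarged symbol leaves the block unchanged, so the factorization of its annular
      -- multiplier expresses `g` through `g` itself.
      have e : g = ((2 : ℂ) ^ (q + 1))⁻¹ • ∑ j, pd j (mop (q + 1) (P.rho j (P.fatS (q + 1))) g) := by
        conv_lhs => rw [hg, ← P.mop_fat_block (q + 1) f, P.mop_eq_sum' (q + 1) (P.annular_fatS q)]
        rw [_root_.smul_apply, _root_.sum_apply]
        rfl
      conv_lhs => rw [e]
      rw [dd_smul, dd_sum, map_smul, map_sum]
      refine (distLpNorm_smul_le _ _).trans ?_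
      rw [enorm_two_pow_inv]
      have h1 : ∀ j, distLpNorm p (P.block n (dd W w (pd j
          (mop (q + 1) (P.rho j (P.fatS (q + 1))) g)))) ≤
          C * 2 ^ n * (C * conv (wt2 W) (vN W p g) w) := fun j => by
        refine (opBound_dd_pd_le hdiv (A := C * 2 ^ n) (fun l => ?_) w j _).trans ?_
        · rw [P.block_eq]; exact (h.block n).mop_mul_pd n l
        · gcongr
          rw [wt2, conv_assoc, ← conv_mul_right]
          exact conv_mono (fun _ _ => le_rfl) fun a ha =>
            (h.rho_fat q j).dd_mop_le hdiv (q + 1) g (by omega)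
      refine (mul_le_mul' le_rfl ((distLpNorm_sum_le _ _).trans
        (Finset.sum_le_sum fun j _ => h1 j))).trans ?_
      rw [Finset.sum_const, Finset.card_univ, Fintype.card_fin, nsmul_eq_mul, dy_comm, dy_of_le hnq]
      calc _ = d * C ^ 2 * ((2 ^ (q + 1))⁻¹ * 2 ^ n) * conv (wt2 W) (vN W p g) w := by ring
        _ ≤ _ := by gcongr; exact le_self_add

theorem BaseBound.block_dd_le (hdiv : ∀ i, (W i).IsDivFree) (h : BaseBound P K C) (n : ℕ)
    (f : 𝓢'(Space d, ℂ)) {w : List (Fin N)} (hw : 2 * w.length + 1 ≤ K) :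
    distLpNorm p (P.block n (dd W w f)) ≤
      ∑' q, (d + 1) * C ^ 2 * dy n q * conv (wt2 W) (vN W p (P.block q f)) w := by
  obtain ⟨T, hT⟩ := dd_eq_op W w
  have := P.distLpNorm_le_tsum_block (p := p) (P.block n * T) f
  simp only [op_mul_apply, ← hT] at this
  exact this.trans (ENNReal.tsum_le_tsum fun q => h.block_dd_block_le hdiv n q f hw)

/-! ### Low frequencies -/

variable (P) in
/-- The spectrum of `g` lies near the origin. -/
def Low (g : 𝓢'(Space d, ℂ)) : Prop := mult (P.fatS 0) g = g

theorem low_block (f : 𝓢'(Space d, ℂ)) : Low P (P.block 0 f) := by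
  have := P.mop_fat_block 0 f
  rwa [mop_zero] at this

theorem Low.pd {g : 𝓢'(Space d, ℂ)} (hg : Low P g) (j : Fin d) : Low P (pd j g) := by
  have h := congrArg (fun T : Op d => T g) (mult_pd_comm (P.fatS 0).hasTemperateGrowth j)
  simp only [op_mul_apply] at h
  rw [Low, h, hg]

theorem Low.gradN_le {g : 𝓢'(Space d, ℂ)} (hg : Low P g) (h : BaseBound P (K + 1) C) :
    gradN p g ≤ (d * C + 1) * distLpNorm p g := by
  refine (gradN_le_of_forall (A := C * distLpNorm p g) fun j => ?_).trans ?_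
  · have := (h.fat 0).pd_mop_le (p := p) 0 j g
    rwa [mop_zero, hg, pow_zero, mul_one] at this
  · rw [← mul_assoc]; gcongr; exact le_self_add

/-- The first field is expanded as `W^j ∂_j`. Here its coefficients are measured in the sup norm;
for this reason `om` contains sup norms next to Lipschitz norms. -/
theorem dd_cons_le_of_forall {g : 𝓢'(Space d, ℂ)} {i : Fin N} {w : List (Fin N)} {A : ℝ≥0∞}
    (h : ∀ (j : Fin d) (a : List (Fin N)), a.length ≤ w.length →
      distLpNorm p (dd W a (pd j g)) ≤ A * wt W a * distLpNorm p (pd j g)) :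
    distLpNorm p (dd W (i :: w) g) ≤ A * wt W (i :: w) * gradN p g := by
  rw [dd_cons, deriv_eq, _root_.sum_apply, dd_sum]
  refine (distLpNorm_sum_le _ _).trans ?_
  have h1 : ∀ j, distLpNorm p (dd W w ((mulOp ((W i).c j) * pd j) g)) ≤
      A * distLpNorm p (pd j g) * wt W (i :: w) := fun j => by
    refine (dd_mulOp_le (p₁ := ∞) (p₂ := p) _ _ w).trans ?_
    have h2 : wt W (i :: w) ≥ conv (fun a => om W (i :: a)) (wt W) w := conv_le_weight_cons _ i w
    refine le_trans ?_ (mul_le_mul' le_rfl h2)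
    rw [← conv_mul_right]
    refine conv_mono (fun a _ => ?_) fun a ha => (h j a ha).trans_eq (by ring)
    rw [dd_dist]
    exact (Finset.single_le_sum (f := fun h => supN (df W a ((W i).c h))) (fun _ _ => zero_le)
      (Finset.mem_univ j)).trans (om_sup_le i a)
  refine (Finset.sum_le_sum fun j _ => h1 j).trans_eq ?_
  rw [← Finset.sum_mul, ← Finset.mul_sum, gradN]; ring

/-- Induction on the length: the partial derivatives of `g`, unlike its derivatives along the
fields, are again of low frequency. -/
theorem Low.dd_le {g : 𝓢'(Space d, ℂ)} (hg : Low P g) (h : BaseBound P (K + 1) C)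
    (w : List (Fin N)) :
    distLpNorm p (dd W w g) ≤ (d * C + 1) ^ w.length * wt W w * distLpNorm p g := by
  induction hn : w.length using Nat.strong_induction_on generalizing w g with
  | _ n ih =>
  cases w with
  | nil =>
    subst hn
    rw [wt, weight_nil]; simp [dd, wd]
  | cons i w =>
    simp only [List.length_cons] at hn
    subst hn
    refine (dd_cons_le_of_forall (A := (d * C + 1) ^ w.length) fun j a ha => ?_).trans ?_
    · refine (ih a.length (by omega) (hg.pd j) a rfl).trans ?_
      gcongr
      simp
    · calc _ ≤ (d * C + 1) ^ w.length * wt W (i :: w) * ((d * C + 1) * distLpNorm p g) := by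
            gcongr; exact hg.gradN_le h
        _ = _ := by rw [pow_succ]; ring

/-- For a nonempty word only the gradient of `g` is needed. This matters for `g = Δ_{-1} m(D) φ`
with `σ ≤ 0`, of which only the gradient is under control. -/
theorem Low.dd_cons_le {g : 𝓢'(Space d, ℂ)} (hg : Low P g) (h : BaseBound P (K + 1) C) (i : Fin N)
    (w : List (Fin N)) :
    distLpNorm p (dd W (i :: w) g) ≤ (d * C + 1) ^ w.length * wt W (i :: w) * gradN p g :=
  dd_cons_le_of_forall fun j a ha => ((hg.pd j).dd_le h a).trans (by gcongr; simp)

theorem Low.block_succ_dd_le {g : 𝓢'(Space d, ℂ)} (hg : Low P g) (h : BaseBound P (K + 1) C)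
    (n : ℕ) (w : List (Fin N)) : distLpNorm p (P.block (n + 1) (dd W w g)) ≤
      C * (d * C + 1) ^ w.length * (2 ^ (n + 1))⁻¹ * wt2 W w * gradN p g := by
  refine (h.block_succ_le n _).trans ?_
  refine (mul_le_mul' le_rfl (gradN_dd_le w _)).trans ?_
  have h1 : ∀ a : List (Fin N), a.length ≤ w.length → ∑ j, distLpNorm p (dd W a (Striated.pd j g)) ≤
      (d * C + 1) ^ w.length * gradN p g * wt W a := fun a ha => by
    refine (Finset.sum_le_sum fun j _ => (hg.pd j).dd_le h a).trans ?_
    rw [← Finset.mul_sum]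
    calc _ = (d * C + 1) ^ a.length * gradN p g * wt W a := by rw [gradN]; ring
      _ ≤ _ := by gcongr; simp
  refine (mul_le_mul' le_rfl (conv_mono (fun _ _ => le_rfl) h1)).trans_eq ?_
  rw [conv_mul_right, wt2]; ring

end Orthogonality

end

section

/-! ### Weighted sequence norms -/

section Sequences

/-- The `ℓ^r` norm of a sequence. -/
def lr (r : ℝ≥0∞) (x : ℕ → ℝ≥0∞) : ℝ≥0∞ := eLpNorm x r Measure.count

theorem lr_top (x : ℕ → ℝ≥0∞) : lr ⊤ x = ⨆ n, x n := by
  rw [lr, eLpNorm_exponent_top, eLpNormEssSup_count]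
  simp

theorem lr_eq {r : ℝ≥0∞} (h0 : r ≠ 0) (ht : r ≠ ⊤) (x : ℕ → ℝ≥0∞) :
    lr r x = (∑' n, x n ^ r.toReal) ^ (1 / r.toReal) := by
  rw [lr, eLpNorm_eq_lintegral_rpow_enorm_toReal h0 ht, lintegral_count]
  simp

theorem lr_one (x : ℕ → ℝ≥0∞) : lr 1 x = ∑' n, x n := by
  rw [lr_eq one_ne_zero ENNReal.one_ne_top]; simp

variable {r : ℝ≥0∞}

theorem lr_mono {x y : ℕ → ℝ≥0∞} (h : ∀ n, x n ≤ y n) : lr r x ≤ lr r y :=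
  eLpNorm_mono_enorm fun n => by simpa using h n

theorem lr_add_le (hr : 1 ≤ r) (x y : ℕ → ℝ≥0∞) : lr r (fun n => x n + y n) ≤ lr r x + lr r y :=
  eLpNorm_add_le (measurable_from_nat.aestronglyMeasurable) (measurable_from_nat.aestronglyMeasurable) hr

theorem lr_const_mul (hr : 1 ≤ r) (c : ℝ≥0∞) (x : ℕ → ℝ≥0∞) :
    lr r (fun n => c * x n) = c * lr r x := by
  by_cases ht : r = ⊤
  · subst ht; rw [lr_top, lr_top, ENNReal.mul_iSup]
  have h0 : r ≠ 0 := (zero_lt_one.trans_le hr).ne'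
  have hp : 0 < r.toReal := ENNReal.toReal_pos h0 ht
  rw [lr_eq h0 ht, lr_eq h0 ht]
  simp only [ENNReal.mul_rpow_of_nonneg _ _ hp.le]
  rw [ENNReal.tsum_mul_left, ENNReal.mul_rpow_of_nonneg _ _ (by positivity), ← ENNReal.rpow_mul,
    mul_one_div_cancel hp.ne', ENNReal.rpow_one]

theorem lr_zero (hr : 1 ≤ r) : lr r (fun _ => 0) = 0 := by
  simpa using lr_const_mul hr 0 fun _ => 0

theorem lr_sum_le (hr : 1 ≤ r) {ι : Type*} (s : Finset ι) (F : ι → ℕ → ℝ≥0∞) :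
    lr r (fun n => ∑ m ∈ s, F m n) ≤ ∑ m ∈ s, lr r (F m) := by
  classical
  induction s using Finset.induction_on with
  | empty => simp [lr_zero hr]
  | insert a s ha ih =>
    simp only [Finset.sum_insert ha]
    exact (lr_add_le hr _ _).trans (add_le_add le_rfl ih)

/-- Minkowski's inequality for series: for finite `r` it passes from finite sums to the limit on
each finite set of indices. -/
theorem lr_tsum_le (hr : 1 ≤ r) (F : ℕ → ℕ → ℝ≥0∞) :
    lr r (fun n => ∑' m, F m n) ≤ ∑' m, lr r (F m) := by
  by_cases ht : r = ⊤
  · subst ht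
    simp only [lr_top]
    exact iSup_le fun n => ENNReal.tsum_le_tsum fun m => le_iSup (F m) n
  have h0 : r ≠ 0 := (zero_lt_one.trans_le hr).ne'
  have hp : 0 < r.toReal := ENNReal.toReal_pos h0 ht
  set T := ∑' m, lr r (F m)
  have h1 : ∀ k, ∑' n, (∑ m ∈ Finset.range k, F m n) ^ r.toReal ≤ T ^ r.toReal := fun k => by
    have := (lr_sum_le hr (Finset.range k) F).trans (ENNReal.sum_le_tsum _)
    rw [lr_eq h0 ht, one_div, ENNReal.rpow_inv_le_iff hp] at this
    exact this
  rw [lr_eq h0 ht, one_div, ENNReal.rpow_inv_le_iff hp, ENNReal.tsum_eq_iSup_sum]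
  refine iSup_le fun s => ?_
  have h2 : Tendsto (fun k => ∑ n ∈ s, (∑ m ∈ Finset.range k, F m n) ^ r.toReal) atTop
      (𝓝 (∑ n ∈ s, (∑' m, F m n) ^ r.toReal)) :=
    tendsto_finsetSum s fun n _ => (ENNReal.continuous_rpow_const.tendsto _).comp
      ENNReal.summable.hasSum.tendsto_sum_nat
  exact le_of_tendsto' h2 fun k => (ENNReal.sum_le_tsum s).trans (h1 k)

theorem lr_comp_le (hr : 1 ≤ r) (x : ℕ → ℝ≥0∞) {u : ℕ → ℕ} {s : Set ℕ} [DecidablePred (· ∈ s)]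
    (hu : Set.InjOn u s) :
    lr r (fun n => if n ∈ s then x (u n) else 0) ≤ lr r x := by
  by_cases ht : r = ⊤
  · subst ht
    simp only [lr_top]
    refine iSup_le fun n => ?_
    split_ifs
    · exact le_iSup x _
    · exact zero_le
  have h0 : r ≠ 0 := (zero_lt_one.trans_le hr).ne'
  have hp : 0 < r.toReal := ENNReal.toReal_pos h0 ht
  rw [lr_eq h0 ht, lr_eq h0 ht]
  refine ENNReal.rpow_le_rpow ?_ (by positivity)
  have h1 : ∑' n, (if n ∈ s then x (u n) else 0) ^ r.toReal = ∑' n : s, x (u n) ^ r.toReal := by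
    rw [tsum_subtype s fun n => x (u n) ^ r.toReal]
    congr 1; ext n
    by_cases hn : n ∈ s <;> simp [hn, hp]
  rw [h1]
  have hinj : Function.Injective fun n : s => u n := fun a b h => Subtype.ext (hu a.2 b.2 h)
  exact ENNReal.tsum_comp_le_tsum_of_injective hinj fun n => x n ^ r.toReal

/-- The sum is split at `q = n` and indexed by the distance `m`; the diagonal is counted twice,
which is harmless. -/
theorem tsum_geometric_le (t : ℝ≥0∞) (x : ℕ → ℝ≥0∞) (n : ℕ) :
    ∑' q, t ^ ((n - q) + (q - n)) * x q ≤
      ∑' m, t ^ m * (if n ∈ {n | m ≤ n} then x (n - m) else 0) +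
      ∑' m, t ^ m * (if n ∈ Set.univ then x (n + m) else 0) := by
  have h0 := Summable.sum_add_tsum_nat_add' (f := fun q => t ^ ((n - q) + (q - n)) * x q)
    (k := n + 1) ENNReal.summable
  rw [← h0]
  refine add_le_add ?_ ?_
  · rw [← Finset.sum_range_reflect]
    refine le_trans (Finset.sum_le_sum fun m hm => ?_) (ENNReal.sum_le_tsum (Finset.range (n + 1)))
    have hm' : m ≤ n := Nat.lt_succ_iff.1 (Finset.mem_range.1 hm)
    have e1 : n + 1 - 1 - m = n - m := by omega
    have e2 : n - (n - m) + (n - m - n) = m := by omega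
    rw [e1, e2]
    simp [hm']
  · have e : ∀ i, t ^ ((n - (i + (n + 1))) + (i + (n + 1) - n)) * x (i + (n + 1)) =
        (fun m => t ^ m * (if n ∈ Set.univ then x (n + m) else 0)) (i + 1) := fun i => by
      have e2 : n - (i + (n + 1)) + (i + (n + 1) - n) = i + 1 := by omega
      rw [e2]
      simp only [Set.mem_univ, if_true]
      congr 2; omega
    simp only [e]
    exact ENNReal.tsum_comp_le_tsum_of_injective (add_left_injective 1) _

/-- Each shift of the sequence has at most the same norm, and the shifts are summed with geometric
weights. -/
theorem lr_young (hr : 1 ≤ r) (t : ℝ≥0∞) (x : ℕ → ℝ≥0∞) :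
    lr r (fun n => ∑' q, t ^ ((n - q) + (q - n)) * x q) ≤ 2 * (∑' m, t ^ m) * lr r x := by
  refine (lr_mono (tsum_geometric_le t x)).trans ((lr_add_le hr _ _).trans ?_)
  have h1 : ∀ (s : ℕ → Set ℕ) [∀ m, DecidablePred (· ∈ s m)] (u : ℕ → ℕ → ℕ),
      (∀ m, Set.InjOn (u m) (s m)) →
      lr r (fun n => ∑' m, t ^ m * (if n ∈ s m then x (u m n) else 0)) ≤ (∑' m, t ^ m) * lr r x := by
    intro s _ u hu
    refine (lr_tsum_le hr _).trans ?_
    rw [← ENNReal.tsum_mul_right]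
    refine ENNReal.tsum_le_tsum fun m => ?_
    rw [lr_const_mul hr]
    exact mul_le_mul' le_rfl (lr_comp_le hr x (hu m))
  rw [two_mul, add_mul]
  refine add_le_add (h1 (fun m => {n | m ≤ n}) (fun m n => n - m) fun m a ha b hb h => ?_)
    (h1 (fun _ => Set.univ) (fun m n => n + m) fun m a _ b _ h => by simpa using h)
  simp only [Set.mem_ofPred_eq] at ha hb
  dsimp only at h
  omega

/-- The weight `2^{(n-1)s}`. -/
def bw (s : ℝ) (n : ℕ) : ℝ≥0∞ := ENNReal.ofReal ((2 : ℝ) ^ (((n : ℝ) - 1) * s))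

theorem bw_ne_zero (s : ℝ) (n : ℕ) : bw s n ≠ 0 := by
  rw [bw, Ne, ENNReal.ofReal_eq_zero, not_le]; positivity

theorem bw_ne_top (s : ℝ) (n : ℕ) : bw s n ≠ ⊤ := ENNReal.ofReal_ne_top

theorem bw_add (s t : ℝ) (n : ℕ) : bw (s + t) n = bw s n * bw t n := by
  rw [bw, bw, bw, ← ENNReal.ofReal_mul (by positivity), ← Real.rpow_add two_pos, mul_add]

theorem bw_zero (n : ℕ) : bw 0 n = 1 := by simp [bw]

theorem two_mul_bw_one (n : ℕ) : 2 * bw 1 n = 2 ^ n := by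
  rw [bw, ← ENNReal.ofReal_ofNat 2, ← ENNReal.ofReal_mul (by norm_num), ← ENNReal.ofReal_pow (by norm_num)]
  congr 1
  rw [mul_one, Real.rpow_sub two_pos, Real.rpow_natCast, Real.rpow_one]
  field_simp

/-- The weighted `ℓ^r` norm. -/
def wlr (s : ℝ) (r : ℝ≥0∞) (x : ℕ → ℝ≥0∞) : ℝ≥0∞ := lr r fun n => bw s n * x n

theorem besovNorm_eq {d : ℕ} (P : LittlewoodPaley d) (s : ℝ) (p r : ℝ≥0∞) [Fact (1 ≤ p)]
    (f : 𝓢'(Space d, ℂ)) : besovNorm P s p r f = wlr s r fun n => distLpNorm p (P.block n f) := rfl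

theorem wlr_mono {s : ℝ} {x y : ℕ → ℝ≥0∞} (h : ∀ n, x n ≤ y n) : wlr s r x ≤ wlr s r y :=
  lr_mono fun n => mul_le_mul' le_rfl (h n)

theorem wlr_add_le {s : ℝ} (hr : 1 ≤ r) (x y : ℕ → ℝ≥0∞) :
    wlr s r (fun n => x n + y n) ≤ wlr s r x + wlr s r y := by
  simp only [wlr, mul_add]; exact lr_add_le hr _ _

theorem wlr_const_mul {s : ℝ} (hr : 1 ≤ r) (c : ℝ≥0∞) (x : ℕ → ℝ≥0∞) :
    wlr s r (fun n => c * x n) = c * wlr s r x := by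
  rw [wlr, wlr, ← lr_const_mul hr]
  congr 1; ext n; ring

theorem wlr_conv_le {ι : Type*} {s : ℝ} (hr : 1 ≤ r) (F : List ι → ℝ≥0∞)
    (G : ℕ → List ι → ℝ≥0∞) (w : List ι) :
    wlr s r (fun n => conv F (G n) w) ≤ conv F (fun a => wlr s r fun n => G n a) w :=
  conv_subadditive (wlr s r) (wlr_add_le hr) (fun c x => (wlr_const_mul hr c x).le) F G w

theorem wlr_bw (s t : ℝ) (x : ℕ → ℝ≥0∞) : wlr s r (fun n => bw t n * x n) = wlr (s + t) r x := by
  simp only [wlr, bw_add, mul_assoc]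

theorem le_wlr (hr : 1 ≤ r) (s : ℝ) (x : ℕ → ℝ≥0∞) (n : ℕ) : bw s n * x n ≤ wlr s r x := by
  by_cases ht : r = ⊤
  · subst ht; rw [wlr, lr_top]; exact le_iSup (fun n => bw s n * x n) n
  have h0 : r ≠ 0 := (zero_lt_one.trans_le hr).ne'
  have hp : 0 < r.toReal := ENNReal.toReal_pos h0 ht
  rw [wlr, lr_eq h0 ht, one_div, ENNReal.le_rpow_inv_iff hp]
  exact ENNReal.le_tsum (f := fun n => (bw s n * x n) ^ r.toReal) n

/-- Conjugation of the kernel by the weights must leave a geometric kernel in `|n - q|`. -/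
theorem wlr_kernel_le (hr : 1 ≤ r) {s : ℝ} {t : ℝ≥0∞} {A : ℕ → ℕ → ℝ≥0∞}
    (hA : ∀ n q, bw s n * A n q ≤ t ^ ((n - q) + (q - n)) * bw s q) (x : ℕ → ℝ≥0∞) :
    wlr s r (fun n => ∑' q, A n q * x q) ≤ 2 * (∑' m, t ^ m) * wlr s r x := by
  refine (lr_mono fun n => ?_).trans (lr_young hr t _)
  rw [← ENNReal.tsum_mul_left]
  refine ENNReal.tsum_le_tsum fun q => ?_
  calc bw s n * (A n q * x q) = bw s n * A n q * x q := by ring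
    _ ≤ t ^ ((n - q) + (q - n)) * bw s q * x q := mul_le_mul' (hA n q) le_rfl
    _ = _ := by ring

theorem tsum_pow_ne_top {a : ℝ} (ha : a < 0) : ∑' m : ℕ, ENNReal.ofReal ((2 : ℝ) ^ a) ^ m ≠ ⊤ := by
  rw [ENNReal.tsum_geometric]
  refine ENNReal.inv_ne_top.2 (tsub_pos_iff_lt.2 ?_).ne'
  rw [← ENNReal.ofReal_one]
  exact (ENNReal.ofReal_lt_ofReal_iff one_pos).2 (Real.rpow_lt_one_of_one_lt_of_neg one_lt_two ha)

/-- The constant of the discrete convolution inequality. -/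
def youngC (a : ℝ) : ℝ≥0∞ := 2 * ∑' m : ℕ, ENNReal.ofReal ((2 : ℝ) ^ a) ^ m

theorem youngC_ne_top {a : ℝ} (ha : a < 0) : youngC a ≠ ⊤ :=
  ENNReal.mul_ne_top (by simp) (tsum_pow_ne_top ha)

theorem bw_mul_le {s : ℝ} {n q k : ℕ} {a : ℝ}
    (h : ((n : ℝ) - q) * s - k ≤ a * (((n - q) + (q - n) : ℕ) : ℝ)) :
    bw s n * 2⁻¹ ^ k ≤ ENNReal.ofReal ((2 : ℝ) ^ a) ^ ((n - q) + (q - n)) * bw s q := by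
  have e : (2⁻¹ : ℝ≥0∞) ^ k = ENNReal.ofReal ((2 : ℝ) ^ (-(k : ℝ))) := by
    rw [Real.rpow_neg two_pos.le, Real.rpow_natCast, ENNReal.ofReal_inv_of_pos (by positivity),
      ENNReal.ofReal_pow (by norm_num), ENNReal.ofReal_ofNat, ENNReal.inv_pow]
  rw [bw, bw, e, ← ENNReal.ofReal_pow (by positivity), ← Real.rpow_natCast ((2 : ℝ) ^ a),
    ← Real.rpow_mul two_pos.le, ← ENNReal.ofReal_mul (by positivity),
    ← ENNReal.ofReal_mul (by positivity), ← Real.rpow_add two_pos, ← Real.rpow_add two_pos]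
  refine ENNReal.ofReal_le_ofReal (Real.rpow_le_rpow_of_exponent_le one_lt_two.le ?_)
  linarith

/-- The weights grow by at most `2^{|s| |n-q|}` against the decay `2^{-|n-q|}`. The constant is
finite exactly for `|s| < 1`, which is how the ranges of `s` and `σ + s` enter. -/
theorem wlr_dy_le (hr : 1 ≤ r) (s : ℝ) (x : ℕ → ℝ≥0∞) :
    wlr s r (fun n => ∑' q, dy n q * x q) ≤ youngC (|s| - 1) * wlr s r x := by
  refine wlr_kernel_le hr (fun n q => bw_mul_le ?_) x
  have h1 : ((n : ℝ) - q) * s ≤ |s| * (((n - q) + (q - n) : ℕ) : ℝ) := by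
    rcases le_total n q with h | h
    · rw [Nat.sub_eq_zero_of_le h, zero_add, Nat.cast_sub h]
      have h2 : (n : ℝ) ≤ q := by exact_mod_cast h
      nlinarith [neg_abs_le s]
    · rw [Nat.sub_eq_zero_of_le h, add_zero, Nat.cast_sub h]
      have h2 : (q : ℝ) ≤ n := by exact_mod_cast h
      nlinarith [le_abs_self s]
  linarith

/-- For `q ≤ n` the kernel has no decay and the weight supplies `2^{-ε(n-q)}`; for `q ≥ n` there
remains `2^{(ε-1)(q-n)}`. Both decay for `0 < ε < 1`; the product estimate needs the negative
regularity here. -/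
theorem wlr_one_sided_le (hr : 1 ≤ r) {ε : ℝ} (x : ℕ → ℝ≥0∞) :
    wlr (-ε) r (fun n => ∑' q, 2⁻¹ ^ (q - n) * x q) ≤
      youngC (max (-ε) (ε - 1)) * wlr (-ε) r x := by
  refine wlr_kernel_le hr (fun n q => bw_mul_le ?_) x
  rcases le_total n q with h | h
  · rw [Nat.sub_eq_zero_of_le h, zero_add, Nat.cast_sub h]
    have h2 : (n : ℝ) ≤ q := by exact_mod_cast h
    nlinarith [le_max_right (-ε) (ε - 1)]
  · rw [Nat.sub_eq_zero_of_le h, add_zero, Nat.cast_sub h]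
    have h2 : (q : ℝ) ≤ n := by exact_mod_cast h
    push_cast
    nlinarith [le_max_left (-ε) (ε - 1)]

theorem dy_zero_right (n : ℕ) : dy n 0 = 2⁻¹ ^ n := by simp [dy]

theorem dy_zero_left (n : ℕ) : dy 0 n = 2⁻¹ ^ n := by simp [dy]

theorem tsum_inv_pow_le (hr : 1 ≤ r) (s : ℝ) (x : ℕ → ℝ≥0∞) :
    bw s 0 * ∑' q, 2⁻¹ ^ q * x q ≤ youngC (|s| - 1) * wlr s r x := by
  have := (le_wlr hr s (fun n => ∑' q, dy n q * x q) 0).trans (wlr_dy_le hr s x)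
  simpa only [dy_zero_left] using this

theorem wlr_inv_pow_le (hr : 1 ≤ r) (s : ℝ) (c : ℝ≥0∞) :
    wlr s r (fun n => 2⁻¹ ^ n * c) ≤ youngC (|s| - 1) * (bw s 0 * c) := by
  -- For a sequence concentrated at `0` the dyadic average is `2^{-n} c`.
  have h := wlr_dy_le hr s (fun q => if q = 0 then c else 0)
  have e1 : ∀ n, ∑' q, dy n q * (if q = 0 then c else 0) = 2⁻¹ ^ n * c := fun n => by
    rw [tsum_eq_single 0 (fun q hq => by simp [hq]), dy_zero_right]; simp
  simp only [e1] at h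
  refine h.trans (mul_le_mul' le_rfl ?_)
  have e2 : wlr s r (fun q => if q = 0 then c else 0) = lr r fun n => if n = 0 then bw s 0 * c else 0 := by
    rw [wlr]; congr 1; ext n; by_cases hn : n = 0 <;> simp [hn]
  rw [e2]
  by_cases ht : r = ⊤
  · subst ht; rw [lr_top]; refine iSup_le fun n => ?_; split_ifs <;> simp
  have h0 : r ≠ 0 := (zero_lt_one.trans_le hr).ne'
  have hp : 0 < r.toReal := ENNReal.toReal_pos h0 ht
  rw [lr_eq h0 ht, tsum_eq_single 0 (fun q hq => by simp [hq, hp])]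
  simp only [if_true]
  rw [← ENNReal.rpow_mul, mul_one_div_cancel hp.ne', ENNReal.rpow_one]

end Sequences

/-! ### Striated norms and masses -/

section Mass

variable {d N : ℕ} (P : LittlewoodPaley d) (W : Fin N → SmoothField d)

/-- The sum of a function over all words of length at most `n` that come from multi-indices. -/
def tm (F : List (Fin N) → ℝ≥0∞) (n : ℕ) : ℝ≥0∞ := ∑ m ∈ Finset.range (n + 1), mass F m

/-- The Besov norms of the derivatives along words. -/
def bN (s : ℝ) (p r : ℝ≥0∞) [Fact (1 ≤ p)] (f : 𝓢'(Space d, ℂ)) (w : List (Fin N)) : ℝ≥0∞ :=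
  besovNorm P s p r (dd W w f)

theorem striatedSum_eq (s : ℝ) (n : ℕ) (p r : ℝ≥0∞) [Fact (1 ≤ p)] (f : 𝓢'(Space d, ℂ)) :
    striatedSum P W s n p r f = ∑ m ∈ Finset.range n, mass (bN P W s p r f) m := by
  simp only [striatedSum, fieldMonomial_eq]; rfl

theorem striatedNorm_eq (s : ℝ) (n : ℕ) (p r : ℝ≥0∞) [Fact (1 ≤ p)] (f : 𝓢'(Space d, ℂ)) :
    striatedNorm P W s n p r f = tm (bN P W s p r f) n := striatedSum_eq P W s (n + 1) p r f

variable {P W}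

theorem length_word_of_mem {n : ℕ} {l : Fin N → ℕ} (h : l ∈ Finset.piAntidiag Finset.univ n) :
    (word l).length = n := by rw [length_word]; exact (Finset.mem_piAntidiag.1 h).1

theorem mass_mono {F G : List (Fin N) → ℝ≥0∞} {n : ℕ} (h : ∀ w, w.length = n → F w ≤ G w) :
    mass F n ≤ mass G n := Finset.sum_le_sum fun _ hl => h _ (length_word_of_mem hl)

theorem tm_mono {F G : List (Fin N) → ℝ≥0∞} {n : ℕ} (h : ∀ w, w.length ≤ n → F w ≤ G w) :
    tm F n ≤ tm G n := Finset.sum_le_sum fun m hm => mass_mono fun w hw =>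
  h w (by have := Finset.mem_range.1 hm; omega)

theorem mass_le_tm (F : List (Fin N) → ℝ≥0∞) {m n : ℕ} (h : m ≤ n) : mass F m ≤ tm F n :=
  Finset.single_le_sum (f := mass F) (fun _ _ => zero_le) (Finset.mem_range.2 (by omega))

theorem tm_mono_right (F : List (Fin N) → ℝ≥0∞) {m n : ℕ} (h : m ≤ n) : tm F m ≤ tm F n :=
  Finset.sum_le_sum_of_subset (Finset.range_mono (by omega))

theorem tm_succ (F : List (Fin N) → ℝ≥0∞) (n : ℕ) : tm F (n + 1) = tm F n + mass F (n + 1) :=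
  Finset.sum_range_succ _ _

theorem mass_const_mul (c : ℝ≥0∞) (F : List (Fin N) → ℝ≥0∞) (n : ℕ) :
    mass (fun w => c * F w) n = c * mass F n := by rw [mass, mass, Finset.mul_sum]

theorem tm_const_mul (c : ℝ≥0∞) (F : List (Fin N) → ℝ≥0∞) (n : ℕ) :
    tm (fun w => c * F w) n = c * tm F n := by
  simp only [tm, mass_const_mul]; rw [Finset.mul_sum]

theorem mass_add (F G : List (Fin N) → ℝ≥0∞) (n : ℕ) :
    mass (fun w => F w + G w) n = mass F n + mass G n := Finset.sum_add_distrib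

theorem tm_add (F G : List (Fin N) → ℝ≥0∞) (n : ℕ) :
    tm (fun w => F w + G w) n = tm F n + tm G n := by
  simp only [tm, mass_add]; rw [Finset.sum_add_distrib]

theorem tm_sum {κ : Type*} (s : Finset κ) (F : κ → List (Fin N) → ℝ≥0∞) (n : ℕ) :
    tm (fun w => ∑ j ∈ s, F j w) n = ∑ j ∈ s, tm (F j) n := by
  simp only [tm, mass]
  rw [Finset.sum_comm]
  exact Finset.sum_congr rfl fun m _ => Finset.sum_comm

theorem mass_conv_le_sum (F G : List (Fin N) → ℝ≥0∞) {m n : ℕ} (h : m ≤ n) : mass (conv F G) m ≤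
    2 ^ n * ∑ μ ∈ Finset.range (n + 1), tm F μ * tm G (n - μ) := by
  refine (mass_conv_le F G m).trans (mul_le_mul' (pow_le_pow_right₀ (by norm_num) h) ?_)
  rw [Finset.Nat.sum_antidiagonal_eq_sum_range_succ (fun i j => mass F i * mass G j)]
  calc ∑ i ∈ Finset.range (m + 1), mass F i * mass G (m - i)
      ≤ ∑ i ∈ Finset.range (m + 1), tm F i * tm G (n - i) := Finset.sum_le_sum fun i _ =>
        mul_le_mul' (mass_le_tm F le_rfl) (mass_le_tm G (by omega))
    _ ≤ _ := Finset.sum_le_sum_of_subset (Finset.range_mono (by omega))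

theorem tm_conv_le_sum (F G : List (Fin N) → ℝ≥0∞) (n : ℕ) : tm (conv F G) n ≤
    (n + 1) * 2 ^ n * ∑ μ ∈ Finset.range (n + 1), tm F μ * tm G (n - μ) := by
  refine (Finset.sum_le_sum fun m hm => mass_conv_le_sum F G (n := n)
    (Nat.lt_succ_iff.1 (Finset.mem_range.1 hm))).trans_eq ?_
  rw [Finset.sum_const, Finset.card_range, nsmul_eq_mul]
  push_cast; ring

theorem tm_conv_le (F G : List (Fin N) → ℝ≥0∞) (n : ℕ) : tm (conv F G) n ≤
    (n + 1) ^ 2 * 2 ^ n * (tm F n * tm G n) := by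
  refine (tm_conv_le_sum F G n).trans ?_
  calc _ ≤ (n + 1) * 2 ^ n * ∑ μ ∈ Finset.range (n + 1), tm F n * tm G n := by
        gcongr with μ hμ
        · exact tm_mono_right F (Nat.lt_succ_iff.1 (Finset.mem_range.1 hμ))
        · exact tm_mono_right G (by omega)
    _ = _ := by
        rw [Finset.sum_const, Finset.card_range, nsmul_eq_mul]; push_cast; ring

theorem word_zero : word (0 : Fin N → ℕ) = [] := by
  rw [← List.length_eq_zero_iff, length_word]; simp

theorem mass_zero (F : List (Fin N) → ℝ≥0∞) : mass F 0 = F [] := by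
  rw [mass, Finset.piAntidiag_zero, Finset.sum_singleton, word_zero]

/-- Among `n + 1` letters the two factors cannot both receive `n + 1`, so the top order occurs in
one factor at a time. -/
theorem tm_conv_succ_le (F G : List (Fin N) → ℝ≥0∞) (n : ℕ) : tm (conv F G) (n + 1) ≤
    (n + 2) ^ 2 * 2 ^ (n + 1) * (tm F n * tm G (n + 1) + tm F (n + 1) * tm G n) := by
  have h1 : ∀ m ∈ Finset.range (n + 1 + 1), mass (conv F G) m ≤
      2 ^ (n + 1) * ((n + 2) * (tm F n * tm G (n + 1) + tm F (n + 1) * tm G n)) := fun m hm => by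
    have hm' : m ≤ n + 1 := Nat.lt_succ_iff.1 (Finset.mem_range.1 hm)
    refine (mass_conv_le F G m).trans (mul_le_mul' (pow_le_pow_right₀ (by norm_num) hm') ?_)
    rw [Finset.Nat.sum_antidiagonal_eq_sum_range_succ (fun i j => mass F i * mass G j)]
    refine (Finset.sum_le_card_nsmul _ _ (tm F n * tm G (n + 1) + tm F (n + 1) * tm G n)
      fun i hi => ?_).trans ?_
    · have hi' : i ≤ m := Nat.lt_succ_iff.1 (Finset.mem_range.1 hi)
      by_cases h : i ≤ n
      · exact (mul_le_mul' (mass_le_tm F h) (mass_le_tm G (by omega))).trans le_self_add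
      · exact (mul_le_mul' (mass_le_tm F (by omega)) (mass_le_tm G (by omega))).trans le_add_self
    · rw [Finset.card_range, nsmul_eq_mul]
      refine mul_le_mul' ?_ le_rfl
      exact_mod_cast Nat.succ_le_succ hm'
  refine (Finset.sum_le_card_nsmul _ _ _ h1).trans_eq ?_
  rw [Finset.card_range, nsmul_eq_mul]
  push_cast; ring

theorem exists_word_cons {l : Fin N → ℕ} (hl : l ≠ 0) :
    ∃ (i : Fin N) (l' : Fin N → ℕ), l = l' + Pi.single i 1 ∧ word l = i :: word l' := by
  induction l using multiIndex_induction with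
  | h0 => exact absurd rfl hl
  | hs l i hi _ => exact ⟨i, l, rfl, word_add_single hi⟩

/-- Splitting off the head of the word is injective on nonzero multi-indices; on the right the head
is no longer required to be the largest letter. -/
theorem mass_succ_le (F : List (Fin N) → ℝ≥0∞) (m : ℕ) :
    mass F (m + 1) ≤ ∑ i, mass (fun w => F (i :: w)) m := by
  classical
  have hne : ∀ l : Fin N → ℕ, l ∈ Finset.piAntidiag Finset.univ (m + 1) → l ≠ 0 := fun l hl h0 => by
    have := (Finset.mem_piAntidiag.1 hl).1
    rw [h0] at this; simp at this
  have hex : ∀ l : Fin N → ℕ, l ∈ Finset.piAntidiag Finset.univ (m + 1) →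
      ∃ x : Fin N × (Fin N → ℕ), l = x.2 + Pi.single x.1 1 ∧ word l = x.1 :: word x.2 :=
    fun l hl => by
      obtain ⟨i, l', h⟩ := exists_word_cons (hne l hl)
      exact ⟨(i, l'), h⟩
  choose x hx1 hx2 using hex
  obtain ⟨s, hs⟩ : ∃ s, s = (Finset.piAntidiag (Finset.univ : Finset (Fin N)) (m + 1)).attach := ⟨_, rfl⟩
  have hinj : Set.InjOn (fun l : {l // l ∈ Finset.piAntidiag (Finset.univ : Finset (Fin N)) (m + 1)} =>
      x l.1 l.2) s := fun a _ b _ h => Subtype.ext (by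
    dsimp only at h
    rw [hx1 a.1 a.2, hx1 b.1 b.2, h])
  calc mass F (m + 1) = ∑ l ∈ s, F (word l.1) := by
        rw [hs, mass]; exact (Finset.sum_attach _ fun l => F (word l)).symm
    _ = ∑ l ∈ s, (fun y : Fin N × (Fin N → ℕ) => F (y.1 :: word y.2)) (x l.1 l.2) :=
        Finset.sum_congr rfl fun l _ => by rw [hx2 l.1 l.2]
    _ = ∑ y ∈ s.image fun l => x l.1 l.2, F (y.1 :: word y.2) :=
        (Finset.sum_image (f := fun y : Fin N × (Fin N → ℕ) => F (y.1 :: word y.2)) hinj).symm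
    _ ≤ ∑ y ∈ Finset.univ ×ˢ Finset.piAntidiag Finset.univ m, F (y.1 :: word y.2) := by
        refine Finset.sum_le_sum_of_subset fun y hy => ?_
        obtain ⟨l, -, rfl⟩ := Finset.mem_image.1 hy
        have h1 := (Finset.mem_piAntidiag.1 l.2).1
        rw [hx1 l.1 l.2] at h1
        simp only [Pi.add_apply, Finset.sum_add_distrib, Finset.sum_pi_single', Finset.mem_univ,
          if_true] at h1
        refine Finset.mem_product.2 ⟨Finset.mem_univ _, Finset.mem_piAntidiag.2 ⟨?_, by simp⟩⟩
        simpa using h1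
    _ = _ := by simp only [Finset.sum_product, mass]

end Mass

end

section

/-! ### The mass of the weight of the family -/

section WeightMass

variable {d N : ℕ} {P : LittlewoodPaley d} {W : Fin N → SmoothField d}

/-- Since `om W [] = 0`, at least one letter goes to `om`, and at most `m` are left for the two
weights. -/
theorem mass_wt_succ_le (m : ℕ) : mass (wt W) (m + 1) ≤
    2 ^ (m + 1) * ((m + 1) * (tm (om W) (m + 1) * tm (wt2 W) m)) := by
  have h0 : mass (wt W) (m + 1) ≤ mass (conv (om W) (wt2 W)) (m + 1) :=
    mass_mono fun w hw => by
      cases w with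
      | nil => simp at hw
      | cons i w => exact weight_cons_le _ _ _
  refine h0.trans ((mass_conv_le _ _ _).trans (mul_le_mul' le_rfl ?_))
  rw [Finset.Nat.sum_antidiagonal_eq_sum_range_succ (fun i j => mass (om W) i * mass (wt2 W) j),
    Finset.sum_range_succ', mass_zero, om, zero_mul, add_zero]
  refine (Finset.sum_le_card_nsmul _ _ (tm (om W) (m + 1) * tm (wt2 W) m) fun i hi =>
    mul_le_mul' (mass_le_tm _ ?_) (mass_le_tm _ (by omega))).trans_eq ?_
  · have := Finset.mem_range.1 hi; omega
  · rw [Finset.card_range, nsmul_eq_mul]; push_cast; rfl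

theorem tm_wt_zero : tm (wt W) 0 = 1 := by
  rw [tm, Finset.sum_range_one, mass_zero, wt, weight_nil]

theorem exists_tm_wt_le (d k : ℕ) (A : ℝ≥0) : ∃ C : ℝ≥0, ∀ (N : ℕ) (W : Fin N → SmoothField d),
    tm (om W) k ≤ A → tm (wt W) k ≤ C := by
  induction k with
  | zero => exact ⟨1, fun N W _ => by rw [tm_wt_zero]; simp⟩
  | succ k ih =>
    obtain ⟨C, hC⟩ := ih
    refine ⟨C + 2 ^ (k + 1) * ((k + 1) * (A * ((k + 1) ^ 2 * 2 ^ k * (C * C)))), fun N W h => ?_⟩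
    have h1 := hC N W ((tm_mono_right _ (Nat.le_succ k)).trans h)
    rw [tm_succ]
    push_cast
    refine add_le_add h1 ((mass_wt_succ_le k).trans ?_)
    gcongr
    exact (tm_conv_le _ _ k).trans (by gcongr)

/-- The uncontrolled quantity `mass (om W) (k + 1)` enters linearly, because the accompanying
weights have length at most `k`. -/
theorem exists_tm_wt_succ_le (d k : ℕ) (A : ℝ≥0) : ∃ C : ℝ≥0,
    ∀ (N : ℕ) (W : Fin N → SmoothField d), tm (om W) k ≤ A →
      tm (wt W) (k + 1) ≤ C * (1 + mass (om W) (k + 1)) := by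
  obtain ⟨C, hC⟩ := exists_tm_wt_le d k A
  refine ⟨C + 2 ^ (k + 1) * ((k + 1) * ((A + 1) * ((k + 1) ^ 2 * 2 ^ k * (C * C)))), fun N W h => ?_⟩
  have h1 := hC N W h
  rw [tm_succ]
  push_cast
  have h2 : tm (wt2 W) k ≤ (k + 1) ^ 2 * 2 ^ k * (C * C) := (tm_conv_le _ _ k).trans (by gcongr)
  have h3 : tm (om W) (k + 1) ≤ (A + 1) * (1 + mass (om W) (k + 1)) := by
    rw [tm_succ, add_mul, mul_add, one_mul, mul_one]
    exact add_le_add (h.trans le_self_add) le_add_self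
  calc tm (wt W) k + mass (wt W) (k + 1)
      ≤ C * (1 + mass (om W) (k + 1)) + 2 ^ (k + 1) * ((k + 1) *
        ((A + 1) * (1 + mass (om W) (k + 1)) * ((k + 1) ^ 2 * 2 ^ k * (C * C)))) := by
        refine add_le_add ?_ ((mass_wt_succ_le k).trans (by gcongr))
        rw [mul_add, mul_one]; exact h1.trans le_self_add
    _ = _ := by ring

variable {p : ℝ≥0∞} [Fact (1 ≤ p)] {C : ℝ≥0∞}

theorem wlr_one_one (x : ℕ → ℝ≥0∞) : ∑' n, 2 ^ n * x n = 2 * wlr 1 1 x := by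
  rw [wlr, lr_one, ← ENNReal.tsum_mul_left]
  exact tsum_congr fun n => by rw [← two_mul_bw_one, mul_assoc]

theorem distLpNorm_le_besovNorm (f : 𝓢'(Space d, ℂ)) :
    distLpNorm p f ≤ besovNorm P 0 p 1 f := by
  rw [besovNorm_eq, wlr, lr_one]
  refine (P.distLpNorm_le_tsum_block (1 : Op d) f).trans_eq (tsum_congr fun n => ?_)
  rw [bw_zero, one_mul]; rfl

/-- `B^1_{p,1}` embeds into the Sobolev space `W^{1,p}`: sum the Bernstein bounds of the blocks. -/
theorem BaseBound.norm_add_gradN_le (h : BaseBound P 1 C) (f : 𝓢'(Space d, ℂ)) :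
    distLpNorm p f + gradN p f ≤ 2 * (1 + d * (d * C)) * besovNorm P 1 p 1 f := by
  have h1 : ∀ n : ℕ, (1 : ℝ≥0∞) ≤ 2 ^ n := fun n => one_le_pow₀ (by norm_num)
  rw [besovNorm_eq, mul_comm 2, mul_assoc, ← wlr_one_one, add_mul, one_mul]
  refine add_le_add ((P.distLpNorm_le_tsum_block (1 : Op d) f).trans
    (ENNReal.tsum_le_tsum fun n => le_mul_of_one_le_left' (h1 n))) ?_
  rw [mul_assoc]
  refine gradN_le_of_forall fun j => (P.distLpNorm_le_tsum_block (pd j) f).trans ?_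
  rw [← ENNReal.tsum_mul_left]
  refine ENNReal.tsum_le_tsum fun n => ((norm_pd_le _ _).trans (h.gradN_block_le n f)).trans_eq ?_
  ring

theorem wlr_one_le_wlr_top {s t : ℝ} (x : ℕ → ℝ≥0∞) :
    wlr s 1 x ≤ (∑' n, bw (-t) n) * wlr (s + t) ⊤ x := by
  rw [wlr, lr_one, ← ENNReal.tsum_mul_right]
  refine ENNReal.tsum_le_tsum fun n => ?_
  have h := mul_le_mul' (le_refl (bw (-t) n)) (le_wlr le_top (s + t) x n)
  refine le_trans (le_of_eq ?_) h
  rw [← mul_assoc, ← bw_add]; congr 2; ring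

theorem tsum_bw_ne_top {t : ℝ} (ht : 0 < t) : ∑' n, bw (-t) n ≠ ⊤ := by
  have h : ∀ n, bw (-t) n = bw (-t) 0 * ENNReal.ofReal ((2 : ℝ) ^ (-t)) ^ n := fun n => by
    rw [bw, bw, ← ENNReal.ofReal_pow (by positivity), ← Real.rpow_natCast ((2 : ℝ) ^ (-t)),
      ← Real.rpow_mul two_pos.le, ← ENNReal.ofReal_mul (by positivity), ← Real.rpow_add two_pos]
    congr 2; push_cast; ring
  rw [tsum_congr h, ENNReal.tsum_mul_left]
  exact ENNReal.mul_ne_top (bw_ne_top _ _) (tsum_pow_ne_top (by linarith))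

/-- The head of the word is the field that is measured, so `m + 1` letters mean only `m`
derivatives. -/
theorem BaseBound.mass_om_succ_le (h : BaseBound P 1 C) (m : ℕ) : mass (om W) (m + 1) ≤
    (d + 1) * (2 * (1 + d * (d * C))) *
      ∑ i, ∑ j, mass (bN P W 1 ∞ 1 ((W i).dist j)) m := by
  refine (mass_succ_le _ m).trans ?_
  rw [Finset.mul_sum]
  refine Finset.sum_le_sum fun i _ => ?_
  rw [mul_assoc, Finset.mul_sum]
  have e : ∑ j, 2 * (1 + d * (d * C)) * mass (bN P W 1 ∞ 1 ((W i).dist j)) m =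
      mass (fun w => ∑ j, 2 * (1 + d * (d * C)) * bN P W 1 ∞ 1 ((W i).dist j) w) m := by
    simp only [← mass_const_mul]; rw [mass, Finset.sum_comm]; rfl
  rw [e, ← mass_const_mul]
  refine mass_mono fun w _ => mul_le_mul' le_rfl (Finset.sum_le_sum fun j _ => ?_)
  rw [supN, lipN_eq, ← dd_dist]
  exact h.norm_add_gradN_le _

theorem tm_om_eq (k : ℕ) : tm (om W) k = ∑ m ∈ Finset.range k, mass (om W) (m + 1) := by
  rw [tm, Finset.sum_range_succ', mass_zero, om, add_zero]

/-- Words of length at most `k` involve fields differentiated at most `k - 1` times, in agreement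
with the hypothesis on the family. The exponent `ρ > 0` pays for the passage from a supremum over
the blocks to a sum. -/
theorem exists_tm_om_le (P : LittlewoodPaley d) {ρ : ℝ} (hρ : 0 < ρ) :
    ∃ C : ℝ≥0, ∀ (N k : ℕ) (W : Fin N → SmoothField d),
      tm (om W) k ≤ C * familyHolderNorm P W ρ k := by
  obtain ⟨C, hC⟩ := exists_baseBound P 1
  lift ∑' n, bw (-ρ) n to ℝ≥0 using tsum_bw_ne_top hρ with A hA
  refine ⟨(d + 1) * (2 * (1 + d * (d * C))) * A, fun N k W => ?_⟩
  rw [tm_om_eq, familyHolderNorm]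
  simp only [striatedSum_eq]
  have e : ∑ m ∈ Finset.range k, ∑ i, ∑ j, mass (bN P W (1 + ρ) ∞ ∞ ((W i).dist j)) m =
      ∑ i, ∑ j, ∑ m ∈ Finset.range k, mass (bN P W (1 + ρ) ∞ ∞ ((W i).dist j)) m := by
    rw [Finset.sum_comm]
    exact Finset.sum_congr rfl fun i _ => Finset.sum_comm
  rw [← e, Finset.mul_sum]
  refine Finset.sum_le_sum fun m _ => (hC.mass_om_succ_le m).trans ?_
  push_cast
  rw [mul_assoc _ (A : ℝ≥0∞)]
  refine mul_le_mul' le_rfl ?_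
  rw [Finset.mul_sum]
  refine Finset.sum_le_sum fun i _ => ?_
  rw [Finset.mul_sum]
  refine Finset.sum_le_sum fun j _ => ?_
  rw [← mass_const_mul, hA]
  exact mass_mono fun w _ => wlr_one_le_wlr_top _

theorem exists_tm_wt (P : LittlewoodPaley d) (k : ℕ) {ρ : ℝ} (hρ : 0 < ρ) (M : ℝ≥0) :
    ∃ C : ℝ≥0, ∀ (N : ℕ) (W : Fin N → SmoothField d), familyHolderNorm P W ρ k ≤ M →
      tm (wt W) k ≤ C ∧ tm (wt W) (k + 1) ≤ C * (1 + ∑ i, fieldNorm P W 1 k ∞ 1 (W i)) := by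
  obtain ⟨B, hB⟩ := exists_tm_om_le P hρ
  obtain ⟨D, hD⟩ := exists_baseBound P 1
  obtain ⟨C₁, h₁⟩ := exists_tm_wt_le d k (B * M)
  obtain ⟨C₂, h₂⟩ := exists_tm_wt_succ_le d k (B * M)
  refine ⟨C₁ + C₂ * (1 + (d + 1) * (2 * (1 + d * (d * D)))), fun N W hW => ?_⟩
  have h0 : tm (om W) k ≤ (B * M : ℝ≥0) := by
    push_cast; exact (hB N k W).trans (mul_le_mul' le_rfl hW)
  refine ⟨(h₁ N W h0).trans (by push_cast; exact le_self_add), (h₂ N W h0).trans ?_⟩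
  set S := ∑ i, fieldNorm P W 1 k ∞ 1 (W i)
  have h3 : mass (om W) (k + 1) ≤ (d + 1) * (2 * (1 + d * (d * D))) * S := by
    refine (hD.mass_om_succ_le k).trans (mul_le_mul' le_rfl (Finset.sum_le_sum fun i _ =>
      Finset.sum_le_sum fun j _ => ?_))
    rw [striatedNorm_eq]; exact mass_le_tm _ le_rfl
  push_cast
  calc C₂ * (1 + mass (om W) (k + 1))
      ≤ C₂ * (1 + (d + 1) * (2 * (1 + d * (d * D))) * S) := by gcongr
    _ ≤ C₂ * ((1 + (d + 1) * (2 * (1 + d * (d * D)))) * (1 + S)) := by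
        refine mul_le_mul' le_rfl ?_
        generalize ((d : ℝ≥0∞) + 1) * (2 * (1 + d * (d * D))) = c
        calc 1 + c * S ≤ (1 + c * S) + (S + c) := le_self_add
          _ = _ := by ring
    _ ≤ _ := by rw [← mul_assoc]; gcongr; exact le_add_self

end WeightMass

end

section

/-! ### Convolution powers of the weight -/

section WeightPowers

variable {d N : ℕ} {P : LittlewoodPaley d} {W : Fin N → SmoothField d}

variable (W) in
/-- The convolution powers of the weight of the family. -/
def wp : ℕ → List (Fin N) → ℝ≥0∞
  | 0 => fun w => if w = [] then 1 else 0
  | n + 1 => conv (wt W) (wp n)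

theorem conv_wp_zero (F : List (Fin N) → ℝ≥0∞) (w : List (Fin N)) : conv (wp W 0) F w = F w := by
  induction w generalizing F with
  | nil => simp [conv_nil, wp]
  | cons i w ih =>
    rw [conv_cons, ih]
    simp only [wp, List.cons_ne_nil, if_false]
    rw [conv_zero_left, zero_add]

theorem wp_one (w : List (Fin N)) : wp W 1 w = wt W w := by
  rw [wp, conv_comm, conv_wp_zero]

theorem conv_wp_add (a b : ℕ) (F : List (Fin N) → ℝ≥0∞) (w : List (Fin N)) :
    conv (wp W a) (conv (wp W b) F) w = conv (wp W (a + b)) F w := by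
  induction a generalizing w with
  | zero => rw [conv_wp_zero, zero_add]
  | succ a ih =>
    rw [wp, Nat.add_right_comm, wp, conv_assoc, conv_assoc]
    exact conv_congr (fun _ _ => rfl) fun c _ => ih c

theorem conv_wt_wp (b : ℕ) (F : List (Fin N) → ℝ≥0∞) (w : List (Fin N)) :
    conv (wt W) (conv (wp W b) F) w = conv (wp W (b + 1)) F w := by
  rw [wp, conv_assoc]

theorem wt2_eq_wp (w : List (Fin N)) : wt2 W w = wp W 2 w := by
  rw [wt2, wp]; exact conv_congr (fun _ _ => rfl) fun c _ => (wp_one c).symm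

theorem conv_wt2 (F : List (Fin N) → ℝ≥0∞) (w : List (Fin N)) :
    conv (wt2 W) F w = conv (wp W 2) F w := conv_congr (fun c _ => wt2_eq_wp c) fun _ _ => rfl

theorem conv_wp_mono {a b : ℕ} (h : a ≤ b) (F : List (Fin N) → ℝ≥0∞) (w : List (Fin N)) :
    conv (wp W a) F w ≤ conv (wp W b) F w := by
  induction b, h using Nat.le_induction with
  | base => exact le_rfl
  | succ b _ ih =>
    refine ih.trans ?_
    rw [← conv_wt_wp]
    exact le_conv_of_one_le (one_le_weight_nil _) _ w

theorem le_conv_wp (a : ℕ) (F : List (Fin N) → ℝ≥0∞) (w : List (Fin N)) :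
    F w ≤ conv (wp W a) F w := by
  have := conv_wp_mono (W := W) (Nat.zero_le a) F w
  rwa [conv_wp_zero] at this

theorem conv_wp_conv_wp (a b c : ℕ) (F G : List (Fin N) → ℝ≥0∞) (w : List (Fin N)) :
    conv (wp W a) (conv (conv (wp W b) F) (conv (wp W c) G)) w =
      conv (wp W (a + b + c)) (conv F G) w := by
  rw [← conv_wp_add, ← conv_wp_add]
  refine conv_congr (fun _ _ => rfl) fun e _ => ?_
  rw [conv_assoc]
  refine conv_congr (fun _ _ => rfl) fun f _ => ?_
  rw [conv_left_comm]

/-- Induction on the power; `tm_conv_succ_le` keeps the bound at length `k + 1` affine in the norm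
of the family. -/
theorem exists_tm_wp (P : LittlewoodPaley d) (k : ℕ) {ρ : ℝ} (hρ : 0 < ρ) (M : ℝ≥0) (n : ℕ) :
    ∃ C : ℝ≥0, ∀ (N : ℕ) (W : Fin N → SmoothField d), familyHolderNorm P W ρ k ≤ M →
      tm (wp W n) k ≤ C ∧ tm (wp W n) (k + 1) ≤ C * (1 + ∑ i, fieldNorm P W 1 k ∞ 1 (W i)) := by
  obtain ⟨A, hA⟩ := exists_tm_wt P k hρ M
  induction n with
  | zero =>
    have h : ∀ (N : ℕ) (W : Fin N → SmoothField d) (l : ℕ), tm (wp W 0) l = 1 := fun N W l => by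
      rw [tm, Finset.sum_range_succ', mass_zero]
      have : ∀ m ∈ Finset.range l, mass (wp W 0) (m + 1) = 0 := fun m _ =>
        Finset.sum_eq_zero fun a ha => by
          have := length_word_of_mem ha
          refine if_neg fun h0 => ?_
          rw [h0] at this; simp at this
      rw [Finset.sum_eq_zero this]; simp [wp]
    refine ⟨1, fun N W _ => ?_⟩
    rw [h, h]; simp
  | succ n ih =>
    obtain ⟨B, hB⟩ := ih
    refine ⟨(k + 1) ^ 2 * 2 ^ k * (A * B) + (k + 2) ^ 2 * 2 ^ (k + 1) * (A * B + A * B),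
      fun N W hW => ?_⟩
    obtain ⟨a1, a2⟩ := hA N W hW
    obtain ⟨b1, b2⟩ := hB N W hW
    set S := ∑ i, fieldNorm P W 1 k ∞ 1 (W i)
    push_cast
    constructor
    · refine ((tm_conv_le _ _ k).trans ?_).trans le_self_add
      gcongr
    · refine (tm_conv_succ_le _ _ k).trans ?_
      calc _ ≤ (k + 2) ^ 2 * 2 ^ (k + 1) * (A * (B * (1 + S)) + A * (1 + S) * B : ℝ≥0∞) := by gcongr
        _ = (k + 2) ^ 2 * 2 ^ (k + 1) * (A * B + A * B) * (1 + S) := by ring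
        _ ≤ _ := by gcongr; exact le_add_self

variable {p r : ℝ≥0∞} [Fact (1 ≤ p)] {K : ℕ} {C : ℝ≥0∞}

/-- Besov norms of derivatives, in terms of the derivatives of the blocks. -/
theorem BaseBound.bN_le (hdiv : ∀ i, (W i).IsDivFree) (h : BaseBound P K C) (hr : 1 ≤ r) (s : ℝ)
    (f : 𝓢'(Space d, ℂ)) {w : List (Fin N)} (hw : 2 * w.length + 1 ≤ K) :
    bN P W s p r f w ≤ (d + 1) * C ^ 2 * youngC (|s| - 1) *
      conv (wp W 2) (fun a => wlr s r fun q => vN W p (P.block q f) a) w := by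
  have h1 : ∀ n, distLpNorm p (P.block n (dd W w f)) ≤ (d + 1) * C ^ 2 *
      ∑' q, dy n q * conv (wp W 2) (vN W p (P.block q f)) w := fun n => by
    refine (h.block_dd_le hdiv n f hw).trans_eq ?_
    rw [← ENNReal.tsum_mul_left]
    exact tsum_congr fun q => by rw [conv_wt2]; ring
  rw [bN, besovNorm_eq]
  refine (wlr_mono h1).trans ?_
  rw [wlr_const_mul hr, mul_assoc (_ * _)]
  exact mul_le_mul' le_rfl ((wlr_dy_le hr s _).trans (mul_le_mul' le_rfl (wlr_conv_le hr _ _ _)))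

theorem wlr_nearN_le (hr : 1 ≤ r) (s : ℝ) (f : 𝓢'(Space d, ℂ)) (w : List (Fin N)) :
    wlr s r (fun q => nearN P W p q f w) ≤ youngC (|s| - 1) * bN P W s p r f w :=
  wlr_dy_le hr s _

theorem mop_pd (q : ℕ) (b : 𝓢(Space d, ℂ)) (j : Fin d) (f : 𝓢'(Space d, ℂ)) :
    mop q b (pd j f) = (2 : ℂ) ^ q • mop q (mulXi j b) f := by
  have h : mop q b * pd j = (2 : ℂ) ^ q • mop q (mulXi j b) := by
    rw [mop, mult_mul_pd, mulXi_dil, coe_two_pow]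
    push_cast
    exact TemperedDistribution.fourierMultiplierCLM_smul (SchwartzMap.hasTemperateGrowth _) _
  rw [← op_mul_apply, h]; rfl

theorem SymBound.dd_mop_mulOp_le (hdiv : ∀ i, (W i).IsDivFree) {b : 𝓢(Space d, ℂ)}
    (h : SymBound K C 1 b) (q : ℕ) (V : TFun d) (f : 𝓢'(Space d, ℂ)) {w : List (Fin N)}
    (hw : 2 * w.length ≤ K) :
    distLpNorm p (dd W w (Striated.mop q b (Striated.mulOp V f))) ≤
      C * conv (wt W) (conv (vN W ∞ V.dist) (vN W p f)) w :=
  (h.dd_mop_le hdiv q _ hw).trans (mul_le_mul' le_rfl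
    (conv_mono' (fun _ => le_rfl) (fun a => dd_mulOp_le (p₁ := ∞) (p₂ := p) V f a) w))

theorem SymBound.dd_mop_pd_mulOp_le (hdiv : ∀ i, (W i).IsDivFree) {b : 𝓢(Space d, ℂ)}
    (h : SymBound (K + 1) C 1 b) (q : ℕ) (j : Fin d) (V : TFun d) (f : 𝓢'(Space d, ℂ))
    {w : List (Fin N)} (hw : 2 * w.length ≤ K) :
    distLpNorm p (dd W w (Striated.mop q b (Striated.pd j (Striated.mulOp V f)))) ≤
      C * 2 ^ q * conv (wt W) (conv (vN W ∞ V.dist) (vN W p f)) w := by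
  rw [mop_pd, dd_smul]
  refine (distLpNorm_smul_le _ _).trans ?_
  have h1 := (h.mul_xi j).dd_mop_mulOp_le (p := p) hdiv q V f hw
  rw [mul_one] at h1
  have e : ‖(2 : ℂ) ^ q‖ₑ = 2 ^ q := by
    rw [enorm_pow]; congr 1; rw [← ofReal_norm]; simp
  rw [e]
  exact (mul_le_mul' le_rfl h1).trans_eq (by ring)

theorem SymBound.dd_mop_pd_pd_mulOp_le (hdiv : ∀ i, (W i).IsDivFree) {b : 𝓢(Space d, ℂ)}
    (h : SymBound (K + 1 + 1) C 1 b) (q : ℕ) (i j : Fin d) (V : TFun d) (f : 𝓢'(Space d, ℂ))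
    {w : List (Fin N)} (hw : 2 * w.length ≤ K) :
    distLpNorm p (dd W w (Striated.mop q b (Striated.pd i (Striated.pd j (Striated.mulOp V f))))) ≤
      C * 2 ^ q * 2 ^ q * conv (wt W) (conv (vN W ∞ V.dist) (vN W p f)) w := by
  rw [mop_pd, dd_smul]
  refine (distLpNorm_smul_le _ _).trans ?_
  have h1 := (h.mul_xi i).dd_mop_pd_mulOp_le (p := p) hdiv q j V f hw
  rw [mul_one] at h1
  have e : ‖(2 : ℂ) ^ q‖ₑ = 2 ^ q := by
    rw [enorm_pow]; congr 1; rw [← ofReal_norm]; simp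
  rw [e]
  exact (mul_le_mul' le_rfl h1).trans_eq (by ring)

variable (P) in
/-- The constants of the Littlewood–Paley decomposition and of the symbols `ξ_j ϕ / |ξ|²`. -/
structure BandBound (K : ℕ) (C : ℝ≥0∞) : Prop where
  base : BaseBound P K C
  rho : ∀ j, AnnBound P K C (P.rho j P.bandS)

theorem AnnBound.mono {K' : ℕ} {C' : ℝ≥0∞} {b : 𝓢(Space d, ℂ)} (h : AnnBound P K C b)
    (hK : K' ≤ K) (hC : C ≤ C') : AnnBound P K' C' b :=
  ⟨h.sym.mono hK hC, h.ann, fun j => (h.rho j).mono hK hC⟩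

variable (P) in
theorem exists_bandBound (K : ℕ) : ∃ C : ℝ≥0, BandBound P K C := by
  obtain ⟨C, hC⟩ := exists_baseBound P K
  have hb : BddFam fun j => P.rho j P.bandS := fun k n =>
    ⟨∑ j, SchwartzMap.seminorm ℂ k n (P.rho j P.bandS), fun i => Finset.single_le_sum
      (f := fun j => SchwartzMap.seminorm ℂ k n (P.rho j P.bandS)) (fun _ _ => apply_nonneg _ _)
      (Finset.mem_univ i)⟩
  obtain ⟨C', hC'⟩ := hb.annBound (P := P) (fun j ξ hξ => P.annular_bandS ξ (fun h0 => hξ (by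
    rw [P.rho_apply, h0, mul_zero]))) K
  have h1 : (C : ℝ≥0∞) ≤ (C + C' : ℝ≥0) := by push_cast; exact le_self_add
  have h2 : (C' : ℝ≥0∞) ≤ (C + C' : ℝ≥0) := by push_cast; exact le_add_self
  exact ⟨C + C', ⟨⟨hC.one_le.trans h1, fun n => (hC.block n).mono le_rfl h1,
    fun n => (hC.fat n).mono le_rfl h1, fun n j => (hC.rho_block n j).mono le_rfl h1,
    fun n j => (hC.rho_fat n j).mono le_rfl h1⟩, fun j => (hC' j).mono le_rfl h2⟩⟩

/-- The converse passage to `BaseBound.bN_le`: from blocks of derivatives to derivatives of blocks.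
-/
theorem BandBound.vN_block_le (hdiv : ∀ i, (W i).IsDivFree) (h : BandBound P K C) (n : ℕ)
    (f : 𝓢'(Space d, ℂ)) {w : List (Fin N)} (hw : 2 * w.length + 1 ≤ K) :
    vN W p (P.block n f) w ≤ (d + 1) ^ 2 * C * C * conv (wp W 2) (nearN P W p n f) w := by
  rw [vN, P.block_eq]
  refine ((good_mop hdiv (k := w.length) hw h.base n (h.base.block n) fun hn => ?_).dd_le f
    le_rfl).trans_eq ?_
  · obtain ⟨n, rfl⟩ := Nat.exists_eq_succ_of_ne_zero hn
    exact h.base.ann_block n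
  · rw [conv_mul_left, conv_wt2]

theorem BandBound.vN_rho_le (hdiv : ∀ i, (W i).IsDivFree) (h : BandBound P K C) (n : ℕ) (j : Fin d)
    (f : 𝓢'(Space d, ℂ)) {w : List (Fin N)} (hw : 2 * w.length + 1 ≤ K) :
    vN W p (mop n (P.rho j P.bandS) f) w ≤
      (d + 1) ^ 2 * C * C * conv (wp W 2) (nearN P W p n f) w := by
  rw [vN]
  refine ((good_mop hdiv (k := w.length) hw h.base n (h.rho j).sym fun hn => h.rho j).dd_le f
    le_rfl).trans_eq ?_
  rw [conv_mul_left, conv_wt2]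

theorem block_pd (n : ℕ) (j : Fin d) (f : 𝓢'(Space d, ℂ)) :
    P.block n (pd j f) = pd j (P.block n f) := by
  rw [← op_mul_apply, ← op_mul_apply]
  exact congrArg (fun T : Op d => T f) (mult_pd_comm (P.symbol_temperate n) j)

/-- A block is recovered from the gradient. -/
theorem block_succ_eq (n : ℕ) (f : 𝓢'(Space d, ℂ)) : P.block (n + 1) f =
    ((2 : ℂ) ^ (n + 1))⁻¹ • ∑ l, mop (n + 1) (P.rho l P.bandS) (pd l f) := by
  rw [P.block_eq, LittlewoodPaley.blockS, P.mop_eq_sum (n + 1) P.annular_bandS]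
  simp

end WeightPowers

end

section

/-! ### Products with a divergence-free field: the field is bounded -/

section ProductBounded

variable {d N : ℕ} {P : LittlewoodPaley d} {W : Fin N → SmoothField d}

variable (W) in
/-- The `L^∞` sizes of the derivatives of a field along words. -/
def fieldN (p : ℝ≥0∞) [Fact (1 ≤ p)] (u : SmoothField d) (w : List (Fin N)) : ℝ≥0∞ :=
  ∑ j, vN W p (u.c j).dist w

theorem vN_le_fieldN {p : ℝ≥0∞} [Fact (1 ≤ p)] (u : SmoothField d) (j : Fin d) (w : List (Fin N)) :
    vN W p (u.c j).dist w ≤ fieldN W p u w :=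
  Finset.single_le_sum (f := fun j => vN W p (u.c j).dist w) (fun _ _ => zero_le) (Finset.mem_univ j)

variable (P W) in
/-- The sizes of the blocks of the gradient near the frequency `2^q`. -/
def nearGrad (p : ℝ≥0∞) [Fact (1 ≤ p)] (q : ℕ) (f : 𝓢'(Space d, ℂ)) (w : List (Fin N)) : ℝ≥0∞ :=
  ∑ l, nearN P W p q (pd l f) w

theorem nearN_le_nearGrad {p : ℝ≥0∞} [Fact (1 ≤ p)] (q : ℕ) (f : 𝓢'(Space d, ℂ)) (l : Fin d)
    (w : List (Fin N)) : nearN P W p q (pd l f) w ≤ nearGrad P W p q f w :=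
  Finset.single_le_sum (f := fun l => nearN P W p q (pd l f) w) (fun _ _ => zero_le)
    (Finset.mem_univ l)

variable {p r : ℝ≥0∞} [Fact (1 ≤ p)] {K : ℕ} {C : ℝ≥0∞}

theorem vN_smul_le (c : ℂ) (f : 𝓢'(Space d, ℂ)) (w : List (Fin N)) :
    vN W p (c • f) w ≤ ‖c‖ₑ * vN W p f w := by
  rw [vN, dd_smul]; exact distLpNorm_smul_le _ _

theorem vN_sum_le {κ : Type*} (s : Finset κ) (f : κ → 𝓢'(Space d, ℂ)) (w : List (Fin N)) :
    vN W p (∑ i ∈ s, f i) w ≤ ∑ i ∈ s, vN W p (f i) w := by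
  rw [vN, dd_sum]; exact distLpNorm_sum_le _ _

theorem sum_le_card_mul {A : ℝ≥0∞} {x : Fin d → ℝ≥0∞} (h : ∀ j, x j ≤ A) : ∑ j, x j ≤ d * A := by
  refine (Finset.sum_le_card_nsmul _ _ A fun j _ => h j).trans_eq ?_
  rw [Finset.card_univ, Fintype.card_fin, nsmul_eq_mul]

/-- A block, in terms of the gradient. -/
theorem BandBound.vN_block_succ_le (hdiv : ∀ i, (W i).IsDivFree) (h : BandBound P K C) (n : ℕ)
    (f : 𝓢'(Space d, ℂ)) {w : List (Fin N)} (hw : 2 * w.length + 1 ≤ K) :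
    vN W p (P.block (n + 1) f) w ≤ (2 ^ (n + 1))⁻¹ * ((d + 1) ^ 2 * C * C *
      conv (wp W 2) (nearGrad P W p (n + 1) f) w) := by
  rw [block_succ_eq]
  refine (vN_smul_le _ _ w).trans ?_
  rw [enorm_two_pow_inv]
  refine mul_le_mul' le_rfl ((vN_sum_le _ _ w).trans ((Finset.sum_le_sum fun l _ =>
    h.vN_rho_le hdiv (n + 1) l (pd l f) hw).trans_eq ?_))
  rw [← Finset.mul_sum, ← conv_sum_right]; rfl

/-- For `n ≤ q` the product is estimated as it stands. For `n > q` the divergence form of `u · ∇`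
hands the derivative to the output block, at the cost of `2^q`, and the block of `φ` is `2^{-n}`
times a block of its gradient. -/
theorem BandBound.block_deriv_block_le (hdiv : ∀ i, (W i).IsDivFree) (h : BandBound P K C)
    {u : SmoothField d} (hu : u.IsDivFree) (q n : ℕ) (φ : 𝓢'(Space d, ℂ)) {w : List (Fin N)}
    (hw : 2 * w.length + 1 ≤ K) :
    vN W p (P.block q (u.deriv (P.block n φ))) w ≤ d * (C * ((d + 1) ^ 2 * C * C)) *
      (2⁻¹ ^ (n - q) * conv (wp W 3) (conv (fieldN W ∞ u) (nearGrad P W p n φ)) w) := by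
  set A : ℝ≥0∞ := (d + 1) ^ 2 * C * C
  have hconv : ∀ (B : ℝ≥0∞) (f : 𝓢'(Space d, ℂ)) (j : Fin d), (∀ a : List (Fin N),
      a.length ≤ w.length → vN W p f a ≤ B * conv (wp W 2) (nearGrad P W p n φ) a) →
      conv (wt W) (conv (vN W ∞ (u.c j).dist) (vN W p f)) w ≤
        B * conv (wp W 3) (conv (fieldN W ∞ u) (nearGrad P W p n φ)) w := fun B f j hf => by
    calc conv (wt W) (conv (vN W ∞ (u.c j).dist) (vN W p f)) w
        ≤ conv (wt W) (conv (fieldN W ∞ u)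
            (fun a => B * conv (wp W 2) (nearGrad P W p n φ) a)) w :=
          conv_mono (fun _ _ => le_rfl) fun a ha => conv_mono (fun b _ => vN_le_fieldN u j b)
            fun b hb => hf b (hb.trans ha)
      _ = B * conv (wp W 3) (conv (fieldN W ∞ u) (nearGrad P W p n φ)) w := by
          rw [← conv_wt_wp, ← conv_mul_right]
          exact conv_congr (fun _ _ => rfl) fun a _ => by rw [conv_mul_right, conv_left_comm]
  rcases le_or_gt n q with hnq | hnq
  · rw [Nat.sub_eq_zero_of_le hnq, pow_zero, one_mul, deriv_eq]
    have e : (∑ j, mulOp (u.c j) * pd j : Op d) (P.block n φ) =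
        ∑ j, mulOp (u.c j) (P.block n (pd j φ)) := by
      rw [_root_.sum_apply]
      exact Finset.sum_congr rfl fun j _ => by rw [op_mul_apply, block_pd]
    rw [e, map_sum]
    refine (vN_sum_le _ _ w).trans ?_
    rw [mul_assoc (d : ℝ≥0∞)]
    refine sum_le_card_mul fun j => ?_
    rw [P.block_eq q, mul_assoc]
    refine ((h.base.block q).dd_mop_mulOp_le hdiv q _ _ (by omega)).trans (mul_le_mul' le_rfl ?_)
    refine hconv A _ j fun a ha => (h.vN_block_le hdiv n _ (by omega)).trans
      (mul_le_mul' le_rfl ?_)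
    exact conv_mono' (fun _ => le_rfl) (fun b => nearN_le_nearGrad n φ j b) a
  · obtain ⟨n, rfl⟩ : ∃ m, n = m + 1 := ⟨n - 1, by omega⟩
    have e : u.deriv (P.block (n + 1) φ) = ∑ j, pd j (mulOp (u.c j) (P.block (n + 1) φ)) := by
      rw [deriv_eq_of_divFree hu, _root_.sum_apply]; rfl
    rw [e, map_sum]
    refine (vN_sum_le _ _ w).trans ?_
    rw [mul_assoc (d : ℝ≥0∞)]
    refine sum_le_card_mul fun j => ?_
    obtain ⟨K, rfl⟩ : ∃ m, K = m + 1 := ⟨K - 1, by omega⟩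
    rw [P.block_eq q]
    refine ((h.base.block q).dd_mop_pd_mulOp_le hdiv q j _ _ (by omega)).trans ?_
    refine (mul_le_mul' le_rfl (hconv ((2 ^ (n + 1))⁻¹ * A) _ j fun a ha =>
      (h.vN_block_succ_le hdiv n φ (by omega)).trans_eq (mul_assoc _ _ _).symm)).trans_eq ?_
    have e2 : (2 : ℝ≥0∞) ^ q * (2 ^ (n + 1))⁻¹ = 2⁻¹ ^ (n + 1 - q) := by
      have := dy_of_le hnq.le
      rw [mul_comm, ← this, dy, Nat.sub_eq_zero_of_le hnq.le, add_zero]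
    rw [← e2]; ring

theorem BandBound.vN_block_deriv_le (hdiv : ∀ i, (W i).IsDivFree) (h : BandBound P K C)
    {u : SmoothField d} (hu : u.IsDivFree) (q : ℕ) (φ : 𝓢'(Space d, ℂ)) {w : List (Fin N)}
    (hw : 2 * w.length + 1 ≤ K) :
    vN W p (P.block q (u.deriv φ)) w ≤ d * (C * ((d + 1) ^ 2 * C * C)) *
      ∑' n, 2⁻¹ ^ (n - q) * conv (wp W 3) (conv (fieldN W ∞ u) (nearGrad P W p n φ)) w := by
  obtain ⟨T, hT⟩ := dd_eq_op W w
  rw [vN, hT, ← ENNReal.tsum_mul_left]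
  refine (P.distLpNorm_le_tsum_block (T * (P.block q * u.deriv : Op d)) φ).trans
    (ENNReal.tsum_le_tsum fun n => ?_)
  have := h.block_deriv_block_le (p := p) hdiv hu q n φ hw
  rwa [vN, hT] at this

theorem wlr_nearGrad_le (hr : 1 ≤ r) (s : ℝ) (f : 𝓢'(Space d, ℂ)) (w : List (Fin N)) :
    wlr s r (fun q => nearGrad P W p q f w) ≤
      youngC (|s| - 1) * ∑ l, bN P W s p r (pd l f) w := by
  rw [Finset.mul_sum]
  refine le_trans ?_ (Finset.sum_le_sum fun l _ => wlr_nearN_le hr s (pd l f) w)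
  have := lr_sum_le hr Finset.univ fun (l : Fin d) q => bw s q * nearN P W p q (pd l f) w
  simp only [← Finset.mul_sum] at this
  exact this

theorem BandBound.bN_deriv_le (hdiv : ∀ i, (W i).IsDivFree) (h : BandBound P K C)
    {u : SmoothField d} (hu : u.IsDivFree) (hr : 1 ≤ r) (ε : ℝ) (φ : 𝓢'(Space d, ℂ))
    {w : List (Fin N)} (hw : 2 * w.length + 1 ≤ K) :
    bN P W (-ε) p r (u.deriv φ) w ≤ (d + 1) * C ^ 2 * youngC (|-ε| - 1) *
      (d * (C * ((d + 1) ^ 2 * C * C)) * (youngC (max (-ε) (ε - 1)) * youngC (|-ε| - 1))) *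
      conv (wp W 5) (conv (fieldN W ∞ u) (fun a => ∑ l, bN P W (-ε) p r (pd l φ) a)) w := by
  refine (h.base.bN_le hdiv hr (-ε) (u.deriv φ) hw).trans ?_
  rw [mul_assoc ((d + 1 : ℝ≥0∞) * C ^ 2 * youngC (|-ε| - 1))]
  refine mul_le_mul' le_rfl ?_
  -- Two powers of the weight come from the passage to blocks in `BaseBound.bN_le`, three from the
  -- estimate of a single block.
  rw [show 5 = 2 + 3 from rfl, ← conv_wp_add, ← conv_mul_right]
  refine conv_mono (fun _ _ => le_rfl) fun a ha => ?_
  refine (wlr_mono fun q => h.vN_block_deriv_le (p := p) hdiv hu q φ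
    (by omega : 2 * a.length + 1 ≤ K)).trans ?_
  rw [wlr_const_mul hr, mul_assoc (_ * _), mul_assoc (youngC _)]
  refine mul_le_mul' le_rfl ((wlr_one_sided_le hr _).trans (mul_le_mul' le_rfl ?_))
  rw [← conv_mul_right]
  refine (wlr_conv_le hr _ _ _).trans (conv_mono (fun _ _ => le_rfl) fun b _ => ?_)
  rw [← conv_mul_right]
  refine (wlr_conv_le hr _ _ _).trans (conv_mono (fun _ _ => le_rfl) fun c _ => ?_)
  exact wlr_nearGrad_le hr _ _ _

theorem tm_fieldN_le (u : SmoothField d) (μ : ℕ) : tm (fieldN W ∞ u) μ ≤ fieldNorm P W 0 μ ∞ 1 u := by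
  rw [fieldNorm]
  simp only [striatedNorm_eq]
  rw [← tm_sum]
  exact tm_mono fun w _ => Finset.sum_le_sum fun j _ => distLpNorm_le_besovNorm _

theorem tm_sum_bN_pd (s : ℝ) (φ : 𝓢'(Space d, ℂ)) (n : ℕ) :
    tm (fun a => ∑ l, bN P W s p r (pd l φ) a) n = gradNorm P W s n p r φ := by
  rw [gradNorm]
  simp only [striatedNorm_eq]
  rw [tm_sum]; rfl

end ProductBounded

end

section

/-! ### Convolutions with Schwartz functions -/

section Convolution

variable {d : ℕ}

/-- The convolution of a function with a vector valued function. -/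
def cv {G : Type*} [NormedAddCommGroup G] [NormedSpace ℂ G] (F : Space d → ℂ) (κ : Space d → G)
    (x : Space d) : G := ∫ y, F y • κ (x - y)

theorem schwartz_decay_one {G : Type*} [NormedAddCommGroup G] [NormedSpace ℝ G]
    (κ : 𝓢(Space d, G)) (k n : ℕ) : ∃ C : ℝ, 0 ≤ C ∧
      ∀ x, ‖iteratedFDeriv ℝ n κ x‖ ≤ C * ((1 + ‖x‖) ^ k)⁻¹ := by
  have h := SchwartzMap.one_add_le_sup_seminorm_apply (𝕜 := ℝ) (m := (k, n)) (k := k) (n := n)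
    le_rfl le_rfl κ
  refine ⟨2 ^ k * ((Finset.Iic (k, n)).sup fun m => SchwartzMap.seminorm ℝ m.1 m.2) κ,
    by positivity, fun x => ?_⟩
  rw [← div_eq_mul_inv, le_div_iff₀ (by positivity), mul_comm]
  exact h x

theorem inv_one_add_pow_le (n : ℕ) (x y : Space d) :
    ((1 + ‖x - y‖) ^ n)⁻¹ ≤ (1 + ‖x‖) ^ n * ((1 + ‖y‖) ^ n)⁻¹ := by
  rw [← div_eq_mul_inv, le_div_iff₀ (by positivity), inv_mul_le_iff₀ (by positivity), ← mul_pow]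
  exact pow_le_pow_left₀ (by positivity) (one_add_norm_le_mul x y) n

variable {F : Space d → ℂ}

theorem norm_smul_inv_pow (n : ℕ) (y : Space d) :
    ‖((1 + ‖y‖) ^ n)⁻¹ • F y‖ = ((1 + ‖y‖) ^ n)⁻¹ * ‖F y‖ := by
  rw [norm_smul, Real.norm_of_nonneg (by positivity)]

theorem TempInt.integrable_cv {G : Type*} [NormedAddCommGroup G] [NormedSpace ℂ G]
    (hF : TempInt F) (κ : 𝓢(Space d, G)) (x : Space d) :
    Integrable fun y => F y • κ (x - y) := by
  have hm := hF.aestronglyMeasurable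
  obtain ⟨n, hn⟩ := hF
  obtain ⟨C, hC0, hC⟩ := schwartz_decay_one κ n 0
  refine (hn.norm.const_mul (C * (1 + ‖x‖) ^ n)).mono'
    (hm.smul (κ.continuous.comp (by fun_prop)).aestronglyMeasurable) (Eventually.of_forall fun y => ?_)
  have h1 := hC (x - y)
  rw [norm_iteratedFDeriv_zero] at h1
  rw [norm_smul, norm_smul_inv_pow]
  calc ‖F y‖ * ‖κ (x - y)‖ ≤ ‖F y‖ * (C * ((1 + ‖x‖) ^ n * ((1 + ‖y‖) ^ n)⁻¹)) := by
        gcongr; exact h1.trans (mul_le_mul_of_nonneg_left (inv_one_add_pow_le n x y) hC0)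
    _ = _ := by ring

theorem TempInt.hasFDerivAt_cv {G : Type*} [NormedAddCommGroup G] [NormedSpace ℂ G]
    (hF : TempInt F) (κ : 𝓢(Space d, G)) (x : Space d) :
    HasFDerivAt (cv F κ) (cv F (SchwartzMap.fderivCLM ℝ (Space d) G κ) x) x := by
  have hF' := hF
  obtain ⟨n, hn⟩ := hF'
  obtain ⟨C, hC0, hC⟩ := schwartz_decay_one (SchwartzMap.fderivCLM ℝ (Space d) G κ) n 0
  refine hasFDerivAt_integral_of_dominated_of_fderiv_le (𝕜 := ℝ) (s := Metric.ball x 1)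
    (F' := fun z y => F y • SchwartzMap.fderivCLM ℝ (Space d) G κ (z - y))
    (bound := fun y => C * (2 + ‖x‖) ^ n * ‖((1 + ‖y‖) ^ n)⁻¹ • F y‖)
    (Metric.ball_mem_nhds x one_pos)
    (Eventually.of_forall fun z => (hF.integrable_cv κ z).aestronglyMeasurable)
    (hF.integrable_cv κ x)
    (hF.integrable_cv (SchwartzMap.fderivCLM ℝ (Space d) G κ) x).aestronglyMeasurable
    (Eventually.of_forall fun y z hz => ?_)
    (hn.norm.const_mul _) (Eventually.of_forall fun y z _ => ?_)
  · have hz' : ‖z - x‖ < 1 := by simpa [dist_eq_norm] using hz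
    have h2 : 1 + ‖z‖ ≤ 2 + ‖x‖ := by
      have := norm_add_le (z - x) x
      rw [sub_add_cancel] at this; linarith
    have h1 := hC (z - y)
    rw [norm_iteratedFDeriv_zero] at h1
    rw [norm_smul, norm_smul_inv_pow]
    calc ‖F y‖ * ‖SchwartzMap.fderivCLM ℝ (Space d) G κ (z - y)‖
        ≤ ‖F y‖ * (C * ((2 + ‖x‖) ^ n * ((1 + ‖y‖) ^ n)⁻¹)) := by
          gcongr
          refine h1.trans (mul_le_mul_of_nonneg_left ((inv_one_add_pow_le n z y).trans ?_) hC0)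
          gcongr
      _ = _ := by ring
  · have h2 : HasFDerivAt (fun z => z - y) (ContinuousLinearMap.id ℝ (Space d)) z :=
      (hasFDerivAt_id z).sub_const y
    have h3 := (κ.differentiableAt (x := z - y)).hasFDerivAt.comp z h2
    rw [ContinuousLinearMap.comp_id] at h3
    exact h3.const_smul (F y)

theorem TempInt.fderiv_cv {G : Type*} [NormedAddCommGroup G] [NormedSpace ℂ G]
    (hF : TempInt F) (κ : 𝓢(Space d, G)) :
    fderiv ℝ (cv F κ) = cv F (SchwartzMap.fderivCLM ℝ (Space d) G κ) :=
  funext fun x => (hF.hasFDerivAt_cv κ x).fderiv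

/-- The target space is part of the induction, which passes to the derivative of `κ`, a function
with values in linear maps. -/
theorem TempInt.contDiff_cv (hF : TempInt F) (n : ℕ) :
    ∀ {G : Type} [NormedAddCommGroup G] [NormedSpace ℂ G] (κ : 𝓢(Space d, G)),
      ContDiff ℝ n (cv F κ) ∧
      ∀ x, ‖iteratedFDeriv ℝ n (cv F κ) x‖ ≤ ∫ y, ‖F y‖ * ‖iteratedFDeriv ℝ n κ (x - y)‖ := by
  induction n with
  | zero =>
    intro G _ _ κ
    refine ⟨contDiff_zero.2 (continuous_iff_continuousAt.2 fun x =>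
      (hF.hasFDerivAt_cv κ x).continuousAt), fun x => ?_⟩
    simp only [norm_iteratedFDeriv_zero, ← norm_smul]
    exact norm_integral_le_integral_norm _
  | succ n ih =>
    intro G _ _ κ
    obtain ⟨h1, h2⟩ := ih (SchwartzMap.fderivCLM ℝ (Space d) G κ)
    rw [← hF.fderiv_cv] at h1 h2
    refine ⟨?_, fun x => ?_⟩
    · push_cast
      exact contDiff_succ_iff_fderiv.2 ⟨fun x => (hF.hasFDerivAt_cv κ x).differentiableAt,
        by simp, h1⟩
    · rw [← norm_iteratedFDeriv_fderiv]
      refine (h2 x).trans_eq ?_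
      congr 1; ext y
      rw [← norm_iteratedFDeriv_fderiv (f := κ)]; rfl

theorem TempInt.hasTemperateGrowth_cv (hF : TempInt F) (κ : 𝓢(Space d, ℂ)) :
    (cv F κ).HasTemperateGrowth := by
  refine ⟨contDiff_infty.2 fun n => (hF.contDiff_cv n κ).1, fun n => ?_⟩
  obtain ⟨k, hk⟩ := hF
  obtain ⟨C, hC0, hC⟩ := schwartz_decay_one κ k n
  refine ⟨k, C * ∫ y, ‖((1 + ‖y‖) ^ k)⁻¹ • F y‖, fun x => ?_⟩
  refine ((TempInt.contDiff_cv ⟨k, hk⟩ n κ).2 x).trans ?_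
  rw [mul_right_comm, ← integral_const_mul]
  refine integral_mono_of_nonneg (Eventually.of_forall fun y => by positivity)
    (hk.norm.const_mul _) (Eventually.of_forall fun y => ?_)
  dsimp only
  rw [norm_smul_inv_pow]
  calc ‖F y‖ * ‖iteratedFDeriv ℝ n κ (x - y)‖
      ≤ ‖F y‖ * (C * ((1 + ‖x‖) ^ k * ((1 + ‖y‖) ^ k)⁻¹)) := by
        gcongr; exact (hC _).trans (mul_le_mul_of_nonneg_left (inv_one_add_pow_le k x y) hC0)
    _ = _ := by ring

/-- Makes a frequency-localized bounded distribution a legitimate multiplier of distributions. It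
allows the roles of `u` and `∇φ` in the product to be exchanged. -/
theorem exists_tfun_mult {f : 𝓢'(Space d, ℂ)} (hf : distLpNorm ∞ f ≠ ⊤) (a : 𝓢(Space d, ℂ)) :
    ∃ V : TFun d, V.dist = mult a f := by
  obtain ⟨F, rfl⟩ := exists_coe_of_distLpNorm_ne_top hf
  refine ⟨⟨cv F (FourierTransform.fourierInv a : 𝓢(Space d, ℂ)),
    (rep_coe F).1.hasTemperateGrowth_cv _⟩, ?_⟩
  have h := (rep_coe F).mult a
  ext θ
  rw [dist_def_apply, h.2 θ]
  refine integral_congr_ae (Eventually.of_forall fun x => ?_)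
  simp only [cv, kern, smul_eq_mul, List.map_nil, List.prod_nil, one_mul]
  congr 2; ext y; rw [mul_comm]

/-- Convolutions of a family with uniform moments and a bounded family of Schwartz functions. -/
theorem exists_bddFam_cv {ι : Type*} {F : ι → Space d → ℂ} {κ : ι → 𝓢(Space d, ℂ)}
    (hκ : BddFam κ) (hF : ∀ k : ℕ, ∃ A : ℝ, ∀ i, (Integrable fun y => (1 + ‖y‖) ^ k * ‖F i y‖) ∧
      ∫ y, (1 + ‖y‖) ^ k * ‖F i y‖ ≤ A) (hm : ∀ i, AEStronglyMeasurable (F i)) :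
    ∃ S : ι → 𝓢(Space d, ℂ), (∀ i x, S i x = cv (F i) (κ i) x) ∧ BddFam S := by
  have hT : ∀ i, TempInt (F i) := fun i => by
    obtain ⟨A, hA⟩ := hF 0
    refine ⟨0, (integrable_norm_iff (by simpa using hm i)).1 ?_⟩
    simpa using (hA i).1
  have hb : ∀ k n : ℕ, ∃ A : ℝ, ∀ i x,
      ‖x‖ ^ k * ‖iteratedFDeriv ℝ n (cv (F i) (κ i)) x‖ ≤ A := fun k n => by
    obtain ⟨A, hA⟩ := hF k
    obtain ⟨B, hB0, hB⟩ := exists_sup_seminorm_le hκ (Finset.Iic (k, n))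
    refine ⟨2 ^ k * B * A, fun i x => ?_⟩
    have h1 : ∀ y, ‖x‖ ^ k * (‖F i y‖ * ‖iteratedFDeriv ℝ n (κ i) (x - y)‖) ≤
        2 ^ k * B * ((1 + ‖y‖) ^ k * ‖F i y‖) := fun y => by
      have h2 := (SchwartzMap.one_add_le_sup_seminorm_apply (𝕜 := ℂ) (m := (k, n)) (k := k) (n := n)
        le_rfl le_rfl (κ i) (x - y)).trans (mul_le_mul_of_nonneg_left (hB i) (by positivity))
      have h3 : ‖x‖ ^ k ≤ (1 + ‖x - y‖) ^ k * (1 + ‖y‖) ^ k := by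
        rw [← mul_pow]
        refine pow_le_pow_left₀ (norm_nonneg _) ?_ k
        have := norm_add_le (x - y) y
        rw [sub_add_cancel] at this
        nlinarith [norm_nonneg (x - y), norm_nonneg y]
      calc _ ≤ (1 + ‖x - y‖) ^ k * (1 + ‖y‖) ^ k *
            (‖F i y‖ * ‖iteratedFDeriv ℝ n (κ i) (x - y)‖) := by gcongr
        _ = (1 + ‖x - y‖) ^ k * ‖iteratedFDeriv ℝ n (κ i) (x - y)‖ *
            ((1 + ‖y‖) ^ k * ‖F i y‖) := by ring
        _ ≤ _ := by gcongr
    calc ‖x‖ ^ k * ‖iteratedFDeriv ℝ n (cv (F i) (κ i)) x‖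
        ≤ ‖x‖ ^ k * ∫ y, ‖F i y‖ * ‖iteratedFDeriv ℝ n (κ i) (x - y)‖ := by
          gcongr; exact ((hT i).contDiff_cv n (κ i)).2 x
      _ = ∫ y, ‖x‖ ^ k * (‖F i y‖ * ‖iteratedFDeriv ℝ n (κ i) (x - y)‖) :=
          (integral_const_mul _ _).symm
      _ ≤ ∫ y, 2 ^ k * B * ((1 + ‖y‖) ^ k * ‖F i y‖) :=
          integral_mono_of_nonneg (Eventually.of_forall fun y => by positivity)
            ((hA i).1.const_mul _) (Eventually.of_forall h1)
      _ ≤ _ := by rw [integral_const_mul]; gcongr; exact (hA i).2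
  refine ⟨fun i => ⟨cv (F i) (κ i), contDiff_infty.2 fun n => ((hT i).contDiff_cv n (κ i)).1,
    fun k n => ?_⟩, fun i x => rfl, fun k n => ?_⟩
  · obtain ⟨A, hA⟩ := hb k n; exact ⟨A, hA i⟩
  · obtain ⟨A, hA⟩ := hb k n
    refine ⟨max A 0, fun i => SchwartzMap.seminorm_le_bound ℂ k n _ (le_max_right _ _)
      fun x => (hA i x).trans (le_max_left _ _)⟩

end Convolution

end

section

/-! ### Products with a divergence-free field: the gradient is bounded -/

section ProductGradient

variable {d N : ℕ} {P : LittlewoodPaley d} {W : Fin N → SmoothField d}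

variable (P W) in
/-- The sizes of the blocks of a field near the frequency `2^q`. -/
def nearField (p : ℝ≥0∞) [Fact (1 ≤ p)] (q : ℕ) (u : SmoothField d) (w : List (Fin N)) : ℝ≥0∞ :=
  ∑ j, nearN P W p q (u.c j).dist w

theorem nearN_le_nearField {p : ℝ≥0∞} [Fact (1 ≤ p)] (q : ℕ) (u : SmoothField d) (j : Fin d)
    (w : List (Fin N)) : nearN P W p q (u.c j).dist w ≤ nearField P W p q u w :=
  Finset.single_le_sum (f := fun j => nearN P W p q (u.c j).dist w) (fun _ _ => zero_le)
    (Finset.mem_univ j)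

variable {p r : ℝ≥0∞} [Fact (1 ≤ p)] {K : ℕ} {C : ℝ≥0∞}

theorem exists_tfun_block (n : ℕ) {f : 𝓢'(Space d, ℂ)} (hf : distLpNorm ∞ (P.block n f) ≠ ⊤) :
    ∃ V : TFun d, V.dist = P.block n f := by
  obtain ⟨V, hV⟩ := exists_tfun_mult hf (dil (two ^ n) (P.fatS n))
  exact ⟨V, hV.trans (P.mop_fat_block n f)⟩

theorem BaseBound.block_succ_ne_top (h : BaseBound P K C) (hC : C ≠ ⊤) (n : ℕ)
    {f : 𝓢'(Space d, ℂ)} (hf : ∀ j, distLpNorm p (P.block (n + 1) (pd j f)) ≠ ⊤) :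
    distLpNorm p (P.block (n + 1) f) ≠ ⊤ := by
  -- The empty family and the empty word recover the plain reverse Bernstein bound.
  have h1 := (h.ann_fat n).dL_le_gradN (p := p) (W := (Fin.elim0 : Fin 0 → SmoothField d))
    (fun i => i.elim0) (n + 1) (P.block (n + 1) f) (w := []) (by simp)
  have e : dL (Fin.elim0 : Fin 0 → SmoothField d) [] (mop (n + 1) (P.fatS (n + 1))) =
    mop (n + 1) (P.fatS (n + 1)) := rfl
  rw [e, P.mop_fat_block] at h1
  refine ne_top_of_le_ne_top ?_ h1
  have h2 : wt2 (Fin.elim0 : Fin 0 → SmoothField d) [] = 1 := by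
    rw [wt2, conv_nil, wt, weight_nil, one_mul]
  rw [h2, mul_one]
  refine ENNReal.mul_ne_top (by simp) (ENNReal.mul_ne_top (ENNReal.mul_ne_top hC (by simp)) ?_)
  refine (ENNReal.sum_lt_top.2 fun j _ => ?_).ne
  rw [← block_pd]; exact (hf j).lt_top

theorem sum_pd_dist_of_divFree {u : SmoothField d} (hu : u.IsDivFree) :
    ∑ j, pd j (u.c j).dist = 0 := by
  have h : ∀ j, pd j (u.c j).dist = mulOp ((u.c j).pd j) (1 : TFun d).dist := fun j => by
    rw [pd_dist, ← dist_eq_mulOp_one]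
  simp only [h]
  rw [← _root_.sum_apply, ← mulOp_sum, (isDivFree_iff u).1 hu, mulOp_zero]; rfl

theorem mulOp_pd (V : TFun d) (j : Fin d) (f : 𝓢'(Space d, ℂ)) :
    mulOp V (pd j f) = pd j (mulOp V f) - mulOp (V.pd j) f := by
  have := congrArg (fun T : Op d => T f) (pd_mul_mulOp j V)
  rw [eq_sub_iff_add_eq, add_comm]
  exact this.symm

theorem block_succ_eq' (n : ℕ) (f : 𝓢'(Space d, ℂ)) : P.block (n + 1) f =
    ((2 : ℂ) ^ (n + 1))⁻¹ • ∑ h, pd h (mop (n + 1) (P.rho h P.bandS) f) := by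
  rw [P.block_eq, LittlewoodPaley.blockS, P.mop_eq_sum' (n + 1) P.annular_bandS]
  simp

/-- Integration by parts: the block is `2^{-(n+1)}` times a divergence, and the derivatives are
moved in front of the product or onto `V`. -/
theorem mulOp_block_succ (n : ℕ) (V : TFun d) (f : 𝓢'(Space d, ℂ)) :
    mulOp V (P.block (n + 1) f) = ((2 : ℂ) ^ (n + 1))⁻¹ • ∑ h,
      (pd h (mulOp V (mop (n + 1) (P.rho h P.bandS) f)) -
        mulOp (V.pd h) (mop (n + 1) (P.rho h P.bandS) f)) := by
  rw [block_succ_eq', map_smul, map_sum]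
  simp only [mulOp_pd]

theorem vN_sub_le (f g : 𝓢'(Space d, ℂ)) (w : List (Fin N)) :
    vN W p (f - g) w ≤ vN W p f w + vN W p g w := by
  rw [vN, dd_sub]; exact distLpNorm_sub_le _ _

theorem conv_wt_conv_le {X Y H V : List (Fin N) → ℝ≥0∞} {x y : ℝ≥0∞} {w : List (Fin N)}
    (hX : ∀ a, a.length ≤ w.length → X a ≤ x * conv (wp W 3) H a)
    (hY : ∀ a, a.length ≤ w.length → Y a ≤ y * conv (wp W 2) V a) :
    conv (wt W) (conv X Y) w ≤ x * y * conv (wp W 6) (conv H V) w := by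
  calc conv (wt W) (conv X Y) w
      ≤ conv (wt W) (conv (fun a => x * conv (wp W 3) H a) (fun a => y * conv (wp W 2) V a)) w :=
        conv_mono (fun _ _ => le_rfl) fun a ha => conv_mono (fun b hb => hX b (hb.trans ha))
          fun b hb => hY b (hb.trans ha)
    _ = conv (wp W 1) (fun a => x * y * conv (conv (wp W 3) H) (conv (wp W 2) V) a) w :=
        conv_congr (fun a _ => (wp_one a).symm) fun a _ => by
          rw [conv_mul_left, conv_mul_right, mul_assoc]
    _ = _ := by
        rw [conv_mul_right]
        congr 1
        exact conv_wp_conv_wp 1 3 2 H V w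

variable {w : List (Fin N)} {u : SmoothField d}

theorem BandBound.vN_block_prod_le (hdiv : ∀ i, (W i).IsDivFree) (h : BandBound P K C)
    (q m n : ℕ) (φ : 𝓢'(Space d, ℂ)) (hw : 2 * w.length + 1 ≤ K) {G : Fin d → TFun d}
    (hG : ∀ j, (G j).dist = P.block m (pd j φ)) :
    vN W p (P.block q (∑ j, mulOp (G j) (P.block n (u.c j).dist))) w ≤
      d * (C * (((d + 1) ^ 2 * C * C) * ((d + 1) ^ 2 * C * C))) *
        conv (wp W 6) (conv (nearGrad P W ∞ m φ) (nearField P W p n u)) w := by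
  rw [map_sum, mul_assoc (d : ℝ≥0∞)]
  refine (vN_sum_le _ _ w).trans (sum_le_card_mul fun j => ?_)
  rw [P.block_eq q, mul_assoc]
  refine ((h.base.block q).dd_mop_mulOp_le hdiv q _ _ (by omega)).trans (mul_le_mul' le_rfl ?_)
  refine conv_wt_conv_le (fun a ha => ?_) fun a ha => ?_
  · rw [hG]
    refine (h.vN_block_le hdiv m _ (by omega)).trans (mul_le_mul' le_rfl ?_)
    exact (conv_mono' (fun _ => le_rfl) (fun b => nearN_le_nearGrad m φ j b) a).trans
      (conv_wp_mono (by norm_num) _ _)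
  · refine (h.vN_block_le hdiv n _ (by omega)).trans (mul_le_mul' le_rfl ?_)
    exact conv_mono' (fun _ => le_rfl) (fun b => nearN_le_nearField n u j b) a

/-- The block of `u` is integrated by parts. The derivative lands on the output block, at the cost
of `2^q`, or on the block of `∇φ`, at the cost of `2^m ≤ 2^q`. -/
theorem BandBound.vN_block_prod_low_le (hdiv : ∀ i, (W i).IsDivFree) (h : BandBound P (K + 1) C)
    {q m : ℕ} (hmq : m ≤ q) (n : ℕ) (φ : 𝓢'(Space d, ℂ)) (hw : 2 * w.length + 1 ≤ K)
    {G : Fin d → TFun d} (hG : ∀ j, (G j).dist = P.block m (pd j φ)) :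
    vN W p (P.block q (∑ j, mulOp (G j) (P.block (n + 1) (u.c j).dist))) w ≤
      d * (d * ((C + C * C) * (((d + 1) ^ 2 * C * C) * ((d + 1) ^ 2 * C * C)))) *
        (2 ^ q * (2 ^ (n + 1))⁻¹) *
        conv (wp W 6) (conv (nearGrad P W ∞ m φ) (nearField P W p (n + 1) u)) w := by
  set A : ℝ≥0∞ := (d + 1) ^ 2 * C * C
  set R := conv (wp W 6) (conv (nearGrad P W ∞ m φ) (nearField P W p (n + 1) u)) w
  have hv : ∀ (j l : Fin d) (a : List (Fin N)), a.length ≤ w.length →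
      vN W p (mop (n + 1) (P.rho l P.bandS) (u.c j).dist) a ≤
        A * conv (wp W 2) (nearField P W p (n + 1) u) a := fun j l a ha =>
    (h.vN_rho_le hdiv (n + 1) l _ (by omega)).trans (mul_le_mul' le_rfl
      (conv_mono' (fun _ => le_rfl) (fun b => nearN_le_nearField (n + 1) u j b) a))
  have hg : ∀ (j : Fin d) (a : List (Fin N)), a.length ≤ w.length →
      vN W ∞ (P.block m (pd j φ)) a ≤ A * conv (wp W 2) (nearGrad P W ∞ m φ) a := fun j a ha =>
    (h.vN_block_le hdiv m _ (by omega)).trans (mul_le_mul' le_rfl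
      (conv_mono' (fun _ => le_rfl) (fun b => nearN_le_nearGrad m φ j b) a))
  rw [map_sum, mul_assoc (d : ℝ≥0∞), mul_assoc (d : ℝ≥0∞)]
  refine (vN_sum_le _ _ w).trans (sum_le_card_mul fun j => ?_)
  rw [mulOp_block_succ, map_smul, map_sum]
  refine (vN_smul_le _ _ w).trans ?_
  rw [enorm_two_pow_inv]
  have h1 : ∀ l, vN W p (P.block q (pd l (mulOp (G j) (mop (n + 1) (P.rho l P.bandS) (u.c j).dist)) -
      mulOp ((G j).pd l) (mop (n + 1) (P.rho l P.bandS) (u.c j).dist))) w ≤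
      (C + C * C) * (A * A) * 2 ^ q * R := fun l => by
    rw [map_sub]
    refine (vN_sub_le _ _ w).trans ?_
    rw [P.block_eq q]
    refine (add_le_add ((h.base.block q).dd_mop_pd_mulOp_le hdiv q l _ _ (by omega))
      ((h.base.block q).dd_mop_mulOp_le hdiv q _ _ (by omega))).trans ?_
    have h2 : conv (wt W) (conv (vN W ∞ (G j).dist)
        (vN W p (mop (n + 1) (P.rho l P.bandS) (u.c j).dist))) w ≤ A * A * R := by
      refine conv_wt_conv_le (fun a ha => ?_) (hv j l)
      rw [hG]
      exact (hg j a ha).trans (mul_le_mul' le_rfl (conv_wp_mono (by norm_num) _ _))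
    have h3 : conv (wt W) (conv (vN W ∞ ((G j).pd l).dist)
        (vN W p (mop (n + 1) (P.rho l P.bandS) (u.c j).dist))) w ≤ C * 2 ^ m * A * A * R := by
      refine conv_wt_conv_le (fun a ha => ?_) (hv j l)
      rw [← pd_dist, hG, ← P.mop_fat_block m (pd j φ)]
      refine ((h.base.fat m).dd_pd_mop_le hdiv m l _ (by omega)).trans ?_
      rw [mul_assoc (C * 2 ^ m)]
      refine mul_le_mul' le_rfl ?_
      rw [← conv_wt_wp, ← conv_mul_right]
      exact conv_mono (fun _ _ => le_rfl) fun b hb => hg j b (hb.trans ha)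
    have h4 : (2 : ℝ≥0∞) ^ m ≤ 2 ^ q := pow_le_pow_right₀ (by norm_num) hmq
    calc _ ≤ C * 2 ^ q * (A * A * R) + C * (C * 2 ^ q * A * A * R) := by
          gcongr; exact h3.trans (by gcongr)
      _ = _ := by ring
  refine (mul_le_mul' le_rfl ((vN_sum_le _ _ w).trans (sum_le_card_mul h1))).trans_eq ?_
  ring

/-- A plain integration by parts would cost `2^m`, too much at this frequency of `∇φ`. First `div u
= 0` moves the gradient off `Φ` onto the output, then the block of `u` is integrated by parts. The
term with two outer derivatives costs `2^{2q}`, but `Φ` is `2^{-(m+1)}` times its gradient and `q ≤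
m + 1`. -/
theorem BandBound.vN_block_prod_high_le (hdiv : ∀ i, (W i).IsDivFree)
    (h : BandBound P (K + 1 + 1) C) (hu : u.IsDivFree) {q m : ℕ} (hmq : q ≤ m + 1) (n : ℕ)
    (φ : 𝓢'(Space d, ℂ)) (hw : 2 * w.length + 1 ≤ K) {Φ : TFun d}
    (hΦ : Φ.dist = P.block (m + 1) φ) :
    vN W p (P.block q (∑ j, mulOp (Φ.pd j) (P.block (n + 1) (u.c j).dist))) w ≤
      d * (d * ((C + C) * (((d + 1) ^ 2 * C * C) * ((d + 1) ^ 2 * C * C)))) *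
        (2 ^ q * (2 ^ (n + 1))⁻¹) *
        conv (wp W 6) (conv (nearGrad P W ∞ (m + 1) φ) (nearField P W p (n + 1) u)) w := by
  set A : ℝ≥0∞ := (d + 1) ^ 2 * C * C
  set R := conv (wp W 6) (conv (nearGrad P W ∞ (m + 1) φ) (nearField P W p (n + 1) u)) w
  have hv : ∀ (j l : Fin d) (a : List (Fin N)), a.length ≤ w.length →
      vN W p (mop (n + 1) (P.rho l P.bandS) (u.c j).dist) a ≤
        A * conv (wp W 2) (nearField P W p (n + 1) u) a := fun j l a ha =>
    (h.vN_rho_le hdiv (n + 1) l _ (by omega)).trans (mul_le_mul' le_rfl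
      (conv_mono' (fun _ => le_rfl) (fun b => nearN_le_nearField (n + 1) u j b) a))
  -- The blocks of `u` are divergence-free as well, since blocks commute with derivatives.
  have e1 : ∑ j, mulOp (Φ.pd j) (P.block (n + 1) (u.c j).dist) =
      ∑ j, pd j (mulOp Φ (P.block (n + 1) (u.c j).dist)) := by
    have e2 : ∑ j, mulOp Φ (pd j (P.block (n + 1) (u.c j).dist)) = 0 := by
      simp only [← block_pd]
      rw [← map_sum, ← map_sum, sum_pd_dist_of_divFree hu, map_zero, map_zero]
    have e3 : ∀ j, mulOp (Φ.pd j) (P.block (n + 1) (u.c j).dist) =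
        pd j (mulOp Φ (P.block (n + 1) (u.c j).dist)) -
          mulOp Φ (pd j (P.block (n + 1) (u.c j).dist)) := fun j => by
      rw [mulOp_pd]; abel
    simp only [e3]
    rw [Finset.sum_sub_distrib, e2, sub_zero]
  rw [e1, map_sum, mul_assoc (d : ℝ≥0∞), mul_assoc (d : ℝ≥0∞)]
  refine (vN_sum_le _ _ w).trans (sum_le_card_mul fun j => ?_)
  rw [mulOp_block_succ, map_smul, map_smul, map_sum, map_sum]
  refine (vN_smul_le _ _ w).trans ?_
  rw [enorm_two_pow_inv]
  have h1 : ∀ l, vN W p (P.block q (pd j (pd l (mulOp Φ (mop (n + 1) (P.rho l P.bandS)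
      (u.c j).dist)) - mulOp (Φ.pd l) (mop (n + 1) (P.rho l P.bandS) (u.c j).dist)))) w ≤
      (C + C) * (A * A) * 2 ^ q * R := fun l => by
    rw [map_sub, map_sub]
    refine (vN_sub_le _ _ w).trans ?_
    rw [P.block_eq q]
    refine (add_le_add ((h.base.block q).dd_mop_pd_pd_mulOp_le hdiv q j l _ _ (by omega))
      ((h.base.block q).dd_mop_pd_mulOp_le hdiv q j _ _ (by omega))).trans ?_
    have h2 : conv (wt W) (conv (vN W ∞ Φ.dist)
        (vN W p (mop (n + 1) (P.rho l P.bandS) (u.c j).dist))) w ≤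
        (2 ^ (m + 1))⁻¹ * A * A * R := by
      refine conv_wt_conv_le (fun a ha => ?_) (hv j l)
      rw [hΦ, mul_assoc]
      exact (h.vN_block_succ_le hdiv m φ (by omega)).trans
        (mul_le_mul' le_rfl (mul_le_mul' le_rfl (conv_wp_mono (by norm_num) _ _)))
    have h3 : conv (wt W) (conv (vN W ∞ (Φ.pd l).dist)
        (vN W p (mop (n + 1) (P.rho l P.bandS) (u.c j).dist))) w ≤ A * A * R := by
      refine conv_wt_conv_le (fun a ha => ?_) (hv j l)
      rw [← pd_dist, hΦ, ← block_pd]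
      refine (h.vN_block_le hdiv (m + 1) _ (by omega)).trans (mul_le_mul' le_rfl ?_)
      exact (conv_mono' (fun _ => le_rfl) (fun b => nearN_le_nearGrad (m + 1) φ l b) a).trans
        (conv_wp_mono (by norm_num) _ _)
    have h4 : (2 : ℝ≥0∞) ^ q * (2 ^ (m + 1))⁻¹ ≤ 1 := by
      rw [← div_eq_mul_inv]
      exact ENNReal.div_le_of_le_mul (by rw [one_mul]; exact pow_le_pow_right₀ (by norm_num) hmq)
    calc _ ≤ C * 2 ^ q * 2 ^ q * ((2 ^ (m + 1))⁻¹ * A * A * R) + C * 2 ^ q * (A * A * R) := by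
          gcongr
      _ = (2 ^ q * (2 ^ (m + 1))⁻¹) * (C * 2 ^ q * (A * A * R)) + C * 2 ^ q * (A * A * R) := by ring
      _ ≤ 1 * (C * 2 ^ q * (A * A * R)) + C * 2 ^ q * (A * A * R) := by gcongr
      _ = _ := by ring
  refine (mul_le_mul' le_rfl ((vN_sum_le _ _ w).trans (sum_le_card_mul h1))).trans_eq ?_
  ring

end ProductGradient

end

/-! ### The product estimate -/

section

section ProductEstimate

variable {d N : ℕ} {P : LittlewoodPaley d} {W : Fin N → SmoothField d}

variable {p r : ℝ≥0∞} [Fact (1 ≤ p)] {K : ℕ} {C : ℝ≥0∞} {w : List (Fin N)} {u : SmoothField d}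

theorem two_pow_mul_inv {q n : ℕ} (h : q ≤ n) : (2 : ℝ≥0∞) ^ q * (2 ^ n)⁻¹ = 2⁻¹ ^ (n - q) := by
  rw [mul_comm, ← dy_of_le h, dy, Nat.sub_eq_zero_of_le h, add_zero]

/-- The gain `2^{-(n-q)_+}` is uniform in the frequency `m` of `∇φ`. For `m ≤ q` the components of
the gradient may be represented separately. For `m > q` they must come from one function `Φ`,
because the cancellation uses that they form a gradient. -/
theorem BandBound.exists_factors (hdiv : ∀ i, (W i).IsDivFree) (h : BandBound P (K + 1 + 1) C)
    (hC : C ≠ ⊤) (hu : u.IsDivFree) (q m : ℕ) {φ : 𝓢'(Space d, ℂ)}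
    (hφ : ∀ j, distLpNorm ∞ (P.block m (pd j φ)) ≠ ⊤) (hw : 2 * w.length + 1 ≤ K) :
    ∃ G : Fin d → TFun d, (∀ j, (G j).dist = P.block m (pd j φ)) ∧ ∀ n,
      vN W p (P.block q (∑ j, mulOp (G j) (P.block n (u.c j).dist))) w ≤
        (d + 1) ^ 2 * ((C + C * C) * (((d + 1) ^ 2 * C * C) * ((d + 1) ^ 2 * C * C))) *
        (2⁻¹ ^ (n - q) * conv (wp W 6) (conv (nearGrad P W ∞ m φ) (nearField P W p n u)) w) := by
  set A : ℝ≥0∞ := (d + 1) ^ 2 * C * C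
  have h1 : (1 : ℝ≥0∞) ≤ C := h.base.one_le
  have hd : (d : ℝ≥0∞) ≤ d + 1 := le_self_add
  have hlow : ∀ {G : Fin d → TFun d}, (∀ j, (G j).dist = P.block m (pd j φ)) → ∀ n ≤ q,
      vN W p (P.block q (∑ j, mulOp (G j) (P.block n (u.c j).dist))) w ≤
        (d + 1) ^ 2 * ((C + C * C) * (A * A)) *
        (2⁻¹ ^ (n - q) * conv (wp W 6) (conv (nearGrad P W ∞ m φ) (nearField P W p n u)) w) := by
    intro G hG n hn
    refine (h.vN_block_prod_le hdiv q m n φ (by omega) hG).trans ?_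
    rw [Nat.sub_eq_zero_of_le hn, pow_zero, one_mul]
    gcongr
    · exact hd.trans (le_self_pow₀ le_add_self (by norm_num))
    · exact le_self_add
  rcases le_or_gt m q with hm | hm
  · choose G hG using fun j => exists_tfun_block m (hφ j)
    refine ⟨G, hG, fun n => ?_⟩
    rcases le_or_gt n q with hn | hn
    · exact hlow hG n hn
    · obtain ⟨n, rfl⟩ : ∃ m, n = m + 1 := ⟨n - 1, by omega⟩
      have h0 : BandBound P (K + 1) C := ⟨⟨h1, fun n => (h.base.block n).mono (by omega) le_rfl,
        fun n => (h.base.fat n).mono (by omega) le_rfl,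
        fun n j => (h.base.rho_block n j).mono (by omega) le_rfl,
        fun n j => (h.base.rho_fat n j).mono (by omega) le_rfl⟩,
        fun j => (h.rho j).mono (by omega) le_rfl⟩
      refine (h0.vN_block_prod_low_le hdiv hm n φ hw hG).trans ?_
      rw [two_pow_mul_inv hn.le, mul_assoc _ (2⁻¹ ^ _), ← mul_assoc (d : ℝ≥0∞) (d : ℝ≥0∞), ← sq]
      gcongr
  · obtain ⟨m, rfl⟩ : ∃ l, m = l + 1 := ⟨m - 1, by omega⟩
    obtain ⟨Φ, hΦ⟩ := exists_tfun_block (m + 1) (h.base.block_succ_ne_top hC m hφ)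
    have hG : ∀ j, (Φ.pd j).dist = P.block (m + 1) (pd j φ) := fun j => by
      rw [← pd_dist, hΦ, block_pd]
    refine ⟨fun j => Φ.pd j, hG, fun n => ?_⟩
    rcases le_or_gt n q with hn | hn
    · exact hlow hG n hn
    · obtain ⟨n, rfl⟩ : ∃ m, n = m + 1 := ⟨n - 1, by omega⟩
      refine (h.vN_block_prod_high_le hdiv hu hm.le n φ hw hΦ).trans ?_
      rw [two_pow_mul_inv hn.le, mul_assoc _ (2⁻¹ ^ _), ← mul_assoc (d : ℝ≥0∞) (d : ℝ≥0∞), ← sq]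
      gcongr
      exact le_mul_of_one_le_left' h1

/-- The product is expanded in the blocks of `φ`, then in those of `u`. As there is no gain in `m`,
the sum over `m` is taken inside, which leads to the space `B^0_{∞,1}` for the gradient. -/
theorem BandBound.vN_block_deriv_le' (hdiv : ∀ i, (W i).IsDivFree) (h : BandBound P (K + 1 + 1) C)
    (hC : C ≠ ⊤) (hu : u.IsDivFree) (q : ℕ) {φ : 𝓢'(Space d, ℂ)}
    (hφ : ∀ m j, distLpNorm ∞ (P.block m (pd j φ)) ≠ ⊤) (hw : 2 * w.length + 1 ≤ K) :
    vN W p (P.block q (u.deriv φ)) w ≤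
      (d + 1) ^ 2 * ((C + C * C) * (((d + 1) ^ 2 * C * C) * ((d + 1) ^ 2 * C * C))) *
      ∑' n, 2⁻¹ ^ (n - q) * conv (wp W 6)
        (conv (fun a => ∑' m, nearGrad P W ∞ m φ a) (nearField P W p n u)) w := by
  set E : ℝ≥0∞ := (d + 1) ^ 2 * ((C + C * C) * (((d + 1) ^ 2 * C * C) * ((d + 1) ^ 2 * C * C)))
  obtain ⟨T, hT⟩ := dd_eq_op W w
  have h1 : ∀ m, distLpNorm p (T (P.block q (u.deriv (P.block m φ)))) ≤
      ∑' n, E * (2⁻¹ ^ (n - q) *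
        conv (wp W 6) (conv (nearGrad P W ∞ m φ) (nearField P W p n u)) w) := fun m => by
    obtain ⟨G, hG, hb⟩ := h.exists_factors (p := p) hdiv hC hu q m (hφ m) hw
    have e : u.deriv (P.block m φ) = ∑ j, mulOp (G j) (u.c j).dist := by
      rw [deriv_eq, _root_.sum_apply]
      refine Finset.sum_congr rfl fun j _ => ?_
      rw [op_mul_apply, ← block_pd, ← hG, mulOp_dist, mulOp_dist, mul_comm]
    rw [e]
    have ht : Tendsto (fun k => ∑ n ∈ Finset.range k,
        T (P.block q (∑ j, mulOp (G j) (P.block n (u.c j).dist)))) atTop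
        (𝓝 (T (P.block q (∑ j, mulOp (G j) (u.c j).dist)))) := by
      have h2 : Tendsto (fun k => ∑ j, mulOp (G j) (∑ n ∈ Finset.range k, P.block n (u.c j).dist))
          atTop (𝓝 (∑ j, mulOp (G j) (u.c j).dist)) :=
        tendsto_finsetSum _ fun j _ =>
          ((mulOp (G j)).continuous.tendsto _).comp (P.tendsto_sum_block _)
      have h3 := ((T * (P.block q : Op d)).continuous.tendsto _).comp h2
      refine h3.congr fun k => ?_
      simp only [Function.comp_apply, op_mul_apply, map_sum]
      rw [Finset.sum_comm]
    refine (distLpNorm_le_tsum ht).trans (ENNReal.tsum_le_tsum fun n => ?_)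
    have := hb n
    rwa [vN, hT] at this
  rw [vN, hT]
  refine (P.distLpNorm_le_tsum_block (T * (P.block q * u.deriv : Op d)) φ).trans
    ((ENNReal.tsum_le_tsum fun m => h1 m).trans ?_)
  rw [ENNReal.tsum_comm, ← ENNReal.tsum_mul_left]
  refine ENNReal.tsum_le_tsum fun n => ?_
  rw [ENNReal.tsum_mul_left, ENNReal.tsum_mul_left]
  refine mul_le_mul' le_rfl (mul_le_mul' le_rfl ?_)
  have hadd : ∀ x y : ℕ → ℝ≥0∞, ∑' n, (x n + y n) ≤ ∑' n, x n + ∑' n, y n := fun x y =>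
    ENNReal.tsum_add.le
  have hmul : ∀ (c : ℝ≥0∞) (x : ℕ → ℝ≥0∞), ∑' n, c * x n ≤ c * ∑' n, x n := fun c x =>
    ENNReal.tsum_mul_left.le
  refine (conv_subadditive (fun x : ℕ → ℝ≥0∞ => ∑' m, x m) hadd hmul (wp W 6)
    (fun m => conv (nearGrad P W ∞ m φ) (nearField P W p n u)) w).trans
    (conv_mono (fun _ _ => le_rfl) fun a _ => ?_)
  have := conv_subadditive (fun x : ℕ → ℝ≥0∞ => ∑' m, x m) hadd hmul (nearField P W p n u)
    (fun m => nearGrad P W ∞ m φ) a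
  rw [conv_comm (fun a => ∑' m, nearGrad P W ∞ m φ a)]
  simpa only [conv_comm (nearGrad P W ∞ _ φ)] using this

theorem wlr_nearField_le (hr : 1 ≤ r) (s : ℝ) (u : SmoothField d) (w : List (Fin N)) :
    wlr s r (fun q => nearField P W p q u w) ≤
      youngC (|s| - 1) * ∑ j, bN P W s p r (u.c j).dist w := by
  rw [Finset.mul_sum]
  refine le_trans ?_ (Finset.sum_le_sum fun l _ => wlr_nearN_le hr s (u.c l).dist w)
  have := lr_sum_le hr Finset.univ fun (l : Fin d) q => bw s q * nearN P W p q (u.c l).dist w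
  simp only [← Finset.mul_sum] at this
  exact this

theorem tsum_nearGrad_le (φ : 𝓢'(Space d, ℂ)) (w : List (Fin N)) :
    ∑' m, nearGrad P W ∞ m φ w ≤ youngC (|0| - 1) * ∑ l, bN P W 0 ∞ 1 (pd l φ) w := by
  have := wlr_nearGrad_le (P := P) (W := W) (p := ∞) (r := 1) le_rfl 0 φ w
  rw [wlr, lr_one] at this
  simpa only [bw_zero, one_mul] using this

theorem wlr_prod_le (hr : 1 ≤ r) (ε : ℝ) {H H' : List (Fin N) → ℝ≥0∞} {y : ℝ≥0∞}
    (hH : ∀ a, H a ≤ y * H' a) (u : SmoothField d) (w : List (Fin N)) :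
    wlr (-ε) r (fun q => ∑' n, 2⁻¹ ^ (n - q) *
      conv (wp W 6) (conv H (nearField P W p n u)) w) ≤
      youngC (max (-ε) (ε - 1)) * (youngC (|-ε| - 1) * y) *
        conv (wp W 6) (conv (fun a => ∑ j, bN P W (-ε) p r (u.c j).dist a) H') w := by
  refine (wlr_one_sided_le hr _).trans ?_
  rw [mul_assoc]
  refine mul_le_mul' le_rfl ((wlr_conv_le hr _ _ _).trans ?_)
  rw [← conv_mul_right]
  refine conv_mono (fun _ _ => le_rfl) fun b _ => (wlr_conv_le hr _ _ _).trans ?_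
  rw [conv_comm _ H', mul_comm (youngC _) y, mul_assoc, ← conv_mul_right, ← conv_mul_left]
  exact conv_mono (fun c _ => hH c) fun c _ => wlr_nearField_le hr _ _ _

theorem BandBound.bN_deriv_le' (hdiv : ∀ i, (W i).IsDivFree) (h : BandBound P (K + 1 + 1) C)
    (hC : C ≠ ⊤) (hu : u.IsDivFree) (hr : 1 ≤ r) (ε : ℝ) {φ : 𝓢'(Space d, ℂ)}
    (hφ : ∀ m j, distLpNorm ∞ (P.block m (pd j φ)) ≠ ⊤) (hw : 2 * w.length + 1 ≤ K) :
    bN P W (-ε) p r (u.deriv φ) w ≤ (d + 1) * C ^ 2 * youngC (|-ε| - 1) *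
      ((d + 1) ^ 2 * ((C + C * C) * (((d + 1) ^ 2 * C * C) * ((d + 1) ^ 2 * C * C))) *
        (youngC (max (-ε) (ε - 1)) * (youngC (|-ε| - 1) * youngC (|0| - 1)))) *
      conv (wp W 8) (conv (fun a => ∑ j, bN P W (-ε) p r (u.c j).dist a)
        (fun a => ∑ l, bN P W 0 ∞ 1 (pd l φ) a)) w := by
  obtain ⟨E, hE⟩ : ∃ E : ℝ≥0∞, E =
    (d + 1) ^ 2 * ((C + C * C) * (((d + 1) ^ 2 * C * C) * ((d + 1) ^ 2 * C * C))) := ⟨_, rfl⟩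
  rw [← hE]
  refine (h.base.bN_le hdiv hr (-ε) (u.deriv φ) (by omega)).trans ?_
  rw [mul_assoc ((d + 1 : ℝ≥0∞) * C ^ 2 * youngC (|-ε| - 1))]
  refine mul_le_mul' le_rfl ?_
  rw [show 8 = 2 + 6 from rfl, ← conv_wp_add, ← conv_mul_right]
  refine conv_mono (fun _ _ => le_rfl) fun a ha => ?_
  have h1 := fun q => h.vN_block_deriv_le' (p := p) hdiv hC hu q hφ (by omega : 2 * a.length + 1 ≤ K)
  rw [← hE] at h1
  refine (wlr_mono h1).trans ?_
  rw [wlr_const_mul hr, mul_assoc E]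
  exact mul_le_mul' le_rfl (wlr_prod_le hr ε (fun b => tsum_nearGrad_le _ _) u a)

theorem youngC_lt_top {a : ℝ} (ha : a < 0) : youngC a < ⊤ := (youngC_ne_top ha).lt_top

theorem eq_zero_of_besovNorm_eq_zero {s : ℝ} (hr : 1 ≤ r) {f : 𝓢'(Space d, ℂ)}
    (h : besovNorm P s p r f = 0) : f = 0 := by
  have h1 : ∀ n, P.block n f = 0 := fun n => by
    refine eq_zero_of_distLpNorm_eq_zero (p := p) ?_
    have := le_wlr hr s (fun n => distLpNorm p (P.block n f)) n
    rw [← besovNorm_eq, h, nonpos_iff_eq_zero, mul_eq_zero] at this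
    exact this.resolve_left (bw_ne_zero s n)
  have h2 := P.tendsto_sum_block f
  simp only [h1, Finset.sum_const_zero] at h2
  exact (tendsto_nhds_unique h2 tendsto_const_nhds)

/-- The product estimate. -/
theorem product_estimate (P : LittlewoodPaley d) (k : ℕ) {ρ : ℝ} (hρ : 0 < ρ) (M : ℝ≥0) {ε : ℝ}
    (hε₀ : 0 < ε) (hε₁ : ε < 1) : ∃ C : ℝ≥0, 0 < C ∧
      ∀ (N : ℕ) (W : Fin N → SmoothField d), (∀ i, (W i).IsDivFree) →
        familyHolderNorm P W ρ k ≤ M →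
      ∀ u : SmoothField d, u.IsDivFree → ∀ φ : 𝓢'(Space d, ℂ),
      ∀ (p r : ℝ≥0∞) [Fact (1 ≤ p)], 1 ≤ r →
        striatedNorm P W (-ε) k p r (u.deriv φ) ≤
          C * min
            (∑ μ ∈ Finset.range (k + 1),
              fieldNorm P W 0 μ ∞ 1 u * gradNorm P W (-ε) (k - μ) p r φ)
            (∑ μ ∈ Finset.range (k + 1),
              fieldNorm P W (-ε) μ p r u * gradNorm P W 0 (k - μ) ∞ 1 φ) := by
  obtain ⟨B, hB⟩ := exists_bandBound P (2 * k + 1 + 1 + 1)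
  obtain ⟨A₁, hA₁⟩ := exists_tm_wp P k hρ M 5
  obtain ⟨A₂, hA₂⟩ := exists_tm_wp P k hρ M 8
  have y1 : youngC (|-ε| - 1) < ⊤ := youngC_lt_top (by rw [abs_neg, abs_of_pos hε₀]; linarith)
  have y2 : youngC (max (-ε) (ε - 1)) < ⊤ := youngC_lt_top (max_lt (by linarith) (by linarith))
  have y3 : youngC (|0| - 1) < ⊤ := youngC_lt_top (by simp)
  set c₁ : ℝ≥0∞ := (d + 1) * B ^ 2 * youngC (|-ε| - 1) *
    (d * (B * ((d + 1) ^ 2 * B * B)) * (youngC (max (-ε) (ε - 1)) * youngC (|-ε| - 1)))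
  set c₂ : ℝ≥0∞ := (d + 1) * B ^ 2 * youngC (|-ε| - 1) *
      ((d + 1) ^ 2 * ((B + B * B) * (((d + 1) ^ 2 * B * B) * ((d + 1) ^ 2 * B * B))) *
        (youngC (max (-ε) (ε - 1)) * (youngC (|-ε| - 1) * youngC (|0| - 1))))
  have hfin : ∀ c : ℝ≥0∞, c < ⊤ → ∀ A : ℝ≥0, c * ((k + 1) ^ 2 * 2 ^ k * (A * ((k + 1) * 2 ^ k))) ≠ ⊤ :=
    fun c hc A => by finiteness
  have hc₁ : c₁ < ⊤ := by finiteness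
  have hc₂ : c₂ < ⊤ := by finiteness
  lift c₁ * ((k + 1) ^ 2 * 2 ^ k * (A₁ * ((k + 1) * 2 ^ k))) to ℝ≥0 using hfin _ hc₁ A₁ with D₁ hD₁
  lift c₂ * ((k + 1) ^ 2 * 2 ^ k * (A₂ * ((k + 1) * 2 ^ k))) to ℝ≥0 using hfin _ hc₂ A₂ with D₂ hD₂
  refine ⟨D₁ + D₂ + 1, by positivity, fun N W hdiv hM u hu φ p r _ hr => ?_⟩
  have hmain : ∀ {c : ℝ≥0∞} {A : ℝ≥0} {F G : List (Fin N) → ℝ≥0∞} {n : ℕ}, tm (wp W n) k ≤ A →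
      (∀ w : List (Fin N), w.length ≤ k → bN P W (-ε) p r (u.deriv φ) w ≤
        c * conv (wp W n) (conv F G) w) →
      striatedNorm P W (-ε) k p r (u.deriv φ) ≤
        c * ((k + 1) ^ 2 * 2 ^ k * (A * ((k + 1) * 2 ^ k))) *
          ∑ μ ∈ Finset.range (k + 1), tm F μ * tm G (k - μ) := by
    intro c A F G n hA hb
    rw [striatedNorm_eq]
    refine (tm_mono hb).trans ?_
    rw [tm_const_mul]
    calc _ ≤ c * ((k + 1) ^ 2 * 2 ^ k * (A * ((k + 1) * 2 ^ k *
          ∑ μ ∈ Finset.range (k + 1), tm F μ * tm G (k - μ)))) := by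
          gcongr
          exact (tm_conv_le _ _ k).trans (by gcongr; exact tm_conv_le_sum F G k)
      _ = _ := by ring
  have key : ∀ {a b c D : ℝ≥0∞}, c ≤ D * a → c ≤ D * b → c ≤ D * min a b := fun {a b c D} ha hb => by
    rcases min_choice a b with h | h <;> rw [h] <;> assumption
  refine key ?_ ?_
  · refine (hmain (hA₁ N W hM).1 fun w hw => hB.bN_deriv_le hdiv hu hr ε φ (by omega)).trans ?_
    rw [← hD₁]
    push_cast
    refine mul_le_mul' (le_self_add.trans le_self_add) (Finset.sum_le_sum fun μ _ => ?_)
    rw [tm_sum_bN_pd]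
    exact mul_le_mul' (tm_fieldN_le u μ) le_rfl
  · have e : ∀ μ, tm (fun a => ∑ j, bN P W (-ε) p r (u.c j).dist a) μ = fieldNorm P W (-ε) μ p r u :=
      fun μ => by
        rw [tm_sum, fieldNorm]
        simp only [striatedNorm_eq]; rfl
    -- With the convention `0 · ∞ = 0` the right-hand side carries no information on `φ` when `u =
    -- 0`; but then the left-hand side vanishes.
    by_cases hu0 : fieldNorm P W (-ε) 0 p r u = 0
    · have hz : ∀ j, (u.c j).dist = 0 := fun j => by
        rw [fieldNorm, Finset.sum_eq_zero_iff] at hu0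
        have := hu0 j (Finset.mem_univ j)
        rw [striatedNorm_eq, tm, Finset.sum_range_one, mass_zero] at this
        exact eq_zero_of_besovNorm_eq_zero hr this
      have h0 : u.deriv φ = 0 := by
        rw [deriv_eq, _root_.sum_apply]
        refine Finset.sum_eq_zero fun j _ => ?_
        rw [op_mul_apply, TFun.eq_zero_of_dist_eq_zero (hz j), mulOp_zero]; rfl
      have h1 : ∀ w, bN P W (-ε) p r (0 : 𝓢'(Space d, ℂ)) w = 0 := fun w => by
        rw [bN, dd_zero, besovNorm_eq]
        simp only [map_zero, distLpNorm_zero]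
        simpa using wlr_const_mul (s := -ε) hr 0 fun _ => 0
      rw [h0, striatedNorm_eq]
      exact (Finset.sum_eq_zero fun m _ => Finset.sum_eq_zero fun l _ => h1 _).le.trans zero_le
    -- The term `μ = 0` of the sum is infinite, as the norm of `u` is not zero.
    by_cases hφ : gradNorm P W 0 k ∞ 1 φ = ⊤
    · have h1 : fieldNorm P W (-ε) 0 p r u * gradNorm P W 0 (k - 0) ∞ 1 φ = ⊤ := by
        rw [Nat.sub_zero, hφ, ENNReal.mul_top hu0]
      have h2 : ∑ μ ∈ Finset.range (k + 1),
          fieldNorm P W (-ε) μ p r u * gradNorm P W 0 (k - μ) ∞ 1 φ = ⊤ :=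
        ENNReal.sum_eq_top.2 ⟨0, by simp, h1⟩
      rw [h2, ENNReal.mul_top (by simp)]
      exact le_top
    -- With finite norms the blocks of the gradient are bounded functions, as the exchange of
    -- factors requires.
    have hblock : ∀ m j, distLpNorm ∞ (P.block m (pd j φ)) ≠ ⊤ := fun m j => by
      rw [← tm_sum_bN_pd] at hφ
      have h1 : distLpNorm ∞ (P.block m (pd j φ)) ≤ tm (fun a => ∑ l, bN P W 0 ∞ 1 (pd l φ) a) k := by
        refine le_trans ?_ (mass_le_tm _ (Nat.zero_le k))
        rw [mass_zero]
        refine le_trans ?_ (Finset.single_le_sum (f := fun l => bN P W 0 ∞ 1 (pd l φ) [])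
          (fun _ _ => zero_le) (Finset.mem_univ j))
        have := le_wlr (r := 1) le_rfl 0 (fun n => distLpNorm ∞ (P.block n (pd j φ))) m
        rw [bw_zero, one_mul] at this
        exact this
      exact ne_top_of_le_ne_top hφ h1
    refine (hmain (hA₂ N W hM).1 fun w hw => hB.bN_deriv_le' hdiv ENNReal.coe_ne_top hu hr ε hblock
      (by omega)).trans ?_
    rw [← hD₂]
    push_cast
    refine mul_le_mul' (le_add_self.trans le_self_add) (Finset.sum_le_sum fun μ _ => ?_)
    rw [tm_sum_bN_pd, e]

end ProductEstimate

end

section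

variable {d : ℕ}

/-! ### Homogeneous symbols on annuli -/

/-- The singularity of `g` at the origin is not seen, because `h` vanishes near it. -/
theorem exists_bddFam_mul {ι : Type*} (h : 𝓢(Space d, ℂ)) {δ : ℝ} (hδ : 0 < δ)
    (hz : ∀ ξ, ‖ξ‖ < δ → h ξ = 0)
    {g : ι → Space d → ℂ} (hg : ∀ i, ContDiffOn ℝ ∞ (g i) {0}ᶜ)
    (hb : ∀ n : ℕ, ∃ A : ℝ, ∀ i ξ, δ ≤ ‖ξ‖ → ‖iteratedFDeriv ℝ n (g i) ξ‖ ≤ A) :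
    ∃ S : ι → 𝓢(Space d, ℂ), (∀ i ξ, S i ξ = h ξ * g i ξ) ∧ BddFam S := by
  choose A hA using hb
  have hopen : IsOpen ({0}ᶜ : Set (Space d)) := isOpen_compl_singleton
  have hloc : ∀ i ξ, ‖ξ‖ < δ → (fun ξ => h ξ * g i ξ) =ᶠ[𝓝 ξ] fun _ => 0 := by
    intro i ξ hξ
    have : Metric.ball (0 : Space d) δ ∈ 𝓝 ξ := Metric.isOpen_ball.mem_nhds (by simpa using hξ)
    filter_upwards [this] with ζ hζ
    rw [hz ζ (by simpa using hζ), zero_mul]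
  have hsm : ∀ i, ContDiff ℝ ∞ fun ξ => h ξ * g i ξ := by
    intro i
    rw [contDiff_iff_contDiffAt]
    intro ξ
    by_cases h0 : ‖ξ‖ < δ
    · exact contDiffAt_const.congr_of_eventuallyEq (hloc i ξ h0)
    · have hne : ξ ∈ ({0}ᶜ : Set (Space d)) := by
        intro h1; rw [h1, norm_zero] at h0; exact h0 hδ
      exact (h.smooth ⊤).contDiffAt.mul ((hg i).contDiffAt (hopen.mem_nhds hne))
  have hbd : ∀ (k n : ℕ) (i : ι) (ξ : Space d),
      ‖ξ‖ ^ k * ‖iteratedFDeriv ℝ n (fun ξ => h ξ * g i ξ) ξ‖ ≤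
        ∑ j ∈ Finset.range (n + 1), (n.choose j : ℝ) * SchwartzMap.seminorm ℂ k j h * |A (n - j)| := by
    intro k n i ξ
    by_cases h0 : ‖ξ‖ < δ
    · rw [(Filter.EventuallyEq.iteratedFDeriv ℝ (hloc i ξ h0) n).eq_of_nhds]
      rw [iteratedFDeriv_zero_fun, Pi.zero_apply, norm_zero, mul_zero]
      positivity
    · have hne : ξ ∈ ({0}ᶜ : Set (Space d)) := by
        intro h1; rw [h1, norm_zero] at h0; exact h0 hδ
      have h1 := norm_iteratedFDerivWithin_mul_le (𝕜 := ℝ) (N := ∞) ((h.smooth ⊤).contDiffOn (s := {0}ᶜ)) (hg i)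
        hopen.uniqueDiffOn hne (n := n) (by exact_mod_cast le_top)
      simp only [iteratedFDerivWithin_of_isOpen _ hopen hne] at h1
      refine (mul_le_mul_of_nonneg_left h1 (by positivity)).trans ?_
      rw [Finset.mul_sum]
      refine Finset.sum_le_sum fun j _ => ?_
      have h2 := SchwartzMap.le_seminorm ℂ k j h ξ
      have h3 := (hA (n - j) i ξ (not_lt.1 h0)).trans (le_abs_self _)
      calc _ = (n.choose j : ℝ) * (‖ξ‖ ^ k * ‖iteratedFDeriv ℝ j h ξ‖)
            * ‖iteratedFDeriv ℝ (n - j) (g i) ξ‖ := by ring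
        _ ≤ _ := by gcongr
  refine ⟨fun i => ⟨fun ξ => h ξ * g i ξ, hsm i, fun k n => ⟨_, hbd k n i⟩⟩, fun i ξ => rfl,
    fun k n => ⟨_, fun i => SchwartzMap.seminorm_le_bound ℂ k n _ (by positivity) (hbd k n i)⟩⟩

variable {m₀ : Space d → ℂ}

theorem contDiffOn_comp_smul (hm : IsZeroOrderSymbol m₀) (s : ℝˣ) :
    ContDiffOn ℝ ∞ (fun ξ => m₀ ((s : ℝ) • ξ)) {0}ᶜ := by
  refine hm.1.comp (contDiff_const_smul (s : ℝ)).contDiffOn fun ξ hξ => ?_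
  simpa using hξ

/-- The Mikhlin condition is invariant under dilations: the factor `|s|^n` of the chain rule turns
`|ξ|^n` into `|s ξ|^n`. -/
theorem norm_iteratedFDeriv_comp_smul_le (hm : IsZeroOrderSymbol m₀) (n : ℕ) :
    ∃ A : ℝ, ∀ (s : ℝˣ) (ξ : Space d), ξ ≠ 0 →
      ‖ξ‖ ^ n * ‖iteratedFDeriv ℝ n (fun ξ => m₀ ((s : ℝ) • ξ)) ξ‖ ≤ A := by
  obtain ⟨A, hA⟩ := hm.2 n
  refine ⟨A, fun s ξ hξ => ?_⟩
  have hopen : IsOpen ({0}ᶜ : Set (Space d)) := isOpen_compl_singleton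
  let e : Space d ≃L[ℝ] Space d := ContinuousLinearEquiv.smulLeft s
  have hs : (s : ℝ) • ξ ≠ 0 := smul_ne_zero s.ne_zero hξ
  have h1 := e.iteratedFDerivWithin_comp_right m₀ hopen.uniqueDiffOn (x := ξ) hs n
  have h2 : IsOpen (e ⁻¹' ({0}ᶜ : Set (Space d))) := hopen.preimage e.continuous
  rw [iteratedFDerivWithin_of_isOpen _ h2 (show ξ ∈ e ⁻¹' ({0}ᶜ : Set (Space d)) from hs),
    iteratedFDerivWithin_of_isOpen _ hopen (show e ξ ∈ ({0}ᶜ : Set (Space d)) from hs)] at h1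
  have h3 : ‖iteratedFDeriv ℝ n (fun ξ => m₀ ((s : ℝ) • ξ)) ξ‖ ≤
      ‖iteratedFDeriv ℝ n m₀ ((s : ℝ) • ξ)‖ * |(s : ℝ)| ^ n := by
    change ‖iteratedFDeriv ℝ n (m₀ ∘ e) ξ‖ ≤ _
    rw [h1]
    refine (ContinuousMultilinearMap.norm_compContinuousLinearMap_le _ _).trans ?_
    rw [Finset.prod_const, Finset.card_univ, Fintype.card_fin]
    refine mul_le_mul_of_nonneg_left (pow_le_pow_left₀ (norm_nonneg _) ?_ n) (norm_nonneg _)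
    refine ContinuousLinearMap.opNorm_le_bound _ (abs_nonneg _) fun x => ?_
    exact (norm_smul (s : ℝ) x).le
  refine (mul_le_mul_of_nonneg_left h3 (by positivity)).trans (le_trans (le_of_eq ?_) (hA _ hs))
  rw [norm_smul, Real.norm_eq_abs]; ring

theorem contDiffAt_norm_rpow (σ : ℝ) {ξ : Space d} (hξ : ξ ≠ 0) :
    ContDiffAt ℝ ∞ (fun ξ : Space d => ((‖ξ‖ ^ σ : ℝ) : ℂ)) ξ :=
  Complex.ofRealCLM.contDiff.contDiffAt.comp ξ
    ((contDiffAt_norm ℝ hξ).rpow_const_of_ne (norm_ne_zero_iff.2 hξ))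

/-- The rescaled symbol `‖ξ‖^σ m₀(s ξ)`. -/
def scaledSymbol (σ : ℝ) (m₀ : Space d → ℂ) (s : ℝˣ) : Space d → ℂ :=
  powerSymbol σ fun ζ => m₀ ((s : ℝ) • ζ)

theorem powerSymbol_smul (σ : ℝ) (m₀ : Space d → ℂ) (s : ℝˣ) (ξ : Space d) :
    powerSymbol σ m₀ ((s : ℝ) • ξ) = ((|(s : ℝ)| ^ σ : ℝ) : ℂ) * scaledSymbol σ m₀ s ξ := by
  rw [powerSymbol, scaledSymbol, powerSymbol, norm_smul, Real.norm_eq_abs,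
    Real.mul_rpow (abs_nonneg _) (norm_nonneg _)]
  push_cast; ring

/-- On a fixed annulus `|ξ|^σ` is smooth, and the dilates of `m₀` are bounded uniformly in `s`. -/
theorem exists_annSymbol (P : LittlewoodPaley d) (σ : ℝ) (hm : IsZeroOrderSymbol m₀) :
    ∃ a : ℝˣ → 𝓢(Space d, ℂ), (∀ s ξ, a s ξ = P.ann ξ * scaledSymbol σ m₀ s ξ) ∧ BddFam a := by
  have hsm : ContDiff ℝ ∞ fun ξ : Space d => P.ann ξ * ((‖ξ‖ ^ σ : ℝ) : ℂ) := by
    rw [contDiff_iff_contDiffAt]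
    intro ξ
    by_cases h : ξ = 0
    · have h1 : (fun ξ : Space d => P.ann ξ * ((‖ξ‖ ^ σ : ℝ) : ℂ)) =ᶠ[𝓝 ξ] fun _ => 0 := by
        have : Metric.ball (0 : Space d) (3 / 32) ∈ 𝓝 ξ := by
          rw [h]; exact Metric.ball_mem_nhds _ (by norm_num)
        filter_upwards [this] with ζ hζ
        rw [P.ann_eq_zero (by simpa using hζ), zero_mul]
      exact contDiffAt_const.congr_of_eventuallyEq h1
    · exact (P.ann.smooth ⊤).contDiffAt.mul (contDiffAt_norm_rpow σ h)
  let hS : 𝓢(Space d, ℂ) := (LittlewoodPaley.hasCompactSupport_of_norm (R := 16 / 3)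
    (f := fun ξ : Space d => P.ann ξ * ((‖ξ‖ ^ σ : ℝ) : ℂ)) fun ξ h => by
      by_contra! hlt
      exact h (by rw [P.ann_eq_zero' hlt, zero_mul])).toSchwartzMap hsm
  have hS_apply : ∀ ξ, hS ξ = P.ann ξ * ((‖ξ‖ ^ σ : ℝ) : ℂ) := fun ξ => rfl
  obtain ⟨S, hS1, hS2⟩ := exists_bddFam_mul (ι := ℝˣ) hS (δ := 3 / 32) (by norm_num)
    (fun ξ hξ => by rw [hS_apply, P.ann_eq_zero hξ, zero_mul])
    (contDiffOn_comp_smul hm) (fun n => by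
      obtain ⟨A, hA⟩ := norm_iteratedFDeriv_comp_smul_le hm n
      refine ⟨A / (3 / 32) ^ n, fun s ξ hξ => ?_⟩
      have h0 : ξ ≠ 0 := by rintro rfl; norm_num at hξ
      rw [le_div_iff₀ (by positivity), mul_comm]
      exact (mul_le_mul_of_nonneg_right (pow_le_pow_left₀ (by norm_num) hξ n)
        (norm_nonneg _)).trans (hA s ξ h0))
  refine ⟨S, fun s ξ => ?_, hS2⟩
  rw [hS1, hS_apply, scaledSymbol, powerSymbol, mul_assoc]

/-! ### Integrability of the symbol -/

theorem IsZeroOrderSymbol.exists_norm_le (hm : IsZeroOrderSymbol m₀) (σ : ℝ) :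
    ∃ A : ℝ, 0 ≤ A ∧ ∀ (s : ℝˣ) (ξ : Space d), ξ ≠ 0 → ‖scaledSymbol σ m₀ s ξ‖ ≤ A * ‖ξ‖ ^ σ := by
  obtain ⟨A, hA⟩ := hm.2 0
  refine ⟨|A|, abs_nonneg A, fun s ξ hξ => ?_⟩
  have h1 := hA _ (smul_ne_zero s.ne_zero hξ)
  rw [pow_zero, one_mul, norm_iteratedFDeriv_zero] at h1
  rw [scaledSymbol, powerSymbol, norm_mul, Complex.norm_real, Real.norm_of_nonneg (by positivity), mul_comm]
  exact mul_le_mul_of_nonneg_right (h1.trans (le_abs_self A)) (by positivity)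

theorem ae_ne_zero (hd : 0 < d) : ∀ᵐ ξ : Space d, ξ ≠ 0 := by
  have : Nontrivial (Space d) := Module.nontrivial_of_finrank_pos (R := ℝ) (by simpa using hd)
  exact compl_mem_ae_iff.2 (measure_singleton 0)

theorem aestronglyMeasurable_scaledSymbol (hd : 0 < d) (hm : IsZeroOrderSymbol m₀) (σ : ℝ) (s : ℝˣ) :
    AEStronglyMeasurable (scaledSymbol σ m₀ s) := by
  have hopen : IsOpen ({0}ᶜ : Set (Space d)) := isOpen_compl_singleton
  have h1 : ContinuousOn (scaledSymbol σ m₀ s) {0}ᶜ := fun ξ hξ =>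
    ((contDiffAt_norm_rpow σ hξ).continuousAt.mul
      ((contDiffOn_comp_smul hm s).continuousOn.continuousAt (hopen.mem_nhds hξ))).continuousWithinAt
  have h2 := h1.aestronglyMeasurable (μ := volume) hopen.measurableSet
  rwa [Measure.restrict_eq_self_of_ae_mem (s := {0}ᶜ) (ae_ne_zero hd)] at h2

/-- `σ > -1 ≥ -d`. -/
theorem integrableOn_norm_rpow (hd : 0 < d) {σ : ℝ} (hσ : -1 < σ) (R : ℝ) :
    IntegrableOn (fun ξ : Space d => ‖ξ‖ ^ σ) (Metric.ball 0 R) := by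
  have hd1 : (1 : ℝ) ≤ d := by exact_mod_cast hd
  refine integrableOn_ball_of_norm_le_rpow (by simpa using Nat.succ_le_of_lt hd) (C := 1) (α := -σ)
    (by simp; linarith) (ae_of_all _ fun ξ => ?_) ?_
  · rw [neg_neg, one_mul, Real.norm_of_nonneg (by positivity)]
  · exact (measurable_norm.pow_const σ).aestronglyMeasurable

theorem tempInt_scaledSymbol (hd : 0 < d) (hm : IsZeroOrderSymbol m₀) {σ : ℝ} (hσ : -1 < σ) (s : ℝˣ) :
    TempInt (scaledSymbol σ m₀ s) := by
  obtain ⟨A, hA0, hA⟩ := hm.exists_norm_le σ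
  -- The decay `n - |σ|` that is left at infinity then exceeds `d`.
  obtain ⟨n, hn⟩ := exists_nat_gt (|σ| + d)
  have hmeas := aestronglyMeasurable_scaledSymbol hd hm σ s
  refine ⟨n, ?_⟩
  have h1 : Integrable (fun ξ : Space d => A * (Metric.ball 0 1).indicator (fun ξ => ‖ξ‖ ^ σ) ξ +
      A * (1 + ‖ξ‖) ^ (-((n : ℝ) - |σ|))) :=
    (((integrableOn_norm_rpow hd hσ 1).integrable_indicator measurableSet_ball).const_mul A).add
      ((integrable_one_add_norm (by simp; linarith)).const_mul A)
  refine h1.mono' ?_ ?_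
  · have hc : Continuous fun x : Space d => ((1 + ‖x‖) ^ n)⁻¹ :=
      ((continuous_const.add continuous_norm).pow n).inv₀ fun x => (pow_pos (one_add_norm_pos x) n).ne'
    exact hc.aestronglyMeasurable.smul hmeas
  · filter_upwards [ae_ne_zero hd] with ξ hξ
    rw [norm_smul, norm_inv, norm_pow, Real.norm_of_nonneg (by positivity : 0 ≤ 1 + ‖ξ‖)]
    have h2 := hA s ξ hξ
    have hinv : ((1 + ‖ξ‖) ^ n)⁻¹ ≤ 1 := inv_le_one_of_one_le₀ (one_le_pow₀ (by simp))
    by_cases hb : ‖ξ‖ < 1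
    · rw [Set.indicator_of_mem (by simpa using hb)]
      have h3 : 0 ≤ A * (1 + ‖ξ‖) ^ (-((n : ℝ) - |σ|)) := by positivity
      have := mul_le_mul hinv h2 (norm_nonneg _) zero_le_one
      linarith
    · rw [Set.indicator_of_notMem (by simpa using hb), mul_zero, zero_add]
      have h4 : ‖ξ‖ ^ σ ≤ (1 + ‖ξ‖) ^ |σ| :=
        (Real.rpow_le_rpow_of_exponent_le (not_lt.1 hb) (le_abs_self σ)).trans
          (Real.rpow_le_rpow (norm_nonneg _) (by simp) (abs_nonneg σ))
      calc _ ≤ ((1 + ‖ξ‖) ^ n)⁻¹ * (A * (1 + ‖ξ‖) ^ |σ|) := by gcongr; exact h2.trans (by gcongr)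
        _ = _ := by
          rw [neg_sub, Real.rpow_sub (by positivity), Real.rpow_natCast]; field_simp

end

section

variable {d : ℕ}

/-! ### A standard mollifier -/

/-- An even mollifier supported in the unit ball. -/
def etaR (d : ℕ) : Space d → ℝ :=
  (⟨1 / 2, 1, by norm_num, by norm_num⟩ : ContDiffBump (0 : Space d)).normed volume

theorem etaR_contDiff : ContDiff ℝ ∞ (etaR d) := ContDiffBump.contDiff_normed _

theorem etaR_hasCompactSupport : HasCompactSupport (etaR d) := ContDiffBump.hasCompactSupport_normed _

theorem integral_etaR : ∫ ζ, etaR d ζ = 1 := ContDiffBump.integral_normed _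

theorem etaR_neg (ζ : Space d) : etaR d (-ζ) = etaR d ζ := ContDiffBump.normed_neg _ ζ

theorem etaR_eq_zero {ζ : Space d} (h : 1 < ‖ζ‖) : etaR d ζ = 0 := by
  by_contra h0
  have h1 : ζ ∈ Function.support (etaR d) := h0
  rw [etaR, ContDiffBump.support_normed_eq] at h1
  have : ‖ζ‖ < 1 := by simpa using h1
  linarith

/-- `etaR` as a complex Schwartz function. -/
def etaS (d : ℕ) : 𝓢(Space d, ℂ) :=
  (etaR_hasCompactSupport.comp_left (g := fun x : ℝ => (x : ℂ)) Complex.ofReal_zero).toSchwartzMap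
    (Complex.ofRealCLM.contDiff.comp etaR_contDiff)

theorem etaS_apply (ζ : Space d) : etaS d ζ = (etaR d ζ : ℂ) := rfl

/-- The rescaled mollifier `|t|^{-d} η(t⁻¹ ·)`. -/
def etaSc (t : ℝˣ) : 𝓢(Space d, ℂ) := (((|(t : ℝ)| ^ d)⁻¹ : ℝ) : ℂ) • dil t (etaS d)

theorem etaSc_apply (t : ℝˣ) (ζ : Space d) :
    etaSc t ζ = (((|(t : ℝ)| ^ d)⁻¹ : ℝ) : ℂ) * (etaR d ((t : ℝ)⁻¹ • ζ) : ℂ) := by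
  rw [etaSc, smul_apply, dil_apply, etaS_apply, smul_eq_mul]

theorem integral_scale {G : Type*} [NormedAddCommGroup G] [NormedSpace ℝ G] (t : ℝˣ) (f : Space d → G) :
    ∫ y, (|(t : ℝ)| ^ d)⁻¹ • f ((t : ℝ)⁻¹ • y) = ∫ y, f y := by
  rw [integral_smul, Measure.integral_comp_inv_smul, smul_smul, finrank_euclideanSpace_fin, abs_pow,
    inv_mul_cancel₀ (pow_ne_zero _ (abs_ne_zero.2 t.ne_zero)), one_smul]

variable {ν ν' : Space d → ℂ}

theorem mollify_eq_cv (ν : Space d → ℂ) (t : ℝˣ) : mollify ν (etaR d) t = cv (etaSc t) ν := by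
  funext ξ
  rw [mollify, cv, ← integral_scale t]
  refine integral_congr_ae (ae_of_all _ fun y => ?_)
  simp only [etaSc_apply]
  rw [smul_smul, mul_inv_cancel₀ t.ne_zero, one_smul, Complex.real_smul, smul_eq_mul, mul_assoc]

theorem cv_comm (F κ : Space d → ℂ) : cv F κ = cv κ F := by
  funext x
  rw [cv, cv, ← integral_sub_left_eq_self _ volume x]
  simp only [sub_sub_cancel, smul_eq_mul, mul_comm]

theorem mollify_temperate (hν : TempInt ν) (t : ℝˣ) :
    (mollify ν (etaR d) t).HasTemperateGrowth := by
  rw [mollify_eq_cv, cv_comm]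
  exact hν.hasTemperateGrowth_cv _

theorem mollify_congr {t : ℝ} {ξ : Space d} (h : ∀ ζ, ‖ξ - ζ‖ ≤ |t| → ν ζ = ν' ζ) :
    mollify ν (etaR d) t ξ = mollify ν' (etaR d) t ξ := by
  refine integral_congr_ae (ae_of_all _ fun ζ => ?_)
  by_cases hζ : 1 < ‖ζ‖
  · simp [etaR_eq_zero hζ]
  · simp only []
    rw [h]
    rw [sub_sub_cancel, norm_smul, Real.norm_eq_abs]
    exact mul_le_of_le_one_right (abs_nonneg t) (not_lt.1 hζ)

theorem mollify_scale (ν : Space d → ℂ) (s t : ℝˣ) (ξ : Space d) :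
    mollify ν (etaR d) t ξ = mollify (fun ζ => ν ((s : ℝ) • ζ)) (etaR d) ((t * s⁻¹ : ℝˣ) : ℝ) ((s : ℝ)⁻¹ • ξ) := by
  refine integral_congr_ae (ae_of_all _ fun ζ => ?_)
  simp only [smul_sub, smul_smul, mul_inv_cancel₀ s.ne_zero, one_smul]
  congr 3
  rw [Units.val_mul, Units.val_inv_eq_inv_val, mul_comm (t : ℝ), ← mul_assoc,
    mul_inv_cancel₀ s.ne_zero, one_mul]

theorem mollify_const_mul (c : ℂ) (ν : Space d → ℂ) (t : ℝ) (ξ : Space d) :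
    mollify (fun ζ => c * ν ζ) (etaR d) t ξ = c * mollify ν (etaR d) t ξ := by
  rw [mollify, mollify, ← integral_const_mul]
  exact integral_congr_ae (ae_of_all _ fun ζ => by simp only []; ring)

theorem mollify_add (hν : TempInt ν) (hν' : TempInt ν') (t : ℝˣ) (ξ : Space d) :
    mollify (fun ζ => ν ζ + ν' ζ) (etaR d) t ξ =
      mollify ν (etaR d) t ξ + mollify ν' (etaR d) t ξ := by
  simp only [mollify_eq_cv, cv_comm (etaSc t)]
  rw [cv, cv, cv, ← integral_add (hν.integrable_cv _ ξ) (hν'.integrable_cv _ ξ)]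
  simp only [add_smul]

theorem fourier_etaS_zero : (FourierTransform.fourier (etaS d) : 𝓢(Space d, ℂ)) 0 = 1 := by
  rw [SchwartzMap.fourier_coe, Real.fourier_eq]
  simp only [inner_zero_right, neg_zero, AddChar.map_zero_eq_one, one_smul, etaS_apply]
  rw [integral_complex_ofReal, integral_etaR, Complex.ofReal_one]

/-- Mollification is multiplication of the inverse Fourier transform by the dilated transform of
`η`. The mollifier is chosen even to remove a reflection. -/
theorem exists_schwartz_mollify (μ : 𝓢(Space d, ℂ)) (t : ℝˣ) (ξ : Space d) :
    (FourierTransform.fourier (SchwartzMap.smulLeftCLM ℂ (dil t⁻¹ (FourierTransform.fourier (etaS d)) :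
      Space d → ℂ) (FourierTransform.fourierInv μ)) : 𝓢(Space d, ℂ)) ξ = mollify μ (etaR d) t ξ := by
  rw [fourier_mul_fourierInv_apply, mollify_eq_cv, cv_comm]
  simp only [fourierInv_dil, FourierTransform.fourierInv_fourier_eq]
  refine integral_congr_ae (ae_of_all _ fun y => ?_)
  simp only [etaSc_apply, etaS_apply, smul_eq_mul, Complex.real_smul, Units.val_inv_eq_inv_val]
  rw [← neg_sub y ξ, smul_neg, etaR_neg, abs_inv, inv_pow]

theorem tendsto_schwartz_mollify (μ : 𝓢(Space d, ℂ)) {α : Type*} {l : Filter α} {t : α → ℝˣ}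
    (ht : Tendsto (fun a => (t a : ℝ)) l (𝓝[≥] 0)) :
    Tendsto (fun a => (FourierTransform.fourier (SchwartzMap.smulLeftCLM ℂ
      (dil (t a)⁻¹ (FourierTransform.fourier (etaS d)) : Space d → ℂ) (FourierTransform.fourierInv μ)) :
        𝓢(Space d, ℂ))) l (𝓝 μ) := by
  have h2 : Tendsto (fun a => SchwartzMap.smulLeftCLM ℂ (dil (t a)⁻¹ (FourierTransform.fourier (etaS d)) :
      Space d → ℂ) (FourierTransform.fourierInv μ)) l (𝓝 (FourierTransform.fourierInv μ)) := by
    refine tendsto_scale ht (FourierTransform.fourier (etaS d)) (FourierTransform.fourierInv μ)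
      (fun a x => ?_) fun x => ?_
    · rw [SchwartzMap.smulLeftCLM_apply_apply (SchwartzMap.hasTemperateGrowth _), dil_apply, smul_eq_mul]
      simp
    · rw [fourier_etaS_zero, one_mul]
  have h3 := ((FourierTransform.fourierCLM ℂ 𝓢(Space d, ℂ)).continuous.tendsto _).comp h2
  have h5 : FourierTransform.fourierCLM ℂ 𝓢(Space d, ℂ) (FourierTransform.fourierInv μ) = μ := by
    change (FourierTransform.fourier (FourierTransform.fourierInv μ : 𝓢(Space d, ℂ)) : 𝓢(Space d, ℂ)) = μ
    exact FourierTransform.fourier_fourierInv_eq μ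
  rw [h5] at h3
  exact h3

/-- The symbol and the transformed test function trade places, which exhibits linearity and
continuity in `a`. -/
theorem mult_apply_apply (a : 𝓢(Space d, ℂ)) (f : 𝓢'(Space d, ℂ)) (θ : 𝓢(Space d, ℂ)) :
    mult a f θ = f (FourierTransform.fourierCLM ℂ 𝓢(Space d, ℂ) (SchwartzMap.smulLeftCLM ℂ
      ((FourierTransform.fourierInv θ : 𝓢(Space d, ℂ)) : Space d → ℂ) a)) := by
  change f (FourierTransform.fourier (SchwartzMap.smulLeftCLM ℂ (a : Space d → ℂ)
    (FourierTransform.fourierInv θ))) = f (FourierTransform.fourier (SchwartzMap.smulLeftCLM ℂ _ a))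
  congr 2
  ext x
  rw [SchwartzMap.smulLeftCLM_apply_apply (SchwartzMap.hasTemperateGrowth _),
    SchwartzMap.smulLeftCLM_apply_apply (SchwartzMap.hasTemperateGrowth _), smul_eq_mul, smul_eq_mul, mul_comm]

theorem mult_sub (a b : 𝓢(Space d, ℂ)) (f : 𝓢'(Space d, ℂ)) :
    mult (a - b : 𝓢(Space d, ℂ)) f = mult a f - mult b f := by
  ext θ
  rw [sub_apply]
  simp only [mult_apply_apply, map_sub]

theorem mult_smul (c : ℂ) (b : 𝓢(Space d, ℂ)) (f : 𝓢'(Space d, ℂ)) :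
    mult (c • b : 𝓢(Space d, ℂ)) f = c • mult b f := by
  ext θ
  rw [smul_apply]
  simp only [mult_apply_apply, map_smul]

theorem mult_sum {κ : Type*} (s : Finset κ) (a : κ → 𝓢(Space d, ℂ)) (f : 𝓢'(Space d, ℂ)) :
    mult (∑ i ∈ s, a i : 𝓢(Space d, ℂ)) f = ∑ i ∈ s, mult (a i) f := by
  ext θ
  rw [sum_apply]
  simp only [mult_apply_apply, map_sum]

theorem tendsto_mult_of_tendsto {α : Type*} {l : Filter α} {a : α → 𝓢(Space d, ℂ)} {b : 𝓢(Space d, ℂ)}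
    (h : Tendsto a l (𝓝 b)) (f : 𝓢'(Space d, ℂ)) :
    Tendsto (fun i => mult (a i) f) l (𝓝 (mult b f)) := by
  refine PointwiseConvergenceCLM.tendsto_iff_forall_tendsto.2 fun θ => ?_
  simp only [mult_apply_apply]
  exact (f.continuous.tendsto _).comp (((FourierTransform.fourierCLM ℂ 𝓢(Space d, ℂ)).continuous.tendsto _).comp
    (((SchwartzMap.smulLeftCLM ℂ _).continuous.tendsto _).comp h))

theorem tendsto_mult_mollify (μ : 𝓢(Space d, ℂ)) {α : Type*} {l : Filter α} {t : α → ℝˣ}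
    (ht : Tendsto (fun a => (t a : ℝ)) l (𝓝[≥] 0)) (f : 𝓢'(Space d, ℂ)) :
    Tendsto (fun a => mult (mollify μ (etaR d) (t a)) f) l (𝓝 (mult μ f)) := by
  refine (tendsto_mult_of_tendsto (tendsto_schwartz_mollify μ ht) f).congr fun a => ?_
  congr 2
  funext ξ
  exact exists_schwartz_mollify μ (t a) ξ

/-- For `|t| ≤ 1` the rescaled mollifiers are supported in the unit ball and have the same `L¹`
norm, so their weighted integrals are uniformly bounded. -/
theorem exists_bddFam_mollify {ι : Type*} {b : ι → 𝓢(Space d, ℂ)} (hb : BddFam b) :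
    ∃ X : ι × {t : ℝˣ // |(t : ℝ)| ≤ 1} → 𝓢(Space d, ℂ),
      (∀ i t ξ, X (i, t) ξ = mollify (b i) (etaR d) (t : ℝˣ) ξ) ∧ BddFam X := by
  obtain ⟨X, hX, hX'⟩ := exists_bddFam_cv (ι := ι × {t : ℝˣ // |(t : ℝ)| ≤ 1})
    (F := fun i => etaSc (d := d) (i.2 : ℝˣ)) (κ := fun i => b i.1) (hb.comp _) (fun k => by
      refine ⟨2 ^ k * ∫ y, ‖etaS d y‖, fun i => ?_⟩
      have hle : ∀ y, (1 + ‖y‖) ^ k * ‖etaSc (d := d) (i.2 : ℝˣ) y‖ ≤ 2 ^ k * ‖etaSc (d := d) (i.2 : ℝˣ) y‖ := by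
        intro y
        by_cases hy : ‖y‖ ≤ 1
        · gcongr; linarith
        · have h0 : etaSc (d := d) (i.2 : ℝˣ) y = 0 := by
            rw [etaSc_apply, etaR_eq_zero, Complex.ofReal_zero, mul_zero]
            rw [norm_smul, norm_inv, Real.norm_eq_abs]
            have h1 : 1 ≤ |((i.2 : ℝˣ) : ℝ)|⁻¹ := (one_le_inv₀ (abs_pos.2 (i.2 : ℝˣ).ne_zero)).2 i.2.2
            nlinarith
          rw [h0]; simp
      have hint : Integrable fun y => 2 ^ k * ‖etaSc (d := d) (i.2 : ℝˣ) y‖ :=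
        ((etaSc (i.2 : ℝˣ)).integrable.norm).const_mul _
      have hi : Integrable fun y => (1 + ‖y‖) ^ k * ‖etaSc (d := d) (i.2 : ℝˣ) y‖ := by
        refine hint.mono' (by fun_prop) (ae_of_all _ fun y => ?_)
        rw [Real.norm_of_nonneg (by positivity)]
        exact hle y
      refine ⟨hi, (integral_mono hi hint hle).trans (le_of_eq ?_)⟩
      rw [integral_const_mul, ← integral_scale (i.2 : ℝˣ) fun y => ‖etaS d y‖]
      congr 2
      funext y
      rw [etaSc_apply, norm_mul, ← etaS_apply, Complex.norm_real, Real.norm_of_nonneg (by positivity), smul_eq_mul])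
    (fun i => (SchwartzMap.continuous _).aestronglyMeasurable)
  refine ⟨X, fun i t ξ => ?_, hX'⟩
  rw [hX, mollify_eq_cv]

variable {m₀ : Space d → ℂ}

/-- The innermost ball, rescaled so that the mollifier has scale one. The symbol is merely
integrable there, with the bound `∫ |ξ|^σ` uniform in `s`, and the smoothness comes from the
mollifier. -/
theorem exists_bddFam_low (P : LittlewoodPaley d) (hd : 0 < d) (hm : IsZeroOrderSymbol m₀) {σ : ℝ}
    (hσ : -1 < σ) :
    ∃ Y : ℝˣ → 𝓢(Space d, ℂ), (∀ s ξ, Y s ξ =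
      mollify (fun ζ => P.lowS ζ * scaledSymbol σ m₀ s ζ) (etaR d) ((1 : ℝˣ) : ℝ) ξ) ∧ BddFam Y := by
  obtain ⟨A, hA0, hA⟩ := hm.exists_norm_le σ
  obtain ⟨B, hB0, hB⟩ := schwartz_decay P.lowS 0
  have hmeas : ∀ s, AEStronglyMeasurable fun ζ => P.lowS ζ * scaledSymbol σ m₀ s ζ := fun s =>
    P.lowS.continuous.aestronglyMeasurable.mul (aestronglyMeasurable_scaledSymbol hd hm σ s)
  obtain ⟨Y, hY, hY'⟩ := exists_bddFam_cv (ι := ℝˣ) (F := fun s ζ => P.lowS ζ * scaledSymbol σ m₀ s ζ)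
    (κ := fun _ => etaSc (d := d) 1) (bddFam_const _) (fun k => by
      have hint : Integrable fun y : Space d =>
          3 ^ k * (B * A) * (Metric.ball (0 : Space d) 2).indicator (fun ξ => ‖ξ‖ ^ σ) y :=
        ((integrableOn_norm_rpow hd hσ 2).integrable_indicator measurableSet_ball).const_mul _
      refine ⟨∫ y : Space d, 3 ^ k * (B * A) * (Metric.ball (0 : Space d) 2).indicator (fun ξ => ‖ξ‖ ^ σ) y,
        fun s => ?_⟩
      have hle : ∀ᵐ y : Space d, (1 + ‖y‖) ^ k * ‖P.lowS y * scaledSymbol σ m₀ s y‖ ≤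
          3 ^ k * (B * A) * (Metric.ball (0 : Space d) 2).indicator (fun ξ => ‖ξ‖ ^ σ) y := by
        filter_upwards [ae_ne_zero hd] with y hy
        by_cases h2 : ‖y‖ < 2
        · rw [Set.indicator_of_mem (by simpa using h2), norm_mul]
          have h3 := hB y
          rw [pow_zero, inv_one, mul_one] at h3
          calc _ ≤ 3 ^ k * (B * (A * ‖y‖ ^ σ)) := by
                gcongr
                · linarith
                · exact hA s y hy
            _ = _ := by ring
        · rw [Set.indicator_of_notMem (by simpa using h2), P.lowS_apply, P.χ_eq_zero (by linarith)]
          simp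
      have hi : Integrable fun y => (1 + ‖y‖) ^ k * ‖P.lowS y * scaledSymbol σ m₀ s y‖ := by
        refine hint.mono' ?_ ?_
        · exact (by fun_prop : Continuous fun y : Space d => (1 + ‖y‖) ^ k).aestronglyMeasurable.mul (hmeas s).norm
        · filter_upwards [hle] with y hy
          rwa [Real.norm_of_nonneg (by positivity)]
      exact ⟨hi, integral_mono_ae hi hint hle⟩) hmeas
  refine ⟨Y, fun s ξ => ?_, hY'⟩
  rw [hY, mollify_eq_cv, cv_comm]

end

section

variable {d : ℕ}

/-! ### Singular multipliers away from the origin and near it -/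

/-- The dyadic scale `2^{-i}`. -/
def sc (i : ℕ) : ℝˣ := (two ^ i)⁻¹

theorem coe_sc (i : ℕ) : ((sc i : ℝˣ) : ℝ) = (2 ^ i)⁻¹ := by
  rw [sc, Units.val_inv_eq_inv_val, coe_two_pow]

theorem tendsto_sc : Tendsto (fun i => ((sc i : ℝˣ) : ℝ)) atTop (𝓝[>] 0) := by
  simp only [coe_sc]
  refine tendsto_nhdsWithin_iff.2 ⟨tendsto_inv_atTop_zero.comp
    (tendsto_pow_atTop_atTop_of_one_lt one_lt_two), Eventually.of_forall fun n => ?_⟩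
  simp only [Set.mem_Ioi]; positivity

theorem tendsto_sc' : Tendsto (fun i => ((sc i : ℝˣ) : ℝ)) atTop (𝓝[≥] 0) :=
  tendsto_sc.mono_right (nhdsWithin_mono _ Set.Ioi_subset_Ici_self)

/-- Convergence of the mollified multipliers along dyadic scales. -/
def MultLim (m : Space d → ℂ) (f F : 𝓢'(Space d, ℂ)) : Prop :=
  Tendsto (fun L => mult (mollify m (etaR d) (sc L)) f) atTop (𝓝 F)

theorem IsMultiplierApply.multLim {m : Space d → ℂ} {f F : 𝓢'(Space d, ℂ)}
    (h : IsMultiplierApply m f F) : MultLim m f F :=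
  (h _ etaR_contDiff etaR_hasCompactSupport integral_etaR).comp tendsto_sc

variable {m : Space d → ℂ} {f F : 𝓢'(Space d, ℂ)}

theorem MultLim.map (h : MultLim m f F) (hm : TempInt m) {a : Space d → ℂ} (ha : a.HasTemperateGrowth) :
    MultLim m (mult a f) (mult a F) := by
  refine (((mult a).continuous.tendsto _).comp h).congr fun L => ?_
  simp only [Function.comp_apply]
  rw [← op_mul_apply, ← op_mul_apply, mult_comm ha (mollify_temperate hm _)]

theorem MultLim.pd (h : MultLim m f F) (hm : TempInt m) (j : Fin d) :
    MultLim m (pd j f) (pd j F) := by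
  rw [pd_eq_mult]; exact h.map hm (xi_temperate j)

theorem mult_mul_apply {a b : Space d → ℂ} (ha : a.HasTemperateGrowth) (hb : b.HasTemperateGrowth)
    (f : 𝓢'(Space d, ℂ)) : mult a (mult b f) = mult (a * b) f := by
  rw [← op_mul_apply, mult_mul ha hb]

/-- Where the symbol agrees with a Schwartz function near the support of a cutoff, `m(D)` is the
usual multiplier. -/
theorem MultLim.mult_eq (h : MultLim m f F) (hm : TempInt m) {b μ : 𝓢(Space d, ℂ)} {δ : ℝ} (hδ : 0 < δ)
    (hb : ∀ ξ, b ξ ≠ 0 → ∀ ζ, ‖ξ - ζ‖ ≤ δ → m ζ = μ ζ) : mult b F = mult b (mult μ f) := by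
  refine tendsto_nhds_unique (((mult b).continuous.tendsto _).comp h) ?_
  refine (((mult b).continuous.tendsto _).comp (tendsto_mult_mollify μ tendsto_sc' f)).congr' ?_
  have h1 : ∀ᶠ L in atTop, |((sc L : ℝˣ) : ℝ)| ≤ δ := by
    have h2 : Tendsto (fun L => |((sc L : ℝˣ) : ℝ)|) atTop (𝓝 0) := by
      simpa using (tendsto_sc.mono_right nhdsWithin_le_nhds).abs
    exact h2.eventually (eventually_le_nhds hδ)
  have hμ : TempInt (μ : Space d → ℂ) := ⟨0, by simpa using μ.integrable⟩
  filter_upwards [h1] with L hL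
  simp only [Function.comp_apply]
  rw [mult_mul_apply b.hasTemperateGrowth (mollify_temperate hμ _),
    mult_mul_apply b.hasTemperateGrowth (mollify_temperate hm _)]
  congr 2
  funext ξ
  by_cases h0 : b ξ = 0
  · simp [h0]
  · simp only [Pi.mul_apply]
    rw [mollify_congr fun ζ hζ => (hb ξ h0 ζ (hζ.trans hL)).symm]

/-- The product of two Schwartz functions. -/
def sprod (b a : 𝓢(Space d, ℂ)) : 𝓢(Space d, ℂ) := SchwartzMap.smulLeftCLM ℂ (b : Space d → ℂ) a

theorem sprod_apply (b a : 𝓢(Space d, ℂ)) (ξ : Space d) : sprod b a ξ = b ξ * a ξ := by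
  rw [sprod, SchwartzMap.smulLeftCLM_apply_apply b.hasTemperateGrowth, smul_eq_mul]

theorem annular_sprod {b : 𝓢(Space d, ℂ)} (hb : LittlewoodPaley.Annular b) (a : 𝓢(Space d, ℂ)) :
    LittlewoodPaley.Annular (sprod b a) := fun ξ h =>
  hb ξ fun h0 => h (by rw [sprod_apply, h0, zero_mul])

variable (P : LittlewoodPaley d)

theorem ann_eq_one' {ξ : Space d} (h1 : 1 / 6 < ‖ξ‖) (h2 : ‖ξ‖ < 3) : P.ann ξ = 1 := by
  rw [LittlewoodPaley.ann, sub_apply, P.cut_eq_one, P.cut_eq_zero, sub_zero]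
  · rw [LittlewoodPaley.abs_two_pow]; linarith
  · rw [LittlewoodPaley.abs_two_pow_inv]; linarith

variable {σ : ℝ} {m₀ : Space d → ℂ}

/-- A choice of Schwartz representatives of the rescaled symbols on the annulus. -/
structure AnnRep (P : LittlewoodPaley d) (σ : ℝ) (m₀ : Space d → ℂ) (a : ℝˣ → 𝓢(Space d, ℂ)) : Prop where
  temp : TempInt (powerSymbol σ m₀)
  eq : ∀ s ξ, a s ξ = P.ann ξ * scaledSymbol σ m₀ s ξ
  bdd : BddFam a

theorem exists_annRep (hd : 0 < d) (hσ : -1 < σ) (hm : IsZeroOrderSymbol m₀) :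
    ∃ a, AnnRep P σ m₀ a := by
  obtain ⟨a, ha, hb⟩ := exists_annSymbol P σ hm
  refine ⟨a, ?_, ha, hb⟩
  have := tempInt_scaledSymbol hd hm hσ 1
  simpa [scaledSymbol] using this

variable {P} {a : ℝˣ → 𝓢(Space d, ℂ)}

theorem dil_sprod_apply (b c : 𝓢(Space d, ℂ)) (s : ℝˣ) (f : 𝓢'(Space d, ℂ)) :
    mult (dil s (sprod b c)) f = mult (dil s b) (mult (dil s c) f) := by
  rw [mult_mul_apply (SchwartzMap.hasTemperateGrowth _) (SchwartzMap.hasTemperateGrowth _)]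
  congr 2
  funext ξ
  simp only [Pi.mul_apply, dil_apply, sprod_apply]

/-- Near the annulus of radius `|s|` the singular symbol is `|s|^σ` times the dilate of `a s`, a
Schwartz function. -/
theorem AnnRep.mult_dil_eq (ha : AnnRep P σ m₀ a) (h : MultLim (powerSymbol σ m₀) f F)
    {b : 𝓢(Space d, ℂ)} (hb : LittlewoodPaley.Annular b) (s : ℝˣ) :
    mult (dil s b) F = ((|(s : ℝ)| ^ σ : ℝ) : ℂ) • mult (dil s (sprod b (a s))) f := by
  have hs : 0 < |(s : ℝ)| := abs_pos.2 s.ne_zero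
  -- The annulus from `3/16` to `8/3`, enlarged by `1/49`, must stay between `1/6` and `3`, where
  -- `ann` is `1`; the inner gap is `3/16 - 1/6 = 1/48`.
  rw [h.mult_eq ha.temp (μ := ((|(s : ℝ)| ^ σ : ℝ) : ℂ) • dil s (a s)) (δ := |(s : ℝ)| / 49) (by positivity),
    mult_smul, map_smul, dil_sprod_apply]
  intro ξ hξ ζ hζ
  rw [dil_apply] at hξ
  obtain ⟨h1, h2⟩ := hb _ hξ
  have h3 : ‖(s : ℝ)⁻¹ • ξ - (s : ℝ)⁻¹ • ζ‖ ≤ 1 / 49 := by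
    rw [← smul_sub, norm_smul, norm_inv, Real.norm_eq_abs]
    calc _ ≤ |(s : ℝ)|⁻¹ * (|(s : ℝ)| / 49) := by gcongr
      _ = _ := by field_simp
  have h4 := norm_sub_norm_le ((s : ℝ)⁻¹ • ξ) ((s : ℝ)⁻¹ • ζ)
  have h5 := norm_sub_norm_le ((s : ℝ)⁻¹ • ζ) ((s : ℝ)⁻¹ • ξ)
  rw [norm_sub_rev] at h5
  have h6 := powerSymbol_smul σ m₀ s ((s : ℝ)⁻¹ • ζ)
  rw [smul_smul, mul_inv_cancel₀ s.ne_zero, one_smul] at h6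
  rw [smul_apply, dil_apply, ha.eq, ann_eq_one' P (by linarith) (by linarith), one_mul, h6,
    smul_eq_mul]

/-- Evaluation at a test function is continuous on `L^p`. Unlike the `L^p` norm, it passes to limits
of distributions, so bounds uniform along the mollification survive. -/
theorem exists_enorm_apply_le (p : ℝ≥0∞) [Fact (1 ≤ p)] (θ : 𝓢(Space d, ℂ)) :
    ∃ c : ℝ≥0, ∀ X : 𝓢'(Space d, ℂ), ‖X θ‖ₑ ≤ c * distLpNorm p X := by
  let Φ : Lp ℂ p (volume : Measure (Space d)) →L[ℂ] ℂ :=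
    (PointwiseConvergenceCLM.evalCLM (RingHom.id ℂ) ℂ θ).comp (Lp.toTemperedDistributionCLM ℂ volume p)
  refine ⟨‖Φ‖₊ + 1, fun X => ?_⟩
  by_cases h : distLpNorm p X = ⊤
  · rw [h, ENNReal.mul_top (by positivity)]; exact le_top
  · obtain ⟨G, rfl⟩ := exists_coe_of_distLpNorm_ne_top h
    rw [distLpNorm_coe]
    change ‖Φ G‖ₑ ≤ _
    refine (Φ.le_opENorm G).trans ?_
    gcongr
    simp [enorm]

end

section

variable {d : ℕ} {P : LittlewoodPaley d} {σ : ℝ} {m₀ : Space d → ℂ} {a : ℝˣ → 𝓢(Space d, ℂ)}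

/-! ### The low frequencies of a singular multiplier -/

/-- The norm of a rescaled multiplier on a symbol of order `σ`, with `τ` derivatives to spare. -/
def lowWeight (σ : ℝ) (τ : ℕ) (i : ℕ) : ℝ≥0∞ :=
  ‖((|((sc i : ℝˣ) : ℝ)| ^ σ : ℝ) : ℂ)‖ₑ * ‖((sc i : ℝˣ) : ℝ)‖ₑ ^ τ

theorem lowWeight_eq (σ : ℝ) (τ i : ℕ) :
    lowWeight σ τ i = ENNReal.ofReal ((2 : ℝ) ^ (-(σ + τ))) ^ i := by
  have h0 : (0 : ℝ) < (2 ^ i)⁻¹ := by positivity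
  have h1 : ‖(((2 ^ i : ℝ)⁻¹ ^ σ : ℝ) : ℂ)‖ₑ = ENNReal.ofReal ((2 ^ i : ℝ)⁻¹ ^ σ) := by
    rw [← ofReal_norm, Complex.norm_real, Real.norm_of_nonneg (by positivity)]
  have h2 : ‖(2 ^ i : ℝ)⁻¹‖ₑ = ENNReal.ofReal ((2 ^ i : ℝ)⁻¹) := Real.enorm_of_nonneg h0.le
  rw [lowWeight, coe_sc, abs_of_pos h0, h1, h2, ← ENNReal.ofReal_pow h0.le,
    ← ENNReal.ofReal_mul (by positivity), ← ENNReal.ofReal_pow (by positivity)]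
  congr 1
  rw [← Real.rpow_natCast _ τ, ← Real.rpow_add h0, ← Real.rpow_natCast _ i, ← Real.rpow_natCast _ i,
    Real.inv_rpow (by positivity), ← Real.rpow_mul zero_le_two, ← Real.rpow_mul zero_le_two,
    ← Real.rpow_neg zero_le_two]
  congr 1; ring

theorem tsum_lowWeight_ne_top {τ : ℕ} (h : 0 < σ + τ) : ∑' i, lowWeight σ τ i ≠ ⊤ := by
  simp only [lowWeight_eq]
  exact tsum_pow_ne_top (by linarith)

/-- Rescaled multipliers act on `f` with norm at most `|s|^τ B`. -/
def ScaleBound (p : ℝ≥0∞) [Fact (1 ≤ p)] (τ : ℕ) (B : ℝ≥0∞) (f : 𝓢'(Space d, ℂ)) : Prop :=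
  ∀ (C : ℝ≥0) (S : 𝓢(Space d, ℂ)) (s : ℝˣ), SymBound 2 C 1 S →
    distLpNorm p (mult (dil s S) f) ≤ C * ‖(s : ℝ)‖ₑ ^ τ * B

theorem scaleBound_zero {p : ℝ≥0∞} [Fact (1 ≤ p)] (f : 𝓢'(Space d, ℂ)) :
    ScaleBound p 0 (distLpNorm p f) f := by
  intro C S s h
  rw [pow_zero, mul_one]
  exact (h.dil s).opBound p f

/-- The derivative in front of `f` supplies a factor `ξ_h`, which has size `|s|` on the rescaled
symbol. -/
theorem scaleBound_one {p : ℝ≥0∞} [Fact (1 ≤ p)] (f : Fin d → 𝓢'(Space d, ℂ)) :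
    ScaleBound p 1 (∑ h, distLpNorm p (f h)) (∑ h, pd h (f h)) := by
  intro C S s h
  rw [map_sum, Finset.mul_sum]
  refine (distLpNorm_sum_le _ _).trans (Finset.sum_le_sum fun j _ => ?_)
  rw [← op_mul_apply, mult_mul_pd, pow_one]
  exact (((h.dil s).mono (K' := 0 + 1) (by omega) le_rfl).mul_xi j).opBound p (f j)

variable (P) in
/-- The annular piece `χ - χ(2 ·)`. -/
def ringS : 𝓢(Space d, ℂ) := P.lowS - P.cut two

theorem annular_ringS : LittlewoodPaley.Annular (ringS P) := by
  intro ξ h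
  constructor
  · by_contra! hlt
    refine h ?_
    rw [ringS, sub_apply, P.lowS_apply, P.χ_eq_one (by linarith), P.cut_eq_one]
    · simp
    · simp only [two, Units.val_mk0, abs_two]; linarith
  · by_contra! hlt
    refine h ?_
    rw [ringS, sub_apply, P.lowS_apply, P.χ_eq_zero (by linarith), P.cut_eq_zero]
    · simp
    · simp only [two, Units.val_mk0, abs_two]; linarith

theorem dil_sc_ringS (i : ℕ) (ξ : Space d) :
    dil (sc i) (ringS P) ξ + dil (sc (i + 1)) P.lowS ξ = dil (sc i) P.lowS ξ := by
  simp only [dil_apply, ringS, sub_apply, P.cut_apply, P.lowS_apply, coe_sc, inv_inv, smul_smul,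
    two, Units.val_mk0, pow_succ']
  ring

theorem tempInt_mul {m : Space d → ℂ} (hm : TempInt m) (b : 𝓢(Space d, ℂ)) : TempInt fun ζ => b ζ * m ζ :=
  hm.mul_tfun ⟨b, b.hasTemperateGrowth⟩

theorem mollify_dil_mul (b : 𝓢(Space d, ℂ)) (s t : ℝˣ) (ξ : Space d) :
    mollify (fun ζ => dil s b ζ * powerSymbol σ m₀ ζ) (etaR d) t ξ = ((|(s : ℝ)| ^ σ : ℝ) : ℂ) *
      mollify (fun ζ => b ζ * scaledSymbol σ m₀ s ζ) (etaR d) ((t * s⁻¹ : ℝˣ) : ℝ) ((s : ℝ)⁻¹ • ξ) := by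
  rw [mollify_scale _ s, ← mollify_const_mul]
  congr 1
  funext ζ
  rw [dil_apply, smul_smul, inv_mul_cancel₀ s.ne_zero, one_smul, powerSymbol_smul]
  ring

theorem AnnRep.mollify_low_eq (ha : AnnRep P σ m₀ a) (t : ℝˣ) (n j : ℕ) (ξ : Space d) :
    mollify (fun ζ => dil (sc n) P.lowS ζ * powerSymbol σ m₀ ζ) (etaR d) t ξ =
      ∑ i ∈ Finset.range j, mollify (fun ζ => dil (sc (n + i)) (ringS P) ζ * powerSymbol σ m₀ ζ) (etaR d) t ξ +
      mollify (fun ζ => dil (sc (n + j)) P.lowS ζ * powerSymbol σ m₀ ζ) (etaR d) t ξ := by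
  induction j with
  | zero => simp
  | succ j ih =>
    rw [ih, Finset.sum_range_succ, add_assoc, ← mollify_add (tempInt_mul ha.temp _) (tempInt_mul ha.temp _)]
    congr 3
    funext ζ
    rw [← add_mul, ← add_assoc n j 1, dil_sc_ringS]

theorem AnnRep.ring_mul_eq (ha : AnnRep P σ m₀ a) (s : ℝˣ) (ζ : Space d) :
    ringS P ζ * scaledSymbol σ m₀ s ζ = sprod (ringS P) (a s) ζ := by
  rw [sprod_apply, ha.eq]
  by_cases h : ringS P ζ = 0
  · simp [h]
  · obtain ⟨h1, h2⟩ := annular_ringS ζ h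
    rw [P.ann_eq_one h1 h2, one_mul]

theorem abs_sc_mul_inv_le {i L : ℕ} (h : i ≤ L) : |((sc L * (sc i)⁻¹ : ℝˣ) : ℝ)| ≤ 1 := by
  rw [Units.val_mul, Units.val_inv_eq_inv_val, coe_sc, coe_sc, inv_inv, abs_of_pos (by positivity),
    inv_mul_le_iff₀ (by positivity), mul_one]
  exact pow_le_pow_right₀ one_le_two h

/-- The ball of radius about `2^{-n}` is cut into rings down to the scale of the mollifier, plus the
remaining ball. The piece at scale `2^{-i}` contributes `2^{-i(σ+τ)}`: the power `σ` is the order of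
the symbol, `τ` comes from the derivatives in front of `f`. The bound is uniform in the
mollification scale. -/
theorem AnnRep.exists_low_bound (ha : AnnRep P σ m₀ a) (hd : 0 < d) (hσ : -1 < σ)
    (hm : IsZeroOrderSymbol m₀) : ∃ C : ℝ≥0, ∀ (p : ℝ≥0∞) [Fact (1 ≤ p)] (τ : ℕ) (B : ℝ≥0∞)
      (f : 𝓢'(Space d, ℂ)), ScaleBound p τ B f → ∀ n j : ℕ,
      distLpNorm p (mult (mollify (fun ζ => dil (sc n) P.lowS ζ * powerSymbol σ m₀ ζ) (etaR d) (sc (n + j))) f) ≤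
        C * B * ∑' i, lowWeight σ τ (i + n) := by
  obtain ⟨X, hX, hXb⟩ := exists_bddFam_mollify (ha.bdd.map (SchwartzMap.smulLeftCLM ℂ (ringS P : Space d → ℂ)))
  obtain ⟨Y, hY, hYb⟩ := exists_bddFam_low P hd hm hσ
  obtain ⟨C₁, hC₁⟩ := hXb.symBound 2
  obtain ⟨C₂, hC₂⟩ := hYb.symBound 2
  refine ⟨C₁ + C₂, fun p _ τ B f hf n j => ?_⟩
  have hsym : ∀ (C : ℝ≥0) (S : 𝓢(Space d, ℂ)) (i : ℕ), SymBound 2 C 1 S →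
      distLpNorm p (mult (((|((sc i : ℝˣ) : ℝ)| ^ σ : ℝ) : ℂ) • dil (sc i) S : 𝓢(Space d, ℂ)) f) ≤
        C * B * lowWeight σ τ i := by
    intro C S i hS
    rw [mult_smul]
    refine (distLpNorm_smul_le _ _).trans ((mul_le_mul_right (hf C S (sc i) hS) _).trans (le_of_eq ?_))
    rw [lowWeight]; ring
  -- For `i < j` a ring, on which the mollifier is relatively small; for `i = j` the last ball,
  -- whose size is the mollification scale.
  let T : ℕ → 𝓢(Space d, ℂ) := fun i => if h : i < j then
    ((|((sc (n + i) : ℝˣ) : ℝ)| ^ σ : ℝ) : ℂ) • dil (sc (n + i))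
      (X (sc (n + i), ⟨sc (n + j) * (sc (n + i))⁻¹, abs_sc_mul_inv_le (by omega)⟩)) else
    ((|((sc (n + i) : ℝˣ) : ℝ)| ^ σ : ℝ) : ℂ) • dil (sc (n + i)) (Y (sc (n + i)))
  have hT : mollify (fun ζ => dil (sc n) P.lowS ζ * powerSymbol σ m₀ ζ) (etaR d) (sc (n + j)) =
      ((∑ i ∈ Finset.range (j + 1), T i : 𝓢(Space d, ℂ)) : Space d → ℂ) := by
    funext ξ
    rw [ha.mollify_low_eq _ n j, sum_apply, Finset.sum_range_succ]
    congr 1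
    · refine Finset.sum_congr rfl fun i hi => ?_
      have hi' : i < j := Finset.mem_range.1 hi
      simp only [T, dif_pos hi']
      rw [mollify_dil_mul, smul_apply, dil_apply, hX, smul_eq_mul]
      congr 2
      funext ζ
      exact ha.ring_mul_eq _ ζ
    · simp only [T, lt_irrefl, dif_neg, not_false_eq_true]
      rw [mollify_dil_mul, smul_apply, dil_apply, hY, smul_eq_mul, mul_inv_cancel]
  rw [hT, mult_sum]
  refine (distLpNorm_sum_le _ _).trans ?_
  rw [← ENNReal.tsum_mul_left]
  refine le_trans (Finset.sum_le_sum fun i _ => ?_) (ENNReal.sum_le_tsum (Finset.range (j + 1)))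
  rw [add_comm i n]
  by_cases h : i < j
  · simp only [T, dif_pos h]
    refine (hsym C₁ _ (n + i) (hC₁ _)).trans ?_
    gcongr; exact le_self_add
  · simp only [T, dif_neg h]
    refine (hsym C₂ _ (n + i) (hC₂ _)).trans ?_
    gcongr; exact le_add_self

/-- Excludes a part of `F` with spectrum at the origin, which no ring detects. The tails of the
geometric series tend to zero, and the bound passes from the mollified symbols to `F` by evaluation
at test functions. -/
theorem AnnRep.tendsto_low (ha : AnnRep P σ m₀ a) (hd : 0 < d) (hσ : -1 < σ)
    (hm : IsZeroOrderSymbol m₀) {p : ℝ≥0∞} [Fact (1 ≤ p)] {τ : ℕ} (hτ : 0 < σ + τ) {B : ℝ≥0∞} (hB : B ≠ ⊤)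
    {f F : 𝓢'(Space d, ℂ)} (hf : ScaleBound p τ B f) (hF : MultLim (powerSymbol σ m₀) f F) :
    Tendsto (fun n => mult (dil (sc n) P.lowS) F) atTop (𝓝 0) := by
  obtain ⟨C, hC⟩ := ha.exists_low_bound hd hσ hm
  obtain ⟨D, hD⟩ := (bddFam_const (ι := Unit) P.lowS).symBound 0
  refine (tendsto_add_atTop_iff_nat 1).1 (PointwiseConvergenceCLM.tendsto_iff_forall_tendsto.2 fun θ => ?_)
  obtain ⟨c, hc⟩ := exists_enorm_apply_le p θ
  have hb : ∀ n, ‖mult (dil (sc (n + 1)) P.lowS) F θ‖ₑ ≤ c * (D * (C * B * ∑' i, lowWeight σ τ (i + n))) := by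
    intro n
    have h1 := PointwiseConvergenceCLM.tendsto_iff_forall_tendsto.1
      (((mult (dil (sc (n + 1)) P.lowS)).continuous.tendsto _).comp hF) θ
    refine le_of_tendsto ((continuous_enorm.tendsto _).comp h1) ?_
    -- The mollifier then moves points by at most `2^{-n}/16`. On the support of `χ(2^{n+1} ·)` this
    -- keeps `2^n |ζ|` below `2/3 + 1/16 < 3/4`, where `χ(2^n ·)` is `1`.
    filter_upwards [eventually_ge_atTop (n + 4)] with L hL
    obtain ⟨j, rfl⟩ := Nat.exists_eq_add_of_le (show n ≤ L by omega)
    refine (hc _).trans ?_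
    gcongr
    have h2 : mult (dil (sc (n + 1)) P.lowS) (mult (mollify (powerSymbol σ m₀) (etaR d) (sc (n + j))) f) =
        mult (dil (sc (n + 1)) P.lowS)
          (mult (mollify (fun ζ => dil (sc n) P.lowS ζ * powerSymbol σ m₀ ζ) (etaR d) (sc (n + j))) f) := by
      rw [mult_mul_apply (SchwartzMap.hasTemperateGrowth _) (mollify_temperate ha.temp _),
        mult_mul_apply (SchwartzMap.hasTemperateGrowth _) (mollify_temperate (tempInt_mul ha.temp _) _)]
      congr 2
      funext ξ
      simp only [Pi.mul_apply]
      by_cases h0 : dil (sc (n + 1)) P.lowS ξ = 0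
      · simp [h0]
      · congr 1
        refine mollify_congr fun ζ hζ => ?_
        rw [dil_apply, P.lowS_apply] at h0
        have h3 := P.χ_supp _ (by simpa using h0)
        rw [norm_smul, coe_sc, inv_inv, Real.norm_of_nonneg (by positivity), pow_succ'] at h3
        rw [coe_sc, abs_of_pos (by positivity)] at hζ
        have h4 : (2 : ℝ) ^ n * (2 ^ (n + j))⁻¹ ≤ 1 / 16 := by
          rw [pow_add, mul_inv, ← mul_assoc, mul_inv_cancel₀ (by positivity), one_mul, one_div]
          refine inv_anti₀ (by norm_num) ?_
          calc (16 : ℝ) = 2 ^ 4 := by norm_num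
            _ ≤ 2 ^ j := pow_le_pow_right₀ one_le_two (by omega)
        have h5 : (2 : ℝ) ^ n * ‖ξ - ζ‖ ≤ 1 / 16 := (mul_le_mul_of_nonneg_left hζ (by positivity)).trans h4
        have h6 := mul_le_mul_of_nonneg_left (norm_sub_norm_le ζ ξ) (by positivity : (0 : ℝ) ≤ 2 ^ n)
        rw [norm_sub_rev ζ ξ] at h6
        rw [dil_apply, P.lowS_apply, P.χ_eq_one, Complex.ofReal_one, one_mul]
        rw [norm_smul, coe_sc, inv_inv, Real.norm_of_nonneg (by positivity)]
        nlinarith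
    simp only [Function.comp_apply, h2]
    refine (((hD ()).dil _).opBound p _).trans ?_
    gcongr
    exact hC p τ B f hf n j
  have h0 : Tendsto (fun n => c * (D * (C * B * ∑' i, lowWeight σ τ (i + n)))) atTop (𝓝 0) := by
    have h1 := ENNReal.tendsto_sum_nat_add _ (tsum_lowWeight_ne_top hτ)
    have h2 := ENNReal.Tendsto.const_mul (a := c * (D * (C * B))) h1 (Or.inr (by finiteness))
    rw [mul_zero] at h2
    refine h2.congr fun n => by ring
  exact tendsto_zero_iff_enorm_tendsto_zero.2
    (tendsto_of_tendsto_of_tendsto_of_le_of_le tendsto_const_nhds h0 (fun _ => zero_le) hb)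

/-- The lowest block is the sum of its dyadic rings by `AnnRep.tendsto_low`. On each ring the
multiplier is regular, and the bounds form a geometric series with ratio `2^{-(σ+τ)}`. -/
theorem AnnRep.exists_low_freq (ha : AnnRep P σ m₀ a) (hd : 0 < d) (hσ : -1 < σ)
    (hm : IsZeroOrderSymbol m₀) {τ : ℕ} (hτ : 0 < σ + τ) :
    ∃ C : ℝ≥0, ∀ (p : ℝ≥0∞) [Fact (1 ≤ p)] (B : ℝ≥0∞) (f F : 𝓢'(Space d, ℂ)),
      MultLim (powerSymbol σ m₀) f F → ScaleBound p τ B f → distLpNorm p (P.block 0 F) ≤ C * B := by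
  obtain ⟨C, hC⟩ := (ha.bdd.map (SchwartzMap.smulLeftCLM ℂ (ringS P : Space d → ℂ))).symBound 2
  have hfin : C * ∑' i, lowWeight σ τ i ≠ ⊤ := ENNReal.mul_ne_top (by finiteness) (tsum_lowWeight_ne_top hτ)
  refine ⟨(C * ∑' i, lowWeight σ τ i).toNNReal + 1, fun p _ B f F hF hf => ?_⟩
  by_cases hB : B = ⊤
  · rw [hB, ENNReal.mul_top (by positivity)]; exact le_top
  have hpart : ∀ n, ∑ i ∈ Finset.range n, mult (dil (sc i) (ringS P)) F =
      P.block 0 F - mult (dil (sc n) P.lowS) F := by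
    intro n
    induction n with
    | zero =>
      rw [P.block_eq, mop]
      simp [sc, LittlewoodPaley.blockS]
    | succ n ih =>
      have h1 : dil (sc n) (ringS P) = dil (sc n) P.lowS - dil (sc (n + 1)) P.lowS := by
        ext ξ
        rw [sub_apply, ← dil_sc_ringS n ξ]; ring
      rw [Finset.sum_range_succ, ih, h1, mult_sub]; abel
  have hlim : Tendsto (fun n => ∑ i ∈ Finset.range n, mult (dil (sc i) (ringS P)) F) atTop (𝓝 (P.block 0 F)) := by
    simp only [hpart]
    have := (tendsto_const_nhds (x := P.block 0 F)).sub (ha.tendsto_low hd hσ hm hτ hB hf hF)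
    rwa [sub_zero] at this
  refine (distLpNorm_le_tsum hlim).trans ?_
  have hterm : ∀ i, distLpNorm p (mult (dil (sc i) (ringS P)) F) ≤ C * B * lowWeight σ τ i := by
    intro i
    rw [ha.mult_dil_eq hF annular_ringS]
    refine (distLpNorm_smul_le _ _).trans ((mul_le_mul_right (hf C _ (sc i) (hC (sc i))) _).trans (le_of_eq ?_))
    rw [lowWeight]; ring
  refine (ENNReal.tsum_le_tsum hterm).trans ?_
  rw [ENNReal.tsum_mul_left, ENNReal.coe_add, ENNReal.coe_toNNReal hfin]
  calc _ = (C * ∑' i, lowWeight σ τ i) * B := by ring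
    _ ≤ _ := by gcongr; exact le_self_add

end

section

variable {d N : ℕ} {P : LittlewoodPaley d} {σ : ℝ} {m₀ : Space d → ℂ} {a : ℝˣ → 𝓢(Space d, ℂ)}
  {W : Fin N → SmoothField d} {K : ℕ} {f F : 𝓢'(Space d, ℂ)} {p r : ℝ≥0∞} [Fact (1 ≤ p)]

/-! ### Striated estimates of a singular multiplier -/

theorem BddFam.sprod {ι κ : Type*} [Fintype ι] {a : κ → 𝓢(Space d, ℂ)} (ha : BddFam a)
    (b : ι → 𝓢(Space d, ℂ)) : BddFam fun x : ι × κ => sprod (b x.1) (a x.2) := by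
  intro k n
  choose A hA using fun i => ha.map (SchwartzMap.smulLeftCLM ℂ (b i : Space d → ℂ)) k n
  refine ⟨∑ i, |A i|, fun x => (hA x.1 x.2).trans ((le_abs_self _).trans ?_)⟩
  exact Finset.single_le_sum (f := fun i => |A i|) (fun i _ => abs_nonneg _) (Finset.mem_univ x.1)

variable (P) in
/-- The symbol of the `n`-th block with the low frequencies removed. -/
def highS (n : ℕ) : 𝓢(Space d, ℂ) := P.blockS n - sprod (P.blockS n) (P.cut (two ^ n))

theorem highS_apply (n : ℕ) (ξ : Space d) :
    highS P n ξ = P.blockS n ξ * (1 - P.cut (two ^ n) ξ) := by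
  rw [highS, sub_apply, sprod_apply]; ring

theorem highS_add_two (n : ℕ) : highS P (n + 2) = highS P 2 := by
  have h : ∀ n, highS P (n + 2) = P.bandS := by
    intro n
    ext ξ
    rw [highS_apply]
    change P.bandS ξ * _ = _
    by_cases h : P.bandS ξ = 0
    · rw [h, zero_mul]
    · rw [P.bandS_apply] at h
      have h1 := (P.ϕ_supp _ (by simpa using h)).1
      rw [norm_smul, Real.norm_two] at h1
      have h2 : (4 : ℝ) ≤ 2 ^ (n + 2) := by
        rw [pow_add]; nlinarith [one_le_pow₀ (one_le_two : (1 : ℝ) ≤ 2) (n := n)]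
      rw [P.cut_eq_zero, sub_zero, mul_one]
      rw [LittlewoodPaley.abs_two_pow]
      nlinarith
  rw [h, h 0]

theorem annular_highS (n : ℕ) : LittlewoodPaley.Annular (highS P n) := by
  intro ξ h
  rw [highS_apply] at h
  cases n with
  | zero =>
    have h1 := left_ne_zero_of_mul h
    have h2 := right_ne_zero_of_mul h
    change P.lowS ξ ≠ 0 at h1
    rw [P.lowS_apply] at h1
    have h3 := P.χ_supp _ (by simpa using h1)
    refine ⟨?_, by linarith⟩
    by_contra! hlt
    rw [P.cut_eq_one (by rw [LittlewoodPaley.abs_two_pow]; linarith)] at h2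
    simp at h2
  | succ n => exact P.annular_bandS ξ (left_ne_zero_of_mul h)

/-- Subtracting the lowest block multiplies every symbol by `1 - χ`. Even the block `n = 0` becomes
annular, so that `AnnRep.mult_dil_eq` covers the whole remainder. -/
theorem block_sub_low (n : ℕ) (F : 𝓢'(Space d, ℂ)) :
    P.block n (F - P.block 0 F) = mop n (highS P n) F := by
  have h : dil (two ^ n) (highS P n) = dil (two ^ n) (P.blockS n) -
      sprod (dil (two ^ n) (P.blockS n)) (P.lowS) := by
    ext ξ
    simp only [highS_apply, dil_apply, sub_apply, sprod_apply, P.cut_apply, P.lowS_apply, smul_smul,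
      mul_inv_cancel₀ (two ^ n).ne_zero, one_smul]
    ring
  rw [map_sub, mop, h, mult_sub]
  congr 1
  · rw [P.block_eq]; rfl
  · rw [P.block_eq, P.block_eq, mop_zero, mop,
      mult_mul_apply (SchwartzMap.hasTemperateGrowth _) (SchwartzMap.hasTemperateGrowth _)]
    congr 2
    funext ξ
    exact (sprod_apply _ _ ξ).symm

theorem enorm_two_pow_rpow (σ : ℝ) (n : ℕ) :
    ‖((|((two ^ n : ℝˣ) : ℝ)| ^ σ : ℝ) : ℂ)‖ₑ = ENNReal.ofReal (2 ^ σ) * bw σ n := by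
  rw [← ofReal_norm, Complex.norm_real, Real.norm_of_nonneg (by positivity), bw,
    ← ENNReal.ofReal_mul (by positivity), LittlewoodPaley.abs_two_pow, ← Real.rpow_natCast,
    ← Real.rpow_mul zero_le_two, ← Real.rpow_add two_pos]
  congr 2; ring

/-- Bounds for the symbols `b a(2^n)`, where `b` runs over the blocks and the high-frequency blocks. -/
structure MultBound (P : LittlewoodPaley d) (a : ℝˣ → 𝓢(Space d, ℂ)) (K : ℕ) (C : ℝ≥0∞) : Prop where
  band : BandBound P K C
  high : ∀ n, AnnBound P K C (sprod (highS P n) (a (two ^ n)))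
  block : ∀ n, AnnBound P K C (sprod P.bandS (a (two ^ n)))

theorem BandBound.mono {C C' : ℝ≥0∞} (h : BandBound P K C) (hC : C ≤ C') : BandBound P K C' where
  base := ⟨h.base.one_le.trans hC, fun n => (h.base.block n).mono le_rfl hC,
    fun n => (h.base.fat n).mono le_rfl hC, fun n j => (h.base.rho_block n j).mono le_rfl hC,
    fun n j => (h.base.rho_fat n j).mono le_rfl hC⟩
  rho j := (h.rho j).mono le_rfl hC

theorem AnnRep.exists_multBound (ha : AnnRep P σ m₀ a) (K : ℕ) : ∃ C : ℝ≥0, MultBound P a K C := by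
  obtain ⟨C₁, h₁⟩ := exists_bandBound P K
  -- Only three symbols occur among the `highS P n`: those of `n = 0`, `n = 1` and all `n ≥ 2`.
  obtain ⟨C₂, h₂⟩ := (ha.bdd.sprod fun i : Fin 3 => highS P i).annBound (P := P)
    (fun x => annular_sprod (annular_highS _) _) K
  obtain ⟨C₃, h₃⟩ := (ha.bdd.sprod fun _ : Unit => P.bandS).annBound (P := P)
    (fun x => annular_sprod P.annular_bandS _) K
  refine ⟨C₁ + C₂ + C₃, h₁.mono ?_, fun n => ?_, fun n => (h₃ ((), two ^ n)).mono le_rfl ?_⟩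
  · rw [ENNReal.coe_add, ENNReal.coe_add, add_assoc]; exact le_self_add
  · have h4 : (C₂ : ℝ≥0∞) ≤ ((C₁ + C₂ + C₃ : ℝ≥0) : ℝ≥0∞) := by
      rw [ENNReal.coe_add, ENNReal.coe_add]; exact le_add_self.trans le_self_add
    match n with
    | 0 => exact (h₂ (0, two ^ 0)).mono le_rfl h4
    | 1 => exact (h₂ (1, two ^ 1)).mono le_rfl h4
    | n + 2 => rw [highS_add_two]; exact (h₂ (2, two ^ (n + 2))).mono le_rfl h4
  · rw [ENNReal.coe_add]; exact le_add_self

variable {C : ℝ≥0∞}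

theorem MultBound.vN_high_le (h : MultBound P a K C) (ha : AnnRep P σ m₀ a)
    (hF : MultLim (powerSymbol σ m₀) f F) (hdiv : ∀ i, (W i).IsDivFree) (n : ℕ) {w : List (Fin N)}
    (hw : 2 * w.length + 1 ≤ K) :
    vN W p (P.block n (F - P.block 0 F)) w ≤ ENNReal.ofReal (2 ^ σ) * bw σ n *
      ((d + 1) ^ 2 * C * C * conv (wp W 2) (nearN P W p n f) w) := by
  rw [block_sub_low, mop, ha.mult_dil_eq hF (annular_highS n)]
  refine (vN_smul_le _ _ _).trans ?_
  rw [enorm_two_pow_rpow]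
  gcongr
  refine ((good_mop hdiv (k := w.length) hw h.band.base n (h.high n).sym fun _ => h.high n).dd_le f
    le_rfl).trans_eq ?_
  rw [conv_mul_left, conv_wt2]

theorem MultBound.bN_high_le (h : MultBound P a K C) (ha : AnnRep P σ m₀ a)
    (hF : MultLim (powerSymbol σ m₀) f F) (hdiv : ∀ i, (W i).IsDivFree) (hr : 1 ≤ r) (s : ℝ)
    {w : List (Fin N)} (hw : 2 * w.length + 1 ≤ K) :
    bN P W s p r (F - P.block 0 F) w ≤ (d + 1) * C ^ 2 * youngC (|s| - 1) *
      (ENNReal.ofReal (2 ^ σ) * ((d + 1) ^ 2 * C * C) * youngC (|s + σ| - 1)) *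
        conv (wp W 4) (bN P W (s + σ) p r f) w := by
  refine (h.band.base.bN_le hdiv hr s _ hw).trans ?_
  rw [mul_assoc ((d + 1) * C ^ 2 * youngC (|s| - 1))]
  gcongr
  refine (conv_mono (F' := wp W 2) (G' := fun b => ENNReal.ofReal (2 ^ σ) * ((d + 1) ^ 2 * C * C) *
    youngC (|s + σ| - 1) * conv (wp W 2) (bN P W (s + σ) p r f) b) (fun _ _ => le_rfl) fun b hb => ?_).trans_eq ?_
  · have h1 : ∀ q, vN W p (P.block q (F - P.block 0 F)) b ≤ ENNReal.ofReal (2 ^ σ) * ((d + 1) ^ 2 * C * C) *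
        (bw σ q * conv (wp W 2) (nearN P W p q f) b) := fun q =>
      (h.vN_high_le ha hF hdiv q (by omega)).trans_eq (by ring)
    refine (wlr_mono h1).trans ?_
    rw [wlr_const_mul hr, mul_assoc (ENNReal.ofReal (2 ^ σ) * ((d + 1) ^ 2 * C * C)), wlr_bw]
    gcongr
    refine (wlr_conv_le hr _ _ _).trans ?_
    rw [← conv_mul_right]
    exact conv_mono' (fun _ => le_rfl) (fun c => wlr_nearN_le hr _ f c) b
  · rw [conv_mul_right, conv_wp_add]

/-- `wp W 0` is the indicator of the empty word. The low part itself is needed only there; otherwise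
its gradient suffices, both for nonempty words and for the higher blocks, which decay like `2^{-n}`.
-/
theorem BaseBound.bN_low_le (h : BaseBound P (K + 1) C) (hr : 1 ≤ r) (s : ℝ) (F : 𝓢'(Space d, ℂ))
    (w : List (Fin N)) :
    bN P W s p r (P.block 0 F) w ≤ youngC (|s| - 1) * bw s 0 * (C * (d * C + 1) ^ w.length) *
      (wp W 2 w * gradN p (P.block 0 F) + wp W 0 w * distLpNorm p (P.block 0 F)) := by
  have hlow : Low P (P.block 0 F) := low_block F
  rw [bN, besovNorm_eq]
  have h1 : ∀ n, distLpNorm p (P.block n (dd W w (P.block 0 F))) ≤ 2⁻¹ ^ n * ((C * (d * C + 1) ^ w.length) *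
      (wp W 2 w * gradN p (P.block 0 F) + wp W 0 w * distLpNorm p (P.block 0 F))) := by
    intro n
    cases n with
    | succ n =>
      refine (hlow.block_succ_dd_le h n w).trans ?_
      rw [wt2_eq_wp, mul_add]
      refine le_trans (le_of_eq ?_) (mul_le_mul_right le_self_add _)
      rw [ENNReal.inv_pow]; ring
    | zero =>
      rw [pow_zero, one_mul, mul_assoc]
      refine (h.block_le 0 _).trans ?_
      gcongr
      cases w with
      | nil => simp [dd, wd, wp]
      | cons i w =>
        refine (hlow.dd_cons_le h i w).trans ?_
        rw [mul_add]
        refine le_trans ?_ le_self_add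
        rw [← mul_assoc]
        gcongr
        · exact le_add_self
        · exact Nat.le_succ _
        · rw [← wt2_eq_wp]; exact wt_le_wt2 _
  refine (wlr_mono h1).trans ((wlr_inv_pow_le hr s _).trans_eq (by ring))

theorem low_scale_le (hr : 1 ≤ r) (t : ℝ) (f : 𝓢'(Space d, ℂ)) :
    distLpNorm p (mop 1 P.lowS f) ≤ ((bw t 0)⁻¹ + (bw t 1)⁻¹) * besovNorm P t p r f := by
  have h : ∀ n, distLpNorm p (P.block n f) ≤ (bw t n)⁻¹ * besovNorm P t p r f := by
    intro n
    rw [besovNorm_eq]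
    have h1 := mul_le_mul_right (le_wlr hr t (fun n => distLpNorm p (P.block n f)) n) (bw t n)⁻¹
    rwa [← mul_assoc, ENNReal.inv_mul_cancel (bw_ne_zero t n) (bw_ne_top t n), one_mul] at h1
  rw [← P.sum_block_apply, Finset.sum_range_succ, Finset.sum_range_one, add_mul]
  exact (distLpNorm_add_le _ _).trans (add_le_add (h 0) (h 1))

/-- `χ(·/2)` is `1` on the support of `χ`. Inserted before `m(D)` acts, it reduces `f` to its first
two blocks. -/
theorem block_zero_eq (F : 𝓢'(Space d, ℂ)) : P.block 0 F = P.block 0 (mop 1 P.lowS F) := by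
  rw [P.block_eq, mop_zero, mop, mult_mul_apply (SchwartzMap.hasTemperateGrowth _) (SchwartzMap.hasTemperateGrowth _)]
  congr 2
  funext ξ
  have h := P.fatS_mul_blockS 0 ξ
  rw [mul_comm] at h
  exact h.symm

/-- The gradient corresponds to `τ = 1`, where `σ > -1` is enough; the block itself corresponds to
`τ = 0` and needs `σ > 0`. Any regularity `t` will do, because only the first two blocks of `f`
matter. -/
theorem AnnRep.exists_low_le (ha : AnnRep P σ m₀ a) (hd : 0 < d) (hσ : -1 < σ)
    (hm : IsZeroOrderSymbol m₀) (t : ℝ) : ∃ D : ℝ≥0, ∀ (p r : ℝ≥0∞) [Fact (1 ≤ p)], 1 ≤ r →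
      ∀ f F : 𝓢'(Space d, ℂ), MultLim (powerSymbol σ m₀) f F →
        gradN p (P.block 0 F) ≤ D * besovNorm P t p r f ∧
        (0 < σ → distLpNorm p (P.block 0 F) ≤ D * besovNorm P t p r f) := by
  have hc : (bw t 0)⁻¹ + (bw t 1)⁻¹ ≠ ⊤ := by simp [bw_ne_zero]
  obtain ⟨C₁, h₁⟩ := ha.exists_low_freq hd hσ hm (τ := 1) (by push_cast; linarith)
  have h₀ : ∃ C₀ : ℝ≥0, 0 < σ → ∀ (p : ℝ≥0∞) [Fact (1 ≤ p)] (B : ℝ≥0∞) (f F : 𝓢'(Space d, ℂ)),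
      MultLim (powerSymbol σ m₀) f F → ScaleBound p 0 B f → distLpNorm p (P.block 0 F) ≤ C₀ * B := by
    by_cases h : 0 < σ
    · obtain ⟨C, hC⟩ := ha.exists_low_freq hd hσ hm (τ := 0) (by simpa using h)
      exact ⟨C, fun _ => hC⟩
    · exact ⟨0, fun h' => absurd h' h⟩
  obtain ⟨C₀, h₀⟩ := h₀
  refine ⟨(d * C₁ + C₀) * ((bw t 0)⁻¹ + (bw t 1)⁻¹).toNNReal, fun p r _ hr f F hF => ?_⟩
  have hF' := hF.map ha.temp (SchwartzMap.hasTemperateGrowth (dil (two ^ 1) P.lowS))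
  have hs := low_scale_le (P := P) (p := p) hr t f
  rw [ENNReal.coe_mul, ENNReal.coe_toNNReal hc, mul_assoc]
  constructor
  · refine (gradN_le_of_forall fun j => ?_ : gradN p (P.block 0 F) ≤ d * (C₁ * distLpNorm p (mop 1 P.lowS f))).trans ?_
    · rw [block_zero_eq, ← block_pd]
      refine h₁ p _ _ _ (hF'.pd ha.temp j) ?_
      -- The vector with the single component `j`; its divergence is the derivative `∂_j`.
      have := scaleBound_one (p := p) fun h => if h = j then mop 1 P.lowS f else 0
      have h2 : ∑ h, pd h (if h = j then mop 1 P.lowS f else 0) = pd j (mop 1 P.lowS f) := by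
        rw [Finset.sum_eq_single j (fun h _ hj => by rw [if_neg hj, map_zero]) (by simp), if_pos rfl]
      have h3 : ∑ h, distLpNorm p (if h = j then mop 1 P.lowS f else 0) = distLpNorm p (mop 1 P.lowS f) := by
        rw [Finset.sum_eq_single j (fun h _ hj => by rw [if_neg hj, distLpNorm_zero]) (by simp), if_pos rfl]
      rwa [h2, h3] at this
    · rw [← mul_assoc]
      gcongr
      push_cast
      exact le_self_add
  · intro hpos
    rw [block_zero_eq]
    refine (h₀ hpos p _ _ _ hF' (scaleBound_zero _)).trans ?_
    change C₀ * distLpNorm p (mop 1 P.lowS f) ≤ _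
    gcongr
    exact le_add_self

end

/-! ### The multiplier estimate -/

section

variable {d N : ℕ} {P : LittlewoodPaley d} {σ : ℝ} {m₀ : Space d → ℂ} {a : ℝˣ → 𝓢(Space d, ℂ)}
  {W : Fin N → SmoothField d} {K : ℕ} {f F : 𝓢'(Space d, ℂ)} {p r : ℝ≥0∞} [Fact (1 ≤ p)]

theorem tm_wp_zero_le (n : ℕ) : tm (wp W 0) n ≤ 1 := by
  have h1 : ∀ m, mass (wp W 0) (m + 1) = 0 := fun m => Finset.sum_eq_zero fun l hl => by
    have h2 := length_word_of_mem hl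
    have h3 : word l ≠ [] := by rintro h; rw [h] at h2; simp at h2
    simp [wp, h3]
  rw [tm, Finset.sum_range_succ', Finset.sum_eq_zero (fun m _ => h1 m), zero_add, mass_zero]
  simp [wp]

/-- `m(D) f` is split into its lowest block and the rest, estimated by `BaseBound.bN_low_le` and
`MultBound.bN_high_le`. -/
theorem exists_bN_mult_le (hd : 0 < d) (P : LittlewoodPaley d) (n : ℕ) {σ s : ℝ} {m₀ : Space d → ℂ}
    (hσ : -1 < σ) (hm : IsZeroOrderSymbol m₀) (hs : |s| < 1) (hsσ : |s + σ| < 1) :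
    ∃ C : ℝ≥0, ∀ (N : ℕ) (W : Fin N → SmoothField d), (∀ i, (W i).IsDivFree) →
      ∀ f F : 𝓢'(Space d, ℂ), MultLim (powerSymbol σ m₀) f F → ∀ (p r : ℝ≥0∞) [Fact (1 ≤ p)], 1 ≤ r →
      ∀ w : List (Fin N), w.length ≤ n → bN P W s p r F w ≤ C * (conv (wp W 4) (bN P W (s + σ) p r f) w +
        wp W 0 w * (if σ ≤ 0 then distLpNorm p (P.block 0 F) else 0)) := by
  obtain ⟨a, ha⟩ := exists_annRep P hd hσ hm
  obtain ⟨C, hC⟩ := ha.exists_multBound (2 * n + 1 + 1)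
  obtain ⟨D, hD⟩ := ha.exists_low_le hd hσ hm (s + σ)
  have hy := youngC_ne_top (a := |s| - 1) (by linarith)
  have hy' := youngC_ne_top (a := |s + σ| - 1) (by linarith)
  set A : ℝ≥0∞ := (d + 1) * C ^ 2 * youngC (|s| - 1) *
      (ENNReal.ofReal (2 ^ σ) * ((d + 1) ^ 2 * C * C) * youngC (|s + σ| - 1)) with hA
  set B : ℝ≥0∞ := youngC (|s| - 1) * bw s 0 * (C * (d * C + 1) ^ n) with hB
  have hA' : A ≠ ⊤ := by rw [hA]; finiteness
  have hB' : B ≠ ⊤ := by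
    have := bw_ne_top s 0
    rw [hB]; finiteness
  refine ⟨A.toNNReal + B.toNNReal * (2 * D + 1), fun N W hdiv f F hF p r _ hr w hw => ?_⟩
  set V := conv (wp W 4) (bN P W (s + σ) p r f) w with hV
  set E : ℝ≥0∞ := if σ ≤ 0 then distLpNorm p (P.block 0 F) else 0 with hE
  have hgrad : wp W 2 w * besovNorm P (s + σ) p r f ≤ V := by
    rw [hV, conv_comm]
    have h1 := le_conv (bN P W (s + σ) p r f) (wp W 2) w
    rw [mul_comm] at h1
    refine h1.trans ?_
    rw [conv_comm, conv_comm _ (wp W 4)]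
    exact conv_wp_mono (by norm_num) _ _
  have hzero : wp W 0 w * besovNorm P (s + σ) p r f ≤ V := by
    rw [hV, conv_comm]
    have h1 := le_conv (bN P W (s + σ) p r f) (wp W 0) w
    rw [mul_comm] at h1
    refine h1.trans ?_
    rw [conv_comm, conv_comm _ (wp W 4)]
    exact conv_wp_mono (by norm_num) _ _
  -- For `σ > 0` the lowest block is controlled by `f`; for `σ ≤ 0` it is kept as the extra term.
  have hg : wp W 0 w * distLpNorm p (P.block 0 F) ≤ D * V + wp W 0 w * E := by
    by_cases h0 : σ ≤ 0
    · rw [hE, if_pos h0]; exact le_add_self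
    · refine le_trans ?_ le_self_add
      calc _ ≤ wp W 0 w * (D * besovNorm P (s + σ) p r f) := by
            gcongr; exact (hD p r hr f F hF).2 (not_le.1 h0)
        _ = D * (wp W 0 w * besovNorm P (s + σ) p r f) := by ring
        _ ≤ _ := by gcongr
  have hsplit : bN P W s p r F w ≤ bN P W s p r (F - P.block 0 F) w + bN P W s p r (P.block 0 F) w := by
    simp only [bN, besovNorm_eq]
    refine le_trans (wlr_mono fun q => ?_) (wlr_add_le hr _ _)
    conv_lhs => rw [← sub_add_cancel F (P.block 0 F), dd_add, map_add]
    exact distLpNorm_add_le _ _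
  have hhigh := hC.bN_high_le (p := p) ha hF hdiv hr s (w := w) (by omega)
  have hlow := hC.band.base.bN_low_le (W := W) (p := p) hr s F w
  have hB2 : youngC (|s| - 1) * bw s 0 * (C * (d * C + 1) ^ w.length) ≤ B := by
    rw [hB]; gcongr; exact le_add_self
  calc _ ≤ A * V + B * (wp W 2 w * (D * besovNorm P (s + σ) p r f) + (D * V + wp W 0 w * E)) := by
        refine hsplit.trans (add_le_add hhigh (hlow.trans ?_))
        gcongr
        exact (hD p r hr f F hF).1
    _ = A * V + B * (D * (wp W 2 w * besovNorm P (s + σ) p r f) + (D * V + wp W 0 w * E)) := by ring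
    _ ≤ A * V + B * (D * V + (D * V + wp W 0 w * E)) := by gcongr
    _ = (A + B * (2 * D)) * V + B * (wp W 0 w * E) := by ring
    _ ≤ (A + B * (2 * D + 1)) * V + (A + B * (2 * D + 1)) * (wp W 0 w * E) := by
        gcongr
        · exact le_self_add
        · calc B = B * 1 := (mul_one B).symm
            _ ≤ B * (2 * D + 1) := by gcongr; exact le_add_self
            _ ≤ _ := le_add_self
    _ = _ := by
        rw [← mul_add, ENNReal.coe_add, ENNReal.coe_mul, ENNReal.coe_toNNReal hA', ENNReal.coe_toNNReal hB']
        norm_cast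

/-- Striated regularity of `m(D) φ`, at one order more than the family is controlled. -/
theorem multiplier_estimate (hd : 0 < d) (P : LittlewoodPaley d) (k : ℕ) {ρ : ℝ} (hρ : 0 < ρ) (M : ℝ≥0)
    {σ s : ℝ} {m₀ : Space d → ℂ} (hσ : -1 < σ) (hm : IsZeroOrderSymbol m₀) (hs : |s| < 1)
    (hsσ : |s + σ| < 1) : ∃ C : ℝ≥0, 0 < C ∧
      ∀ (N : ℕ) (W : Fin N → SmoothField d), (∀ i, (W i).IsDivFree) → familyHolderNorm P W ρ k ≤ M →
      ∀ φ mφ : 𝓢'(Space d, ℂ), IsMultiplierApply (powerSymbol σ m₀) φ mφ →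
      ∀ (p r : ℝ≥0∞) [Fact (1 ≤ p)], 1 ≤ r →
        striatedNorm P W s (k + 1) p r mφ ≤
          C * striatedNorm P W (s + σ) (k + 1) p r φ +
          C * (∑ i, fieldNorm P W 1 k ∞ 1 (W i)) * striatedNorm P W (s + σ) k p r φ +
          C * (if σ ≤ 0 then distLpNorm p (P.block 0 mφ) else 0) := by
  obtain ⟨A, hA⟩ := exists_bN_mult_le hd P (k + 1) hσ hm hs hsσ
  obtain ⟨B, hB⟩ := exists_tm_wp P k hρ M 4
  set c : ℝ≥0 := (k + 2) ^ 2 * 2 ^ (k + 1) with hc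
  refine ⟨A * (c * (2 * B)) + A + 1, by positivity, fun N W hdiv hW φ mφ hφ p r _ hr => ?_⟩
  simp only [striatedNorm_eq]
  refine (tm_mono fun w hw => hA N W hdiv φ mφ hφ.multLim p r hr w hw).trans ?_
  set E : ℝ≥0∞ := if σ ≤ 0 then distLpNorm p (P.block 0 mφ) else 0
  set S := ∑ i, fieldNorm P W 1 k ∞ 1 (W i)
  set X := tm (bN P W (s + σ) p r φ) k
  set X' := tm (bN P W (s + σ) p r φ) (k + 1)
  have hX : X ≤ X' := tm_mono_right _ (Nat.le_succ k)
  rw [tm_const_mul, tm_add]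
  -- Either `φ` carries all `k + 1` derivatives against a bounded weight, or the weight does, at the
  -- cost `1 + S`, against at most `k` derivatives of `φ`.
  have h1 : tm (conv (wp W 4) (bN P W (s + σ) p r φ)) (k + 1) ≤ c * (2 * B) * (X' + S * X) := by
    refine (tm_conv_succ_le _ _ k).trans ?_
    calc _ ≤ (k + 2) ^ 2 * 2 ^ (k + 1) * (B * X' + B * (1 + S) * X) := by
          gcongr
          · exact (hB N W hW).1
          · exact (hB N W hW).2
      _ = (k + 2) ^ 2 * 2 ^ (k + 1) * B * (X' + X + S * X) := by ring
      _ ≤ (k + 2) ^ 2 * 2 ^ (k + 1) * B * (2 * (X' + S * X)) := by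
          gcongr
          calc X' + X + S * X ≤ X' + X' + (S * X + S * X) := by gcongr; exact le_self_add
            _ = _ := by ring
      _ = _ := by rw [hc]; push_cast; ring
  have h2 : tm (fun w => wp W 0 w * E) (k + 1) ≤ E := by
    simp only [mul_comm _ E]
    rw [tm_const_mul]
    exact (mul_le_mul_right (tm_wp_zero_le (k + 1)) E).trans_eq (mul_one E)
  calc _ ≤ A * (c * (2 * B) * (X' + S * X) + E) := by gcongr
    _ = A * (c * (2 * B)) * X' + A * (c * (2 * B)) * S * X + A * E := by ring
    _ ≤ _ := by
      push_cast
      gcongr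
      · rw [add_assoc]; exact le_self_add
      · rw [add_assoc]; exact le_self_add
      · exact le_add_self.trans le_self_add

end

section

variable {d N : ℕ} {P : LittlewoodPaley d} {W : Fin N → SmoothField d} {K : ℕ} {C L : ℝ≥0∞}
  {p r : ℝ≥0∞} [Fact (1 ≤ p)] {u : SmoothField d}

/-! ### Commutators of a transport operator with multipliers -/

variable (W) in
/-- The Lipschitz norms of the striated derivatives of a vector field. -/
def lipF (u : SmoothField d) (w : List (Fin N)) : ℝ≥0∞ := ∑ j, lipN (df W w (u.c j))

theorem lipN_le_lipF (j : Fin d) (w : List (Fin N)) : lipN (df W w (u.c j)) ≤ lipF W u w :=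
  Finset.single_le_sum (f := fun j => lipN (df W w (u.c j))) (fun _ _ => zero_le) (Finset.mem_univ j)

theorem conv_lipF (G : List (Fin N) → ℝ≥0∞) (w : List (Fin N)) :
    conv (lipF W u) G w = ∑ j, conv (fun a => lipN (df W a (u.c j))) G w :=
  conv_sum_left Finset.univ (fun j a => lipN (df W a (u.c j))) G w

/-- A second form of the commutator, with the derivative on the argument. It is the better one for
arguments of frequency below that of `b`; `lie_deriv_mult` serves for higher ones. -/
theorem lie_deriv_mult_eq (hu : u.IsDivFree) (b : 𝓢(Space d, ℂ)) :
    ⁅u.deriv, mult b⁆ = ∑ j, ⁅mulOp (u.c j), mult b⁆ * pd j := by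
  simp only [lie_deriv_mult hu, ad_mul_pd, mult_mul_pd, Finset.sum_add_distrib]
  rw [← Finset.mul_sum, ← mulOp_sum, (isDivFree_iff u).1 hu, mulOp_zero, mul_zero, add_zero]

theorem SymBound.dL_ad_mult_le (hdiv : ∀ i, (W i).IsDivFree) {b : 𝓢(Space d, ℂ)} (h : SymBound K C L b)
    (V : TFun d) (g : 𝓢'(Space d, ℂ)) {w : List (Fin N)} (hw : 2 * w.length + 1 ≤ K) :
    distLpNorm p (dL W w ⁅mulOp V, mult b⁆ g) ≤
      C * L⁻¹ * conv (fun a => lipN (df W a V)) (wt W) w * distLpNorm p g := by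
  refine (dL_ad_le (nrm := fun T => distLpNorm p (T g)) (fun S T => distLpNorm_add_le _ _)
    (F := fun a => lipN (df W a V)) (G := fun c => C * L⁻¹ * distLpNorm p g * wt W c)
    fun a c _ hc => ?_).trans_eq ?_
  · exact (h.ad_dL_le hdiv g _ (by omega)).trans_eq (by ring)
  · rw [conv_mul_right]; ring

theorem SymBound.dL_lie_le (hdiv : ∀ i, (W i).IsDivFree) (hu : u.IsDivFree) {b : 𝓢(Space d, ℂ)}
    (h : SymBound K C L b) (g : 𝓢'(Space d, ℂ)) {w : List (Fin N)} (hw : 2 * w.length + 1 ≤ K) :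
    distLpNorm p (dL W w ⁅u.deriv, mult b⁆ g) ≤ C * L⁻¹ * conv (lipF W u) (wp W 2) w * gradN p g := by
  rw [lie_deriv_mult_eq hu, dL_sum, sum_apply]
  refine (distLpNorm_sum_le _ _).trans ?_
  rw [conv_lipF, Finset.mul_sum, Finset.sum_mul]
  refine Finset.sum_le_sum fun j _ => ?_
  refine (dL_mul_le (nrm := fun T => distLpNorm p (T g)) (fun S T => distLpNorm_add_le _ _)
    (F := fun a => C * L⁻¹ * conv (fun a => lipN (df W a (u.c j))) (wt W) a)
    (G := fun c => gradN p g * wt W c) fun a c ha _ => ?_).trans_eq ?_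
  · rw [op_mul_apply]
    refine (h.dL_ad_mult_le hdiv _ _ (by omega)).trans ?_
    gcongr
    exact (Striated.dL_pd_le c j g).trans_eq (mul_comm _ _)
  · rw [conv_mul_left, conv_mul_right, conv_assoc]
    have : conv (fun a => lipN (df W a (u.c j))) (conv (wt W) (wt W)) w =
        conv (fun a => lipN (df W a (u.c j))) (wp W 2) w :=
      conv_congr (fun _ _ => rfl) fun a _ => wt2_eq_wp a
    rw [this]; ring

theorem SymBound.dL_lie_pd_le (hdiv : ∀ i, (W i).IsDivFree) (hu : u.IsDivFree) {b : 𝓢(Space d, ℂ)}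
    (h : SymBound (K + 1) C L b) (l : Fin d) (g : 𝓢'(Space d, ℂ)) {w : List (Fin N)}
    (hw : 2 * w.length + 2 ≤ K) :
    distLpNorm p (dL W w ⁅u.deriv, mult b⁆ (pd l g)) ≤
      2 * (C * L) * conv (lipF W u) (wp W 2) w * distLpNorm p g := by
  rw [lie_deriv_mult hu, dL_sum, sum_apply]
  refine (distLpNorm_sum_le _ _).trans ?_
  rw [conv_lipF, Finset.mul_sum, Finset.sum_mul]
  refine Finset.sum_le_sum fun j _ => ?_
  refine (dL_ad_le (nrm := fun T => distLpNorm p (T (pd l g))) (fun S T => distLpNorm_add_le _ _)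
    (F := fun a => lipN (df W a (u.c j))) (G := fun c => 2 * (C * L) * distLpNorm p g * wp W 2 c)
    fun a c _ hc => ?_).trans_eq ?_
  · refine ((h.mul_xi j).ad_dL_pd_le hdiv l g _ (by omega)).trans ?_
    calc _ ≤ 2 * (C * L) * lipN (df W a (u.c j)) * wp W 2 c * distLpNorm p g := by
          gcongr; rw [← wt2_eq_wp]; exact wt_le_wt2 _
      _ = _ := by ring
  · rw [conv_mul_right]; ring

/-- For `n ≤ q` the commutator with `u^j` gains `2^{-q}` and the derivative of the block costs
`2^n`. For `n > q` the derivative is put into the symbol, which makes the commutator of order zero,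
and the block as a divergence yields `2^{q-n}`. No annular support is needed, since the commutator
provides the gain. -/
theorem good_lie (hdiv : ∀ i, (W i).IsDivFree) (hu : u.IsDivFree) {k : ℕ} {C' : ℝ≥0∞} {b : 𝓢(Space d, ℂ)}
    (hK : 2 * k + 2 ≤ K) (hB : BaseBound P (K + 1) C) (q : ℕ) (hb : SymBound (K + 1) C' 1 b) :
    Good P W k (fun w => 2 * d * C * C' * conv (lipF W u) (wp W 2) w) q ⁅u.deriv, mop q b⁆ := by
  intro p _ f n w hw
  have hs := hb.mop q
  by_cases hn : n ≤ q
  · refine (hs.dL_lie_le hdiv hu _ (by omega)).trans ?_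
    rw [dy_of_le hn]
    calc _ ≤ C' * (2 ^ q)⁻¹ * conv (lipF W u) (wp W 2) w * (d * (C * 2 ^ n * distLpNorm p (P.block n f))) := by
          gcongr; exact hB.gradN_block_le n f
      _ = 1 * (d * C * C' * conv (lipF W u) (wp W 2) w * ((2 ^ q)⁻¹ * 2 ^ n) * distLpNorm p (P.block n f)) := by ring
      _ ≤ 2 * (d * C * C' * conv (lipF W u) (wp W 2) w * ((2 ^ q)⁻¹ * 2 ^ n) * distLpNorm p (P.block n f)) := by
          gcongr; exact one_le_two
      _ = _ := by ring
  · obtain ⟨n, rfl⟩ : ∃ n', n = n' + 1 := ⟨n - 1, by omega⟩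
    refine (hB.apply_block_le n f fun j g => hs.dL_lie_pd_le hdiv hu j g (by omega)).trans_eq ?_
    rw [dy_comm, dy_of_le (by omega)]; ring

/-- Only the gradient of the low-frequency argument appears on the right, as needed for `g = Δ_{-1}
m(D) f` with `σ ≤ 0`. -/
theorem SymBound.dd_lie_low_le (hdiv : ∀ i, (W i).IsDivFree) (hu : u.IsDivFree) {C' : ℝ≥0∞}
    (hB : BaseBound P (K + 1) C') {b : 𝓢(Space d, ℂ)} (h : SymBound (K + 1) C L b) {g : 𝓢'(Space d, ℂ)}
    (hg : Low P g) {w : List (Fin N)} (hw : 2 * w.length ≤ K) :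
    distLpNorm p (dd W w (⁅u.deriv, mult b⁆ g)) ≤
      C * L⁻¹ * (d * C' + 1) ^ w.length * conv (lipF W u) (wp W 2) w * gradN p g := by
  rw [lie_deriv_mult_eq hu, sum_apply, dd_sum]
  refine (distLpNorm_sum_le _ _).trans ?_
  rw [gradN, Finset.mul_sum]
  refine Finset.sum_le_sum fun j _ => ?_
  rw [op_mul_apply]
  refine (dd_apply_le (F := fun a => C * L⁻¹ * conv (lipF W u) (wt W) a)
    (G := fun c => (d * C' + 1) ^ w.length * distLpNorm p (pd j g) * wt W c) fun a c ha hc => ?_).trans_eq ?_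
  · refine (h.dL_ad_mult_le hdiv _ _ (by omega)).trans ?_
    gcongr
    · exact conv_mono' (fun a => lipN_le_lipF j a) (fun _ => le_rfl) a
    · refine ((hg.pd j).dd_le hB c).trans ?_
      calc _ ≤ (d * C' + 1) ^ w.length * wt W c * distLpNorm p (pd j g) := by gcongr; exact le_add_self
        _ = _ := by ring
  · rw [conv_mul_left, conv_mul_right, conv_assoc]
    have : conv (lipF W u) (conv (wt W) (wt W)) w = conv (lipF W u) (wp W 2) w :=
      conv_congr (fun _ _ => rfl) fun a _ => wt2_eq_wp a
    rw [this]; ring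

/-- Low frequencies of a product. -/
theorem BaseBound.mult_mulOp_le {C' : ℝ≥0∞} (hB : BaseBound P K C') {b : 𝓢(Space d, ℂ)}
    (h : SymBound (0 + 1) C 1 b) (V : TFun d) (f : 𝓢'(Space d, ℂ)) :
    distLpNorm p (mult b (mulOp V f)) ≤
      (d + 1) * (C * C') * (supN V + lipN V) * ∑' n, 2⁻¹ ^ n * distLpNorm p (P.block n f) := by
  have hmul : ∀ (U : TFun d) (g : 𝓢'(Space d, ℂ)), distLpNorm p (mulOp U g) ≤ supN U * distLpNorm p g :=
    fun U g => distLpNorm_mulOp_le (p₁ := ∞) (p₂ := p) U g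
  -- Integration by parts moves the derivative to the low-frequency symbol or to `V`. Writing a
  -- block as a divergence then gains `2^{-n}`, so that regularity above `-1` suffices while `V` is
  -- only Lipschitz.
  have hpd : ∀ (j : Fin d) (g : 𝓢'(Space d, ℂ)),
      distLpNorm p ((mult b * mulOp V) (pd j g)) ≤ C * (supN V + lipN V) * distLpNorm p g := by
    intro j g
    rw [op_mul_apply, mulOp_pd, map_sub, ← op_mul_apply (mult b) (pd j), mult_mul_pd]
    refine (distLpNorm_sub_le _ _).trans ?_
    have h1 := (h.mul_xi j).opBound p (mulOp V g)
    have h2 := h.opBound p (mulOp (V.pd j) g)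
    rw [mul_one] at h1
    calc _ ≤ C * (supN V * distLpNorm p g) + C * (lipN V * distLpNorm p g) := by
          refine add_le_add (h1.trans (by gcongr; exact hmul _ _)) (h2.trans ?_)
          gcongr
          exact (hmul _ _).trans (by gcongr; exact supN_pd_le_lipN V j)
      _ = _ := by ring
  refine (P.distLpNorm_le_tsum_block (mult b * mulOp V) f).trans ?_
  rw [← ENNReal.tsum_mul_left]
  refine ENNReal.tsum_le_tsum fun n => ?_
  cases n with
  | zero =>
    rw [op_mul_apply, pow_zero, one_mul]
    refine (h.opBound p _).trans ?_
    calc _ ≤ C * (supN V * distLpNorm p (P.block 0 f)) := by gcongr; exact hmul _ _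
      _ = 1 * (C * 1) * supN V * distLpNorm p (P.block 0 f) := by ring
      _ ≤ _ := by
        gcongr
        · exact le_add_self
        · exact hB.one_le
        · exact le_self_add
  | succ n =>
    refine (hB.apply_block_le n f hpd).trans ?_
    rw [ENNReal.inv_pow]
    calc _ = d * (C * C') * (supN V + lipN V) * (2⁻¹ ^ (n + 1) * distLpNorm p (P.block (n + 1) f)) := by ring
      _ ≤ _ := by gcongr; exact le_self_add

end

/-! ### The commutator: its lowest block and the decomposition of the others -/

section

variable {d N : ℕ} {P : LittlewoodPaley d} {σ : ℝ} {m₀ : Space d → ℂ} {a : ℝˣ → 𝓢(Space d, ℂ)}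
  {W : Fin N → SmoothField d} {K : ℕ} {C : ℝ≥0∞} {p r : ℝ≥0∞} [Fact (1 ≤ p)] {u : SmoothField d}
  {f F G : 𝓢'(Space d, ℂ)}

theorem wp_nil (n : ℕ) : wp W n [] = 1 := by
  induction n with
  | zero => simp [wp]
  | succ n ih => rw [wp, conv_nil, ih, mul_one]; exact weight_nil _

theorem tsum_block_le (hr : 1 ≤ r) (t : ℝ) (f : 𝓢'(Space d, ℂ)) :
    ∑' n, 2⁻¹ ^ n * distLpNorm p (P.block n f) ≤
      (bw t 0)⁻¹ * youngC (|t| - 1) * besovNorm P t p r f := by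
  have h := mul_le_mul_right (tsum_inv_pow_le hr t fun n => distLpNorm p (P.block n f)) (bw t 0)⁻¹
  rwa [← mul_assoc, ENNReal.inv_mul_cancel (bw_ne_zero t 0) (bw_ne_top t 0), one_mul, ← mul_assoc,
    ← besovNorm_eq] at h

theorem sum_le_sum_mul {x y : Fin d → ℝ≥0∞} {c z : ℝ≥0∞} (h : ∀ j, x j ≤ c * y j * z) :
    ∑ j, x j ≤ c * (∑ j, y j) * z := by
  rw [Finset.mul_sum, Finset.sum_mul]
  exact Finset.sum_le_sum fun j _ => h j

theorem SymBound.mult_deriv_le (hu : u.IsDivFree) {C' : ℝ≥0∞} (hB : BaseBound P K C') {b : 𝓢(Space d, ℂ)}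
    (h : SymBound (0 + 1 + 1) C 1 b) (f : 𝓢'(Space d, ℂ)) :
    distLpNorm p (mult b (u.deriv f)) ≤ (d + 1) * (C * C') * (∑ j, (supN (u.c j) + lipN (u.c j))) *
      ∑' n, 2⁻¹ ^ n * distLpNorm p (P.block n f) := by
  rw [deriv_eq_of_divFree hu, sum_apply, map_sum]
  refine (distLpNorm_sum_le _ _).trans (sum_le_sum_mul fun j => ?_)
  rw [op_mul_apply, ← op_mul_apply (mult b), mult_mul_pd]
  have h1 := hB.mult_mulOp_le (p := p) (h.mul_xi j) (u.c j) f
  rwa [mul_one] at h1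

/-- The lowest block of the commutator. -/
theorem AnnRep.exists_low_comm_le (ha : AnnRep P σ m₀ a) (hd : 0 < d) (hσ : -1 < σ)
    (hm : IsZeroOrderSymbol m₀) {s : ℝ} (hs : |s| < 1) (hsσ : |s + σ| < 1) :
    ∃ D : ℝ≥0, ∀ (p r : ℝ≥0∞) [Fact (1 ≤ p)], 1 ≤ r → ∀ u : SmoothField d, u.IsDivFree →
      ∀ f F G : 𝓢'(Space d, ℂ), MultLim (powerSymbol σ m₀) f F → MultLim (powerSymbol σ m₀) (u.deriv f) G →
      distLpNorm p (P.block 0 (G - u.deriv F)) ≤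
        D * (∑ j, (supN (u.c j) + lipN (u.c j))) * besovNorm P (s + σ) p r f := by
  obtain ⟨C, hC⟩ := ha.exists_multBound 2
  obtain ⟨D₁, hD₁⟩ := ha.exists_low_le hd hσ hm (s + σ)
  obtain ⟨D₂, hD₂⟩ := ha.exists_low_freq hd hσ hm (τ := 1) (by push_cast; linarith)
  obtain ⟨D₃, hD₃⟩ := (bddFam_const (ι := Unit) (dil (two ^ 1) P.lowS)).symBound 1
  have hy := youngC_ne_top (a := |s| - 1) (by linarith)
  have hy' := youngC_ne_top (a := |s + σ| - 1) (by linarith)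
  have hb : (bw s 0)⁻¹ ≠ ⊤ := by simp [bw_ne_zero]
  have hb' : (bw (s + σ) 0)⁻¹ ≠ ⊤ := by simp [bw_ne_zero]
  set A : ℝ≥0∞ := (d + 1) * C ^ 2 * youngC (|s| - 1) *
      (ENNReal.ofReal (2 ^ σ) * ((d + 1) ^ 2 * C * C) * youngC (|s + σ| - 1)) with hA
  set T : ℝ≥0∞ := D₂ * ((d + 1) * (D₃ * C) * ((bw (s + σ) 0)⁻¹ * youngC (|s + σ| - 1))) +
    (C * D₁ + (d + 1) * (C * C) * ((bw s 0)⁻¹ * youngC (|s| - 1) * A)) with hT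
  have hT' : T ≠ ⊤ := by
    rw [hT, hA]; finiteness
  refine ⟨T.toNNReal, fun p r _ hr u hu f F G hF hG => ?_⟩
  set Q := ∑ j, (supN (u.c j) + lipN (u.c j)) with hQ
  set B := besovNorm P (s + σ) p r f with hB
  have hlow : SymBound (0 + 1 + 1) C 1 P.lowS := hC.band.base.block 0
  have hblock : ∀ X, P.block 0 X = mult P.lowS X := fun X => by rw [P.block_eq, mop_zero]; rfl
  have h1 : distLpNorm p (P.block 0 G) ≤
      D₂ * ((d + 1) * (D₃ * C) * ((bw (s + σ) 0)⁻¹ * youngC (|s + σ| - 1))) * Q * B := by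
    have hG' := hG.map ha.temp (SchwartzMap.hasTemperateGrowth (dil (two ^ 1) P.lowS))
    -- The divergence form provides `τ = 1`, so `σ > -1` suffices and no extra low-frequency term is
    -- left.
    have h2 : mult (dil (two ^ 1) P.lowS) (u.deriv f) =
        ∑ j, pd j (mult (dil (two ^ 1) P.lowS) (mulOp (u.c j) f)) := by
      rw [deriv_eq_of_divFree hu, sum_apply, map_sum]
      refine Finset.sum_congr rfl fun j _ => ?_
      rw [op_mul_apply, ← op_mul_apply (mult _), mult_pd_comm (SchwartzMap.hasTemperateGrowth _), op_mul_apply]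
    rw [h2] at hG'
    rw [block_zero_eq]
    refine (hD₂ p _ _ _ hG' (scaleBound_one _)).trans ?_
    rw [mul_assoc, mul_assoc]
    refine mul_le_mul_right ?_ _
    refine (sum_le_sum_mul fun j => hC.band.base.mult_mulOp_le (hD₃ ()) (u.c j) f).trans ?_
    calc _ ≤ (d + 1) * (D₃ * C) * Q * ((bw (s + σ) 0)⁻¹ * youngC (|s + σ| - 1) * B) := by
          gcongr; exact tsum_block_le hr _ f
      _ = _ := by ring
  -- The low part of `m(D) f` enters through its gradient, multiplied by `u` in the sup norm.
  have h3 : distLpNorm p (P.block 0 (u.deriv (P.block 0 F))) ≤ C * D₁ * Q * B := by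
    refine (hC.band.base.block_le 0 _).trans ?_
    rw [mul_assoc, mul_assoc]
    gcongr
    rw [deriv_eq, sum_apply]
    refine (distLpNorm_sum_le _ _).trans ?_
    calc _ ≤ ∑ j, (supN (u.c j) + lipN (u.c j)) * gradN p (P.block 0 F) := by
          refine Finset.sum_le_sum fun j _ => ?_
          rw [op_mul_apply]
          refine (distLpNorm_mulOp_le (p₁ := ∞) (p₂ := p) _ _).trans ?_
          exact mul_le_mul' le_self_add (norm_pd_le _ j)
      _ = Q * gradN p (P.block 0 F) := by rw [hQ, Finset.sum_mul]
      _ ≤ Q * (D₁ * B) := by gcongr; exact (hD₁ p r hr f F hF).1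
      _ = _ := by ring
  have h4 : distLpNorm p (P.block 0 (u.deriv (F - P.block 0 F))) ≤
      (d + 1) * (C * C) * ((bw s 0)⁻¹ * youngC (|s| - 1) * A) * Q * B := by
    rw [hblock]
    refine (hlow.mult_deriv_le hu hC.band.base _).trans ?_
    -- The empty family gives the classical Besov bound for the high part of `F`.
    have h5 := hC.bN_high_le (W := (Fin.elim0 : Fin 0 → SmoothField d)) (p := p) ha hF (fun i => i.elim0) hr s
      (w := []) (by simp)
    rw [conv_nil, wp_nil, one_mul] at h5
    calc _ ≤ (d + 1) * (C * C) * Q * ((bw s 0)⁻¹ * youngC (|s| - 1) * (A * B)) := by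
          gcongr; exact (tsum_block_le hr s _).trans (by gcongr; exact h5)
      _ = _ := by ring
  have h6 : P.block 0 (G - u.deriv F) = P.block 0 G - (P.block 0 (u.deriv (P.block 0 F)) +
      P.block 0 (u.deriv (F - P.block 0 F))) := by
    simp only [map_sub]; abel
  rw [h6, ENNReal.coe_toNNReal hT', hT]
  exact ((distLpNorm_sub_le _ _).trans
    (add_le_add h1 ((distLpNorm_add_le _ _).trans (add_le_add h3 h4)))).trans_eq (by ring)

/-- A block of `m(D)` is `2^{qσ}` times a regular multiplier; adding and subtracting `u · ∇` applied
to the block of `F` leaves two commutators with regular multipliers. The second is split according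
to the low and high frequencies of `F`. -/
theorem AnnRep.block_comm_eq (ha : AnnRep P σ m₀ a) (hF : MultLim (powerSymbol σ m₀) f F)
    (hG : MultLim (powerSymbol σ m₀) (u.deriv f) G) (q : ℕ) :
    P.block (q + 1) (G - u.deriv F) =
      -(((|((two ^ (q + 1) : ℝˣ) : ℝ)| ^ σ : ℝ) : ℂ) •
        ⁅u.deriv, mop (q + 1) (sprod P.bandS (a (two ^ (q + 1))))⁆ f) +
      (⁅u.deriv, mop (q + 1) (P.blockS (q + 1))⁆ (F - P.block 0 F) +
        ⁅u.deriv, mop (q + 1) (P.blockS (q + 1))⁆ (P.block 0 F)) := by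
  rw [← map_add, sub_add_cancel]
  have h1 : mop (q + 1) (P.blockS (q + 1)) F = ((|((two ^ (q + 1) : ℝˣ) : ℝ)| ^ σ : ℝ) : ℂ) •
      mop (q + 1) (sprod P.bandS (a (two ^ (q + 1)))) f := ha.mult_dil_eq hF P.annular_bandS (two ^ (q + 1))
  have h2 : mop (q + 1) (P.blockS (q + 1)) G = ((|((two ^ (q + 1) : ℝˣ) : ℝ)| ^ σ : ℝ) : ℂ) •
      mop (q + 1) (sprod P.bandS (a (two ^ (q + 1)))) (u.deriv f) := ha.mult_dil_eq hG P.annular_bandS (two ^ (q + 1))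
  simp only [Ring.lie_def, sub_apply, op_mul_apply, P.block_eq, map_sub]
  rw [h1, h2, map_smul, smul_sub]
  abel

end

/-! ### The commutator estimate -/

section

variable {d N : ℕ} {P : LittlewoodPaley d} {σ : ℝ} {m₀ : Space d → ℂ} {a : ℝˣ → 𝓢(Space d, ℂ)}
  {W : Fin N → SmoothField d} {K : ℕ} {C : ℝ≥0∞} {p r : ℝ≥0∞} [Fact (1 ≤ p)] {u : SmoothField d}
  {f F G : 𝓢'(Space d, ℂ)}

variable (W) in
/-- The striated Lipschitz norms of a vector field, with its sup norm at order zero. -/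
def transN (u : SmoothField d) (w : List (Fin N)) : ℝ≥0∞ :=
  lipF W u w + wp W 0 w * ∑ j, supN (u.c j)

theorem conv_lipF_le (w : List (Fin N)) :
    conv (lipF W u) (wp W 2) w ≤ conv (wp W 2) (transN W u) w := by
  rw [conv_comm]
  exact conv_mono' (fun _ => le_rfl) (fun _ => le_self_add) w

theorem wt_mul_le (w : List (Fin N)) :
    wt W w * ∑ j, (supN (u.c j) + lipN (u.c j)) ≤ conv (wp W 2) (transN W u) w := by
  have h : ∑ j, (supN (u.c j) + lipN (u.c j)) = transN W u [] := by
    rw [Finset.sum_add_distrib, transN, wp_nil, one_mul, add_comm]; rfl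
  rw [h, conv_comm, mul_comm]
  refine le_trans ?_ (le_conv _ _ w)
  gcongr
  rw [← wt2_eq_wp]; exact wt_le_wt2 w

/-- The commutators acting on `f` and on the high part of `F` are treated by `good_lie`, the one
acting on the low part by `SymBound.dd_lie_low_le`. The lowest block comes from the hypothesis `hZ`,
the derivatives being harmless at low frequency. The last term collects the low contributions, which
decay like `2^{-q}`. -/
theorem MultBound.vN_comm_le (h : MultBound P a (K + 1) C) (ha : AnnRep P σ m₀ a)
    (hF : MultLim (powerSymbol σ m₀) f F) (hG : MultLim (powerSymbol σ m₀) (u.deriv f) G)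
    (hdiv : ∀ i, (W i).IsDivFree) (hu : u.IsDivFree) {B D : ℝ≥0∞} (hB : gradN p (P.block 0 F) ≤ D * B)
    (hZ : distLpNorm p (P.block 0 (G - u.deriv F)) ≤ D * (∑ j, (supN (u.c j) + lipN (u.c j))) * B)
    (q : ℕ) {w : List (Fin N)} (hw : 2 * w.length + 2 ≤ K) :
    vN W p (P.block q (G - u.deriv F)) w ≤
      2 * d * C * C * ENNReal.ofReal (2 ^ σ) *
        (bw σ q * conv (conv (wp W 2) (transN W u)) (nearN P W p q f) w) +
      (2 * d * C * C * conv (conv (wp W 2) (transN W u)) (nearN P W p q (F - P.block 0 F)) w +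
        2⁻¹ ^ q * (C * (d * C + 1) ^ w.length * D * (conv (wp W 2) (transN W u) w * B))) := by
  have hbase := h.band.base
  cases q with
  | zero =>
    refine le_trans ?_ (le_add_self.trans le_add_self)
    rw [pow_zero, one_mul]
    refine ((low_block (P := P) (G - u.deriv F)).dd_le hbase w).trans ?_
    calc _ ≤ 1 * (d * C + 1) ^ w.length * wt W w * (D * (∑ j, (supN (u.c j) + lipN (u.c j))) * B) := by
          rw [one_mul]; gcongr
      _ = 1 * (d * C + 1) ^ w.length * D * (wt W w * (∑ j, (supN (u.c j) + lipN (u.c j))) * B) := by ring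
      _ ≤ _ := by
        gcongr
        · exact hbase.one_le
        · exact wt_mul_le w
  | succ q =>
    have hgood : ∀ {b : 𝓢(Space d, ℂ)} (g : 𝓢'(Space d, ℂ)), SymBound (K + 1) C 1 b →
        vN W p (⁅u.deriv, mop (q + 1) b⁆ g) w ≤
          2 * d * C * C * conv (conv (wp W 2) (transN W u)) (nearN P W p (q + 1) g) w := by
      intro b g hb
      refine ((good_lie (k := w.length) hdiv hu hw hbase (q + 1) hb).dd_le g le_rfl).trans ?_
      rw [conv_mul_left]
      gcongr
      exact conv_mono' conv_lipF_le (fun _ => le_rfl) w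
    rw [ha.block_comm_eq hF hG, vN, dd_add, dd_add, dd_neg]
    refine (distLpNorm_add_le _ _).trans (add_le_add ?_ ((distLpNorm_add_le _ _).trans (add_le_add ?_ ?_)))
    · rw [distLpNorm_neg]
      refine (vN_smul_le _ _ _).trans ?_
      rw [enorm_two_pow_rpow]
      refine (mul_le_mul_right (hgood f (h.block (q + 1)).sym) _).trans_eq (by ring)
    · exact hgood _ (hbase.block (q + 1))
    · refine (((hbase.block (q + 1)).mop (q + 1)).dd_lie_low_le hdiv hu hbase (low_block F) (by omega)).trans ?_
      calc _ ≤ C * (2 ^ (q + 1))⁻¹ * (d * C + 1) ^ w.length * conv (wp W 2) (transN W u) w * (D * B) := by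
            gcongr; exact conv_lipF_le w
        _ = _ := by rw [ENNReal.inv_pow]; ring

theorem exists_bN_comm_le (hd : 0 < d) (P : LittlewoodPaley d) (n : ℕ) {σ s : ℝ} {m₀ : Space d → ℂ}
    (hσ : -1 < σ) (hm : IsZeroOrderSymbol m₀) (hs : |s| < 1) (hsσ : |s + σ| < 1) :
    ∃ C : ℝ≥0, ∀ (N : ℕ) (W : Fin N → SmoothField d), (∀ i, (W i).IsDivFree) →
      ∀ u : SmoothField d, u.IsDivFree → ∀ f F G : 𝓢'(Space d, ℂ), MultLim (powerSymbol σ m₀) f F →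
      MultLim (powerSymbol σ m₀) (u.deriv f) G → ∀ (p r : ℝ≥0∞) [Fact (1 ≤ p)], 1 ≤ r →
      ∀ w : List (Fin N), w.length ≤ n → bN P W s p r (G - u.deriv F) w ≤
        C * conv (wp W 8) (conv (transN W u) (bN P W (s + σ) p r f)) w := by
  obtain ⟨a, ha⟩ := exists_annRep P hd hσ hm
  obtain ⟨C, hC⟩ := ha.exists_multBound (2 * n + 2 + 1)
  obtain ⟨D₁, hD₁⟩ := ha.exists_low_le hd hσ hm (s + σ)
  obtain ⟨D₂, hD₂⟩ := ha.exists_low_comm_le hd hσ hm hs hsσ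
  have hy := youngC_ne_top (a := |s| - 1) (by linarith)
  have hy' := youngC_ne_top (a := |s + σ| - 1) (by linarith)
  have hbw := bw_ne_top s 0
  set Y := youngC (|s| - 1)
  set Y' := youngC (|s + σ| - 1)
  set A : ℝ≥0∞ := (d + 1) * C ^ 2 * Y * (ENNReal.ofReal (2 ^ σ) * ((d + 1) ^ 2 * C * C) * Y') with hA
  set T : ℝ≥0∞ := 2 * d * C * C * ENNReal.ofReal (2 ^ σ) * Y' + (2 * d * C * C * (Y * A) +
    Y * (bw s 0 * (C * (d * C + 1) ^ n * (D₁ + D₂ : ℝ≥0)))) with hT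
  have hT' : (d + 1) * C ^ 2 * Y * T ≠ ⊤ := by
    rw [hT, hA]; finiteness
  refine ⟨((d + 1) * C ^ 2 * Y * T).toNNReal, fun N W hdiv u hu f F G hF hG p r _ hr w hw => ?_⟩
  set B := besovNorm P (s + σ) p r f with hB
  have hgrad : gradN p (P.block 0 F) ≤ (D₁ + D₂ : ℝ≥0) * B :=
    (hD₁ p r hr f F hF).1.trans (by gcongr; exact le_self_add)
  have hZ : distLpNorm p (P.block 0 (G - u.deriv F)) ≤
      (D₁ + D₂ : ℝ≥0) * (∑ j, (supN (u.c j) + lipN (u.c j))) * B :=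
    (hD₂ p r hr u hu f F G hF hG).trans (by gcongr; exact le_add_self)
  rw [ENNReal.coe_toNNReal hT', mul_assoc _ T]
  refine (hC.band.base.bN_le hdiv hr s _ (by omega)).trans ?_
  gcongr
  -- Eight powers of the weight: two from the passage to blocks, two from the commutator and four
  -- from `m(D)` acting on the high part.
  have hT8 : T * conv (wp W 8) (conv (transN W u) (bN P W (s + σ) p r f)) w = conv (wp W 2)
      (fun b => T * conv (conv (wp W 2) (transN W u)) (conv (wp W 4) (bN P W (s + σ) p r f)) b) w := by
    rw [conv_mul_right, conv_wp_conv_wp]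
  rw [hT8]
  refine conv_mono (fun _ _ => le_rfl) fun b hb => ?_
  have hbn : b.length ≤ n := hb.trans hw
  set Γ := conv (wp W 2) (transN W u) with hΓ
  set X := bN P W (s + σ) p r f with hX
  have h1 : conv Γ X b ≤ conv Γ (conv (wp W 4) X) b :=
    conv_mono' (fun _ => le_rfl) (fun c => le_conv_wp 4 X c) b
  have h2 : Γ b * B ≤ conv Γ (conv (wp W 4) X) b := by
    refine le_trans ?_ h1
    rw [conv_comm, mul_comm]
    exact le_conv X Γ b
  refine (wlr_mono fun q => hC.vN_comm_le ha hF hG hdiv hu hgrad hZ q (w := b) (by omega)).trans ?_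
  refine (wlr_add_le hr _ _).trans ?_
  rw [hT, add_mul, add_mul]
  refine add_le_add ?_ ((wlr_add_le hr _ _).trans (add_le_add ?_ ?_))
  · rw [wlr_const_mul hr, wlr_bw, mul_assoc (2 * (d : ℝ≥0∞) * C * C * ENNReal.ofReal (2 ^ σ))]
    refine mul_le_mul_right ?_ _
    refine (wlr_conv_le hr _ _ _).trans ?_
    calc _ ≤ conv Γ (fun c => Y' * X c) b := conv_mono' (fun _ => le_rfl) (fun c => wlr_nearN_le hr _ f c) b
      _ = Y' * conv Γ X b := conv_mul_right _ _ _ _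
      _ ≤ _ := by gcongr
  · rw [wlr_const_mul hr, mul_assoc (2 * (d : ℝ≥0∞) * C * C)]
    refine mul_le_mul_right ?_ _
    refine (wlr_conv_le hr _ _ _).trans ?_
    rw [← conv_mul_right]
    refine conv_mono (fun _ _ => le_rfl) fun c hc => ?_
    refine (wlr_nearN_le hr _ _ c).trans ?_
    rw [mul_assoc]
    gcongr
    exact hC.bN_high_le ha hF hdiv hr s (by omega)
  · refine (wlr_inv_pow_le hr s _).trans ?_
    calc _ ≤ Y * (bw s 0 * (C * (d * C + 1) ^ n * (D₁ + D₂ : ℝ≥0) * conv Γ (conv (wp W 4) X) b)) := by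
          gcongr; exact le_add_self
      _ = _ := by ring

/-- The Lipschitz norms concern gradients of derivatives of `u`, the right-hand side derivatives of
the gradient; the exchange costs one weight. The sup norm of `u` enters at the empty word only. -/
theorem tm_transN_le (k : ℕ) (u : SmoothField d) : tm (transN W u) k ≤
    (k + 1) ^ 2 * 2 ^ k * (tm (wp W 1) k * fieldGradNorm P W 0 k ∞ 1 u) + u.supNorm := by
  have h1 : tm (fun w => wp W 0 w * ∑ j, supN (u.c j)) k ≤ u.supNorm := by
    simp only [mul_comm _ (∑ j, supN (u.c j))]
    rw [tm_const_mul]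
    refine (mul_le_mul_right (tm_wp_zero_le k) _).trans ?_
    rw [mul_one, SmoothField.supNorm]
    exact Finset.sum_le_sum fun j _ => (u.c j).distLpNorm_le_eLpNorm
  have h2 : ∀ w : List (Fin N), lipF W u w ≤
      conv (wp W 1) (fun b => ∑ j, ∑ l, bN P W 0 ∞ 1 (pd l (u.dist j)) b) w := by
    intro w
    rw [conv_sum_right]
    refine Finset.sum_le_sum fun j _ => ?_
    rw [lipN_eq, ← dd_dist]
    refine (gradN_dd_le w (u.c j).dist).trans ?_
    refine conv_mono' (fun b => (wp_one b).ge) (fun b => Finset.sum_le_sum fun l _ => ?_) w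
    exact distLpNorm_le_besovNorm _
  have h3 : tm (fun b => ∑ j, ∑ l, bN P W 0 ∞ 1 (pd l (u.dist j)) b) k = fieldGradNorm P W 0 k ∞ 1 u := by
    rw [tm_sum]
    exact Finset.sum_congr rfl fun j _ => tm_sum_bN_pd 0 (u.dist j) k
  rw [show transN W u = fun w => lipF W u w + wp W 0 w * ∑ j, supN (u.c j) from rfl, tm_add, ← h3]
  exact add_le_add ((tm_mono fun w _ => h2 w).trans (tm_conv_le _ _ k)) h1

/-- The commutator of `m(D)` with the transport operator of a divergence-free field. -/
theorem commutator_estimate (hd : 0 < d) (P : LittlewoodPaley d) (k : ℕ) {ρ : ℝ} (hρ : 0 < ρ) (M : ℝ≥0)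
    {σ s : ℝ} {m₀ : Space d → ℂ} (hσ : -1 < σ) (hm : IsZeroOrderSymbol m₀) (hs : |s| < 1)
    (hsσ : |s + σ| < 1) : ∃ C : ℝ≥0, 0 < C ∧
      ∀ (N : ℕ) (W : Fin N → SmoothField d), (∀ i, (W i).IsDivFree) → familyHolderNorm P W ρ k ≤ M →
      ∀ u : SmoothField d, u.IsDivFree → ∀ φ mφ muφ : 𝓢'(Space d, ℂ),
        IsMultiplierApply (powerSymbol σ m₀) φ mφ → IsMultiplierApply (powerSymbol σ m₀) (u.deriv φ) muφ →
      ∀ (p r : ℝ≥0∞) [Fact (1 ≤ p)], 1 ≤ r →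
        striatedNorm P W s k p r (muφ - u.deriv mφ) ≤
          C * (fieldGradNorm P W 0 k ∞ 1 u + u.supNorm) * striatedNorm P W (s + σ) k p r φ := by
  obtain ⟨A, hA⟩ := exists_bN_comm_le hd P k hσ hm hs hsσ
  obtain ⟨B₁, hB₁⟩ := exists_tm_wp P k hρ M 1
  obtain ⟨B₈, hB₈⟩ := exists_tm_wp P k hρ M 8
  set c : ℝ≥0 := (k + 1) ^ 2 * 2 ^ k with hc
  have hc' : (c : ℝ≥0∞) = (k + 1) ^ 2 * 2 ^ k := by rw [hc]; push_cast; rfl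
  refine ⟨A * (c * B₈ * c) * (c * B₁ + 1) + 1, by positivity, fun N W hdiv hW u hu φ mφ muφ hφ huφ p r _ hr => ?_⟩
  simp only [striatedNorm_eq]
  refine (tm_mono fun w hw => hA N W hdiv u hu φ mφ muφ hφ.multLim huφ.multLim p r hr w hw).trans ?_
  rw [tm_const_mul]
  set X := tm (bN P W (s + σ) p r φ) k
  set U := fieldGradNorm P W 0 k ∞ 1 u
  have h1 : tm (transN W u) k ≤ (c * B₁ + 1) * (U + u.supNorm) := by
    refine (tm_transN_le (P := P) k u).trans ?_
    rw [← hc']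
    calc _ ≤ c * (B₁ * U) + u.supNorm := by gcongr; exact (hB₁ N W hW).1
      _ ≤ c * (B₁ * U) + u.supNorm + (U + c * B₁ * u.supNorm) := le_self_add
      _ = _ := by ring
  calc _ ≤ A * (c * (B₈ * (c * (((c * B₁ + 1) * (U + u.supNorm)) * X)))) := by
        gcongr
        refine (tm_conv_le _ _ k).trans ?_
        rw [← hc']
        gcongr
        · exact (hB₈ N W hW).1
        · refine (tm_conv_le _ _ k).trans ?_
          rw [← hc']
          gcongr
    _ = A * (c * B₈ * c) * (c * B₁ + 1) * (U + u.supNorm) * X := by ring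
    _ ≤ _ := by push_cast; gcongr; exact le_self_add

end

end Striated

end

theorem lemma2p2 (d : ℕ) (hd : 0 < d) (P : LittlewoodPaley d) (k : ℕ) (ρ : ℝ)
    (hρ₀ : 0 < ρ) (hρ₁ : ρ < 1) (M : ℝ≥0) :
    (∀ ε : ℝ, 0 < ε → ε < 1 → ∃ C : ℝ≥0, 0 < C ∧
      ∀ (N : ℕ) (W : Fin N → SmoothField d), 0 < N → (∀ i, (W i).IsDivFree) →
        familyHolderNorm P W ρ k ≤ M →
      ∀ u : SmoothField d, u.IsDivFree → ∀ φ : 𝓢'(Space d, ℂ),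
      ∀ (p r : ℝ≥0∞) [Fact (1 ≤ p)], 1 ≤ r →
        striatedNorm P W (-ε) k p r (u.deriv φ) ≤
          C * min
            (∑ μ ∈ Finset.range (k + 1),
              fieldNorm P W 0 μ ∞ 1 u * gradNorm P W (-ε) (k - μ) p r φ)
            (∑ μ ∈ Finset.range (k + 1),
              fieldNorm P W (-ε) μ p r u * gradNorm P W 0 (k - μ) ∞ 1 φ)) ∧
    (∀ (σ s : ℝ) (m₀ : Space d → ℂ), -1 < σ → IsZeroOrderSymbol m₀ →
      -1 < s → s < 1 → -1 < σ + s → σ + s < 1 → ∃ C : ℝ≥0, 0 < C ∧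
      ∀ (N : ℕ) (W : Fin N → SmoothField d), 0 < N → (∀ i, (W i).IsDivFree) →
        familyHolderNorm P W ρ k ≤ M →
      ∀ u : SmoothField d, u.IsDivFree → ∀ φ mφ muφ : 𝓢'(Space d, ℂ),
        IsMultiplierApply (powerSymbol σ m₀) φ mφ →
        IsMultiplierApply (powerSymbol σ m₀) (u.deriv φ) muφ →
      ∀ (p r : ℝ≥0∞) [Fact (1 ≤ p)], 1 ≤ r →
        striatedNorm P W s k p r (muφ - u.deriv mφ) ≤
          C * (fieldGradNorm P W 0 k ∞ 1 u + u.supNorm) * striatedNorm P W (s + σ) k p r φ) ∧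
    (∀ (σ s : ℝ) (m₀ : Space d → ℂ), -1 < σ → IsZeroOrderSymbol m₀ →
      -1 < s → s < 1 → -1 < σ + s → σ + s < 1 → ∃ C : ℝ≥0, 0 < C ∧
      ∀ (N : ℕ) (W : Fin N → SmoothField d), 0 < N → (∀ i, (W i).IsDivFree) →
        familyHolderNorm P W ρ k ≤ M →
      ∀ φ mφ : 𝓢'(Space d, ℂ), IsMultiplierApply (powerSymbol σ m₀) φ mφ →
      ∀ (p r : ℝ≥0∞) [Fact (1 ≤ p)], 1 ≤ r →
        striatedNorm P W s (k + 1) p r mφ ≤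
          C * striatedNorm P W (s + σ) (k + 1) p r φ +
          C * (∑ i, fieldNorm P W 1 k ∞ 1 (W i)) * striatedNorm P W (s + σ) k p r φ +
          C * (if σ ≤ 0 then distLpNorm p (P.block 0 mφ) else 0)) := by
  refine ⟨fun ε hε₀ hε₁ => ?_, fun σ s m₀ hσ hm hs₀ hs₁ h₀ h₁ => ?_, fun σ s m₀ hσ hm hs₀ hs₁ h₀ h₁ => ?_⟩
  · obtain ⟨C, hC, h⟩ := product_estimate P k hρ₀ M hε₀ hε₁
    exact ⟨C, hC, fun N W _ => h N W⟩
  · obtain ⟨C, hC, h⟩ := commutator_estimate hd P k hρ₀ M hσ hm (abs_lt.2 ⟨hs₀, hs₁⟩)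
      (abs_lt.2 ⟨by linarith, by linarith⟩)
    exact ⟨C, hC, fun N W _ => h N W⟩
  · obtain ⟨C, hC, h⟩ := multiplier_estimate hd P k hρ₀ M hσ hm (abs_lt.2 ⟨hs₀, hs₁⟩)
      (abs_lt.2 ⟨by linarith, by linarith⟩)
    exact ⟨C, hC, fun N W _ => h N W⟩
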